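/- Conventions: $\Delta=\partial\bar\partial=\frac14(\partial_{xx}+\partial_{yy})$, $dA=\frac1\pi\,dx\,dy$, $\operatorname{erfc}(t)=\frac{2}{\sqrt\pi}\int_t^\infty e^{-x^2}dx$, and $\theta(z;\tau)=\sum_{\ell\in\mathbb Z}e^{2\pi i\ell z}e^{\pi i\ell^2\tau}$; a prime on $\log\theta$ denotes the derivative in the first argument. For a radially symmetric function $f$ on $\mathbb C$ write $f(r)$ for its value on $|z|=r$. Let $Q:\mathbb C\to\mathbb R$ be radially symmetric and lower semicontinuous, with $Q(z)-2\log|z|\to+\infty$ as $|z|\to\infty$. Let $\sigma$ be its equilibrium measure, i.e. the minimizer of $I_Q[\mu]=\iint\log\frac1{|z-w|}\,d\mu(z)\,d\mu(w)+\int Q\,d\mu$ over all compactly supported Borel probability measures on $\mathbb C$, let $S=\operatorname{supp}\sigma$, and let $\check Q(z)=\gamma-2\int\log\frac1{|z-w|}\,d\sigma(w)$, where $\gamma=2\iint\log\frac1{|z-w|}\,d\sigma(z)\,d\sigma(w)+\int Q\,d\sigma$. Assume that $Q$ is $C^2$ in a neighbourhood of $S$, that $\Delta Q>0$ on $\partial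 S$, that $Q>\check Q$ on $\mathbb C\setminus S$, and that $$S=\bigcup_{k=0}^N\{a_k\le|z|\le b_k\},\qquad 0\le a_0<b_0<a_1<b_1<\dots<a_N<b_N,\quad N\ge1.$$ Fix $0\le k<N$, put $r_1=b_k$, $r_2=a_{k+1}$, $G=\{r_1<|z|<r_2\}$, and assume that $Q$ is $C^6$ in a neighbourhood of $\partial G$. Let $B=\frac{Q(r_2)-Q(r_1)}{\log(r_2/r_1)}$ (so that $\check Q(z)=A+B\log|z|$ in $G$ for a constant $A$). Let $\lambda:\mathbb C\to\mathbb R$ be radially symmetric and $C^6$, with support contained in the interior of $S\cup G$ (so $\lambda$ vanishes near all other components of $\mathbb C\setminus S$), and let $s\in\mathbb R$. For the perturbed potential $\tilde Q_n=Q-\frac{s\lambda}n$ put $\tilde p_j(z)=z^je^{-n\tilde Q_n(z)/2}$ and let $$\tilde R_{n,s\lambda}(z)=\sum_{j=0}^{n-1}\frac{|\tilde p_j(z)|^2}{\|\tilde p_j\|^2},\qquad \|f\|^2=\int_{\mathbb C}|f|^2\,dA,$$ be the 1-point function in potential $\tilde Q_n$ (terms with $\|\tilde p_j\|=\infty$ being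 zero). Let $\partial_{\mathrm n}$ denote the normal derivative on $\partial S$ pointing out of $S$ (at $|z|=r_1$ it is $\frac{\partial}{\partial r}$). **Theorem.** Fix $\alpha\in[0,2\pi)$ and put $z=e^{i\alpha}\Big(r_1+\frac t{\sqrt{2n\Delta Q(r_1)}}\Big)$ with $t\in\mathbb R$, $|t|\le\log n$. Then, as $n\to\infty$, uniformly for $|t|\le\log n$, $$\begin{aligned}\tilde R_{n,s\lambda}(z)={}&n\Delta Q(r_1)\frac{\operatorname{erfc}(t)}2+\frac{\sqrt{n\Delta Q(r_1)}}{\sqrt{2\pi}\,r_1}e^{-t^2}\Bigg[\frac s2\bigg(r_1\lambda'(r_1)+\frac{\lambda(r_1)-\lambda(r_2)}{\log(r_2/r_1)}\bigg)+\frac16(t^2-2)\\&+r_1\frac{\partial_{\mathrm n}\Delta Q(r_1)}{\Delta Q(r_1)}\bigg(\frac12\sqrt\pi\,t\operatorname{erfc}(t)e^{t^2}-\frac1{12}(2t^2+5)\bigg)+\frac{\log\frac{\Delta Q(r_2)}{\Delta Q(r_1)}}{4\log(r_2/r_1)}\\&+\frac1{2\log(r_2/r_1)}(\log\theta)'\bigg(\frac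 B2n+\frac{\log\frac{\Delta Q(r_2)}{\Delta Q(r_1)}}{4\log(r_2/r_1)}+\frac{s(\lambda(r_1)-\lambda(r_2))}{2\log(r_2/r_1)};\frac{\pi i}{\log(r_2/r_1)}\bigg)\Bigg]+\mathcal O(\log^4n).\end{aligned}$$ -/

import Mathlib

open MeasureTheory Filter Topology

noncomputable section

namespace CoulombGap

/-- The normalized area measure `dA = dx dy / π` on the plane. -/
def areaMeasure : Measure ℂ := ENNReal.ofReal (1 / Real.pi) • volume

/-- The Laplacian in the normalization `Δ = ∂ ∂̄ = (∂ₓₓ + ∂ᵧᵧ) / 4`. -/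
def lap (Q : ℂ → ℝ) (z : ℂ) : ℝ := (1 / 4) * Laplacian.laplacian Q z

/-- The radial derivative `d/dr f(r)` of a function on the plane, on the positive real axis. For a
radially symmetric `f`, it is the derivative of `f` along the unit normal of the circle of radius
`r` that points away from the origin. -/
def radialDeriv (f : ℂ → ℝ) (r : ℝ) : ℝ := deriv (fun x : ℝ => f (x : ℂ)) r

/-- Radial symmetry: `f z` depends on `|z|` only. -/
def IsRadial (f : ℂ → ℝ) : Prop := ∀ z : ℂ, f z = f ((‖z‖ : ℝ) : ℂ)

/-! ### Weighted potential theory -/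

/-- The logarithmic potential `U^μ(z) = ∫ log (1 / |z - w|) dμ(w)`. -/
def logPotential (μ : Measure ℂ) (z : ℂ) : ℝ := ∫ w, Real.log (1 / ‖z - w‖) ∂μ

/-- Compactly supported unit measures of finite weighted logarithmic energy. The kernel
`log (1 / |z - w|)` is `+∞` on the diagonal (where `Real.log (1 / 0) = 0`), so that finite energy
means: no atoms (for a product `μ × μ` this says that the diagonal is a null set), and
integrability of the kernel and of `Q`. For a measure of compact support, kernel and `Q` (lower
semicontinuous) are bounded below, and the energy of every other such measure is `+∞`. -/
structure HasFiniteEnergy (Q : ℂ → ℝ) (μ : Measure ℂ) : Prop where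
  isProbabilityMeasure : IsProbabilityMeasure μ
  compactSupport : ∃ K : Set ℂ, IsCompact K ∧ μ Kᶜ = 0
  noAtom : ∀ z : ℂ, μ {z} = 0
  integrable_kernel : Integrable (fun p : ℂ × ℂ => Real.log (1 / ‖p.1 - p.2‖)) (μ.prod μ)
  integrable_potential : Integrable Q μ

/-- The weighted logarithmic energy `I_Q[μ] = ∬ log (1 / |z - w|) dμ dμ + ∫ Q dμ`. -/
def energy (Q : ℂ → ℝ) (μ : Measure ℂ) : ℝ :=
  (∫ p : ℂ × ℂ, Real.log (1 / ‖p.1 - p.2‖) ∂(μ.prod μ)) + ∫ z, Q z ∂μ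

/-- `σ` is the equilibrium measure of `Q`: it minimizes `I_Q` over all compactly supported unit
measures (those of infinite energy need not be compared with). -/
def IsEquilibriumMeasure (Q : ℂ → ℝ) (σ : Measure ℂ) : Prop :=
  HasFiniteEnergy Q σ ∧ ∀ μ : Measure ℂ, HasFiniteEnergy Q μ → energy Q σ ≤ energy Q μ

/-- Robin's constant `γ = 2 ∬ log (1 / |z - w|) dσ dσ + ∫ Q dσ`, the constant value of
`Q + 2 U^σ` on the droplet, integrated against the equilibrium measure `σ`. -/
def robinConst (Q : ℂ → ℝ) (σ : Measure ℂ) : ℝ :=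
  2 * (∫ p : ℂ × ℂ, Real.log (1 / ‖p.1 - p.2‖) ∂(σ.prod σ)) + ∫ z, Q z ∂σ

/-- The obstacle function `γ - 2 U^σ`. -/
def obstacle (Q : ℂ → ℝ) (σ : Measure ℂ) (z : ℂ) : ℝ :=
  robinConst Q σ - 2 * logPotential σ z

/-- The class of radially symmetric potentials `Q`, with equilibrium measure `σ`, whose droplet
`S = supp σ` is the union of the `N + 1` annuli `a k ≤ |z| ≤ b k`, `0 ≤ k ≤ N`. -/
structure IsRadialPotential (Q : ℂ → ℝ) (σ : Measure ℂ) (N : ℕ) (a b : ℕ → ℝ) : Prop where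
  radial : IsRadial Q
  lowerSemicontinuous : LowerSemicontinuous Q
  growth : Tendsto (fun z : ℂ => Q z - 2 * Real.log ‖z‖) (cocompact ℂ) atTop
  equilibrium : IsEquilibriumMeasure Q σ
  /-- `Q` is `C²`-smooth in a neighbourhood of the droplet. -/
  smooth : ∃ U : Set ℂ, IsOpen U ∧ σ.support ⊆ U ∧ ContDiffOn ℝ 2 Q U
  lap_pos : ∀ z ∈ frontier σ.support, 0 < lap Q z
  obstacle_lt : ∀ z, z ∉ σ.support → obstacle Q σ z < Q z
  radius_nonneg : 0 ≤ a 0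
  radius_lt : ∀ k, k ≤ N → a k < b k
  radius_lt_succ : ∀ k, k < N → b k < a (k + 1)
  droplet_eq : σ.support = {z : ℂ | ∃ k, k ≤ N ∧ a k ≤ ‖z‖ ∧ ‖z‖ ≤ b k}

/-! ### The one-point function -/

/-- The weighted monomial `p_j(z) = z ^ j e^{- n V(z) / 2}`. -/
def weightedMonomial (V : ℂ → ℝ) (n j : ℕ) (z : ℂ) : ℂ :=
  z ^ j * ((Real.exp (-((n : ℝ) * V z / 2)) : ℝ) : ℂ)

/-- The squared norm `‖p_j‖²` in `L²(ℂ, dA)`. -/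
def sqNorm (V : ℂ → ℝ) (n j : ℕ) : ℝ := ∫ w, ‖weightedMonomial V n j w‖ ^ 2 ∂areaMeasure

/-- The canonical correlation kernel
`K_n(z, w) = ∑_{j < n} p_j(z) conj (p_j(w)) / ‖p_j‖²` of the potential `V`. (If `p_j` is not in
`L²`, which the growth of the potential leaves possible for `j = n - 1`, then `sqNorm` is `0` and
the term is `0`, so that this remains the reproducing kernel of the space of all weighted
polynomials of degree less than `n` in `L²`.) -/
def corrKernel (V : ℂ → ℝ) (n : ℕ) (z w : ℂ) : ℂ :=
  ∑ j ∈ Finset.range n, weightedMonomial V n j z *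
    (starRingEnd ℂ) (weightedMonomial V n j w) / ((sqNorm V n j : ℝ) : ℂ)

/-- The one-point function `R_n(z) = K_n(z, z)`, a real number. -/
def onePoint (V : ℂ → ℝ) (n : ℕ) (z : ℂ) : ℝ := (corrKernel V n z z).re

/-- The perturbed potential `Q - s λ / n`. -/
def perturbed (Q lam : ℂ → ℝ) (s : ℝ) (n : ℕ) (z : ℂ) : ℝ := Q z - s * lam z / (n : ℝ)

/-! ### Special functions -/

/-- The complementary error function. -/
def erfc (t : ℝ) : ℝ := 2 / Real.sqrt Real.pi * ∫ x in Set.Ioi t, Real.exp (-x ^ 2)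

/-- `(log θ)'(x; τ) = θ'(x; τ) / θ(x; τ)` for real `x` and `τ = i y`, `y > 0`, where
`θ(z; τ) = ∑_{l ∈ ℤ} e^{2 π i l z} e^{π i l² τ}` and the prime is the derivative in `z`. For these
arguments the quotient is real. -/
def logTheta' (x y : ℝ) : ℝ :=
  (logDeriv (fun z : ℂ => jacobiTheta₂ z (Complex.I * (y : ℂ))) (x : ℂ)).re

/-- The constant `B = (q(r₂) - q(r₁)) / log (r₂ / r₁)`, `q(r) = Q(r)`, such that the obstacle
function is `A + B log |z|` in the gap `r₁ < |z| < r₂`. -/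
def gapB (Q : ℂ → ℝ) (r₁ r₂ : ℝ) : ℝ := (Q (r₂ : ℂ) - Q (r₁ : ℂ)) / Real.log (r₂ / r₁)

end CoulombGap

end

/-! For a radial weight the kernel is diagonal in the monomials, so the one-point function is a sum
over degrees `j` of normalized densities. Put `y = log |z|` and `x = j - n M`, where `M` is the
equilibrium mass of the disc `|z| ≤ r₁`. The density of degree `j` is then proportional to `exp (2 x
y + a y - n U y)` with `U y = Q(e^y) - 2 M y - v` and `a y = 2 y + s λ(e^y)`
(`onePoint_perturbed_eq`). The variational conditions for `σ`, averaged over circles, show that `U`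
is nonnegative with exactly the two zeros `y₁ = log r₁` and `y₂ = log r₂`
(`exists_gap_effective_potential`). Averaging over circles makes it unnecessary to know that `σ` is
radial. Equality of the two minima gives `2 M = B`, and `U'' = 4 r² ΔQ` makes both wells
nondegenerate.

At a point near `y₁` each summand factors into the reciprocal of the local integral over the left
well and the fraction of the total mass that sits in this well (`gapWeight_div_integral`). Laplace's
method, uniform in the tilt (`laplace_inv`, `LocalModel.laplace`), makes the first factor a Gaussian
in `x` of width of order `√n` with a first correction. Comparison of the two wells makes the second
factor a Fermi factor `1 / (1 + e^{2L(x - δ)})` with `L = log (r₂ / r₁)`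
(`GapModel.fraction_approx`).

The Gaussian varies on the scale `√n`, while the Fermi factor drops from one to zero on the scale of
a few degrees. The sum is therefore the Gaussian summed over `x < 0`, which the midpoint rule turns
into the error function profile, plus the Gaussian at `0` times the sum of Fermi factor minus step
function (`exists_fermi_sum_bound`). Since `n M` is in general not an integer, the latter sum
oscillates with `n`. It can be computed exactly. The `q`-binomial theorem expresses the mean number
of occupied levels in two ways, and in the limit the Fermi sum becomes the mean of a discrete
Gaussian (`fermi_mul_tsum`). Jacobi's imaginary transformation identifies this mean with `(log θ)'`
(`logTheta'_mul_tsum`, `tsum_fermi`).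

The error is counted as follows. About `log n` degrees lie near the Fermi transition, each with an
error `O(1)`. About `√n log n` further degrees matter, each with an error `O(1 / √n)`. The remaining
ones are negligible, so that the summation costs `O(log n)` (`GapModel.gapSum_asymptotics`).
Expanding the profile at `y = y₁ + log (1 + σ t)` costs `O((1 + |t|)^4)` (`exists_edge_expansion`),
which for `|t| ≤ log n` is the stated `O(log^4 n)`. -/

namespace CoulombGap

/-! ### The `q`-binomial theorem -/

/-- The `q`-Pochhammer symbol `(q; q)_m`. -/
noncomputable def qPoch (q : ℝ) (m : ℕ) : ℝ := ∏ i ∈ Finset.range m, (1 - q ^ (i + 1))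

/-- The Gaussian binomial coefficient, by the `q`-Pascal rule. -/
noncomputable def qBinom (q : ℝ) : ℕ → ℕ → ℝ
  | _, 0 => 1
  | 0, _ + 1 => 0
  | m + 1, k + 1 => qBinom q m (k + 1) + q ^ (m - k) * qBinom q m k

theorem qBinom_zero_right (q : ℝ) (m : ℕ) : qBinom q m 0 = 1 := by
  cases m <;> rfl

theorem qBinom_of_lt (q : ℝ) : ∀ m k : ℕ, m < k → qBinom q m k = 0
  | _, 0, h => absurd h (Nat.not_lt_zero _)
  | 0, _ + 1, _ => rfl
  | m + 1, k + 1, h => by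
    rw [qBinom, qBinom_of_lt q m (k + 1) (by omega), qBinom_of_lt q m k (by omega)]; simp

theorem qPoch_succ (q : ℝ) (m : ℕ) : qPoch q (m + 1) = qPoch q m * (1 - q ^ (m + 1)) := by
  rw [qPoch, Finset.prod_range_succ, ← qPoch]

theorem qPoch_pos {q : ℝ} (h0 : 0 < q) (h1 : q < 1) (m : ℕ) : 0 < qPoch q m :=
  Finset.prod_pos fun i _ => by
    have := pow_lt_one₀ h0.le h1 (Nat.succ_ne_zero i)
    simp only [Nat.succ_eq_add_one] at this; linarith

theorem qBinom_self (q : ℝ) : ∀ m : ℕ, qBinom q m m = 1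
  | 0 => rfl
  | m + 1 => by
    rw [qBinom, qBinom_of_lt q m (m + 1) (by omega), qBinom_self q m]; simp

/-- The two Pascal neighbours combine through `1 - q^(a+b+2) = (1 - q^(b+1)) + q^(b+1) (1 -
q^(a+1))`. The product form is kept free of division. -/
theorem qBinom_add_mul (q : ℝ) : ∀ a b : ℕ,
    qBinom q (a + b) a * (qPoch q a * qPoch q b) = qPoch q (a + b)
  | 0, b => by simp [qBinom_zero_right, qPoch]
  | a + 1, 0 => by rw [add_zero, qBinom_self]; simp [qPoch]
  | a + 1, b + 1 => by
    have h1 := qBinom_add_mul q (a + 1) b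
    have h2 := qBinom_add_mul q a (b + 1)
    have e : a + 1 + (b + 1) = (a + b + 1) + 1 := by omega
    have e1 : a + 1 + b = a + b + 1 := by omega
    have e2 : a + (b + 1) = a + b + 1 := by omega
    have e3 : a + b + 1 - a = b + 1 := by omega
    rw [e1] at h1; rw [e2] at h2
    rw [e, qBinom, e3, qPoch_succ q (a + b + 1)]
    rw [qPoch_succ] at h1 h2 ⊢
    rw [qPoch_succ q b]
    have hp : q ^ (a + b + 1 + 1) = q ^ (a + 1) * q ^ (b + 1) := by ring
    rw [hp]
    linear_combination (1 - q ^ (b + 1)) * h1 + q ^ (b + 1) * (1 - q ^ (a + 1)) * h2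

/-- Appending the factor `1 + w q^m` is the `q`-Pascal rule, because `(k+1).choose 2 = k + k.choose
2`. -/
theorem gauss_binomial (q w : ℝ) : ∀ m : ℕ, ∏ j ∈ Finset.range m, (1 + w * q ^ j) =
    ∑ k ∈ Finset.range (m + 1), q ^ (k.choose 2) * qBinom q m k * w ^ k
  | 0 => by simp [qBinom_zero_right]
  | m + 1 => by
    rw [Finset.prod_range_succ, gauss_binomial q w m, Finset.sum_range_succ' _ (m + 1)]
    have h1 : ∀ k ∈ Finset.range (m + 1),
        q ^ ((k + 1).choose 2) * qBinom q (m + 1) (k + 1) * w ^ (k + 1) =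
        q ^ ((k + 1).choose 2) * qBinom q m (k + 1) * w ^ (k + 1) +
          (q ^ (k.choose 2) * qBinom q m k * w ^ k) * (w * q ^ m) := by
      intro k hk
      have hk' : k ≤ m := by simpa [Nat.lt_succ_iff] using hk
      have h2 : (k + 1).choose 2 = k + k.choose 2 := by
        rw [Nat.choose_succ_succ' k 1, Nat.choose_one_right]
      obtain ⟨d, rfl⟩ := Nat.exists_eq_add_of_le hk'
      rw [qBinom, h2, Nat.add_sub_cancel_left]
      ring
    rw [Finset.sum_congr rfl h1, Finset.sum_add_distrib, ← Finset.sum_mul, mul_add, mul_one]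
    have h3 : ∑ k ∈ Finset.range (m + 1), q ^ (k.choose 2) * qBinom q m k * w ^ k =
        ∑ k ∈ Finset.range (m + 1), q ^ ((k + 1).choose 2) * qBinom q m (k + 1) * w ^ (k + 1) + 1 := by
      have h4 := Finset.sum_range_succ' (fun k => q ^ (k.choose 2) * qBinom q m k * w ^ k) (m + 1)
      rw [Finset.sum_range_succ, qBinom_of_lt q m (m + 1) (by omega)] at h4
      simp only [mul_zero, zero_mul, add_zero, qBinom_zero_right] at h4
      rw [h4]; simp
    simp only [qBinom_zero_right]
    nth_rewrite 1 [h3]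
    simp
    ring

/-- The logarithmic derivative of the `q`-binomial theorem. -/
theorem gauss_binomial_logDeriv {q w : ℝ} (hq : 0 < q) (hw : 0 < w) (m : ℕ) :
    (∑ j ∈ Finset.range m, w * q ^ j / (1 + w * q ^ j)) *
      ∑ k ∈ Finset.range (m + 1), q ^ (k.choose 2) * qBinom q m k * w ^ k =
    ∑ k ∈ Finset.range (m + 1), (k : ℝ) * (q ^ (k.choose 2) * qBinom q m k * w ^ k) := by
  have hpos : ∀ j : ℕ, 0 < 1 + w * q ^ j := fun j => by positivity
  have h1 : logDeriv (fun w : ℝ => ∏ j ∈ Finset.range m, (1 + w * q ^ j)) w =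
      ∑ j ∈ Finset.range m, q ^ j / (1 + w * q ^ j) := by
    have := logDeriv_prod (s := Finset.range m) (f := fun j (w : ℝ) => 1 + w * q ^ j) (x := w)
      (fun j _ => (hpos j).ne') (fun j _ => by fun_prop)
    rw [this]
    refine Finset.sum_congr rfl fun j _ => ?_
    rw [logDeriv_apply]
    simp
  have h2 : HasDerivAt (fun w : ℝ => ∏ j ∈ Finset.range m, (1 + w * q ^ j))
      (∑ k ∈ Finset.range (m + 1), q ^ (k.choose 2) * qBinom q m k * (k * w ^ (k - 1))) w := by
    have e : (fun w : ℝ => ∏ j ∈ Finset.range m, (1 + w * q ^ j)) = fun w : ℝ =>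
      ∑ k ∈ Finset.range (m + 1), q ^ (k.choose 2) * qBinom q m k * w ^ k := by
      ext w; exact gauss_binomial q w m
    rw [e]
    exact HasDerivAt.fun_sum fun k _ => (hasDerivAt_pow k w).const_mul _
  rw [logDeriv_apply, h2.deriv, div_eq_iff (Finset.prod_pos fun j _ => hpos j).ne',
    gauss_binomial] at h1
  have h3 := congrArg (fun x => w * x) h1
  simp only [Finset.mul_sum] at h3
  have e4 : (∑ j ∈ Finset.range m, w * q ^ j / (1 + w * q ^ j)) =
      w * ∑ j ∈ Finset.range m, q ^ j / (1 + w * q ^ j) := by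
    rw [Finset.mul_sum]; exact Finset.sum_congr rfl fun j _ => by rw [mul_div_assoc]
  rw [e4, mul_assoc, Finset.mul_sum, Finset.mul_sum, ← h3]
  refine Finset.sum_congr rfl fun k _ => ?_
  cases k with
  | zero => simp
  | succ k => rw [Nat.add_sub_cancel, pow_succ]; ring

/-- The value of the limit is irrelevant, since it will cancel from a quotient. What counts is its
positivity and the uniform lower bound, which follows from monotonicity and later dominates the
Gaussian binomials. -/
theorem exists_qPoch_limit {q : ℝ} (h0 : 0 < q) (h1 : q < 1) :
    ∃ d : ℝ, 0 < d ∧ (∀ m, d ≤ qPoch q m) ∧ Tendsto (qPoch q) atTop (𝓝 d) := by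
  have hs : Summable (fun i : ℕ => Real.log (1 + -(q ^ (i + 1)))) := by
    apply Real.summable_log_one_add_of_summable
    exact ((summable_geometric_of_lt_one h0.le h1).mul_left q).neg.congr fun i => by
      simp [pow_succ, mul_comm]
  have hf : ∀ i : ℕ, 0 < 1 - q ^ (i + 1) := fun i => by
    have := pow_lt_one₀ h0.le h1 (Nat.succ_ne_zero i)
    simp only [Nat.succ_eq_add_one] at this; linarith
  have ht : Tendsto (qPoch q) atTop (𝓝 (Real.exp (∑' i : ℕ, Real.log (1 + -(q ^ (i + 1)))))) := by
    refine ((Real.continuous_exp.tendsto _).comp hs.hasSum.tendsto_sum_nat).congr fun m => ?_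
    simp only [Function.comp]
    rw [Real.exp_sum]
    refine Finset.prod_congr rfl fun i _ => ?_
    rw [← sub_eq_add_neg, Real.exp_log (hf i)]
  have hanti : Antitone (qPoch q) := antitone_nat_of_succ_le fun m => by
    rw [qPoch_succ]
    have := qPoch_pos h0 h1 m
    have h2 : 0 < q ^ (m + 1) := by positivity
    nlinarith
  exact ⟨_, Real.exp_pos _, fun m => hanti.le_of_tendsto ht m, ht⟩

/-! ### Fermi sums and the theta function -/

/-- The Fermi factor `1 / (1 + e^{2 L x})`. -/
noncomputable def fermi (L x : ℝ) : ℝ := 1 / (1 + Real.exp (2 * L * x))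

/-- The bounds `1 - fermi ≤ e^{2L(x-δ)}` and `fermi ≤ e^{-2L(x-δ)}` hold for all real arguments,
whatever the sign of `x - δ`. The shift therefore costs only a constant factor. -/
theorem abs_fermi_sub_le {L : ℝ} (hL : 0 < L) (x δ : ℝ) :
    |fermi L (x - δ) - if x < 0 then 1 else 0| ≤
      Real.exp (2 * L * |δ|) * Real.exp (-(2 * L * |x|)) := by
  have hp : 0 < Real.exp (2 * L * (x - δ)) := Real.exp_pos _
  rw [← Real.exp_add]
  split_ifs with h
  · have : fermi L (x - δ) - 1 =
        -(Real.exp (2 * L * (x - δ)) / (1 + Real.exp (2 * L * (x - δ)))) := by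
      rw [fermi]; field_simp; ring
    rw [this, abs_neg, abs_of_pos (by positivity), abs_of_neg h]
    refine (div_le_self hp.le (by linarith)).trans (Real.exp_le_exp.2 ?_)
    nlinarith [neg_abs_le δ]
  · rw [sub_zero, abs_of_nonneg (not_lt.1 h), fermi, abs_of_pos (by positivity)]
    refine (one_div_le_one_div_of_le hp (by linarith)).trans ?_
    rw [one_div, ← Real.exp_neg]
    refine Real.exp_le_exp.2 ?_
    nlinarith [le_abs_self δ]

theorem summable_exp_neg_abs_int {c : ℝ} (hc : 0 < c) :
    Summable (fun j : ℤ => Real.exp (-(c * |(j : ℝ)|))) := by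
  have h : Summable (fun n : ℕ => Real.exp (-(c * (n : ℝ)))) := by
    refine (Real.summable_exp_nat_mul_iff.2 (neg_lt_zero.2 hc)).congr fun n => ?_
    ring_nf
  refine Summable.of_nat_of_neg (h.congr fun n => ?_) (h.congr fun n => ?_) <;> simp

/-- Comparison with the standard majorant of the theta series, whose parameters are chosen so that
its exponent is `-L (k² - 2 |x| |k|)`. -/
theorem summable_pow_mul_gaussian {L : ℝ} (hL : 0 < L) (x : ℝ) (i : ℕ) :
    Summable (fun k : ℤ => |(k : ℝ)| ^ i * Real.exp (-(L * ((k : ℝ) - x) ^ 2))) := by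
  have h := summable_pow_mul_jacobiTheta₂_term_bound (L / Real.pi * |x|)
    (div_pos hL Real.pi_pos) i
  refine Summable.of_nonneg_of_le (fun k => by positivity) (fun k => ?_) h
  push_cast
  refine mul_le_mul_of_nonneg_left (Real.exp_le_exp.2 ?_) (by positivity)
  have hpi := Real.pi_pos.ne'
  have e : -Real.pi * (L / Real.pi * (k : ℝ) ^ 2 - 2 * (L / Real.pi * |x|) * |(k : ℝ)|) =
      L * (2 * (|x| * |(k : ℝ)|) - (k : ℝ) ^ 2) := by
    field_simp; ring
  rw [e, ← abs_mul]
  have := le_abs_self (x * k)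
  nlinarith [sq_nonneg x, mul_nonneg hL.le (sq_nonneg x), mul_le_mul_of_nonneg_left this hL.le]

theorem sum_range_eq_tsum_int (N : ℕ) (F : ℤ → ℝ) :
    ∑ k ∈ Finset.range (2 * N + 1), F ((k : ℤ) - N) =
      ∑' k : ℤ, if -(N : ℤ) ≤ k ∧ k ≤ N then F k else 0 := by
  rw [tsum_eq_sum (s := Finset.Icc (-(N : ℤ)) N)]
  · refine Finset.sum_nbij' (fun k => (k : ℤ) - N) (fun k => (k + N).toNat) ?_ ?_ ?_ ?_ ?_
    · intro k hk; simp only [Finset.mem_range, Finset.mem_Icc] at *; omega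
    · intro k hk; simp only [Finset.mem_range, Finset.mem_Icc] at *; omega
    · intro k hk; simp
    · intro k hk; simp only [Finset.mem_Icc] at *; omega
    · intro k hk
      simp only [Finset.mem_range] at hk
      rw [if_pos (by omega)]
  · intro k hk
    rw [Finset.mem_Icc] at hk
    rw [if_neg hk]

/-- This counts `2N` independent fermionic levels in two ways. With `q = e^{-2L}` and `w =
e^{2L(c+N)}` the factor `1 + w q^j` gives the level `j` the occupation probability `fermi L (j - N -
c)`. Completing the square turns `q^(k choose 2) w^k` into a Gaussian in `k` centred at `N + c +
1/2`, times a factor without `k` that cancels. Both sides are the mean occupation number, reduced by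
the `N` levels that the step function fills. -/
theorem gaussian_mean_finite (L c : ℝ) (N : ℕ) :
    (∑ j ∈ Finset.range (2 * N), (fermi L ((j : ℝ) - N - c) - if j < N then 1 else 0)) *
      ∑ k ∈ Finset.range (2 * N + 1), qBinom (Real.exp (-(2 * L))) (2 * N) k *
        Real.exp (-(L * ((k : ℝ) - N - (c + 1 / 2)) ^ 2)) =
    ∑ k ∈ Finset.range (2 * N + 1), ((k : ℝ) - N) * (qBinom (Real.exp (-(2 * L))) (2 * N) k *
        Real.exp (-(L * ((k : ℝ) - N - (c + 1 / 2)) ^ 2))) := by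
  have h := gauss_binomial_logDeriv (q := Real.exp (-(2 * L))) (w := Real.exp (2 * L * (c + N)))
    (Real.exp_pos _) (Real.exp_pos _) (2 * N)
  set q := Real.exp (-(2 * L)) with hq
  have h1 : ∀ j ∈ Finset.range (2 * N), Real.exp (2 * L * (c + N)) * q ^ j /
      (1 + Real.exp (2 * L * (c + N)) * q ^ j) = fermi L ((j : ℝ) - N - c) := by
    intro j _
    rw [hq, ← Real.exp_nat_mul, ← Real.exp_add, fermi]
    have e : 2 * L * ((j : ℝ) - N - c) = -(2 * L * (c + N) + j * -(2 * L)) := by ring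
    rw [e, Real.exp_neg]
    have := Real.exp_pos (2 * L * (c + N) + j * -(2 * L))
    field_simp
    ring
  have h2 : ∀ k : ℕ, q ^ (k.choose 2) * qBinom q (2 * N) k * Real.exp (2 * L * (c + N)) ^ k =
      Real.exp (L * (N + c + 1 / 2) ^ 2) * (qBinom q (2 * N) k *
        Real.exp (-(L * ((k : ℝ) - N - (c + 1 / 2)) ^ 2))) := by
    intro k
    have : q ^ (k.choose 2) * Real.exp (2 * L * (c + N)) ^ k = Real.exp (L * (N + c + 1 / 2) ^ 2) *
        Real.exp (-(L * ((k : ℝ) - N - (c + 1 / 2)) ^ 2)) := by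
      rw [hq, ← Real.exp_nat_mul, ← Real.exp_nat_mul, ← Real.exp_add, ← Real.exp_add,
        Nat.cast_choose_two]
      congr 1; ring
    linear_combination qBinom q (2 * N) k * this
  rw [Finset.sum_congr rfl h1] at h
  simp only [h2] at h
  have hE := Real.exp_pos (L * (N + c + 1 / 2) ^ 2)
  simp only [mul_left_comm _ (Real.exp (L * (N + c + 1 / 2) ^ 2)), ← Finset.mul_sum] at h
  have h3 := mul_left_cancel₀ hE.ne' h
  have h4 : ∑ j ∈ Finset.range (2 * N), (if j < N then (1 : ℝ) else 0) = N := by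
    rw [← Finset.sum_filter]
    have : (Finset.range (2 * N)).filter (· < N) = Finset.range N := by
      ext; simp only [Finset.mem_filter, Finset.mem_range]; omega
    simp [this]
  rw [Finset.sum_sub_distrib, h4, sub_mul, h3, Finset.mul_sum, ← Finset.sum_sub_distrib]
  exact Finset.sum_congr rfl fun k _ => by ring

theorem qBinom_le {q d : ℝ} (h0 : 0 < q) (h1 : q < 1) (hd : 0 < d) (hqd : ∀ m, d ≤ qPoch q m)
    (a b : ℕ) : qBinom q (a + b) a ≤ 1 / d ^ 2 := by
  have h := qBinom_add_mul q a b
  rw [le_div_iff₀ (by positivity)]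
  have hle : qPoch q (a + b) ≤ 1 := Finset.prod_le_one
    (fun i _ => by have := pow_le_one₀ (n := i + 1) h0.le h1.le; linarith)
    (fun i _ => by have : 0 < q ^ (i + 1) := by positivity
                   linarith)
  have hb : 0 ≤ qBinom q (a + b) a := by
    rw [← mul_nonneg_iff_of_pos_right (mul_pos (qPoch_pos h0 h1 a) (qPoch_pos h0 h1 b)), h]
    exact (qPoch_pos h0 h1 _).le
  have : d ^ 2 ≤ qPoch q a * qPoch q b := by
    rw [sq]; exact mul_le_mul (hqd a) (hqd b) hd.le (qPoch_pos h0 h1 a).le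
  nlinarith [mul_le_mul_of_nonneg_left this hb]

theorem qBinom_nonneg {q : ℝ} (h0 : 0 < q) (h1 : q < 1) (a b : ℕ) : 0 ≤ qBinom q (a + b) a := by
  rw [← mul_nonneg_iff_of_pos_right (mul_pos (qPoch_pos h0 h1 a) (qPoch_pos h0 h1 b)),
    qBinom_add_mul]
  exact (qPoch_pos h0 h1 _).le

/-- Dominated convergence for Gaussian sums weighted by central Gaussian binomials. -/
theorem tendsto_central_sum {L d : ℝ} (hL : 0 < L) (hd : 0 < d)
    (hqd : ∀ m, d ≤ qPoch (Real.exp (-(2 * L))) m)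
    (ht : Tendsto (qPoch (Real.exp (-(2 * L)))) atTop (𝓝 d)) (x : ℝ) (i : ℕ) :
    Tendsto (fun N : ℕ => ∑ k ∈ Finset.range (2 * N + 1), ((k : ℝ) - N) ^ i *
      (qBinom (Real.exp (-(2 * L))) (2 * N) k * Real.exp (-(L * ((k : ℝ) - N - x) ^ 2)))) atTop
      (𝓝 (1 / d * ∑' k : ℤ, (k : ℝ) ^ i * Real.exp (-(L * ((k : ℝ) - x) ^ 2)))) := by
  set q := Real.exp (-(2 * L)) with hq
  have h0 : 0 < q := Real.exp_pos _
  have h1 : q < 1 := by rw [hq, Real.exp_lt_one_iff]; linarith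
  have e : ∀ N : ℕ, ∑ k ∈ Finset.range (2 * N + 1), ((k : ℝ) - N) ^ i *
      (qBinom q (2 * N) k * Real.exp (-(L * ((k : ℝ) - N - x) ^ 2))) =
      ∑' k : ℤ, if -(N : ℤ) ≤ k ∧ k ≤ N then (k : ℝ) ^ i * (qBinom q (2 * N) (k + N).toNat *
        Real.exp (-(L * ((k : ℝ) - x) ^ 2))) else 0 := by
    intro N
    rw [← sum_range_eq_tsum_int N (fun k => (k : ℝ) ^ i * (qBinom q (2 * N) (k + N).toNat *
        Real.exp (-(L * ((k : ℝ) - x) ^ 2))))]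
    refine Finset.sum_congr rfl fun k _ => ?_
    simp
  simp only [e]
  rw [← tsum_mul_left]
  refine tendsto_tsum_of_dominated_convergence
    (bound := fun k : ℤ => 1 / d ^ 2 * (|(k : ℝ)| ^ i * Real.exp (-(L * ((k : ℝ) - x) ^ 2))))
    ((summable_pow_mul_gaussian hL x i).mul_left _) ?_ ?_
  · intro k
    have hev : ∀ᶠ N : ℕ in atTop, qPoch q (2 * N) /
        (qPoch q (k + N).toNat * qPoch q ((N : ℤ) - k).toNat) *
          ((k : ℝ) ^ i * Real.exp (-(L * ((k : ℝ) - x) ^ 2))) =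
        if -(N : ℤ) ≤ k ∧ k ≤ N then (k : ℝ) ^ i * (qBinom q (2 * N) (k + N).toNat *
          Real.exp (-(L * ((k : ℝ) - x) ^ 2))) else 0 := by
      -- For `N ≥ |k|` neither `toNat` truncates, and the Gaussian binomial is a quotient of
      -- Pochhammer symbols that tends to `d / (d * d)`.
      filter_upwards [eventually_ge_atTop k.natAbs] with N hN
      have hk : -(N : ℤ) ≤ k ∧ k ≤ N := by omega
      rw [if_pos hk]
      have h := qBinom_add_mul q (k + N).toNat ((N : ℤ) - k).toNat
      have e2 : (k + N).toNat + ((N : ℤ) - k).toNat = 2 * N := by omega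
      rw [e2] at h
      rw [← h]
      have := (qPoch_pos h0 h1 (k + N).toNat).ne'
      have := (qPoch_pos h0 h1 ((N : ℤ) - k).toNat).ne'
      field_simp
    have t1 : Tendsto (fun N : ℕ => 2 * N) atTop atTop :=
      tendsto_atTop_mono (fun N => by simp only [id]; omega) tendsto_id
    have t2 : Tendsto (fun N : ℕ => (k + N).toNat) atTop atTop :=
      tendsto_atTop_atTop.2 fun b => ⟨b + k.natAbs, fun N hN => by omega⟩
    have t3 : Tendsto (fun N : ℕ => ((N : ℤ) - k).toNat) atTop atTop :=
      tendsto_atTop_atTop.2 fun b => ⟨b + k.natAbs, fun N hN => by omega⟩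
    have h := (((ht.comp t1).div ((ht.comp t2).mul (ht.comp t3)) (by positivity)).mul_const
      ((k : ℝ) ^ i * Real.exp (-(L * ((k : ℝ) - x) ^ 2))))
    have e3 : d / (d * d) = 1 / d := by field_simp
    rw [e3] at h
    exact Tendsto.congr' hev h
  · refine Eventually.of_forall fun N k => ?_
    split_ifs with hk
    · have e2 : (k + N).toNat + ((N : ℤ) - k).toNat = 2 * N := by omega
      have hb := qBinom_le h0 h1 hd hqd (k + N).toNat ((N : ℤ) - k).toNat
      have hn := qBinom_nonneg h0 h1 (k + N).toNat ((N : ℤ) - k).toNat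
      rw [e2] at hb hn
      rw [Real.norm_eq_abs, abs_mul, abs_mul, abs_of_nonneg hn, Real.abs_exp, abs_pow]
      rw [mul_left_comm]
      exact mul_le_mul_of_nonneg_right hb (by positivity)
    · rw [norm_zero]; positivity

theorem summable_fermi {L : ℝ} (hL : 0 < L) (c : ℝ) :
    Summable (fun j : ℤ => fermi L (j - c) - if (j : ℝ) < 0 then 1 else 0) :=
  Summable.of_norm_bounded ((summable_exp_neg_abs_int (mul_pos two_pos hL)).mul_left _)
    fun j => abs_fermi_sub_le hL j c

/-- This is the limit of `gaussian_mean_finite`. All central Gaussian binomials tend to the same `1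
/ d`, which cancels, so the Fermi sum is the mean of the discrete Gaussian centred at `c + 1/2`. -/
theorem fermi_mul_tsum {L : ℝ} (hL : 0 < L) (c : ℝ) :
    (∑' j : ℤ, (fermi L (j - c) - if (j : ℝ) < 0 then 1 else 0)) *
      ∑' k : ℤ, Real.exp (-(L * ((k : ℝ) - (c + 1 / 2)) ^ 2)) =
    ∑' k : ℤ, (k : ℝ) * Real.exp (-(L * ((k : ℝ) - (c + 1 / 2)) ^ 2)) := by
  have hq0 : 0 < Real.exp (-(2 * L)) := Real.exp_pos _
  have hq1 : Real.exp (-(2 * L)) < 1 := by rw [Real.exp_lt_one_iff]; linarith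
  obtain ⟨d, hd, hqd, ht⟩ := exists_qPoch_limit hq0 hq1
  have t0 := tendsto_central_sum hL hd hqd ht (c + 1 / 2) 0
  have t1 := tendsto_central_sum hL hd hqd ht (c + 1 / 2) 1
  simp only [pow_zero, one_mul, pow_one] at t0 t1
  have tf : Tendsto (fun N : ℕ => ∑ j ∈ Finset.range (2 * N), (fermi L ((j : ℝ) - N - c) -
      if j < N then 1 else 0)) atTop
      (𝓝 (∑' j : ℤ, (fermi L (j - c) - if (j : ℝ) < 0 then 1 else 0))) := by
    have hs := (summable_fermi hL c).hasSum
    have tI : Tendsto (fun N : ℕ => Finset.Ico (-(N : ℤ)) N) atTop atTop := by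
      refine tendsto_atTop_finset_of_monotone (fun a b hab => Finset.Ico_subset_Ico (by omega)
        (by omega)) fun j => ⟨j.natAbs + 1, by rw [Finset.mem_Ico]; omega⟩
    refine (hs.comp tI).congr fun N => ?_
    simp only [Function.comp]
    refine Finset.sum_nbij' (fun k => (k + N).toNat) (fun k => (k : ℤ) - N) ?_ ?_ ?_ ?_ ?_
    · intro k hk; simp only [Finset.mem_range, Finset.mem_Ico] at *; omega
    · intro k hk; simp only [Finset.mem_range, Finset.mem_Ico] at *; omega
    · intro k hk; simp only [Finset.mem_Ico] at *; omega
    · intro k hk; simp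
    · intro k hk
      rw [Finset.mem_Ico] at hk
      obtain ⟨m, hm⟩ := Int.eq_ofNat_of_zero_le (show 0 ≤ k + N by omega)
      have hm' : (k : ℝ) = (m : ℝ) - N := by
        have : (k : ℝ) + N = m := by exact_mod_cast hm
        linarith
      rw [hm, Int.toNat_natCast, hm']
      congr 1
      have : (m : ℝ) - N < 0 ↔ m < N := by rw [sub_neg, Nat.cast_lt]
      simp only [this]
  have h := (tf.mul t0)
  simp only [gaussian_mean_finite] at h
  have h2 := tendsto_nhds_unique h t1
  have hd' : (1 / d) ≠ 0 := by positivity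
  apply mul_left_cancel₀ hd'
  linear_combination h2

/-- The Gaussian form of the logarithmic derivative of the theta function, by Jacobi's imaginary
transformation. -/
theorem logTheta'_mul_tsum {L : ℝ} (hL : 0 < L) (x : ℝ) :
    logTheta' x (Real.pi / L) * ∑' k : ℤ, Real.exp (-(L * ((k : ℝ) - x) ^ 2)) =
      2 * L * ∑' k : ℤ, ((k : ℝ) - x) * Real.exp (-(L * ((k : ℝ) - x) ^ 2)) := by
  have hpi := Real.pi_pos
  have hpi' : (Real.pi : ℂ) ≠ 0 := by exact_mod_cast hpi.ne'
  have hLc : (L : ℂ) ≠ 0 := by exact_mod_cast hL.ne'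
  set τ : ℂ := Complex.I * ((Real.pi / L : ℝ) : ℂ) with hτ
  have hτ0 : τ ≠ 0 := by
    rw [hτ]; exact mul_ne_zero Complex.I_ne_zero (by exact_mod_cast (div_pos hpi hL).ne')
  have hinv : -1 / τ = Complex.I * ((L / Real.pi : ℝ) : ℂ) := by
    rw [hτ]; push_cast; field_simp; simp
  have him : 0 < (-1 / τ).im := by
    rw [hinv]; simpa using div_pos hL hpi
  have hterm : ∀ n : ℤ, jacobiTheta₂_term n ((x : ℂ) / τ) (-1 / τ) =
      ((Real.exp (L * x ^ 2) * Real.exp (-(L * ((n : ℝ) - x) ^ 2)) : ℝ) : ℂ) := by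
    intro n
    rw [jacobiTheta₂_term, hinv, hτ, ← Real.exp_add]
    push_cast
    congr 1
    field_simp
    linear_combination ((n : ℂ) ^ 2) * Complex.I_sq
  have hS0 : jacobiTheta₂ ((x : ℂ) / τ) (-1 / τ) =
      ((Real.exp (L * x ^ 2) * ∑' k : ℤ, Real.exp (-(L * ((k : ℝ) - x) ^ 2)) : ℝ) : ℂ) := by
    rw [jacobiTheta₂, ← tsum_mul_left, Complex.ofReal_tsum]
    exact tsum_congr hterm
  have hS1 : jacobiTheta₂' ((x : ℂ) / τ) (-1 / τ) = 2 * Real.pi * Complex.I *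
      ((Real.exp (L * x ^ 2) * ∑' k : ℤ, (k : ℝ) * Real.exp (-(L * ((k : ℝ) - x) ^ 2)) : ℝ) : ℂ) := by
    rw [jacobiTheta₂', ← tsum_mul_left, Complex.ofReal_tsum, ← tsum_mul_left]
    refine tsum_congr fun n => ?_
    rw [jacobiTheta₂'_term, hterm]; push_cast; ring
  have hs0 : Summable fun k : ℤ => Real.exp (-(L * ((k : ℝ) - x) ^ 2)) := by
    simpa using summable_pow_mul_gaussian hL x 0
  have hs1 : Summable fun k : ℤ => (k : ℝ) * Real.exp (-(L * ((k : ℝ) - x) ^ 2)) := by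
    refine Summable.of_norm ((summable_pow_mul_gaussian hL x 1).congr fun k => ?_)
    simp
  set S0 := ∑' k : ℤ, Real.exp (-(L * ((k : ℝ) - x) ^ 2)) with hS0d
  set S1 := ∑' k : ℤ, (k : ℝ) * Real.exp (-(L * ((k : ℝ) - x) ^ 2)) with hS1d
  have hS0pos : 0 < S0 := hs0.tsum_pos (fun k => (Real.exp_pos _).le) 0 (Real.exp_pos _)
  have hld : logDeriv (fun z : ℂ => jacobiTheta₂ z τ) (x : ℂ) =
      ((2 * L * (S1 / S0 - x) : ℝ) : ℂ) := by
    -- At `-1 / τ = i L / π` the theta series has real Gaussian terms. The exponential prefactor has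
    -- logarithmic derivative `-2 L x`, which subtracts the centre `x` from the mean.
    have e : (fun z : ℂ => jacobiTheta₂ z τ) = fun z : ℂ => (1 / (-Complex.I * τ) ^ (1 / 2 : ℂ)) *
        (Complex.exp (-Real.pi * Complex.I * z ^ 2 / τ) * jacobiTheta₂ (z / τ) (-1 / τ)) := by
      ext z; rw [jacobiTheta₂_functional_equation, mul_assoc]
    have hc : (1 / (-Complex.I * τ) ^ (1 / 2 : ℂ)) ≠ 0 := by
      refine one_div_ne_zero ?_
      rw [Complex.cpow_ne_zero_iff]
      left; exact mul_ne_zero (neg_ne_zero.2 Complex.I_ne_zero) hτ0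
    have hd1 : HasDerivAt (fun z : ℂ => Complex.exp (-Real.pi * Complex.I * z ^ 2 / τ))
        (Complex.exp (-Real.pi * Complex.I * (x : ℂ) ^ 2 / τ) *
          (-Real.pi * Complex.I * (2 * (x : ℂ)) / τ)) (x : ℂ) := by
      have h := (((hasDerivAt_pow 2 (x : ℂ)).const_mul (-Real.pi * Complex.I)).div_const τ).cexp
      simpa using h
    have hd2 : HasDerivAt (fun z : ℂ => jacobiTheta₂ (z / τ) (-1 / τ))
        (jacobiTheta₂' ((x : ℂ) / τ) (-1 / τ) * (1 / τ)) (x : ℂ) :=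
      HasDerivAt.comp (h₂ := fun z => jacobiTheta₂ z (-1 / τ)) (h := fun z => z / τ) (x : ℂ)
        (hasDerivAt_jacobiTheta₂_fst ((x : ℂ) / τ) him) ((hasDerivAt_id (x : ℂ)).div_const τ)
    have hd := (hd1.mul hd2).const_mul (1 / (-Complex.I * τ) ^ (1 / 2 : ℂ))
    have hS0c : (S0 : ℂ) ≠ 0 := by exact_mod_cast hS0pos.ne'
    have hE : (Complex.exp (L * (x : ℂ) ^ 2)) ≠ 0 := Complex.exp_ne_zero _
    have hE2 : Complex.exp (-Real.pi * Complex.I * (x : ℂ) ^ 2 / τ) ≠ 0 := Complex.exp_ne_zero _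
    have ex := congrFun e (x : ℂ)
    rw [logDeriv_apply, ex, e]
    have hd' := hd.deriv
    simp only [Pi.mul_def] at hd'
    rw [hd', hS0, hS1]
    push_cast
    have hc2 : (-Complex.I * τ) ^ (1 / 2 : ℂ) ≠ 0 := by
      intro h; rw [h] at hc; simp at hc
    have hτ' : 1 / τ = -Complex.I * L / Real.pi := by
      rw [hτ]; push_cast; field_simp; simp
    have hx : -(Real.pi : ℂ) * Complex.I * (2 * (x : ℂ)) / τ = -(2 * L * x) := by
      rw [div_eq_mul_one_div, hτ']; field_simp; linear_combination (x : ℂ) * Complex.I_sq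
    rw [hx, hτ']
    rw [div_eq_iff (mul_ne_zero hc (mul_ne_zero hE2 (mul_ne_zero hE hS0c)))]
    field_simp
    linear_combination (-(S1 : ℂ)) * Complex.I_sq
  have hsub : ∑' k : ℤ, ((k : ℝ) - x) * Real.exp (-(L * ((k : ℝ) - x) ^ 2)) = S1 - x * S0 := by
    simp only [sub_mul]
    rw [(hs1).tsum_sub (hs0.mul_left x), tsum_mul_left]
  rw [logTheta', hld, Complex.ofReal_re, hsub]
  field_simp

/-- Periodicity makes integer thresholds drop out, so that the rounding of `n M` leaves no trace in
the result. -/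
theorem logTheta'_sub_int (x y : ℝ) (m : ℤ) : logTheta' (x - m) y = logTheta' x y := by
  have h : ∀ (n : ℕ) (x : ℝ), logTheta' (x + n) y = logTheta' x y := by
    intro n
    induction n with
    | zero => simp
    | succ n ih =>
      intro x
      have e : x + ((n + 1 : ℕ) : ℝ) = (x + n) + 1 := by push_cast; ring
      rw [e, ← ih x]
      unfold logTheta'
      have e2 : (fun z : ℂ => jacobiTheta₂ z (Complex.I * y)) =
          (fun z : ℂ => jacobiTheta₂ z (Complex.I * y)) ∘ fun z => z + 1 := by
        ext z; simp [jacobiTheta₂_add_left]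
      rw [logDeriv_apply, logDeriv_apply]
      conv_rhs => rw [e2]
      have e3 : deriv ((fun z : ℂ => jacobiTheta₂ z (Complex.I * y)) ∘ fun z => z + 1)
          ((x + n : ℝ) : ℂ) = deriv (fun z : ℂ => jacobiTheta₂ z (Complex.I * y))
            (((x + n : ℝ) : ℂ) + 1) :=
        deriv_comp_add_const (fun z : ℂ => jacobiTheta₂ z (Complex.I * y)) 1 _
      rw [e3]
      simp [jacobiTheta₂_add_left]
  obtain ⟨n, rfl | rfl⟩ := m.eq_nat_or_neg
  · rw [← h n (x - (n : ℤ))]; simp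
  · rw [← h n x]; simp

/-- The Fermi sum with threshold `m` in terms of the theta function. -/
theorem tsum_fermi {L : ℝ} (hL : 0 < L) (c : ℝ) (m : ℤ) :
    ∑' j : ℤ, (fermi L (j - c) - if j < m then 1 else 0) + m =
      c + 1 / 2 + 1 / (2 * L) * logTheta' (c + 1 / 2) (Real.pi / L) := by
  have h1 := fermi_mul_tsum hL (c - m)
  have h2 := logTheta'_mul_tsum hL (c - m + 1 / 2)
  set x := c - m + 1 / 2 with hx
  have hs0 : Summable fun k : ℤ => Real.exp (-(L * ((k : ℝ) - x) ^ 2)) := by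
    simpa using summable_pow_mul_gaussian hL x 0
  have hs1 : Summable fun k : ℤ => (k : ℝ) * Real.exp (-(L * ((k : ℝ) - x) ^ 2)) := by
    refine Summable.of_norm ((summable_pow_mul_gaussian hL x 1).congr fun k => ?_)
    simp
  have hS0pos : 0 < ∑' k : ℤ, Real.exp (-(L * ((k : ℝ) - x) ^ 2)) :=
    hs0.tsum_pos (fun k => (Real.exp_pos _).le) 0 (Real.exp_pos _)
  have hsub : ∑' k : ℤ, ((k : ℝ) - x) * Real.exp (-(L * ((k : ℝ) - x) ^ 2)) =
      (∑' k : ℤ, (k : ℝ) * Real.exp (-(L * ((k : ℝ) - x) ^ 2))) -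
        x * ∑' k : ℤ, Real.exp (-(L * ((k : ℝ) - x) ^ 2)) := by
    simp only [sub_mul]
    rw [(hs1).tsum_sub (hs0.mul_left x), tsum_mul_left]
  have hper : logTheta' x (Real.pi / L) = logTheta' (c + 1 / 2) (Real.pi / L) := by
    rw [← logTheta'_sub_int (c + 1 / 2) _ m, hx]; ring_nf
  have hshift : ∑' j : ℤ, (fermi L (j - c) - if j < m then 1 else 0) =
      ∑' j : ℤ, (fermi L (j - (c - m)) - if (j : ℝ) < 0 then 1 else 0) := by
    rw [← (Equiv.addRight m).tsum_eq]
    refine tsum_congr fun j => ?_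
    simp only [Equiv.coe_addRight, Int.cast_add]
    have e1 : (j : ℝ) + m - c = j - (c - m) := by ring
    have e2 : j + m < m ↔ (j : ℝ) < 0 := by
      rw [show ((j : ℝ) < 0) ↔ j < 0 by exact_mod_cast Iff.rfl]; omega
    simp only [e1, e2]
  rw [hshift, ← hper]
  apply mul_right_cancel₀ hS0pos.ne'
  rw [add_mul, h1, add_mul (c + 1 / 2), mul_assoc (1 / (2 * L)), h2, hsub]
  field_simp
  rw [hx]; ring

/-! ### Circle averages of the logarithmic kernel -/

/-- The normalized arc length measure on the circle of radius `ρ` about the origin. -/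
noncomputable def circleMeasure (ρ : ℝ) : Measure ℂ :=
  ENNReal.ofReal (2 * Real.pi)⁻¹ •
    (volume.restrict (Set.Ioc 0 (2 * Real.pi))).map (circleMap 0 ρ)

theorem measurable_circleMap_zero (ρ : ℝ) : Measurable (circleMap 0 ρ) :=
  (continuous_circleMap 0 ρ).measurable

instance isProbabilityMeasure_circleMeasure (ρ : ℝ) : IsProbabilityMeasure (circleMeasure ρ) := by
  refine ⟨?_⟩
  rw [circleMeasure, Measure.smul_apply, Measure.map_apply (measurable_circleMap_zero ρ) .univ]
  simp only [Set.preimage_univ, Measure.restrict_apply_univ, Real.volume_Ioc, sub_zero, smul_eq_mul]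
  rw [← ENNReal.ofReal_mul (by positivity), inv_mul_cancel₀ (by positivity), ENNReal.ofReal_one]

theorem ae_circleMeasure_norm {ρ : ℝ} (hρ : 0 < ρ) : ∀ᵐ z ∂circleMeasure ρ, ‖z‖ = ρ := by
  refine Measure.ae_smul_measure ?_ _
  rw [ae_map_iff (measurable_circleMap_zero ρ).aemeasurable
    (measurableSet_eq_fun measurable_norm measurable_const)]
  exact Eventually.of_forall fun θ => by simp [abs_of_pos hρ]

theorem circleMeasure_singleton {ρ : ℝ} (hρ : 0 < ρ) (z : ℂ) : circleMeasure ρ {z} = 0 := by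
  rw [circleMeasure, Measure.smul_apply, Measure.map_apply (measurable_circleMap_zero ρ)
    (measurableSet_singleton z)]
  have h : (circleMap 0 ρ ⁻¹' {z}).Countable := (Set.countable_singleton z).preimage_circleMap 0 hρ.ne'
  have := h.measure_zero (volume.restrict (Set.Ioc 0 (2 * Real.pi)))
  rw [this, smul_zero]

theorem integral_circleMeasure {f : ℂ → ℝ} (hf : Measurable f) (ρ : ℝ) :
    ∫ z, f z ∂circleMeasure ρ = Real.circleAverage f 0 ρ := by
  rw [circleMeasure, integral_smul_measure, integral_map (measurable_circleMap_zero ρ).aemeasurable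
    hf.aestronglyMeasurable, Real.circleAverage_def,
    intervalIntegral.integral_of_le (by positivity), ENNReal.toReal_ofReal (by positivity)]

theorem measurable_log_norm_sub (w : ℂ) : Measurable (fun z : ℂ => Real.log ‖z - w‖) :=
  Real.measurable_log.comp (measurable_norm.comp (measurable_id.sub_const w))

/-- The circle average underlying Jensen's formula. Tested against circles, a measure is seen only
through the distribution of `|w|`. -/
theorem integral_log_norm_sub {ρ : ℝ} (hρ : 0 < ρ) (w : ℂ) :
    ∫ z, Real.log ‖z - w‖ ∂circleMeasure ρ = Real.log (max ρ ‖w‖) := by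
  rw [integral_circleMeasure (measurable_log_norm_sub w)]
  have h := circleAverage_log_norm_sub_const_eq_log_radius_add_posLog (c := 0) (a := w) hρ.ne'
  rw [h, zero_sub, norm_neg, Real.posLog_eq_log_max_one (by positivity),
    ← Real.log_mul hρ.ne' (by positivity), mul_max_of_nonneg _ _ hρ.le, mul_one,
    mul_inv_cancel_left₀ hρ.ne']

theorem integrable_log_norm_sub {ρ : ℝ} (w : ℂ) :
    Integrable (fun z => Real.log ‖z - w‖) (circleMeasure ρ) := by
  refine Integrable.smul_measure ?_ ENNReal.ofReal_ne_top
  rw [integrable_map_measure (measurable_log_norm_sub w).aestronglyMeasurable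
    (measurable_circleMap_zero ρ).aemeasurable]
  have h : CircleIntegrable (fun z => Real.log ‖z - w‖) 0 ρ :=
    circleIntegrable_log_norm_sub_const (c := 0) (a := w) ρ
  exact h.1

theorem measurable_kernel :
    Measurable (fun p : ℂ × ℂ => Real.log (1 / ‖p.1 - p.2‖)) :=
  Real.measurable_log.comp (measurable_const.div
    (measurable_norm.comp (measurable_fst.sub measurable_snd)))

/-- The signed integral is known exactly. On the circle `log |z - w|` is at most the nonnegative
number `m = log (1 + ρ + |w|)`, so its absolute value is at most `2 m - log |z - w|`. -/
theorem integral_abs_log_norm_sub_le {ρ : ℝ} (hρ : 0 < ρ) (w : ℂ) :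
    ∫ z, |Real.log ‖z - w‖| ∂circleMeasure ρ ≤ 2 * Real.log (1 + ρ + ‖w‖) - Real.log ρ := by
  have hle : ∀ᵐ z ∂circleMeasure ρ, |Real.log ‖z - w‖| ≤
      2 * Real.log (1 + ρ + ‖w‖) - Real.log ‖z - w‖ := by
    filter_upwards [ae_circleMeasure_norm hρ] with z hz
    have h1 : 0 ≤ Real.log (1 + ρ + ‖w‖) := Real.log_nonneg (by linarith [norm_nonneg w])
    have h2 : Real.log ‖z - w‖ ≤ Real.log (1 + ρ + ‖w‖) := by
      rcases eq_or_lt_of_le (norm_nonneg (z - w)) with h | h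
      · rw [← h, Real.log_zero]; exact h1
      · exact Real.log_le_log h (by linarith [norm_sub_le z w])
    rw [abs_le]; constructor <;> linarith
  refine (integral_mono_ae (integrable_log_norm_sub w).abs
    ((integrable_const _).sub (integrable_log_norm_sub w)) hle).trans ?_
  simp only [Pi.sub_apply]
  rw [integral_sub (integrable_const _) (integrable_log_norm_sub w), integral_log_norm_sub hρ]
  simp only [integral_const, probReal_univ, one_smul]
  linarith [Real.log_le_log hρ (le_max_left ρ ‖w‖)]

theorem exists_norm_le_of_compactSupport {μ : Measure ℂ}
    (hμ : ∃ K : Set ℂ, IsCompact K ∧ μ Kᶜ = 0) : ∃ R : ℝ, 0 ≤ R ∧ ∀ᵐ w ∂μ, ‖w‖ ≤ R := by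
  obtain ⟨K, hK, h0⟩ := hμ
  obtain ⟨R, hR⟩ := hK.isBounded.exists_norm_le
  refine ⟨max R 0, le_max_right _ _, ?_⟩
  have : ∀ᵐ w ∂μ, w ∈ K := by
    rw [ae_iff]; exact h0
  filter_upwards [this] with w hw
  exact (hR w hw).trans (le_max_left _ _)

theorem log_one_div_norm (z w : ℂ) : Real.log (1 / ‖z - w‖) = -Real.log ‖w - z‖ := by
  rw [one_div, Real.log_inv, norm_sub_rev]

theorem integrable_kernel_circle {μ : Measure ℂ} [IsFiniteMeasure μ]
    (hμ : ∃ K : Set ℂ, IsCompact K ∧ μ Kᶜ = 0) {ρ : ℝ} (hρ : 0 < ρ) :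
    Integrable (fun p : ℂ × ℂ => Real.log (1 / ‖p.1 - p.2‖)) (μ.prod (circleMeasure ρ)) := by
  obtain ⟨R, hR0, hR⟩ := exists_norm_le_of_compactSupport hμ
  have hm := measurable_kernel.aestronglyMeasurable (μ := μ.prod (circleMeasure ρ))
  rw [integrable_prod_iff hm]
  constructor
  · refine Eventually.of_forall fun w => ?_
    simp only [log_one_div_norm]
    exact (integrable_log_norm_sub w).neg
  · refine Integrable.mono' (integrable_const (2 * Real.log (1 + ρ + R) - Real.log ρ))
      hm.norm.integral_prod_right' ?_
    filter_upwards [hR] with w hw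
    simp only [log_one_div_norm, norm_neg, Real.norm_eq_abs]
    rw [abs_of_nonneg (integral_nonneg fun _ => abs_nonneg _)]
    refine (integral_abs_log_norm_sub_le hρ w).trans ?_
    have := Real.log_le_log (show 0 < 1 + ρ + ‖w‖ by positivity) (by linarith : 1 + ρ + ‖w‖ ≤ 1 + ρ + R)
    linarith

theorem integral_kernel_circle {μ : Measure ℂ} [IsFiniteMeasure μ]
    (hμ : ∃ K : Set ℂ, IsCompact K ∧ μ Kᶜ = 0) {ρ : ℝ} (hρ : 0 < ρ) :
    ∫ p : ℂ × ℂ, Real.log (1 / ‖p.1 - p.2‖) ∂(μ.prod (circleMeasure ρ)) =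
      -∫ w, Real.log (max ρ ‖w‖) ∂μ := by
  rw [integral_prod _ (integrable_kernel_circle hμ hρ), ← integral_neg]
  refine integral_congr_ae (Eventually.of_forall fun w => ?_)
  simp only [log_one_div_norm, integral_neg, integral_log_norm_sub hρ]

theorem circleMeasure_compactSupport {ρ : ℝ} (hρ : 0 < ρ) :
    ∃ K : Set ℂ, IsCompact K ∧ circleMeasure ρ Kᶜ = 0 :=
  ⟨Metric.closedBall 0 ρ, isCompact_closedBall 0 ρ, by
    have h := ae_circleMeasure_norm hρ
    refine measure_mono_null (fun z hz => ?_) (ae_iff.1 h)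
    simp only [Set.mem_compl_iff, mem_closedBall_zero_iff] at hz
    exact fun h => hz h.le⟩

theorem ae_circleMeasure_radial {Q : ℂ → ℝ} (hQ : IsRadial Q) {ρ : ℝ} (hρ : 0 < ρ) :
    Q =ᵐ[circleMeasure ρ] fun _ => Q (ρ : ℂ) := by
  filter_upwards [ae_circleMeasure_norm hρ] with z hz
  rw [hQ z, hz]

theorem hasFiniteEnergy_circleMeasure {Q : ℂ → ℝ} (hQ : IsRadial Q) {ρ : ℝ} (hρ : 0 < ρ) :
    HasFiniteEnergy Q (circleMeasure ρ) where
  isProbabilityMeasure := inferInstance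
  compactSupport := circleMeasure_compactSupport hρ
  noAtom := circleMeasure_singleton hρ
  integrable_kernel := integrable_kernel_circle (circleMeasure_compactSupport hρ) hρ
  integrable_potential := (integrable_congr (ae_circleMeasure_radial hQ hρ)).2 (integrable_const _)

/-! ### Variational conditions for the equilibrium measure -/

theorem kernel_swap {μ ν : Measure ℂ} [SFinite μ] [SFinite ν]
    (h : Integrable (fun p : ℂ × ℂ => Real.log (1 / ‖p.1 - p.2‖)) (μ.prod ν)) :
    Integrable (fun p : ℂ × ℂ => Real.log (1 / ‖p.1 - p.2‖)) (ν.prod μ) ∧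
    ∫ p : ℂ × ℂ, Real.log (1 / ‖p.1 - p.2‖) ∂(ν.prod μ) =
      ∫ p : ℂ × ℂ, Real.log (1 / ‖p.1 - p.2‖) ∂(μ.prod ν) := by
  have e : (fun p : ℂ × ℂ => Real.log (1 / ‖p.1 - p.2‖)) =
      (fun p : ℂ × ℂ => Real.log (1 / ‖p.1 - p.2‖)) ∘ Prod.swap := by
    ext p; simp [norm_sub_rev]
  constructor
  · rw [e]; exact h.swap
  · conv_lhs => rw [e]
    exact integral_prod_swap (μ := μ) (ν := ν) (fun p : ℂ × ℂ => Real.log (1 / ‖p.1 - p.2‖))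

/-- The first variation of the weighted energy at the equilibrium measure. -/
theorem robinConst_le {Q : ℂ → ℝ} {σ ν : Measure ℂ} (hσ : IsEquilibriumMeasure Q σ)
    (hν : HasFiniteEnergy Q ν)
    (hk : Integrable (fun p : ℂ × ℂ => Real.log (1 / ‖p.1 - p.2‖)) (σ.prod ν)) :
    robinConst Q σ ≤
      2 * (∫ p : ℂ × ℂ, Real.log (1 / ‖p.1 - p.2‖) ∂(σ.prod ν)) + ∫ z, Q z ∂ν := by
  have i1 := hσ.1.isProbabilityMeasure
  have i2 := hν.isProbabilityMeasure
  obtain ⟨hk', hkint⟩ := kernel_swap hk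
  set k := fun p : ℂ × ℂ => Real.log (1 / ‖p.1 - p.2‖) with hkdef
  set A := ∫ p, k p ∂(σ.prod σ) with hA
  set B := ∫ p, k p ∂(σ.prod ν) with hB
  set C := ∫ p, k p ∂(ν.prod ν) with hC
  set E := ∫ z, Q z ∂σ with hE
  set F := ∫ z, Q z ∂ν with hF
  -- The competitor is `(1 - ε) σ + ε ν`. Its energy is a quadratic polynomial in `ε`, and
  -- nonnegativity of the linear coefficient is the claim.
  have key : ∀ ε : ℝ, 0 < ε → ε < 1 →
      A + E ≤ (1 - ε) ^ 2 * A + 2 * ε * (1 - ε) * B + ε ^ 2 * C + (1 - ε) * E + ε * F := by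
    intro ε h0 h1
    set u := ENNReal.ofReal (1 - ε) with hu
    set v := ENNReal.ofReal ε with hv
    have hut : u ≠ ⊤ := ENNReal.ofReal_ne_top
    have hvt : v ≠ ⊤ := ENNReal.ofReal_ne_top
    have hur : u.toReal = 1 - ε := ENNReal.toReal_ofReal (by linarith)
    have hvr : v.toReal = ε := ENNReal.toReal_ofReal h0.le
    have hprod : (u • σ + v • ν).prod (u • σ + v • ν) =
        (u • u • σ.prod σ + u • v • ν.prod σ) + (v • u • σ.prod ν + v • v • ν.prod ν) := by
      have : IsFiniteMeasure (u • σ) := Measure.smul_finite σ hut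
      have : IsFiniteMeasure (v • ν) := Measure.smul_finite ν hvt
      rw [Measure.prod_add, Measure.add_prod, Measure.add_prod]
      simp only [Measure.prod_smul_left, Measure.prod_smul_right]
    have k1 : Integrable k (u • u • σ.prod σ) :=
      (hσ.1.integrable_kernel.smul_measure hut).smul_measure hut
    have k2 : Integrable k (u • v • ν.prod σ) := (hk'.smul_measure hvt).smul_measure hut
    have k3 : Integrable k (v • u • σ.prod ν) := (hk.smul_measure hut).smul_measure hvt
    have k4 : Integrable k (v • v • ν.prod ν) :=
      (hν.integrable_kernel.smul_measure hvt).smul_measure hvt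
    have hmem : HasFiniteEnergy Q (u • σ + v • ν) := by
      refine ⟨⟨?_⟩, ?_, ?_, ?_, ?_⟩
      · simp only [Measure.add_apply, Measure.smul_apply, measure_univ, smul_eq_mul, mul_one]
        rw [← ENNReal.ofReal_add (by linarith) h0.le]; simp
      · obtain ⟨K, hK, hK0⟩ := hσ.1.compactSupport
        obtain ⟨K', hK', hK0'⟩ := hν.compactSupport
        refine ⟨K ∪ K', hK.union hK', ?_⟩
        simp only [Measure.add_apply, Measure.smul_apply, smul_eq_mul]
        rw [measure_mono_null (Set.compl_subset_compl.2 Set.subset_union_left) hK0,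
          measure_mono_null (Set.compl_subset_compl.2 Set.subset_union_right) hK0']
        simp
      · intro z
        simp [hσ.1.noAtom z, hν.noAtom z]
      · rw [hprod]
        exact (k1.add_measure k2).add_measure (k3.add_measure k4)
      · exact (hσ.1.integrable_potential.smul_measure hut).add_measure
          (hν.integrable_potential.smul_measure hvt)
    have h := hσ.2 _ hmem
    rw [energy, energy, hprod, integral_add_measure (k1.add_measure k2) (k3.add_measure k4),
      integral_add_measure k1 k2, integral_add_measure k3 k4,
      integral_add_measure (hσ.1.integrable_potential.smul_measure hut)
        (hν.integrable_potential.smul_measure hvt)] at h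
    simp only [integral_smul_measure, hur, hvr, smul_eq_mul] at h
    simp only [hkdef] at hkint hA hB hC
    rw [hkint, ← hA, ← hB, ← hC] at h
    linarith
  rw [robinConst, ← hA, ← hE]
  by_contra hcon
  push Not at hcon
  -- the defect is quadratic in `ε`
  set g := 2 * A + E - (2 * B + F) with hg
  have hgpos : 0 < g := by linarith
  set D := |A - 2 * B + C| + 1 with hD
  have hDpos : 0 < D := by positivity
  set ε := min (1 / 2) (g / (2 * D)) with hε
  have e0 : 0 < ε := lt_min (by norm_num) (by positivity)
  have e1 : ε < 1 := (min_le_left _ _).trans_lt (by norm_num)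
  have e2 : ε * D ≤ g / 2 := by
    have : ε ≤ g / (2 * D) := min_le_right _ _
    calc ε * D ≤ g / (2 * D) * D := mul_le_mul_of_nonneg_right this hDpos.le
      _ = g / 2 := by field_simp
  have h := key ε e0 e1
  have h3 : ε * g ≤ ε ^ 2 * (A - 2 * B + C) := by nlinarith
  have h4 : ε * (ε * (A - 2 * B + C)) ≤ ε * (ε * D) := by
    have := le_abs_self (A - 2 * B + C)
    gcongr; linarith
  nlinarith

/-- Normalized restrictions of `σ` are the competitors that localize the first variation to an
arbitrary set of positive mass. -/
theorem HasFiniteEnergy.cond {Q : ℂ → ℝ} {σ : Measure ℂ} (h : HasFiniteEnergy Q σ) {E : Set ℂ}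
    (hE : σ E ≠ 0) :
    HasFiniteEnergy Q ((σ E)⁻¹ • σ.restrict E) := by
  have i1 := h.isProbabilityMeasure
  have ht : (σ E)⁻¹ ≠ ⊤ := ENNReal.inv_ne_top.2 hE
  have hle : σ.restrict E ≤ σ := Measure.restrict_le_self
  refine ⟨⟨?_⟩, ?_, ?_, ?_, ?_⟩
  · rw [Measure.smul_apply, Measure.restrict_apply_univ, smul_eq_mul,
      ENNReal.inv_mul_cancel hE (measure_ne_top σ E)]
  · obtain ⟨K, hK, h0⟩ := h.compactSupport
    refine ⟨K, hK, ?_⟩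
    rw [Measure.smul_apply, le_antisymm ((hle _).trans h0.le) bot_le]; simp
  · intro z
    rw [Measure.smul_apply, le_antisymm ((hle _).trans (h.noAtom z).le) bot_le]; simp
  · simp only [Measure.prod_smul_left, Measure.prod_smul_right]
    refine (Integrable.smul_measure ?_ ht).smul_measure ht
    rw [Measure.prod_restrict]
    exact h.integrable_kernel.restrict
  · exact h.integrable_potential.restrict.smul_measure ht

/-- Equality in the variational inequality holds almost everywhere. -/
theorem ae_obstacle_eq {Q : ℂ → ℝ} {σ : Measure ℂ} (hσ : IsEquilibriumMeasure Q σ) :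
    ∀ᵐ z ∂σ, Q z + 2 * logPotential σ z = robinConst Q σ := by
  have i1 := hσ.1.isProbabilityMeasure
  have hk := hσ.1.integrable_kernel
  have hP : Integrable (logPotential σ) σ := hk.integral_prod_left
  have hPint : ∫ z, logPotential σ z ∂σ =
      ∫ p : ℂ × ℂ, Real.log (1 / ‖p.1 - p.2‖) ∂(σ.prod σ) := (integral_prod _ hk).symm
  set g : ℂ → ℝ := fun z => Q z + 2 * logPotential σ z - robinConst Q σ with hg
  have hgi : Integrable g σ :=
    (hσ.1.integrable_potential.add (hP.const_mul 2)).sub (integrable_const _)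
  have hg0 : ∫ z, g z ∂σ = 0 := by
    have : ∫ z, g z ∂σ = ∫ z, Q z ∂σ + 2 * ∫ z, logPotential σ z ∂σ - robinConst Q σ := by
      have hs : Integrable (fun z => Q z + 2 * logPotential σ z) σ :=
        hσ.1.integrable_potential.add (hP.const_mul 2)
      simp only [hg]
      rw [integral_sub hs (integrable_const _),
        integral_add hσ.1.integrable_potential (hP.const_mul 2), integral_const_mul]
      simp
    rw [this, hPint, robinConst]; ring
  -- The first variation towards the normalized restriction to `E` says that `g` has nonnegative
  -- integral over `E`. Since the total integral of `g` vanishes by the definition of `robinConst`,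
  -- this forces `g = 0` almost everywhere.
  have hnn : 0 ≤ᵐ[σ] g := by
    refine ae_nonneg_of_forall_setIntegral_nonneg hgi fun E hE _ => ?_
    by_cases h0 : σ E = 0
    · rw [setIntegral_measure_zero _ h0]
    · have ht : (σ E)⁻¹ ≠ ⊤ := ENNReal.inv_ne_top.2 h0
      have hprod : Integrable (fun p : ℂ × ℂ => Real.log (1 / ‖p.1 - p.2‖))
          ((σ.restrict E).prod σ) := by
        have h2 : (σ.restrict E).prod σ = (σ.prod σ).restrict (E ×ˢ Set.univ) := by
          rw [← Measure.prod_restrict, Measure.restrict_univ]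
        rw [h2]; exact hk.restrict
      obtain ⟨hsw, hswi⟩ := kernel_swap hprod
      have hk2 : Integrable (fun p : ℂ × ℂ => Real.log (1 / ‖p.1 - p.2‖))
          (σ.prod ((σ E)⁻¹ • σ.restrict E)) := by
        rw [Measure.prod_smul_right]
        exact hsw.smul_measure ht
      have h := robinConst_le hσ (hσ.1.cond h0) hk2
      rw [Measure.prod_smul_right, integral_smul_measure, integral_smul_measure, hswi,
        integral_prod _ hprod] at h
      have h3 : ∫ z in E, g z ∂σ = ∫ z in E, Q z ∂σ + 2 * ∫ z in E, logPotential σ z ∂σ -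
          (σ E).toReal * robinConst Q σ := by
        have hs : Integrable (fun z => Q z + 2 * logPotential σ z) (σ.restrict E) :=
          hσ.1.integrable_potential.restrict.add (hP.restrict.const_mul 2)
        simp only [hg]
        rw [integral_sub hs (integrable_const _),
          integral_add hσ.1.integrable_potential.restrict (hP.restrict.const_mul 2),
          integral_const_mul]
        simp [Measure.real]
      have hpos : 0 < (σ E).toReal := ENNReal.toReal_pos h0 (measure_ne_top σ E)
      rw [h3]
      simp only [logPotential]
      rw [ENNReal.toReal_inv, smul_eq_mul, smul_eq_mul] at h
      have h4 := mul_le_mul_of_nonneg_left h hpos.le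
      field_simp at h4
      linarith
  have hae := (integral_eq_zero_iff_of_nonneg_ae hnn hgi).1 hg0
  filter_upwards [hae] with z hz
  simp only [hg, Pi.zero_apply] at hz
  linarith

/-- The logarithmic kernel, truncated at height `m`. -/
noncomputable def truncKernel (m : ℕ) (z w : ℂ) : ℝ := -Real.log (max ‖z - w‖ (Real.exp (-(m : ℝ))))

theorem continuous_truncKernel (m : ℕ) : Continuous (fun p : ℂ × ℂ => truncKernel m p.1 p.2) := by
  unfold truncKernel
  refine (Continuous.log (by fun_prop) fun p => ?_).neg
  exact (lt_max_of_lt_right (Real.exp_pos _)).ne'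

theorem truncKernel_le (m : ℕ) {z w : ℂ} (h : w ≠ z) : truncKernel m z w ≤ Real.log (1 / ‖z - w‖) := by
  rw [truncKernel, one_div, Real.log_inv, neg_le_neg_iff]
  exact Real.log_le_log (norm_pos_iff.2 (sub_ne_zero.2 h.symm)) (le_max_left _ _)

theorem abs_truncKernel_le (m : ℕ) (z w : ℂ) :
    |truncKernel m z w| ≤ |Real.log (1 / ‖z - w‖)| + m := by
  rw [truncKernel, abs_neg, one_div, Real.log_inv, abs_neg]
  rcases le_total ‖z - w‖ (Real.exp (-(m : ℝ))) with h | h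
  · rw [max_eq_right h, Real.log_exp, abs_neg, Nat.abs_cast]
    linarith [abs_nonneg (Real.log ‖z - w‖)]
  · rw [max_eq_left h]
    linarith [Nat.cast_nonneg (α := ℝ) m]

theorem abs_truncKernel_le_of_norm_le (m : ℕ) {z w : ℂ} {R : ℝ} (h : ‖z - w‖ ≤ R) :
    |truncKernel m z w| ≤ |Real.log (max R (Real.exp (-(m : ℝ))))| + m := by
  rw [truncKernel, abs_neg, abs_le]
  have h1 : Real.exp (-(m : ℝ)) ≤ max ‖z - w‖ (Real.exp (-(m : ℝ))) := le_max_right _ _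
  have h2 := Real.log_le_log (Real.exp_pos _) h1
  have h3 := Real.log_le_log (lt_max_of_lt_right (Real.exp_pos _))
    (max_le_max h (le_refl (Real.exp (-(m : ℝ)))))
  rw [Real.log_exp] at h2
  have := le_abs_self (Real.log (max R (Real.exp (-(m : ℝ)))))
  have := abs_nonneg (Real.log (max R (Real.exp (-(m : ℝ)))))
  have := Nat.cast_nonneg (α := ℝ) m
  constructor <;> linarith

/-- Continuity allows an almost everywhere inequality to be carried to every point of the support.
The full potential is only lower semicontinuous, which is the reason for truncating. -/
theorem continuous_truncPotential {σ : Measure ℂ} [IsFiniteMeasure σ] {R : ℝ}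
    (hR : ∀ᵐ w ∂σ, ‖w‖ ≤ R) (m : ℕ) : Continuous (fun z => ∫ w, truncKernel m z w ∂σ) := by
  have hc := continuous_truncKernel m
  rw [continuous_iff_continuousAt]
  intro z₀
  refine continuousAt_of_dominated
    (bound := fun _ => |Real.log (max (‖z₀‖ + 1 + R) (Real.exp (-(m : ℝ))))| + m) ?_ ?_
    (integrable_const _) ?_
  · exact Eventually.of_forall fun z =>
      (hc.comp (Continuous.prodMk_right z)).aestronglyMeasurable
  · filter_upwards [Metric.ball_mem_nhds z₀ one_pos] with z hz
    filter_upwards [hR] with w hw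
    refine abs_truncKernel_le_of_norm_le m ((norm_sub_le z w).trans ?_)
    have : ‖z‖ ≤ ‖z₀‖ + ‖z - z₀‖ := by
      have := norm_add_le z₀ (z - z₀); simpa using this
    rw [Metric.mem_ball, dist_eq_norm] at hz
    linarith
  · exact Eventually.of_forall fun w =>
      (hc.comp (Continuous.prodMk_left w)).continuousAt

/-- On the support, the potential with truncated kernel is below the obstacle. -/
theorem truncPotential_le {Q : ℂ → ℝ} {σ : Measure ℂ} (hσ : IsEquilibriumMeasure Q σ) (m : ℕ)
    {z : ℂ} (hz : z ∈ σ.support) (hQ : ContinuousAt Q z) :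
    Q z + 2 * ∫ w, truncKernel m z w ∂σ ≤ robinConst Q σ := by
  have i1 := hσ.1.isProbabilityMeasure
  obtain ⟨R, hR0, hR⟩ := exists_norm_le_of_compactSupport hσ.1.compactSupport
  have hae : ∀ᵐ z ∂σ, Q z + 2 * ∫ w, truncKernel m z w ∂σ ≤ robinConst Q σ := by
    filter_upwards [ae_obstacle_eq hσ, hσ.1.integrable_kernel.prod_right_ae] with z h1 h2
    rw [← h1]
    have hne : ∀ᵐ w ∂σ, w ≠ z := by
      rw [ae_iff]; simpa using hσ.1.noAtom z
    have : ∫ w, truncKernel m z w ∂σ ≤ logPotential σ z := by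
      refine integral_mono_ae (Integrable.mono' (h2.abs.add (integrable_const (m : ℝ)))
        ((continuous_truncKernel m).comp (Continuous.prodMk_right z)).aestronglyMeasurable
        (Eventually.of_forall fun w => abs_truncKernel_le m z w)) h2 ?_
      filter_upwards [hne] with w hw using truncKernel_le m hw
    linarith
  by_contra hcon
  push Not at hcon
  have hc : ContinuousAt (fun z => Q z + 2 * ∫ w, truncKernel m z w ∂σ) z :=
    hQ.add ((continuous_truncPotential hR m).continuousAt.const_mul 2)
  have hev := hc.eventually_const_lt hcon
  rw [Measure.mem_support_iff_forall] at hz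
  have hpos := hz _ hev
  refine hpos.ne' (measure_mono_null (fun w hw => ?_) (ae_iff.1 hae))
  exact not_le.2 hw

/-- Off the diagonal the truncation does not exceed the kernel in absolute value, so the kernel is
its own majorant. The diagonal must be null because `truncKernel` equals `m` there, while `Real.log
(1 / 0) = 0`. -/
theorem tendsto_integral_truncKernel {μ : Measure (ℂ × ℂ)} [IsFiniteMeasure μ]
    (hd : ∀ᵐ p ∂μ, p.2 ≠ p.1)
    (hk : Integrable (fun p : ℂ × ℂ => Real.log (1 / ‖p.1 - p.2‖)) μ) :
    Tendsto (fun m : ℕ => ∫ p, truncKernel m p.1 p.2 ∂μ) atTop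
      (𝓝 (∫ p : ℂ × ℂ, Real.log (1 / ‖p.1 - p.2‖) ∂μ)) := by
  have hle : ∀ (m : ℕ) (z w : ℂ), w ≠ z → |truncKernel m z w| ≤ |Real.log (1 / ‖z - w‖)| := by
    intro m z w h
    have hpos : 0 < ‖z - w‖ := norm_pos_iff.2 (sub_ne_zero.2 h.symm)
    rw [truncKernel, abs_neg, one_div, Real.log_inv, abs_neg]
    rcases le_total ‖z - w‖ (Real.exp (-(m : ℝ))) with h | h
    · rw [max_eq_right h, Real.log_exp, abs_neg, Nat.abs_cast]
      have := Real.log_le_log hpos h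
      rw [Real.log_exp] at this
      exact le_trans (by linarith) (neg_le_abs _)
    · rw [max_eq_left h]
  refine tendsto_integral_of_dominated_convergence _
    (fun m => (continuous_truncKernel m).aestronglyMeasurable) hk.abs
    (fun m => hd.mono fun p hp => hle m p.1 p.2 hp) ?_
  filter_upwards [hd] with p hp
  have hpos : 0 < ‖p.1 - p.2‖ := norm_pos_iff.2 (sub_ne_zero.2 hp.symm)
  obtain ⟨M, hM⟩ := exists_nat_ge (-Real.log ‖p.1 - p.2‖)
  refine tendsto_const_nhds.congr' ?_
  filter_upwards [eventually_ge_atTop M] with m hm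
  rw [truncKernel, one_div, Real.log_inv, max_eq_left]
  have : (M : ℝ) ≤ m := by exact_mod_cast hm
  calc Real.exp (-(m : ℝ)) ≤ Real.exp (Real.log ‖p.1 - p.2‖) := Real.exp_le_exp.2 (by linarith)
    _ = _ := Real.exp_log hpos

theorem ae_ne_circle {σ : Measure ℂ} [SFinite σ] {ρ : ℝ} (hρ : 0 < ρ) :
    ∀ᵐ p ∂(σ.prod (circleMeasure ρ)), p.1 ≠ p.2 := by
  refine (Measure.ae_prod_iff_ae_ae ?_).2 (Eventually.of_forall fun z => ?_)
  · exact (measurableSet_eq_fun measurable_fst measurable_snd).compl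
  · rw [ae_iff]
    have := circleMeasure_singleton hρ z
    refine measure_mono_null (fun w hw => ?_) this
    simpa [eq_comm] using hw

/-! ### Obstacle inequalities averaged over circles -/

/-- The radial average of the logarithmic potential is a lower bound for the potential. -/
theorem le_radial_obstacle {Q : ℂ → ℝ} {σ : Measure ℂ} (hQ : IsRadial Q)
    (hσ : IsEquilibriumMeasure Q σ) {ρ : ℝ} (hρ : 0 < ρ) :
    robinConst Q σ ≤ Q (ρ : ℂ) - 2 * ∫ w, Real.log (max ρ ‖w‖) ∂σ := by
  have i1 := hσ.1.isProbabilityMeasure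
  have h := robinConst_le hσ (hasFiniteEnergy_circleMeasure hQ hρ)
    (integrable_kernel_circle hσ.1.compactSupport hρ)
  rw [integral_kernel_circle hσ.1.compactSupport hρ, integral_congr_ae
    (ae_circleMeasure_radial hQ hρ)] at h
  simp at h
  linarith

/-- Equality on circles contained in the droplet. -/
theorem radial_obstacle_le {Q : ℂ → ℝ} {σ : Measure ℂ} (hQ : IsRadial Q)
    (hσ : IsEquilibriumMeasure Q σ) {ρ : ℝ} (hρ : 0 < ρ)
    (hS : Metric.sphere (0 : ℂ) ρ ⊆ σ.support) (hc : ∀ z ∈ σ.support, ContinuousAt Q z) :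
    Q (ρ : ℂ) - 2 * ∫ w, Real.log (max ρ ‖w‖) ∂σ ≤ robinConst Q σ := by
  have i1 := hσ.1.isProbabilityMeasure
  have hcs := hσ.1.compactSupport
  obtain ⟨hk, hki⟩ := kernel_swap (integrable_kernel_circle hcs hρ)
  have hne : ∀ᵐ p ∂((circleMeasure ρ).prod σ), p.2 ≠ p.1 := by
    have h := ae_ne_circle (σ := σ) hρ
    have h2 := (Measure.measurePreserving_swap (μ := circleMeasure ρ) (ν := σ)).quasiMeasurePreserving.ae h
    filter_upwards [h2] with p hp using hp
  have ht := tendsto_integral_truncKernel hne hk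
  rw [hki, integral_kernel_circle hcs hρ] at ht
  -- The pointwise bound on the support is averaged over the circle while the kernel is still
  -- truncated. Only then does `m` tend to infinity, so no regularity of the full potential enters.
  have hb : ∀ m : ℕ, ∫ p, truncKernel m p.1 p.2 ∂((circleMeasure ρ).prod σ) ≤
      (robinConst Q σ - Q (ρ : ℂ)) / 2 := by
    intro m
    have hi : Integrable (fun p : ℂ × ℂ => truncKernel m p.1 p.2) ((circleMeasure ρ).prod σ) :=
      Integrable.mono' (hk.abs.add (integrable_const (m : ℝ)))
        (continuous_truncKernel m).aestronglyMeasurable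
        (Eventually.of_forall fun p => abs_truncKernel_le m p.1 p.2)
    rw [integral_prod _ hi]
    have h2 : ∀ᵐ z ∂circleMeasure ρ, ∫ w, truncKernel m z w ∂σ ≤
        (robinConst Q σ - Q (ρ : ℂ)) / 2 := by
      filter_upwards [ae_circleMeasure_norm hρ] with z hz
      have hz' : z ∈ σ.support := hS (by simpa using hz)
      have := truncPotential_le hσ m hz' (hc z hz')
      rw [hQ z, hz] at this
      linarith
    refine (integral_mono_ae hi.integral_prod_left (integrable_const _) h2).trans ?_
    simp
  have := le_of_tendsto' ht hb
  linarith

/-- Strict inequality on circles outside of the droplet. -/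
theorem lt_radial_obstacle {Q : ℂ → ℝ} {σ : Measure ℂ} (hQ : IsRadial Q)
    (hσ : IsEquilibriumMeasure Q σ) {ρ : ℝ} (hρ : 0 < ρ)
    (hlt : ∀ z : ℂ, ‖z‖ = ρ → obstacle Q σ z < Q z) :
    robinConst Q σ < Q (ρ : ℂ) - 2 * ∫ w, Real.log (max ρ ‖w‖) ∂σ := by
  have i1 := hσ.1.isProbabilityMeasure
  have hcs := hσ.1.compactSupport
  obtain ⟨hk, hki⟩ := kernel_swap (integrable_kernel_circle hcs hρ)
  rw [integral_kernel_circle hcs hρ, integral_prod _ hk] at hki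
  have hP : Integrable (logPotential σ) (circleMeasure ρ) := hk.integral_prod_left
  set g : ℂ → ℝ := fun z => Q (ρ : ℂ) - robinConst Q σ + 2 * logPotential σ z with hg
  have hgi : Integrable g (circleMeasure ρ) := (integrable_const _).add (hP.const_mul 2)
  have hpos : ∀ᵐ z ∂circleMeasure ρ, 0 < g z := by
    filter_upwards [ae_circleMeasure_norm hρ] with z hz
    have := hlt z hz
    rw [obstacle, hQ z, hz] at this
    simp only [hg]; linarith
  have h0 : 0 < ∫ z, g z ∂circleMeasure ρ := by
    rw [integral_pos_iff_support_of_nonneg_ae (hpos.mono fun z hz => hz.le) hgi]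
    have : Function.support g =ᵐ[circleMeasure ρ] Set.univ := by
      filter_upwards [hpos] with z hz
      exact propext ⟨fun _ => trivial, fun _ => hz.ne'⟩
    rw [measure_congr this, measure_univ]; exact one_pos
  have h1 : ∫ z, g z ∂circleMeasure ρ = Q (ρ : ℂ) - robinConst Q σ +
      2 * ∫ z, logPotential σ z ∂circleMeasure ρ := by
    simp only [hg]
    rw [integral_add (integrable_const _) (hP.const_mul 2), integral_const_mul]
    simp
  have h2 : ∫ z, logPotential σ z ∂circleMeasure ρ = -∫ w, Real.log (max ρ ‖w‖) ∂σ := hki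
  rw [h1, h2] at h0
  linarith

/-! ### The effective potential of a gap -/

theorem mem_support_of_norm {Q : ℂ → ℝ} {σ : Measure ℂ} {N : ℕ} {a b : ℕ → ℝ}
    (hQ : IsRadialPotential Q σ N a b) {k : ℕ} (hk : k ≤ N) {z : ℂ} (h1 : a k ≤ ‖z‖)
    (h2 : ‖z‖ ≤ b k) : z ∈ σ.support := by
  rw [hQ.droplet_eq]; exact ⟨k, hk, h1, h2⟩

theorem radii_mono {Q : ℂ → ℝ} {σ : Measure ℂ} {N : ℕ} {a b : ℕ → ℝ}
    (hQ : IsRadialPotential Q σ N a b) {i j : ℕ} (hij : i ≤ j) (hj : j ≤ N) :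
    a i ≤ a j ∧ b i ≤ b j := by
  induction j, hij using Nat.le_induction with
  | base => exact ⟨le_rfl, le_rfl⟩
  | succ j hij ih =>
    obtain ⟨h1, h2⟩ := ih (by omega)
    have h3 := hQ.radius_lt j (by omega)
    have h4 := hQ.radius_lt_succ j (by omega)
    have h5 := hQ.radius_lt (j + 1) hj
    exact ⟨by linarith, by linarith⟩

theorem notMem_support_of_gap {Q : ℂ → ℝ} {σ : Measure ℂ} {N : ℕ} {a b : ℕ → ℝ}
    (hQ : IsRadialPotential Q σ N a b) {k : ℕ} {z : ℂ} (h1 : b k < ‖z‖) (h2 : ‖z‖ < a (k + 1))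
    (hk : k < N) : z ∉ σ.support := by
  rw [hQ.droplet_eq]
  rintro ⟨i, hi, h3, h4⟩
  rcases le_or_gt i k with h | h
  · have := (radii_mono hQ h hk.le).2
    linarith
  · have := (radii_mono hQ (Nat.succ_le_of_lt h) hi).1
    simp only [Nat.succ_eq_add_one] at this
    linarith

theorem radius_nonneg_of_le {Q : ℂ → ℝ} {σ : Measure ℂ} {N : ℕ} {a b : ℕ → ℝ}
    (hQ : IsRadialPotential Q σ N a b) {k : ℕ} (hk : k ≤ N) : 0 ≤ a k :=
  hQ.radius_nonneg.trans (radii_mono hQ (Nat.zero_le k) hk).1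

theorem measure_pos_of_isOpen {σ : Measure ℂ} {z : ℂ} (hz : z ∈ σ.support) {O : Set ℂ}
    (hO : IsOpen O) (h : z ∈ O) : 0 < σ O :=
  (Measure.mem_support_iff_forall z).1 hz O (hO.mem_nhds h)

/-- Outside of the droplet the effective potential `q(ρ) - 2 M log ρ` of a gap is larger than its
common value at the end points of the gap, where `M` is the mass inside of the gap. -/
theorem exists_gap_effective_potential {Q : ℂ → ℝ} {σ : Measure ℂ} {N : ℕ} {a b : ℕ → ℝ}
    (hQ : IsRadialPotential Q σ N a b) {k : ℕ} (hk : k < N) :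
    ∃ M v : ℝ, 0 < M ∧ M < 1 ∧
      Q (b k : ℂ) - 2 * M * Real.log (b k) = v ∧
      Q (a (k + 1) : ℂ) - 2 * M * Real.log (a (k + 1)) = v ∧
      ∀ ρ : ℝ, 0 < ρ → ρ ≠ b k → ρ ≠ a (k + 1) → v < Q (ρ : ℂ) - 2 * M * Real.log ρ := by
  have i1 := hQ.equilibrium.1.isProbabilityMeasure
  set r₁ := b k with hr₁
  set r₂ := a (k + 1) with hr₂
  have h12 : r₁ < r₂ := hQ.radius_lt_succ k hk
  have hak : a k < r₁ := hQ.radius_lt k hk.le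
  have hbk : r₂ < b (k + 1) := hQ.radius_lt (k + 1) hk
  have ha0 : 0 ≤ a k := radius_nonneg_of_le hQ hk.le
  have h1pos : 0 < r₁ := ha0.trans_lt hak
  have h2pos : 0 < r₂ := h1pos.trans h12
  have hm1 : (r₁ : ℂ) ∈ σ.support := mem_support_of_norm hQ hk.le
    (by rw [Complex.norm_real, Real.norm_of_nonneg h1pos.le]; exact hak.le)
    (by rw [Complex.norm_real, Real.norm_of_nonneg h1pos.le])
  have hm2 : (r₂ : ℂ) ∈ σ.support := mem_support_of_norm hQ hk
    (by rw [Complex.norm_real, Real.norm_of_nonneg h2pos.le])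
    (by rw [Complex.norm_real, Real.norm_of_nonneg h2pos.le]; exact hbk.le)
  obtain ⟨R, hR0, hR⟩ := exists_norm_le_of_compactSupport hQ.equilibrium.1.compactSupport
  have hgap : ∀ᵐ w ∂σ, ‖w‖ ≤ r₁ ∨ r₂ ≤ ‖w‖ := by
    filter_upwards [Measure.support_mem_ae (μ := σ)] with w hw
    by_contra hcon
    push Not at hcon
    exact notMem_support_of_gap hQ hcon.1 hcon.2 hk hw
  set A : Set ℂ := {w | ‖w‖ ≤ r₁} with hA
  have hAm : MeasurableSet A := measurableSet_le measurable_norm measurable_const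
  set M := (σ A).toReal with hM
  -- `S ρ + T` is a minorant of `log (max ρ |w|)` that is affine in `log ρ`, with slope one for `w`
  -- in the inner disc and zero otherwise. For `ρ` in the closed gap it is exact for almost every
  -- `w`. Its integral is `M log ρ + t`.
  set T : ℂ → ℝ := fun w => if ‖w‖ ≤ r₁ then 0 else Real.log ‖w‖ with hT
  have hTm : Measurable T := Measurable.ite hAm measurable_const
    (Real.measurable_log.comp measurable_norm)
  have hlogb : ∀ x : ℝ, r₁ ≤ x → x ≤ max r₁ R → |Real.log x| ≤ |Real.log r₁| + |Real.log (max r₁ R)| := by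
    intro x h1 h2
    have := Real.log_le_log h1pos h1
    have := Real.log_le_log (h1pos.trans_le h1) h2
    rw [abs_le]
    constructor <;>
    linarith [abs_nonneg (Real.log r₁), abs_nonneg (Real.log (max r₁ R)), neg_abs_le (Real.log r₁),
      le_abs_self (Real.log (max r₁ R))]
  have hTi : Integrable T σ := by
    refine Integrable.mono' (integrable_const (|Real.log r₁| + |Real.log (max r₁ R)|))
      hTm.aestronglyMeasurable ?_
    filter_upwards [hR] with w hw
    simp only [hT]
    split_ifs with h
    · simp only [norm_zero]; positivity
    · exact hlogb _ (not_le.1 h).le (hw.trans (le_max_right _ _))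
  set S : ℝ → ℂ → ℝ := fun ρ w => if ‖w‖ ≤ r₁ then Real.log ρ else 0 with hS
  have hSi : ∀ ρ, Integrable (S ρ) σ := fun ρ =>
    Integrable.mono' (integrable_const |Real.log ρ|)
      (Measurable.ite hAm measurable_const measurable_const).aestronglyMeasurable
      (Eventually.of_forall fun w => by
        simp only [hS]; split_ifs
        · exact le_rfl
        · simp)
  have hSint : ∀ ρ, ∫ w, S ρ w ∂σ = M * Real.log ρ := by
    intro ρ
    have : S ρ = A.indicator fun _ => Real.log ρ := by
      ext w; simp only [hS, Set.indicator, hA, Set.mem_ofPred_eq]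
    rw [this, integral_indicator_const _ hAm, smul_eq_mul, Measure.real]
  have hJm : ∀ ρ : ℝ, Measurable fun w : ℂ => Real.log (max ρ ‖w‖) := fun ρ =>
    Real.measurable_log.comp (measurable_const.max measurable_norm)
  have hJi : ∀ ρ : ℝ, 0 < ρ → Integrable (fun w : ℂ => Real.log (max ρ ‖w‖)) σ := by
    intro ρ hρ
    refine Integrable.mono' (integrable_const (|Real.log ρ| + |Real.log (max ρ R)|))
      (hJm ρ).aestronglyMeasurable ?_
    filter_upwards [hR] with w hw
    have h1 := Real.log_le_log hρ (le_max_left ρ ‖w‖)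
    have h2 := Real.log_le_log (lt_max_of_lt_left hρ) (max_le_max (le_refl ρ) hw)
    rw [Real.norm_eq_abs, abs_le]
    constructor <;>
    linarith [abs_nonneg (Real.log ρ), abs_nonneg (Real.log (max ρ R)), neg_abs_le (Real.log ρ),
      le_abs_self (Real.log (max ρ R))]
  set t := ∫ w, T w ∂σ with ht
  have hle : ∀ ρ : ℝ, 0 < ρ → ∀ w : ℂ, S ρ w + T w ≤ Real.log (max ρ ‖w‖) := by
    intro ρ hρ w
    simp only [hS, hT]
    split_ifs with h
    · rw [add_zero]; exact Real.log_le_log hρ (le_max_left _ _)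
    · rw [zero_add]
      exact Real.log_le_log (h1pos.trans (not_le.1 h)) (le_max_right _ _)
  have hSTint : ∀ ρ, ∫ w, (S ρ w + T w) ∂σ = M * Real.log ρ + t := fun ρ => by
    rw [integral_add (hSi ρ) hTi, hSint]
  have hJle : ∀ ρ : ℝ, 0 < ρ → M * Real.log ρ + t ≤ ∫ w, Real.log (max ρ ‖w‖) ∂σ := by
    intro ρ hρ
    rw [← hSTint]
    exact integral_mono ((hSi ρ).add hTi) (hJi ρ hρ) (hle ρ hρ)
  have hJeq : ∀ ρ : ℝ, r₁ ≤ ρ → ρ ≤ r₂ → ∫ w, Real.log (max ρ ‖w‖) ∂σ = M * Real.log ρ + t := by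
    intro ρ h1 h2
    rw [← hSTint]
    refine integral_congr_ae ?_
    filter_upwards [hgap] with w hw
    simp only [hS, hT]
    rcases hw with hw | hw
    · rw [if_pos hw, if_pos hw, add_zero, max_eq_left (hw.trans h1)]
    · rw [if_neg (by linarith), if_neg (by linarith), zero_add, max_eq_right (h2.trans hw)]
  -- Away from the closed gap the minorant is strict on the mass of `σ` near an end point of the
  -- gap. That mass is positive because the end points belong to the support.
  have hJlt : ∀ ρ : ℝ, 0 < ρ → ∀ O : Set ℂ, 0 < σ O →
      (∀ w ∈ O, (‖w‖ ≤ r₁ ∨ r₂ ≤ ‖w‖) → S ρ w + T w < Real.log (max ρ ‖w‖)) →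
      M * Real.log ρ + t < ∫ w, Real.log (max ρ ‖w‖) ∂σ := by
    intro ρ hρ O hO hlt
    have hST : Integrable (fun w => S ρ w + T w) σ := (hSi ρ).add hTi
    rw [← hSTint, ← sub_pos, ← integral_sub (hJi ρ hρ) hST]
    rw [integral_pos_iff_support_of_nonneg (fun w => sub_nonneg.2 (hle ρ hρ w))
      ((hJi ρ hρ).sub hST)]
    refine hO.trans_le (measure_mono_ae ?_)
    filter_upwards [hgap] with w hw hwO
    exact (sub_pos.2 (hlt w hwO hw)).ne'
  have hcont : ∀ z ∈ σ.support, ContinuousAt Q z := by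
    obtain ⟨U, hU, hsub, hd⟩ := hQ.smooth
    exact fun z hz => (hd.continuousOn).continuousAt (hU.mem_nhds (hsub hz))
  have hlow := fun (ρ : ℝ) (hρ : 0 < ρ) => le_radial_obstacle hQ.radial hQ.equilibrium hρ
  have hfr : ∀ (i : ℕ) (ρ : ℝ), i ≤ N → 0 < ρ → a i ≤ ρ → ρ ≤ b i →
      Q (ρ : ℂ) - 2 * ∫ w, Real.log (max ρ ‖w‖) ∂σ = robinConst Q σ := by
    intro i ρ hi hρ h1 h2
    refine le_antisymm (radial_obstacle_le hQ.radial hQ.equilibrium hρ ?_ hcont) (hlow ρ hρ)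
    intro z hz
    rw [mem_sphere_zero_iff_norm] at hz
    exact mem_support_of_norm hQ hi (by rw [hz]; exact h1) (by rw [hz]; exact h2)
  refine ⟨M, robinConst Q σ + 2 * t, ?_, ?_, ?_, ?_, ?_⟩
  · refine ENNReal.toReal_pos ?_ (measure_ne_top σ A)
    have hz : (((a k + r₁) / 2 : ℝ) : ℂ) ∈ σ.support := by
      refine mem_support_of_norm hQ hk.le ?_ ?_ <;>
      rw [Complex.norm_real, Real.norm_of_nonneg (by linarith)] <;> linarith
    have := measure_pos_of_isOpen hz (isOpen_lt continuous_norm (continuous_const (y := r₁)))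
      (by rw [Set.mem_ofPred_eq, Complex.norm_real, Real.norm_of_nonneg (by linarith)]; linarith)
    exact (this.trans_le (measure_mono fun w (hw : ‖w‖ < r₁) => hw.le)).ne'
  · have hpos := measure_pos_of_isOpen hm2 (isOpen_lt (continuous_const (y := r₁)) continuous_norm)
      (by rw [Set.mem_ofPred_eq, Complex.norm_real, Real.norm_of_nonneg h2pos.le]; exact h12)
    have hc : {w : ℂ | r₁ < ‖w‖} = Aᶜ := by ext w; simp [hA]
    rw [hc] at hpos
    have h := probReal_compl_eq_one_sub (μ := σ) hAm
    have h2 : 0 < σ.real Aᶜ := ENNReal.toReal_pos hpos.ne' (measure_ne_top σ _)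
    rw [h] at h2
    have : M = σ.real A := rfl
    linarith
  · have h := hfr k r₁ hk.le h1pos hak.le le_rfl
    rw [hJeq r₁ le_rfl h12.le] at h
    linarith
  · have h := hfr (k + 1) r₂ hk h2pos le_rfl hbk.le
    rw [hJeq r₂ h12.le le_rfl] at h
    linarith
  -- Strictness has two sources. In the gap it is the assumed strict obstacle inequality. On all
  -- other circles, including those in the droplet where the obstacle inequality is an equality, it
  -- is the strict minorization of the averaged potential.
  · intro ρ hρ hn1 hn2
    rcases lt_or_gt_of_ne hn1 with h1 | h1
    · have h := hJlt ρ hρ {w | ρ < ‖w‖ ∧ ‖w‖ < r₂} (measure_pos_of_isOpen hm1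
        ((isOpen_lt continuous_const continuous_norm).inter (isOpen_lt continuous_norm continuous_const))
        (by simp only [Set.mem_ofPred_eq]
            rw [Complex.norm_real, Real.norm_of_nonneg h1pos.le]; exact ⟨h1, h12⟩)) (by
          rintro w ⟨hw1, hw2⟩ hw3
          have hw4 : ‖w‖ ≤ r₁ := hw3.resolve_right (by linarith)
          simp only [hS, hT]
          rw [if_pos hw4, if_pos hw4, add_zero, max_eq_right hw1.le]
          exact Real.log_lt_log hρ hw1)
      linarith [hlow ρ hρ]
    · rcases lt_or_gt_of_ne hn2 with h2 | h2
      · have h := lt_radial_obstacle hQ.radial hQ.equilibrium hρ fun z hz =>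
          hQ.obstacle_lt z (notMem_support_of_gap hQ (by rw [hz]; exact h1) (by rw [hz]; exact h2) hk)
        rw [hJeq ρ h1.le h2.le] at h
        linarith
      · have h := hJlt ρ hρ {w | r₁ < ‖w‖ ∧ ‖w‖ < ρ} (measure_pos_of_isOpen hm2
          ((isOpen_lt continuous_const continuous_norm).inter (isOpen_lt continuous_norm continuous_const))
          (by simp only [Set.mem_ofPred_eq]
              rw [Complex.norm_real, Real.norm_of_nonneg h2pos.le]; exact ⟨h12, h2⟩)) (by
            rintro w ⟨hw1, hw2⟩ hw3
            simp only [hS, hT]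
            rw [if_neg (by linarith), if_neg (by linarith), zero_add, max_eq_left hw2.le]
            exact Real.log_lt_log (h1pos.trans hw1) hw2)
        linarith [hlow ρ hρ]

/-- Coercivity of the effective potential in the logarithmic variable. -/
theorem gap_effective_potential_coercive {Q : ℂ → ℝ} (hlsc : LowerSemicontinuous Q)
    (hgrowth : Tendsto (fun z : ℂ => Q z - 2 * Real.log ‖z‖) (cocompact ℂ) atTop)
    {M v y₁ y₂ : ℝ} (hM0 : 0 < M) (hM1 : M < 1)
    (hpos : ∀ y : ℝ, y ≠ y₁ → y ≠ y₂ → 0 < Q (Real.exp y : ℂ) - 2 * M * y - v) {δ : ℝ} (hδ : 0 < δ) :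
    ∃ c : ℝ, 0 < c ∧ ∀ y : ℝ, δ ≤ |y - y₁| → δ ≤ |y - y₂| →
      c * (1 + |y|) ≤ Q (Real.exp y : ℂ) - 2 * M * y - v := by
  have hexp : Continuous fun y : ℝ => (Real.exp y : ℂ) :=
    Complex.continuous_ofReal.comp Real.continuous_exp
  -- Growth of `Q` beyond `2 log |z|` leaves the slope `2 (1 - M)` at `+∞`, and boundedness of `Q`
  -- from below on the unit disc leaves the slope `2 M` at `-∞`. This is where `0 < M < 1` is
  -- needed.
  have htop : ∀ᶠ y : ℝ in atTop, (1 - M) * (1 + |y|) ≤ Q (Real.exp y : ℂ) - 2 * M * y - v := by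
    have ht : Tendsto (fun y : ℝ => (Real.exp y : ℂ)) atTop (cocompact ℂ) := by
      rw [← Metric.cobounded_eq_cocompact, ← tendsto_norm_atTop_iff_cobounded]
      refine Real.tendsto_exp_atTop.congr fun y => ?_
      rw [Complex.norm_real, Real.norm_of_nonneg (Real.exp_pos y).le]
    filter_upwards [(hgrowth.comp ht).eventually_ge_atTop 0, eventually_ge_atTop 0,
      (tendsto_id.const_mul_atTop (sub_pos.2 hM1)).eventually_ge_atTop (v + (1 - M))] with y h1 h2 h3
    simp only [Function.comp, Complex.norm_real, Real.norm_of_nonneg (Real.exp_pos y).le,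
      Real.log_exp, id] at h1 h3
    rw [abs_of_nonneg h2]
    linarith
  have hbot : ∀ᶠ y : ℝ in atBot, M * (1 + |y|) ≤ Q (Real.exp y : ℂ) - 2 * M * y - v := by
    obtain ⟨z₀, -, hz₀⟩ := LowerSemicontinuousOn.exists_isMinOn
      (Metric.nonempty_closedBall.2 zero_le_one) (isCompact_closedBall (0 : ℂ) 1)
      (hlsc.lowerSemicontinuousOn _)
    filter_upwards [eventually_le_atBot 0, (tendsto_id.const_mul_atBot hM0).eventually_le_atBot
      (Q z₀ - v - M)] with y h1 h2
    have h3 : Q z₀ ≤ Q (Real.exp y : ℂ) := hz₀ (by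
      rw [mem_closedBall_zero_iff, Complex.norm_real, Real.norm_of_nonneg (Real.exp_pos y).le]
      exact Real.exp_le_one_iff.2 h1)
    simp only [id] at h2
    rw [abs_of_nonpos h1]
    linarith
  obtain ⟨Y₁, hY₁⟩ := eventually_atTop.1 htop
  obtain ⟨Y₂, hY₂⟩ := eventually_atBot.1 hbot
  set Y := max |Y₁| |Y₂| with hY
  have hYnn : 0 ≤ Y := (abs_nonneg _).trans (le_max_left _ _)
  set K : Set ℝ := Set.Icc (-Y) Y ∩ ({y | δ ≤ |y - y₁|} ∩ {y | δ ≤ |y - y₂|}) with hK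
  have hKc : IsCompact K := isCompact_Icc.inter_right
    ((isClosed_le continuous_const (by fun_prop)).inter (isClosed_le continuous_const (by fun_prop)))
  have hmid : ∃ c : ℝ, 0 < c ∧ ∀ y ∈ K, c ≤ Q (Real.exp y : ℂ) - 2 * M * y - v := by
    rcases K.eq_empty_or_nonempty with h | h
    · exact ⟨1, one_pos, by simp [h]⟩
    · have hl : LowerSemicontinuous fun y : ℝ => Q (Real.exp y : ℂ) + (-(2 * M * y) - v) :=
        (hlsc.comp hexp).add (Continuous.lowerSemicontinuous (by fun_prop))
      obtain ⟨y₀, hy₀, hmin⟩ := LowerSemicontinuousOn.exists_isMinOn h hKc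
        (hl.lowerSemicontinuousOn K)
      refine ⟨Q (Real.exp y₀ : ℂ) - 2 * M * y₀ - v, hpos y₀ ?_ ?_, fun y hy => ?_⟩
      · rintro rfl
        have := hy₀.2.1
        simp only [Set.mem_ofPred_eq, sub_self, abs_zero] at this
        linarith
      · rintro rfl
        have := hy₀.2.2
        simp only [Set.mem_ofPred_eq, sub_self, abs_zero] at this
        linarith
      · have := hmin hy
        simp only [Set.mem_ofPred_eq] at this
        linarith
  obtain ⟨c₀, hc₀, hmin⟩ := hmid
  refine ⟨min (c₀ / (1 + Y)) (min (1 - M) M), lt_min (by positivity) (lt_min (by linarith) hM0), ?_⟩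
  intro y hy1 hy2
  have hnn : 0 ≤ 1 + |y| := by positivity
  rcases le_or_gt |y| Y with h | h
  · refine le_trans ?_ (hmin y ⟨abs_le.1 h, hy1, hy2⟩)
    calc min (c₀ / (1 + Y)) (min (1 - M) M) * (1 + |y|) ≤ c₀ / (1 + Y) * (1 + Y) := by
          gcongr
          exact min_le_left _ _
      _ = c₀ := by field_simp
  · rcases le_total 0 y with h0 | h0
    · refine le_trans (mul_le_mul_of_nonneg_right ((min_le_right _ _).trans (min_le_left _ _)) hnn)
        (hY₁ y ?_)
      rw [abs_of_nonneg h0] at h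
      linarith [le_abs_self Y₁, le_max_left |Y₁| |Y₂|]
    · refine le_trans (mul_le_mul_of_nonneg_right ((min_le_right _ _).trans (min_le_right _ _)) hnn)
        (hY₂ y ?_)
      rw [abs_of_nonpos h0] at h
      linarith [neg_abs_le Y₂, le_max_right |Y₁| |Y₂|]

/-! ### Laplace's method for tilted integrals -/

theorem integrable_exp_linear_sub_sq {b : ℝ} (hb : 0 < b) (η : ℝ) :
    Integrable (fun w : ℝ => Real.exp (2 * η * w - b * w ^ 2)) ∧
      ∫ w : ℝ, Real.exp (2 * η * w - b * w ^ 2) = √(Real.pi / b) * Real.exp (η ^ 2 / b) := by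
  have e : (fun w : ℝ => Real.exp (2 * η * w - b * w ^ 2)) = fun w : ℝ =>
      Real.exp (-b * (w - η / b) ^ 2) * Real.exp (η ^ 2 / b) := by
    ext w
    rw [← Real.exp_add]
    congr 1; field_simp; ring
  rw [e]
  refine ⟨((integrable_exp_neg_mul_sq hb).comp_sub_right (η / b)).mul_const _, ?_⟩
  rw [integral_mul_const, integral_sub_right_eq_self (fun w => Real.exp (-b * w ^ 2)),
    integral_gaussian]

theorem pow_le_factorial_mul_exp (k : ℕ) {x : ℝ} (hx : 0 ≤ x) :
    x ^ k ≤ k.factorial * Real.exp x := by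
  have h := Real.pow_div_factorial_le_exp x hx k
  rwa [div_le_iff₀' (by positivity)] at h

theorem one_add_abs_pow_le_exp_sq (k : ℕ) {κ : ℝ} (hκ : 0 < κ) : ∃ K : ℝ, 0 < K ∧
    ∀ w : ℝ, (1 + |w|) ^ k ≤ K * Real.exp (κ * w ^ 2) := by
  refine ⟨2 ^ k * (1 + k.factorial / κ ^ k), by positivity, fun w => ?_⟩
  have hx : 0 ≤ κ * w ^ 2 := by positivity
  have h1 := pow_le_factorial_mul_exp k hx
  have hE := Real.one_le_exp hx
  have h2 : (1 + |w|) ^ k ≤ 2 ^ k * (1 + (w ^ 2) ^ k) := by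
    have h3 : 1 + |w| ≤ 2 * max 1 (w ^ 2) := by
      rw [← sq_abs w]
      rcases le_total |w| 1 with h | h
      · linarith [le_max_left 1 (|w| ^ 2)]
      · have : |w| ≤ |w| ^ 2 := by nlinarith
        linarith [le_max_right 1 (|w| ^ 2), le_max_left 1 (|w| ^ 2)]
    calc (1 + |w|) ^ k ≤ (2 * max 1 (w ^ 2)) ^ k := pow_le_pow_left₀ (by positivity) h3 k
      _ = 2 ^ k * (max 1 (w ^ 2)) ^ k := mul_pow _ _ _
      _ ≤ 2 ^ k * (1 + (w ^ 2) ^ k) := by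
          gcongr
          rcases le_total 1 (w ^ 2) with h | h
          · rw [max_eq_right h]; linarith
          · rw [max_eq_left h, one_pow]
            have : 0 ≤ (w ^ 2) ^ k := by positivity
            linarith
  have h4 : (w ^ 2) ^ k ≤ k.factorial / κ ^ k * Real.exp (κ * w ^ 2) := by
    rw [div_mul_eq_mul_div, le_div_iff₀ (by positivity)]
    rw [mul_pow] at h1; linarith
  calc (1 + |w|) ^ k ≤ 2 ^ k * (1 + (w ^ 2) ^ k) := h2
    _ ≤ 2 ^ k * (Real.exp (κ * w ^ 2) + k.factorial / κ ^ k * Real.exp (κ * w ^ 2)) := by gcongr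
    _ = _ := by ring

theorem integrable_pow_mul_exp_linear_sub_sq (k : ℕ) (η : ℝ) :
    Integrable (fun w : ℝ => w ^ k * Real.exp (2 * η * w - w ^ 2)) := by
  obtain ⟨K, hK, h⟩ := one_add_abs_pow_le_exp_sq k (κ := 1 / 8) (by norm_num)
  refine Integrable.mono' ((integrable_exp_linear_sub_sq (b := 7 / 8) (by norm_num) η).1.const_mul K)
    (by fun_prop) (Eventually.of_forall fun w => ?_)
  rw [norm_mul, norm_pow, Real.norm_eq_abs, Real.norm_eq_abs, Real.abs_exp]
  have h1 : |w| ^ k ≤ (1 + |w|) ^ k := pow_le_pow_left₀ (abs_nonneg w) (by linarith) k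
  calc |w| ^ k * Real.exp (2 * η * w - w ^ 2) ≤
        (K * Real.exp (1 / 8 * w ^ 2)) * Real.exp (2 * η * w - w ^ 2) := by
        gcongr; exact h1.trans (h w)
    _ = K * Real.exp (2 * η * w - 7 / 8 * w ^ 2) := by
        rw [mul_assoc, ← Real.exp_add]; ring_nf

/-- The derivative of `w^k e^{2ηw - w²}` has integral zero. For `k = 0` the truncated exponent `k -
1` is harmless, as its coefficient vanishes. -/
theorem integral_pow_mul_exp_rec (k : ℕ) (η : ℝ) :
    ∫ w : ℝ, w ^ (k + 1) * Real.exp (2 * η * w - w ^ 2) =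
      η * (∫ w : ℝ, w ^ k * Real.exp (2 * η * w - w ^ 2)) +
        k / 2 * ∫ w : ℝ, w ^ (k - 1) * Real.exp (2 * η * w - w ^ 2) := by
  have i1 := integrable_pow_mul_exp_linear_sub_sq (k + 1) η
  have i2 := integrable_pow_mul_exp_linear_sub_sq k η
  have i3 := integrable_pow_mul_exp_linear_sub_sq (k - 1) η
  have hd : ∀ w : ℝ, HasDerivAt (fun w : ℝ => w ^ k * Real.exp (2 * η * w - w ^ 2))
      ((k : ℝ) * (w ^ (k - 1) * Real.exp (2 * η * w - w ^ 2)) +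
        (2 * η) * (w ^ k * Real.exp (2 * η * w - w ^ 2)) -
        2 * (w ^ (k + 1) * Real.exp (2 * η * w - w ^ 2))) w := by
    intro w
    have h := (hasDerivAt_pow k w).mul
      ((((hasDerivAt_id w).const_mul (2 * η)).sub (hasDerivAt_pow 2 w)).exp)
    refine h.congr_deriv ?_
    simp
    ring
  have h := integral_eq_zero_of_hasDerivAt_of_integrable hd
    (((i3.const_mul _).add (i2.const_mul _)).sub (i1.const_mul _)) i2
  have hs : Integrable (fun w : ℝ => (k : ℝ) * (w ^ (k - 1) * Real.exp (2 * η * w - w ^ 2)) +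
        (2 * η) * (w ^ k * Real.exp (2 * η * w - w ^ 2))) := (i3.const_mul _).add (i2.const_mul _)
  rw [integral_sub hs (i1.const_mul _), integral_add (i3.const_mul _) (i2.const_mul _),
    integral_const_mul, integral_const_mul, integral_const_mul] at h
  linarith

/-- The first correction polynomial of Laplace's method. -/
noncomputable def laplacePoly (β c η : ℝ) : ℝ := β * η - c * (η ^ 3 + 3 / 2 * η)

/-- Relative to `√π e^{η²}` the moments of order 0, 1 and 3 are `1`, `η` and `η³ + 3η/2`. This is
the origin of `laplacePoly`. -/
theorem integral_laplace_main (ς β c η : ℝ) :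
    Integrable (fun w : ℝ => Real.exp (2 * η * w - w ^ 2) * (1 + ς * (β * w - c * w ^ 3))) ∧
    ∫ w : ℝ, Real.exp (2 * η * w - w ^ 2) * (1 + ς * (β * w - c * w ^ 3)) =
      √Real.pi * Real.exp (η ^ 2) * (1 + ς * laplacePoly β c η) := by
  have i0 := integrable_pow_mul_exp_linear_sub_sq 0 η
  have i1 := integrable_pow_mul_exp_linear_sub_sq 1 η
  have i3 := integrable_pow_mul_exp_linear_sub_sq 3 η
  have r1 := integral_pow_mul_exp_rec 0 η
  have r2 := integral_pow_mul_exp_rec 1 η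
  have r3 := integral_pow_mul_exp_rec 2 η
  have r0 : ∫ w : ℝ, w ^ 0 * Real.exp (2 * η * w - w ^ 2) = √Real.pi * Real.exp (η ^ 2) := by
    have := (integrable_exp_linear_sub_sq one_pos η).2
    simpa using this
  have e : (fun w : ℝ => Real.exp (2 * η * w - w ^ 2) * (1 + ς * (β * w - c * w ^ 3))) = fun w =>
      w ^ 0 * Real.exp (2 * η * w - w ^ 2) + ((ς * β) * (w ^ 1 * Real.exp (2 * η * w - w ^ 2)) -
        (ς * c) * (w ^ 3 * Real.exp (2 * η * w - w ^ 2))) := by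
    ext w; ring
  have i13 : Integrable (fun w : ℝ => (ς * β) * (w ^ 1 * Real.exp (2 * η * w - w ^ 2)) -
        (ς * c) * (w ^ 3 * Real.exp (2 * η * w - w ^ 2))) := (i1.const_mul _).sub (i3.const_mul _)
  rw [e]
  refine ⟨i0.add i13, ?_⟩
  rw [integral_add i0 i13, integral_sub (i1.const_mul _) (i3.const_mul _), integral_const_mul,
    integral_const_mul]
  simp only [zero_add, Nat.reduceAdd, Nat.reduceSub, Nat.cast_zero, zero_div, zero_mul, add_zero,
    Nat.cast_one, Nat.cast_ofNat] at r1 r2 r3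
  rw [r3, r2, r1, r0, laplacePoly]
  ring

theorem abs_exp_sub_one_sub_le (x : ℝ) : |Real.exp x - 1 - x| ≤ x ^ 2 * Real.exp |x| := by
  have h := Complex.norm_exp_sub_sum_le_norm_mul_exp (x : ℂ) 2
  simp only [Finset.sum_range_succ, Finset.range_zero, Finset.sum_empty, pow_zero,
    Nat.factorial_zero, Nat.cast_one, div_one, zero_add, pow_one, Nat.factorial_one,
    Complex.norm_real, Real.norm_eq_abs, sq_abs] at h
  rw [← Complex.ofReal_exp, ← Complex.ofReal_one, ← Complex.ofReal_add, ← Complex.ofReal_sub,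
    Complex.norm_real, Real.norm_eq_abs, ← sub_sub] at h
  exact h

theorem poly_le_one_add_pow_four {u : ℝ} (hu : 0 ≤ u) :
    u + u ^ 3 + (u ^ 2 + u ^ 4) ≤ 2 * (1 + u) ^ 4 ∧ u ^ 2 + u ^ 4 ≤ (1 + u) ^ 8 := by
  have h2 := pow_nonneg hu 2
  have h3 := pow_nonneg hu 3
  have h4 := pow_nonneg hu 4
  have e : (1 + u) ^ 4 = 1 + 4 * u + 6 * u ^ 2 + 4 * u ^ 3 + u ^ 4 := by ring
  refine ⟨by rw [e]; linarith, le_trans (b := (1 + u) ^ 4) (by rw [e]; linarith) ?_⟩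
  exact pow_le_pow_right₀ (by linarith) (by norm_num)

theorem poly_le_one_add_pow_eight {C u : ℝ} (hC : 1 ≤ C) (hu : 0 ≤ u) :
    (1 + C * (u + u ^ 3)) * u ^ 2 ≤ 3 * C * (1 + u) ^ 8 := by
  have hC0 : 0 ≤ C := by linarith
  have h1 := mul_nonneg hC0 hu
  have h2 := mul_nonneg hC0 (pow_nonneg hu 2)
  have h3 := mul_nonneg hC0 (pow_nonneg hu 3)
  have e : 3 * C * (1 + u) ^ 3 = 3 * C + 9 * (C * u) + 9 * (C * u ^ 2) + 3 * (C * u ^ 3) := by ring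
  have h4 : 1 + C * (u + u ^ 3) ≤ 3 * C * (1 + u) ^ 3 := by rw [e]; linarith
  have h5 : u ^ 2 ≤ (1 + u) ^ 2 := pow_le_pow_left₀ hu (by linarith) 2
  calc (1 + C * (u + u ^ 3)) * u ^ 2 ≤ (3 * C * (1 + u) ^ 3) * (1 + u) ^ 2 := by gcongr
    _ = 3 * C * (1 + u) ^ 5 := by ring
    _ ≤ 3 * C * (1 + u) ^ 8 := by
      gcongr
      · linarith
      · norm_num

theorem abs_laplace_correction_le {C ς β c w : ℝ} (hς : 0 < ς) (hβ : |β| ≤ C) (hc : |c| ≤ C) :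
    |ς * (β * w - c * w ^ 3)| ≤ ς * C * (|w| + |w| ^ 3) := by
  rw [abs_mul, abs_of_pos hς, mul_assoc]
  refine mul_le_mul_of_nonneg_left ?_ hς.le
  calc |β * w - c * w ^ 3| ≤ |β * w| + |c * w ^ 3| := abs_sub _ _
    _ = |β| * |w| + |c| * |w| ^ 3 := by rw [abs_mul, abs_mul, abs_pow]
    _ ≤ C * |w| + C * |w| ^ 3 := by gcongr
    _ = C * (|w| + |w| ^ 3) := by ring

theorem exp_one_div_32_le : Real.exp (1 / 32) ≤ 2 := by
  have := Real.exp_one_lt_d9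
  have h2 : Real.exp (1 / 32) ≤ Real.exp (1 / 2) := Real.exp_le_exp.2 (by norm_num)
  have h3 : Real.exp (1 / 2) ^ 2 = Real.exp 1 := by rw [← Real.exp_nat_mul]; norm_num
  have h4 := Real.exp_pos (1 / 2)
  nlinarith

/-- The pointwise estimate behind Laplace's method, inside of the window. -/
theorem laplace_pointwise_inside {C : ℝ} (hC : 1 ≤ C) : ∃ K : ℝ, 0 < K ∧
    ∀ ς β c η w e : ℝ, 0 < ς → ς ≤ 1 → |β| ≤ C → |c| ≤ C →
    ς * |w| ≤ 1 / (64 * C) → |e - (-w ^ 2 + ς * (β * w - c * w ^ 3))| ≤ C * ς ^ 2 * (w ^ 2 + w ^ 4) →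
      |Real.exp (2 * η * w + e) - Real.exp (2 * η * w - w ^ 2) * (1 + ς * (β * w - c * w ^ 3))| ≤
        K * ς ^ 2 * Real.exp (2 * η * w - 7 / 8 * w ^ 2) := by
  obtain ⟨K₈, hK₈, h8⟩ := one_add_abs_pow_le_exp_sq 8 (κ := 1 / 16) (by norm_num)
  refine ⟨20 * C ^ 2 * K₈, by positivity, ?_⟩
  intro ς β c η w e hς hς1 hβ hc
  set u := |w| with hu
  have hu0 : 0 ≤ u := abs_nonneg w
  have hw2 : w ^ 2 = u ^ 2 := (sq_abs w).symm
  have hw4 : w ^ 4 = u ^ 4 := by rw [show w ^ 4 = (w ^ 2) ^ 2 by ring, hw2]; ring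
  set m := ς * (β * w - c * w ^ 3) with hm
  have hmle : |m| ≤ ς * C * (u + u ^ 3) := abs_laplace_correction_le hς hβ hc
  have hp8 : ∀ P : ℝ, P ≤ (1 + u) ^ 8 → P ≤ K₈ * Real.exp (1 / 16 * w ^ 2) := fun P hP =>
    hP.trans (h8 w)
  have hC2 : C ≤ C ^ 2 := by nlinarith
  have hfac : ∀ t : ℝ, Real.exp (2 * η * w - w ^ 2) * Real.exp (t * w ^ 2) =
      Real.exp (2 * η * w - (1 - t) * w ^ 2) := fun t => by rw [← Real.exp_add]; ring_nf
  have hE : Real.exp (2 * η * w - 7 / 8 * w ^ 2) =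
      Real.exp (2 * η * w - w ^ 2) * Real.exp (1 / 8 * w ^ 2) := by rw [hfac]; norm_num
  have hpos := Real.exp_pos (2 * η * w - w ^ 2)
  have he16 : Real.exp (1 / 16 * w ^ 2) ≤ Real.exp (1 / 8 * w ^ 2) :=
    Real.exp_le_exp.2 (by nlinarith [sq_nonneg w])
  intro hδ he
  set X := e + w ^ 2 with hX
  have hXm : |X - m| ≤ C * ς ^ 2 * (u ^ 2 + u ^ 4) := by
    rw [← hw2, ← hw4]
    have : X - m = e - (-w ^ 2 + m) := by rw [hX]; ring
    rwa [this]
  -- The size of the window is chosen for this bound. It gives `|X| ≤ (1 + w²) / 32`, hence `e^{|X|}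
  -- ≤ 2 e^{w²/32}`, and the polynomial factors still fit below `e^{w²/8}`.
  have hςu : ς * u * C ≤ 1 / 64 := by
    rw [le_div_iff₀ (by positivity)] at hδ
    linarith
  have hςu0 : 0 ≤ ς * u := by positivity
  have hςu1 : ς * u ≤ 1 := by nlinarith
  have hXle : |X| ≤ 1 / 32 + 1 / 32 * u ^ 2 := by
    have h1 : |X| ≤ |m| + |X - m| := by
      have := abs_add_le m (X - m); simpa using this
    have h2 : ς * C * (u + u ^ 3) = (ς * u * C) * (1 + u ^ 2) := by ring
    have h3 : C * ς ^ 2 * (u ^ 2 + u ^ 4) = (ς * u * C) * (ς * u) * (1 + u ^ 2) := by ring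
    have h4 : (ς * u * C) * (ς * u) ≤ 1 / 64 * 1 := mul_le_mul hςu hςu1 hςu0 (by norm_num)
    have h5 : 0 ≤ 1 + u ^ 2 := by positivity
    have h6 := mul_le_mul_of_nonneg_right hςu h5
    have h7 := mul_le_mul_of_nonneg_right h4 h5
    rw [← h2] at h6
    rw [← h3] at h7
    linarith
  have hXle2 : |X| ≤ ς * C * (2 * (1 + u) ^ 4) := by
    have h1 : |X| ≤ |m| + |X - m| := by
      have := abs_add_le m (X - m); simpa using this
    have h2 : C * ς ^ 2 * (u ^ 2 + u ^ 4) ≤ ς * C * (u ^ 2 + u ^ 4) := by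
      have : ς ^ 2 ≤ ς := by nlinarith
      have h3 : 0 ≤ C * (u ^ 2 + u ^ 4) := by positivity
      nlinarith
    have h4 := (poly_le_one_add_pow_four hu0).1
    have h5 := mul_le_mul_of_nonneg_left h4 (show 0 ≤ ς * C by positivity)
    linarith
  have hX2 : X ^ 2 ≤ 4 * C ^ 2 * ς ^ 2 * (1 + u) ^ 8 := by
    rw [← sq_abs X]
    calc |X| ^ 2 ≤ (ς * C * (2 * (1 + u) ^ 4)) ^ 2 := pow_le_pow_left₀ (abs_nonneg X) hXle2 2
      _ = _ := by ring
  have hexpX : Real.exp |X| ≤ 2 * Real.exp (1 / 32 * w ^ 2) := by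
    have h1 := exp_one_div_32_le
    calc Real.exp |X| ≤ Real.exp (1 / 32 + 1 / 32 * w ^ 2) := Real.exp_le_exp.2 (by rw [hw2]; exact hXle)
      _ = Real.exp (1 / 32) * Real.exp (1 / 32 * w ^ 2) := Real.exp_add _ _
      _ ≤ _ := by gcongr
  have hmain : |Real.exp X - (1 + m)| ≤ 20 * C ^ 2 * K₈ * ς ^ 2 * Real.exp (1 / 8 * w ^ 2) := by
    have h1 : |Real.exp X - (1 + m)| ≤ |Real.exp X - 1 - X| + |X - m| := by
      have := abs_add_le (Real.exp X - 1 - X) (X - m)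
      have e2 : Real.exp X - 1 - X + (X - m) = Real.exp X - (1 + m) := by ring
      rwa [e2] at this
    have h2 : |Real.exp X - 1 - X| ≤ (4 * C ^ 2 * ς ^ 2 * (K₈ * Real.exp (1 / 16 * w ^ 2))) *
        (2 * Real.exp (1 / 32 * w ^ 2)) := by
      refine (abs_exp_sub_one_sub_le X).trans ?_
      refine mul_le_mul (hX2.trans ?_) hexpX (Real.exp_pos _).le (by positivity)
      gcongr
      exact hp8 _ le_rfl
    have h3 : Real.exp (1 / 16 * w ^ 2) * Real.exp (1 / 32 * w ^ 2) ≤ Real.exp (1 / 8 * w ^ 2) := by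
      rw [← Real.exp_add]
      exact Real.exp_le_exp.2 (by nlinarith [sq_nonneg w])
    have h4 : |X - m| ≤ C ^ 2 * ς ^ 2 * (K₈ * Real.exp (1 / 8 * w ^ 2)) := by
      refine hXm.trans ?_
      have h5 := (poly_le_one_add_pow_four hu0).2
      have h7 := (hp8 _ h5).trans (mul_le_mul_of_nonneg_left he16 hK₈.le)
      exact mul_le_mul (mul_le_mul_of_nonneg_right hC2 (by positivity)) h7 (by positivity)
        (by positivity)
    have h8 : (4 * C ^ 2 * ς ^ 2 * (K₈ * Real.exp (1 / 16 * w ^ 2))) *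
        (2 * Real.exp (1 / 32 * w ^ 2)) ≤ 8 * C ^ 2 * ς ^ 2 * K₈ * Real.exp (1 / 8 * w ^ 2) := by
      calc _ = 8 * C ^ 2 * ς ^ 2 * K₈ * (Real.exp (1 / 16 * w ^ 2) * Real.exp (1 / 32 * w ^ 2)) := by ring
        _ ≤ _ := by gcongr
    have h9 : 0 ≤ C ^ 2 * ς ^ 2 * K₈ * Real.exp (1 / 8 * w ^ 2) := by positivity
    linarith
  have e3 : Real.exp (2 * η * w + e) = Real.exp (2 * η * w - w ^ 2) * Real.exp X := by
    rw [← Real.exp_add, hX]; ring_nf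
  rw [e3, ← mul_sub, abs_mul, Real.abs_exp, hE]
  calc Real.exp (2 * η * w - w ^ 2) * |Real.exp X - (1 + m)| ≤
      Real.exp (2 * η * w - w ^ 2) * (20 * C ^ 2 * K₈ * ς ^ 2 * Real.exp (1 / 8 * w ^ 2)) := by gcongr
    _ = (20 * C ^ 2 * K₈) * ς ^ 2 * (Real.exp (2 * η * w - w ^ 2) * Real.exp (1 / 8 * w ^ 2)) := by ring

/-- The pointwise estimate behind Laplace's method, outside of the window. -/
theorem laplace_pointwise_outside {C d : ℝ} (hC : 1 ≤ C) (hd : 0 < d) : ∃ K : ℝ, 0 < K ∧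
    ∀ ς β c η w : ℝ, 0 < ς → ς ≤ 1 → |β| ≤ C → |c| ≤ C → d ≤ ς * |w| →
      |Real.exp (2 * η * w - w ^ 2) * (1 + ς * (β * w - c * w ^ 3))| ≤
        K * ς ^ 2 * Real.exp (2 * η * w - 7 / 8 * w ^ 2) := by
  obtain ⟨K₈, hK₈, h8⟩ := one_add_abs_pow_le_exp_sq 8 (κ := 1 / 16) (by norm_num)
  refine ⟨3 * C * K₈ / d ^ 2, by positivity, ?_⟩
  intro ς β c η w hς hς1 hβ hc
  set u := |w| with hu
  have hu0 : 0 ≤ u := abs_nonneg w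
  have hw2 : w ^ 2 = u ^ 2 := (sq_abs w).symm
  have hw4 : w ^ 4 = u ^ 4 := by rw [show w ^ 4 = (w ^ 2) ^ 2 by ring, hw2]; ring
  set m := ς * (β * w - c * w ^ 3) with hm
  have hmle : |m| ≤ ς * C * (u + u ^ 3) := abs_laplace_correction_le hς hβ hc
  have hp8 : ∀ P : ℝ, P ≤ (1 + u) ^ 8 → P ≤ K₈ * Real.exp (1 / 16 * w ^ 2) := fun P hP =>
    hP.trans (h8 w)
  have hC2 : C ≤ C ^ 2 := by nlinarith
  have hfac : ∀ t : ℝ, Real.exp (2 * η * w - w ^ 2) * Real.exp (t * w ^ 2) =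
      Real.exp (2 * η * w - (1 - t) * w ^ 2) := fun t => by rw [← Real.exp_add]; ring_nf
  have hE : Real.exp (2 * η * w - 7 / 8 * w ^ 2) =
      Real.exp (2 * η * w - w ^ 2) * Real.exp (1 / 8 * w ^ 2) := by rw [hfac]; norm_num
  have hpos := Real.exp_pos (2 * η * w - w ^ 2)
  have he16 : Real.exp (1 / 16 * w ^ 2) ≤ Real.exp (1 / 8 * w ^ 2) :=
    Real.exp_le_exp.2 (by nlinarith [sq_nonneg w])
  intro hdw
  have h1 : |1 + m| ≤ 1 + C * (u + u ^ 3) := by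
    refine (abs_add_le _ _).trans ?_
    rw [abs_one]
    have : ς * C * (u + u ^ 3) ≤ 1 * C * (u + u ^ 3) := by gcongr
    linarith
  -- Outside of the window this factor can be inserted for free, and it supplies the gain `ς²`.
  have h2 : 1 ≤ ς ^ 2 * u ^ 2 / d ^ 2 := by
    rw [le_div_iff₀ (by positivity), one_mul, ← mul_pow]
    exact pow_le_pow_left₀ hd.le hdw 2
  have h3 := poly_le_one_add_pow_eight hC hu0
  have h6 : |1 + m| ≤ 3 * C * K₈ / d ^ 2 * ς ^ 2 * Real.exp (1 / 8 * w ^ 2) := by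
    calc |1 + m| ≤ (1 + C * (u + u ^ 3)) * 1 := by rw [mul_one]; exact h1
      _ ≤ (1 + C * (u + u ^ 3)) * (ς ^ 2 * u ^ 2 / d ^ 2) := by gcongr
      _ = (1 + C * (u + u ^ 3)) * u ^ 2 * (ς ^ 2 / d ^ 2) := by ring
      _ ≤ 3 * C * (1 + u) ^ 8 * (ς ^ 2 / d ^ 2) := by gcongr
      _ ≤ 3 * C * (K₈ * Real.exp (1 / 8 * w ^ 2)) * (ς ^ 2 / d ^ 2) := by
        gcongr
        exact (hp8 _ le_rfl).trans (mul_le_mul_of_nonneg_left he16 hK₈.le)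
      _ = _ := by ring
  rw [abs_mul, Real.abs_exp, hE]
  calc Real.exp (2 * η * w - w ^ 2) * |1 + m| ≤ Real.exp (2 * η * w - w ^ 2) *
        (3 * C * K₈ / d ^ 2 * ς ^ 2 * Real.exp (1 / 8 * w ^ 2)) := by gcongr
    _ = (3 * C * K₈ / d ^ 2) * ς ^ 2 *
        (Real.exp (2 * η * w - w ^ 2) * Real.exp (1 / 8 * w ^ 2)) := by ring

/-- Hypotheses of Laplace's method at scale `ς`: the exponent `E` is a perturbed parabola on the
window `J`. -/
structure LaplaceData (C d ς β c : ℝ) (J : Set ℝ) (E : ℝ → ℝ) : Prop where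
  pos : 0 < ς
  le_one : ς ≤ 1
  beta_le : |β| ≤ C
  c_le : |c| ≤ C
  measurableSet : MeasurableSet J
  aestronglyMeasurable : AEStronglyMeasurable E (volume.restrict J)
  window_le : ∀ w ∈ J, ς * |w| ≤ 1 / (64 * C)
  window_ge : ∀ w, w ∉ J → d ≤ ς * |w|
  approx : ∀ w ∈ J, |E w - (-w ^ 2 + ς * (β * w - c * w ^ 3))| ≤ C * ς ^ 2 * (w ^ 2 + w ^ 4)

/-- The pointwise errors are integrated against the wider Gaussian `e^{2ηw - 7w²/8}`, whose mass
grows like `e^{8η²/7}`. The relative error `ς² e^{η²/7}` is small only for moderate tilts, and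
larger ones need a separate argument. -/
theorem laplace_integral {C d : ℝ} (hC : 1 ≤ C) (hd : 0 < d) : ∃ K : ℝ, 0 < K ∧
    ∀ (ς β c : ℝ) (J : Set ℝ) (E : ℝ → ℝ), LaplaceData C d ς β c J E → ∀ η : ℝ,
      IntegrableOn (fun w => Real.exp (2 * η * w + E w)) J ∧
      |(∫ w in J, Real.exp (2 * η * w + E w)) -
        √Real.pi * Real.exp (η ^ 2) * (1 + ς * laplacePoly β c η)| ≤
        K * ς ^ 2 * Real.exp (8 / 7 * η ^ 2) := by
  obtain ⟨K₁, hK₁, h1⟩ := laplace_pointwise_inside hC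
  obtain ⟨K₂, hK₂, h2⟩ := laplace_pointwise_outside hC hd
  refine ⟨(K₁ + K₂) * √(Real.pi / (7 / 8)), by positivity, ?_⟩
  intro ς β c J E h η
  obtain ⟨hmi, hmain⟩ := integral_laplace_main ς β c η
  obtain ⟨hgi, hgauss⟩ := integrable_exp_linear_sub_sq (b := 7 / 8) (by norm_num) η
  set f : ℝ → ℝ := fun w => Real.exp (2 * η * w + E w) with hf
  set m : ℝ → ℝ := fun w => Real.exp (2 * η * w - w ^ 2) * (1 + ς * (β * w - c * w ^ 3)) with hm
  set g : ℝ → ℝ := fun w => (K₁ + K₂) * ς ^ 2 * Real.exp (2 * η * w - 7 / 8 * w ^ 2) with hg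
  have hgI : Integrable g := hgi.const_mul _
  have hpt : ∀ w, |J.indicator f w - m w| ≤ g w := by
    intro w
    by_cases hw : w ∈ J
    · rw [Set.indicator_of_mem hw]
      refine (h1 ς β c η w (E w) h.pos h.le_one h.beta_le h.c_le (h.window_le w hw) (h.approx w hw)).trans ?_
      simp only [hg]
      gcongr; linarith
    · rw [Set.indicator_of_notMem hw, zero_sub, abs_neg]
      refine (h2 ς β c η w h.pos h.le_one h.beta_le h.c_le (h.window_ge w hw)).trans ?_
      simp only [hg]
      gcongr; linarith
  have hfm : AEStronglyMeasurable (J.indicator f) := by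
    rw [aestronglyMeasurable_indicator_iff h.measurableSet]
    have := h.aestronglyMeasurable
    exact Real.continuous_exp.comp_aestronglyMeasurable
      ((by fun_prop : AEStronglyMeasurable (fun w : ℝ => 2 * η * w) (volume.restrict J)).add this)
  have hdi : Integrable (fun w => J.indicator f w - m w) :=
    hgI.mono' (hfm.sub hmi.aestronglyMeasurable) (Eventually.of_forall hpt)
  have hfi : Integrable (J.indicator f) := by
    have := hdi.add hmi
    refine this.congr (Eventually.of_forall fun w => ?_)
    simp
  refine ⟨(integrable_indicator_iff h.measurableSet).1 hfi, ?_⟩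
  rw [← integral_indicator h.measurableSet, ← hmain, ← integral_sub hfi hmi]
  refine (abs_integral_le_integral_abs).trans ((integral_mono hdi.abs hgI hpt).trans ?_)
  simp only [hg]
  rw [integral_const_mul, hgauss]
  apply le_of_eq
  have : η ^ 2 / (7 / 8) = 8 / 7 * η ^ 2 := by ring
  rw [this]; ring

theorem abs_laplacePoly_le {C : ℝ} (hC : 1 ≤ C) : ∃ K : ℝ, 0 < K ∧ ∀ β c η : ℝ, |β| ≤ C → |c| ≤ C →
    |laplacePoly β c η| ≤ K * Real.exp (η ^ 2 / 28) := by
  obtain ⟨K, hK, h⟩ := one_add_abs_pow_le_exp_sq 3 (κ := 1 / 28) (by norm_num)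
  refine ⟨3 * C * K, by positivity, fun β c η hβ hc => ?_⟩
  have h1 : |laplacePoly β c η| ≤ 3 * C * (1 + |η|) ^ 3 := by
    have h0 := abs_nonneg η
    calc |laplacePoly β c η| ≤ |β * η| + |c * (η ^ 3 + 3 / 2 * η)| := abs_sub _ _
      _ ≤ C * |η| + C * (|η| ^ 3 + 3 / 2 * |η|) := by
        rw [abs_mul, abs_mul]
        have : |η ^ 3 + 3 / 2 * η| ≤ |η| ^ 3 + 3 / 2 * |η| := by
          refine (abs_add_le _ _).trans ?_
          rw [abs_pow, abs_mul, abs_of_pos (by norm_num : (0 : ℝ) < 3 / 2)]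
        gcongr
      _ = C * (|η| ^ 3 + 5 / 2 * |η|) := by ring
      _ ≤ C * (3 * (1 + |η|) ^ 3) := by
        gcongr
        have e : (1 + |η|) ^ 3 = 1 + 3 * |η| + 3 * |η| ^ 2 + |η| ^ 3 := by ring
        have := pow_nonneg h0 2
        have := pow_nonneg h0 3
        rw [e]; linarith
      _ = _ := by ring
  have h2 := h η
  rw [one_div_mul_eq_div] at h2
  calc |laplacePoly β c η| ≤ 3 * C * (1 + |η|) ^ 3 := h1
    _ ≤ 3 * C * (K * Real.exp (η ^ 2 / 28)) := by gcongr
    _ = _ := by ring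

theorem abs_inv_one_add_sub_le {a e : ℝ} (h : |a + e| ≤ 1 / 2) (he : |e| ≤ 1) :
    |1 / (1 + (a + e)) - (1 - a)| ≤ 2 * (a ^ 2 + 3 * |e|) := by
  have h1 := (abs_le.1 h).1
  have hpos : 0 < 1 + (a + e) := by linarith
  have ha : |a| ≤ 3 / 2 := by
    have := abs_sub (a + e) e
    rw [add_sub_cancel_right] at this; linarith
  have e1 : 1 / (1 + (a + e)) - (1 - a) = (a * (a + e) - e) / (1 + (a + e)) := by
    field_simp; ring
  rw [e1, abs_div, abs_of_pos hpos, div_le_iff₀ hpos]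
  have h2 : |a * (a + e) - e| ≤ a ^ 2 + 3 * |e| := by
    calc |a * (a + e) - e| = |a ^ 2 + (a - 1) * e| := by congr 1; ring
      _ ≤ |a ^ 2| + |(a - 1) * e| := abs_add_le _ _
      _ ≤ a ^ 2 + 3 * |e| := by
        rw [abs_of_nonneg (sq_nonneg a), abs_mul]
        have : |a - 1| ≤ 3 := by
          have := abs_sub a 1
          rw [abs_one] at this; linarith
        gcongr
  have h3 : 0 ≤ a ^ 2 + 3 * |e| := by positivity
  nlinarith

/-- Laplace's method for the reciprocal integral, for moderate values of the tilt `η`. -/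
theorem laplace_inv_moderate {C d : ℝ} (hC : 1 ≤ C) (hd : 0 < d) : ∃ K ς₀ : ℝ, 0 < K ∧ 0 < ς₀ ∧
    ∀ (ς β c : ℝ) (J : Set ℝ) (E : ℝ → ℝ), LaplaceData C d ς β c J E → ς ≤ ς₀ → ∀ η : ℝ,
      Real.exp (η ^ 2) * ς ^ 4 ≤ 1 →
      (√Real.pi / 2 * Real.exp (η ^ 2) ≤ ∫ w in J, Real.exp (2 * η * w + E w)) ∧
      (∫ w in J, Real.exp (2 * η * w + E w)) ≤ 3 / 2 * √Real.pi * Real.exp (η ^ 2) ∧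
      |1 / (∫ w in J, Real.exp (2 * η * w + E w)) -
        1 / √Real.pi * Real.exp (-η ^ 2) * (1 - ς * laplacePoly β c η)| ≤ K * ς ^ 2 := by
  obtain ⟨K₁, hK₁, h1⟩ := laplace_integral hC hd
  obtain ⟨K₂, hK₂, h2⟩ := abs_laplacePoly_le hC
  have hpi : 0 < √Real.pi := Real.sqrt_pos.2 Real.pi_pos
  set K₃ := K₁ / √Real.pi with hK₃
  have hK₃pos : 0 < K₃ := by positivity
  refine ⟨1 / √Real.pi * (2 * (K₂ ^ 2 + 3 * K₃)), min (1 / (4 * K₃)) (1 / (16 * K₂ ^ 2)),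
    by positivity, by positivity, ?_⟩
  intro ς β c J E h hς η hη
  have hς1 : K₃ * ς ≤ 1 / 4 := by
    have := hς.trans (min_le_left _ _)
    rw [le_div_iff₀ (by positivity)] at this; linarith
  have hς2 : K₂ ^ 2 * ς ≤ 1 / 16 := by
    have := hς.trans (min_le_right _ _)
    rw [le_div_iff₀ (by positivity)] at this; linarith
  have hςp := h.pos
  -- In powers of `g` the main term is `g^28`, the error of `laplace_integral` is `g^32` and
  -- `laplacePoly` is `O(g)`. The hypothesis becomes `ς g^7 ≤ 1`, which makes the relative error `ς²
  -- g^4` and the correction `ς g` small.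
  set g := Real.exp (η ^ 2 / 28) with hg
  have hg1 : 1 ≤ g := Real.one_le_exp (by positivity)
  have hg0 : 0 < g := by linarith
  have hg28 : Real.exp (η ^ 2) = g ^ 28 := by
    rw [hg, ← Real.exp_nat_mul]; congr 1; push_cast; ring
  have hg32 : Real.exp (8 / 7 * η ^ 2) = g ^ 28 * g ^ 4 := by
    rw [← pow_add, hg, ← Real.exp_nat_mul]; congr 1; push_cast; ring
  have hςg : ς * g ^ 7 ≤ 1 := by
    rw [hg28] at hη
    have : (ς * g ^ 7) ^ 4 ≤ 1 := by
      calc (ς * g ^ 7) ^ 4 = g ^ 28 * ς ^ 4 := by ring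
        _ ≤ 1 := hη
    exact (pow_le_one_iff_of_nonneg (by positivity) (by norm_num)).1 this
  have hςg4 : ς * g ^ 4 ≤ 1 := by
    refine le_trans ?_ hςg
    gcongr
    norm_num
  have hςg2 : ς * g ^ 2 ≤ 1 := by
    refine le_trans ?_ hςg
    gcongr
    norm_num
  obtain ⟨hi, hF⟩ := h1 ς β c J E h η
  set F := ∫ w in J, Real.exp (2 * η * w + E w) with hFdef
  set a := ς * laplacePoly β c η with ha
  set e := F / (√Real.pi * g ^ 28) - (1 + a) with he
  have hFe : F = √Real.pi * g ^ 28 * (1 + (a + e)) := by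
    rw [he]; field_simp; ring
  have hebd : |e| ≤ K₃ * ς ^ 2 * g ^ 4 := by
    rw [hg28, hg32] at hF
    have e1 : F - √Real.pi * g ^ 28 * (1 + a) = √Real.pi * g ^ 28 * e := by rw [hFe]; ring
    rw [e1, abs_mul, abs_of_pos (by positivity : 0 < √Real.pi * g ^ 28)] at hF
    have e2 : K₁ * ς ^ 2 * (g ^ 28 * g ^ 4) = √Real.pi * g ^ 28 * (K₃ * ς ^ 2 * g ^ 4) := by
      rw [hK₃]; field_simp
    rw [e2] at hF
    exact le_of_mul_le_mul_left hF (by positivity)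
  have habd : |a| ≤ K₂ * ς * g := by
    rw [ha, abs_mul, abs_of_pos hςp]
    have := mul_le_mul_of_nonneg_left (h2 β c η h.beta_le h.c_le) hςp.le
    calc ς * |laplacePoly β c η| ≤ ς * (K₂ * g) := this
      _ = _ := by ring
  have ha2 : a ^ 2 ≤ K₂ ^ 2 * ς ^ 2 * g ^ 2 := by
    rw [← sq_abs a]
    calc |a| ^ 2 ≤ (K₂ * ς * g) ^ 2 := pow_le_pow_left₀ (abs_nonneg a) habd 2
      _ = _ := by ring
  have he4 : |e| ≤ 1 / 4 := by
    calc |e| ≤ K₃ * ς ^ 2 * g ^ 4 := hebd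
      _ = (K₃ * ς) * (ς * g ^ 4) := by ring
      _ ≤ 1 / 4 * 1 := by gcongr
      _ = 1 / 4 := by ring
  have ha4 : |a| ≤ 1 / 4 := by
    have : a ^ 2 ≤ (1 / 4) ^ 2 := by
      calc a ^ 2 ≤ K₂ ^ 2 * ς ^ 2 * g ^ 2 := ha2
        _ = (K₂ ^ 2 * ς) * (ς * g ^ 2) := by ring
        _ ≤ 1 / 16 * 1 := by gcongr
        _ = (1 / 4) ^ 2 := by norm_num
    exact abs_le_of_sq_le_sq this (by norm_num)
  have hae : |a + e| ≤ 1 / 2 := (abs_add_le a e).trans (by linarith)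
  have hae' := abs_le.1 hae
  have hP : 0 < √Real.pi * g ^ 28 := by positivity
  rw [hg28]
  refine ⟨?_, ?_, ?_⟩
  · rw [hFe]
    have : √Real.pi * g ^ 28 * (1 / 2) ≤ √Real.pi * g ^ 28 * (1 + (a + e)) := by
      gcongr; linarith
    linarith
  · rw [hFe]
    have : √Real.pi * g ^ 28 * (1 + (a + e)) ≤ √Real.pi * g ^ 28 * (3 / 2) := by
      gcongr; linarith
    linarith
  · have e1 : Real.exp (-η ^ 2) = 1 / g ^ 28 := by rw [Real.exp_neg, hg28, one_div]
    have e2 : 1 / F - 1 / √Real.pi * Real.exp (-η ^ 2) * (1 - a) =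
        1 / √Real.pi * (1 / g ^ 28) * (1 / (1 + (a + e)) - (1 - a)) := by
      have : 1 + (a + e) ≠ 0 := by linarith
      rw [e1, hFe]; field_simp
    rw [e2, abs_mul, abs_of_pos (by positivity : 0 < 1 / √Real.pi * (1 / g ^ 28))]
    have h3 := abs_inv_one_add_sub_le hae (by linarith)
    have h4 : 2 * (a ^ 2 + 3 * |e|) ≤ 2 * (K₂ ^ 2 + 3 * K₃) * ς ^ 2 * g ^ 28 := by
      have g1 : g ^ 2 ≤ g ^ 28 := pow_le_pow_right₀ hg1 (by norm_num)
      have g2 : g ^ 4 ≤ g ^ 28 := pow_le_pow_right₀ hg1 (by norm_num)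
      have b1 : a ^ 2 ≤ K₂ ^ 2 * ς ^ 2 * g ^ 28 := ha2.trans (by gcongr)
      have b2 : |e| ≤ K₃ * ς ^ 2 * g ^ 28 := hebd.trans (by gcongr)
      linarith
    calc 1 / √Real.pi * (1 / g ^ 28) * |1 / (1 + (a + e)) - (1 - a)| ≤
        1 / √Real.pi * (1 / g ^ 28) * (2 * (K₂ ^ 2 + 3 * K₃) * ς ^ 2 * g ^ 28) := by
          gcongr; exact h3.trans h4
      _ = _ := by field_simp

/-- Monotonicity of convex exponential integrals in the tilt. -/
theorem tilted_integral_mono {J : Set ℝ} {E : ℝ → ℝ}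
    (hi : ∀ η : ℝ, IntegrableOn (fun w => Real.exp (2 * η * w + E w)) J) {θ η : ℝ} (hθ0 : 0 < θ)
    (hθ1 : θ ≤ 1)
    (h0 : (∫ w in J, Real.exp (2 * 0 * w + E w)) ≤ ∫ w in J, Real.exp (2 * (θ * η) * w + E w)) :
    (∫ w in J, Real.exp (2 * (θ * η) * w + E w)) ≤ ∫ w in J, Real.exp (2 * η * w + E w) := by
  have hle : (∫ w in J, Real.exp (2 * (θ * η) * w + E w)) ≤
      ∫ w in J, ((1 - θ) * Real.exp (2 * 0 * w + E w) + θ * Real.exp (2 * η * w + E w)) := by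
    refine integral_mono (hi _) (((hi 0).const_mul _).add ((hi η).const_mul _)) fun w => ?_
    have := convexOn_exp.2 (Set.mem_univ (2 * 0 * w + E w)) (Set.mem_univ (2 * η * w + E w))
      (sub_nonneg.2 hθ1) hθ0.le (by ring)
    simp only [smul_eq_mul] at this
    refine le_trans (le_of_eq ?_) this
    congr 1; ring
  rw [integral_add ((hi 0).const_mul _) ((hi η).const_mul _), integral_const_mul,
    integral_const_mul] at hle
  have h1 := mul_le_mul_of_nonneg_left h0 (sub_nonneg.2 hθ1)
  have h2 : θ * (∫ w in J, Real.exp (2 * (θ * η) * w + E w)) ≤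
      θ * ∫ w in J, Real.exp (2 * η * w + E w) := by linarith
  exact le_of_mul_le_mul_left h2 hθ0

/-- Laplace's method for the reciprocal integral, uniformly in the tilt `η`. -/
theorem laplace_inv {C d : ℝ} (hC : 1 ≤ C) (hd : 0 < d) : ∃ K ς₀ : ℝ, 0 < K ∧ 0 < ς₀ ∧
    ∀ (ς β c : ℝ) (J : Set ℝ) (E : ℝ → ℝ), LaplaceData C d ς β c J E → ς ≤ ς₀ → ∀ η : ℝ,
      IntegrableOn (fun w => Real.exp (2 * η * w + E w)) J ∧
      0 < (∫ w in J, Real.exp (2 * η * w + E w)) ∧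
      |1 / (∫ w in J, Real.exp (2 * η * w + E w)) -
        1 / √Real.pi * Real.exp (-η ^ 2) * (1 - ς * laplacePoly β c η)| ≤ K * ς ^ 2 ∧
      (1 ≤ Real.exp (η ^ 2) * ς ^ 4 → 1 / (∫ w in J, Real.exp (2 * η * w + E w)) ≤ K * ς ^ 4) := by
  obtain ⟨K₁, ς₁, hK₁, hς₁, h1⟩ := laplace_inv_moderate hC hd
  obtain ⟨K₂, hK₂, h2⟩ := abs_laplacePoly_le hC
  obtain ⟨K₀, hK₀, h0⟩ := laplace_integral hC hd
  have hpi : 0 < √Real.pi := Real.sqrt_pos.2 Real.pi_pos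
  refine ⟨K₁ + 2 / √Real.pi + 1 / √Real.pi * (1 + K₂), min ς₁ (1 / 2), by positivity, by positivity, ?_⟩
  intro ς β c J E h hς η
  have hςp := h.pos
  have hςle : ς ≤ ς₁ := hς.trans (min_le_left _ _)
  have hςhalf : ς ≤ 1 / 2 := hς.trans (min_le_right _ _)
  have hi : ∀ η : ℝ, IntegrableOn (fun w => Real.exp (2 * η * w + E w)) J := fun η =>
    (h0 ς β c J E h η).1
  have hs4 : ς ^ 4 ≤ 1 / 3 := by
    have : ς ^ 4 ≤ (1 / 2) ^ 4 := pow_le_pow_left₀ hςp.le hςhalf 4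
    exact this.trans (by norm_num)
  refine ⟨hi η, ?_⟩
  -- Past the threshold `e^{η²} ς^4 = 1` the expansion is replaced by convexity in the tilt. The
  -- integral at `η` is at least the one at the threshold tilt `θ η`, which has order `ς^{-4}` and
  -- exceeds the integral at tilt zero.
  have hlarge : 1 ≤ Real.exp (η ^ 2) * ς ^ 4 →
      √Real.pi / 2 * (1 / ς ^ 4) ≤ ∫ w in J, Real.exp (2 * η * w + E w) := by
    intro hη
    set H2 := Real.log (1 / ς ^ 4) with hH2
    have hexpH : Real.exp H2 = 1 / ς ^ 4 := Real.exp_log (by positivity)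
    have hH2pos : 0 < H2 := Real.log_pos (by rw [lt_div_iff₀ (by positivity)]; linarith)
    have hH2le : H2 ≤ η ^ 2 := by
      rw [← Real.exp_le_exp, hexpH, div_le_iff₀ (by positivity)]; exact hη
    have hη2 : 0 < η ^ 2 := hH2pos.trans_le hH2le
    set θ := √(H2 / η ^ 2) with hθ
    have hθ0 : 0 < θ := Real.sqrt_pos.2 (by positivity)
    have hθ1 : θ ≤ 1 := by
      exact Real.sqrt_le_one.2 ((div_le_one hη2).2 hH2le)
    have hθη : (θ * η) ^ 2 = H2 := by
      rw [mul_pow, hθ, Real.sq_sqrt (by positivity), div_mul_cancel₀ _ hη2.ne']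
    have hm := h1 ς β c J E h hςle (θ * η) (by rw [hθη, hexpH]; field_simp; exact le_rfl)
    have hm0 := h1 ς β c J E h hςle 0 (by simp; linarith)
    rw [hθη, hexpH] at hm
    have h3 : 3 / 2 * √Real.pi * Real.exp (0 ^ 2) ≤ √Real.pi / 2 * (1 / ς ^ 4) := by
      have : 3 ≤ 1 / ς ^ 4 := by rw [le_div_iff₀ (by positivity)]; linarith
      have := mul_le_mul_of_nonneg_left this (by positivity : 0 ≤ √Real.pi / 2)
      simp only [ne_eq, OfNat.ofNat_ne_zero, not_false_eq_true, zero_pow, Real.exp_zero, mul_one]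
      linarith
    exact hm.1.trans (tilted_integral_mono hi hθ0 hθ1 (hm0.2.1.trans (h3.trans hm.1)))
  rcases le_total (Real.exp (η ^ 2) * ς ^ 4) 1 with hη | hη
  · have hm := h1 ς β c J E h hςle η hη
    have hFpos : 0 < ∫ w in J, Real.exp (2 * η * w + E w) :=
      lt_of_lt_of_le (by positivity) hm.1
    refine ⟨hFpos, hm.2.2.trans ?_, fun hη' => ?_⟩
    · have : 0 ≤ 2 / √Real.pi + 1 / √Real.pi * (1 + K₂) := by positivity
      gcongr; linarith
    · have h5 := hlarge hη'
      have h6 : 1 / (∫ w in J, Real.exp (2 * η * w + E w)) ≤ 1 / (√Real.pi / 2 * (1 / ς ^ 4)) :=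
        one_div_le_one_div_of_le (by positivity) h5
      refine h6.trans ?_
      have e : 1 / (√Real.pi / 2 * (1 / ς ^ 4)) = 2 / √Real.pi * ς ^ 4 := by field_simp
      rw [e]
      have : 0 ≤ K₁ + 1 / √Real.pi * (1 + K₂) := by positivity
      gcongr; linarith
  · have h5 := hlarge hη
    have hFpos : 0 < ∫ w in J, Real.exp (2 * η * w + E w) := lt_of_lt_of_le (by positivity) h5
    have h6 : 1 / (∫ w in J, Real.exp (2 * η * w + E w)) ≤ 2 / √Real.pi * ς ^ 4 := by
      refine (one_div_le_one_div_of_le (by positivity) h5).trans (le_of_eq ?_)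
      field_simp
    refine ⟨hFpos, ?_, fun _ => h6.trans ?_⟩
    -- Past the threshold the model is itself `O(ς²)`, so the comparison is between two small
    -- quantities.
    · have h7 : |1 / √Real.pi * Real.exp (-η ^ 2) * (1 - ς * laplacePoly β c η)| ≤
          1 / √Real.pi * (1 + K₂) * ς ^ 2 := by
        set g := Real.exp (η ^ 2 / 28) with hg
        have hg1 : 1 ≤ g := Real.one_le_exp (by positivity)
        have hg28 : Real.exp (η ^ 2) = g ^ 28 := by
          rw [hg, ← Real.exp_nat_mul]; congr 1; push_cast; ring
        have e1 : Real.exp (-η ^ 2) = 1 / g ^ 28 := by rw [Real.exp_neg, hg28, one_div]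
        have hgς : 1 ≤ g ^ 14 * ς ^ 2 := by
          rw [hg28] at hη
          have : 1 ≤ (g ^ 14 * ς ^ 2) ^ 2 := by
            calc 1 ≤ g ^ 28 * ς ^ 4 := hη
              _ = _ := by ring
          nlinarith [(by positivity : 0 ≤ g ^ 14 * ς ^ 2)]
        have h8 : |1 - ς * laplacePoly β c η| ≤ (1 + K₂) * g ^ 14 := by
          refine (abs_sub _ _).trans ?_
          rw [abs_one, abs_mul, abs_of_pos hςp]
          have h9 := h2 β c η h.beta_le h.c_le
          have h10 : ς * |laplacePoly β c η| ≤ 1 * (K₂ * g) := by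
            gcongr
            exact h.le_one
          have h11 : g ≤ g ^ 14 := le_self_pow₀ hg1 (by norm_num)
          have h12 : 1 ≤ g ^ 14 := one_le_pow₀ hg1
          nlinarith
        rw [abs_mul, abs_mul, abs_of_pos (by positivity : 0 < 1 / √Real.pi), Real.abs_exp, e1]
        calc 1 / √Real.pi * (1 / g ^ 28) * |1 - ς * laplacePoly β c η| ≤
              1 / √Real.pi * (1 / g ^ 28) * ((1 + K₂) * g ^ 14) := by gcongr
          _ = 1 / √Real.pi * (1 + K₂) * (1 / g ^ 14) := by field_simp
          _ ≤ 1 / √Real.pi * (1 + K₂) * ς ^ 2 := by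
            gcongr
            rw [div_le_iff₀ (by positivity)]; linarith
      have h8 : |1 / (∫ w in J, Real.exp (2 * η * w + E w))| ≤ 2 / √Real.pi * ς ^ 2 := by
        rw [abs_of_pos (by positivity)]
        refine h6.trans ?_
        have : ς ^ 4 ≤ ς ^ 2 := pow_le_pow_of_le_one hςp.le h.le_one (by norm_num)
        gcongr
      have h9 : 0 ≤ K₁ * ς ^ 2 := by positivity
      refine (abs_sub _ _).trans ?_
      linarith
    · have : 0 ≤ K₁ + 1 / √Real.pi * (1 + K₂) := by positivity
      gcongr; linarith

/-! ### Taylor expansion and the local model at a well -/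

theorem continuousAt_iteratedDeriv {f : ℝ → ℝ} {y₀ : ℝ} {n k : ℕ} (hf : ContDiffAt ℝ n f y₀)
    (hk : k ≤ n) : ContinuousAt (iteratedDeriv k f) y₀ := by
  have h := hf.continuousAt_iteratedFDeriv (k := k) (by exact_mod_cast hk)
  rw [iteratedDeriv_eq_equiv_comp]
  exact (LinearIsometryEquiv.continuous _).continuousAt.comp h

/-- A Taylor expansion that is uniform in the base point. -/
theorem exists_taylor_bound {f : ℝ → ℝ} {y₀ : ℝ} {n : ℕ} (hf : ContDiffAt ℝ (n + 1 : ℕ) f y₀) :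
    ∃ ρ C : ℝ, 0 < ρ ∧ 0 < C ∧ (∀ y, |y - y₀| ≤ ρ → ContDiffAt ℝ (n + 1 : ℕ) f y) ∧
      (∀ y z, |y - y₀| ≤ ρ → |z - y₀| ≤ ρ →
        |f z - ∑ k ∈ Finset.range (n + 1), iteratedDeriv k f y * (z - y) ^ k / k.factorial| ≤
          C * |z - y| ^ (n + 1)) ∧
      ∀ y, |y - y₀| ≤ ρ → ∀ k ≤ n + 1, |iteratedDeriv k f y| ≤ C := by
  have h1 : ∀ᶠ y in 𝓝 y₀, ContDiffAt ℝ (n + 1 : ℕ) f y := hf.eventually (by simp)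
  set C := 1 + ∑ k ∈ Finset.range (n + 2), |iteratedDeriv k f y₀| with hC
  have hCk : ∀ k ≤ n + 1, |iteratedDeriv k f y₀| < C := by
    intro k hk
    have : |iteratedDeriv k f y₀| ≤ ∑ k ∈ Finset.range (n + 2), |iteratedDeriv k f y₀| :=
      Finset.single_le_sum (f := fun k => |iteratedDeriv k f y₀|) (fun _ _ => abs_nonneg _)
        (Finset.mem_range.2 (by omega))
    linarith
  have hC0 : 0 < C := (abs_nonneg _).trans_lt (hCk 0 (by omega))
  have h2 : ∀ᶠ y in 𝓝 y₀, ∀ k ∈ Finset.range (n + 2), |iteratedDeriv k f y| < C := by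
    rw [Filter.eventually_all_finset]
    intro k hk
    have hk' : k ≤ n + 1 := by have := Finset.mem_range.1 hk; omega
    exact (continuousAt_iteratedDeriv hf hk').abs.eventually_lt_const (hCk k hk')
  obtain ⟨ε, hε, hball⟩ := Metric.eventually_nhds_iff.1 (h1.and h2)
  have hB : ∀ y, |y - y₀| ≤ ε / 2 → ContDiffAt ℝ (n + 1 : ℕ) f y ∧
      ∀ k ≤ n + 1, |iteratedDeriv k f y| ≤ C := by
    intro y hy
    obtain ⟨a1, a2⟩ := hball (y := y) (by rw [Real.dist_eq]; linarith)
    exact ⟨a1, fun k hk => (a2 k (Finset.mem_range.2 (by omega))).le⟩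
  refine ⟨ε / 2, C, by positivity, hC0, fun y hy => (hB y hy).1, ?_, fun y hy => (hB y hy).2⟩
  intro y z hy hz
  rcases eq_or_ne y z with rfl | hne
  · rw [Finset.sum_range_succ']
    simp
  have hsub : ∀ t ∈ Set.uIcc y z, |t - y₀| ≤ ε / 2 := by
    intro t ht
    have h3 : Set.uIcc y z ⊆ Set.Icc (y₀ - ε / 2) (y₀ + ε / 2) := by
      rw [abs_le] at hy hz
      exact Set.uIcc_subset_Icc ⟨by linarith, by linarith⟩ ⟨by linarith, by linarith⟩
    have := h3 ht
    rw [abs_le]; constructor <;> linarith [this.1, this.2]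
  have hcd : ContDiffOn ℝ (n + 1 : ℕ) f (Set.uIcc y z) := fun t ht =>
    ((hB t (hsub t ht)).1).contDiffWithinAt
  obtain ⟨t, ht, heq⟩ := taylor_mean_remainder_lagrange_iteratedDeriv hne
    (by exact_mod_cast hcd)
  rw [taylor_within_apply] at heq
  have e : ∑ k ∈ Finset.range (n + 1), ((k.factorial : ℝ)⁻¹ * (z - y) ^ k) •
      iteratedDerivWithin k f (Set.uIcc y z) y =
      ∑ k ∈ Finset.range (n + 1), iteratedDeriv k f y * (z - y) ^ k / k.factorial := by
    refine Finset.sum_congr rfl fun k hk => ?_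
    have hk' : k ≤ n + 1 := by have := Finset.mem_range.1 hk; omega
    rw [iteratedDerivWithin_eq_iteratedDeriv (uniqueDiffOn_uIcc hne)
      ((hB y hy).1.of_le (by exact_mod_cast hk')) Set.left_mem_uIcc, smul_eq_mul]
    ring
  rw [e] at heq
  rw [heq, abs_div, abs_mul, abs_pow]
  have ht' : |iteratedDeriv (n + 1) f t| ≤ C :=
    (hB t (hsub t (Set.Ioo_subset_Icc_self ht))).2 (n + 1) le_rfl
  have hfac : (1 : ℝ) ≤ |((n + 1).factorial : ℝ)| := by
    rw [Nat.abs_cast]; exact_mod_cast Nat.succ_le_of_lt (Nat.factorial_pos _)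
  rw [div_le_iff₀ (by linarith)]
  have h5 : 0 ≤ C * |z - y| ^ (n + 1) := by positivity
  calc |iteratedDeriv (n + 1) f t| * |z - y| ^ (n + 1) ≤ C * |z - y| ^ (n + 1) := by gcongr
    _ ≤ C * |z - y| ^ (n + 1) * |((n + 1).factorial : ℝ)| := le_mul_of_one_le_right h5 hfac

/-- Local regularity of the potential `U` and of the amplitude `a` at a well of `U`. -/
structure LocalModel (U a : ℝ → ℝ) (y₀ ρ C : ℝ) : Prop where
  rho_pos : 0 < ρ
  one_le : 1 ≤ C
  measurable_U : Measurable U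
  measurable_a : Measurable a
  taylor_U : ∀ y z, |y - y₀| ≤ ρ → |z - y₀| ≤ ρ →
    |U z - (U y + deriv U y * (z - y) + iteratedDeriv 2 U y / 2 * (z - y) ^ 2 +
      iteratedDeriv 3 U y / 6 * (z - y) ^ 3)| ≤ C * (z - y) ^ 4
  taylor_a : ∀ y z, |y - y₀| ≤ ρ → |z - y₀| ≤ ρ →
    |a z - (a y + deriv a y * (z - y))| ≤ C * (z - y) ^ 2
  le_U2 : ∀ y, |y - y₀| ≤ ρ → 1 / C ≤ iteratedDeriv 2 U y
  U2_le : ∀ y, |y - y₀| ≤ ρ → iteratedDeriv 2 U y ≤ C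
  U3_le : ∀ y, |y - y₀| ≤ ρ → |iteratedDeriv 3 U y| ≤ C
  a1_le : ∀ y, |y - y₀| ≤ ρ → |deriv a y| ≤ C

theorem exists_localModel {U a : ℝ → ℝ} {y₀ : ℝ} (hU : Measurable U) (ha : Measurable a)
    (hU4 : ContDiffAt ℝ 4 U y₀) (ha2 : ContDiffAt ℝ 2 a y₀) (hpos : 0 < iteratedDeriv 2 U y₀) :
    ∃ ρ C : ℝ, LocalModel U a y₀ ρ C := by
  obtain ⟨ρ₁, C₁, hρ₁, hC₁, -, hT₁, hB₁⟩ := exists_taylor_bound (n := 3) hU4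
  obtain ⟨ρ₂, C₂, hρ₂, hC₂, -, hT₂, hB₂⟩ := exists_taylor_bound (n := 1) ha2
  have hc : ContinuousAt (iteratedDeriv 2 U) y₀ := continuousAt_iteratedDeriv (n := 4) hU4 (by norm_num)
  have hev := hc.eventually_const_lt (half_lt_self hpos)
  obtain ⟨ε, hε, hball⟩ := Metric.eventually_nhds_iff.1 hev
  set m := iteratedDeriv 2 U y₀ with hm
  -- The summand `2 / m` ensures `1 / C ≤ m / 2`, the lower bound of the curvature near `y₀`.
  refine ⟨min (min ρ₁ ρ₂) (ε / 2), 1 + C₁ + C₂ + 2 / m, ⟨by positivity, ?_, hU, ha, ?_, ?_, ?_, ?_, ?_, ?_⟩⟩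
  · have : 0 < 2 / m := by positivity
    linarith
  · intro y z hy hz
    have h := hT₁ y z (hy.trans ((min_le_left _ _).trans (min_le_left _ _)))
      (hz.trans ((min_le_left _ _).trans (min_le_left _ _)))
    simp only [Finset.sum_range_succ, Finset.sum_range_zero, iteratedDeriv_zero, iteratedDeriv_one] at h
    norm_num [Nat.factorial] at h
    have e4 : |z - y| ^ 4 = (z - y) ^ 4 := by rw [← abs_pow]; exact abs_of_nonneg (by positivity)
    rw [e4] at h
    have h0 : 0 ≤ (z - y) ^ 4 := by positivity
    have hm0 : 0 < 2 / m := by positivity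
    refine le_trans (le_of_eq ?_) (h.trans (by nlinarith))
    congr 1; ring
  · intro y z hy hz
    have h := hT₂ y z (hy.trans ((min_le_left _ _).trans (min_le_right _ _)))
      (hz.trans ((min_le_left _ _).trans (min_le_right _ _)))
    simp only [Finset.sum_range_succ, Finset.sum_range_zero, iteratedDeriv_zero, iteratedDeriv_one] at h
    norm_num [Nat.factorial] at h
    have h0 : 0 ≤ (z - y) ^ 2 := by positivity
    have hm0 : 0 < 2 / m := by positivity
    exact h.trans (by nlinarith)
  · intro y hy
    have h1 := hball (y := y) (by
      rw [Real.dist_eq]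
      have := hy.trans (min_le_right _ _)
      linarith)
    refine le_trans ?_ h1.le
    rw [div_le_iff₀ (by positivity)]
    have : m / 2 * (2 / m) = 1 := by field_simp
    have h2 : 0 ≤ m / 2 * (1 + C₁ + C₂) := by positivity
    linarith
  · intro y hy
    have := hB₁ y (hy.trans ((min_le_left _ _).trans (min_le_left _ _))) 2 (by norm_num)
    have hm0 : 0 < 2 / m := by positivity
    linarith [le_abs_self (iteratedDeriv 2 U y)]
  · intro y hy
    have := hB₁ y (hy.trans ((min_le_left _ _).trans (min_le_left _ _))) 3 (by norm_num)
    have hm0 : 0 < 2 / m := by positivity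
    linarith
  · intro y hy
    have := hB₂ y (hy.trans ((min_le_left _ _).trans (min_le_right _ _))) 1 (by norm_num)
    rw [iteratedDeriv_one] at this
    have hm0 : 0 < 2 / m := by positivity
    linarith

/-- The Gaussian width `√(2 / (n U''(y)))`. -/
noncomputable def laplaceScale (U : ℝ → ℝ) (n : ℕ) (y : ℝ) : ℝ := √(2 / (n * iteratedDeriv 2 U y))

/-- The normalized local integral near the well `y₀`. -/
noncomputable def localIntegral (U a : ℝ → ℝ) (n : ℕ) (y₀ ρ x y : ℝ) : ℝ :=
  ∫ z in Set.Icc (y₀ - ρ) (y₀ + ρ), Real.exp (2 * x * (z - y) + (a z - a y) - n * (U z - U y))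

theorem laplaceScale_sq {U : ℝ → ℝ} {n : ℕ} {y : ℝ} (hn : 0 < n) (hU : 0 < iteratedDeriv 2 U y) :
    0 < laplaceScale U n y ∧ n * iteratedDeriv 2 U y * laplaceScale U n y ^ 2 = 2 := by
  have hn' : (0 : ℝ) < n := by exact_mod_cast hn
  refine ⟨Real.sqrt_pos.2 (by positivity), ?_⟩
  rw [laplaceScale, Real.sq_sqrt (by positivity)]
  field_simp

/-- With `n U''(y) ς² = 2` the substitution `z = y + ς w` normalizes the quadratic term to `-w²`.
The linear term of `n U` is added back here, since it belongs to the tilt. The terms from `a'` and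
`U'''` are of order `ς`, and the Taylor remainders are of order `ς²`. The window is centred at `y₀`
and not at `y`; it contains the points with `ς |w| ≤ ρ₀ / 2` because `|y - y₀| ≤ ρ₀ / 2`. -/
theorem LocalModel.laplaceData {U a : ℝ → ℝ} {y₀ ρ C : ℝ} (h : LocalModel U a y₀ ρ C) {ρ₀ : ℝ}
    (hρ₀ : 0 < ρ₀) (hle : ρ₀ ≤ ρ) (hsmall : 2 * ρ₀ ≤ 1 / (64 * (2 * C ^ 2))) {n : ℕ} (hn : 0 < n)
    {y : ℝ} (hy : |y - y₀| ≤ ρ₀ / 2) (hς1 : laplaceScale U n y ≤ 1) :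
    LaplaceData (2 * C ^ 2) (ρ₀ / 2) (laplaceScale U n y) (deriv a y)
      (iteratedDeriv 3 U y / (3 * iteratedDeriv 2 U y))
      {w | |y + laplaceScale U n y * w - y₀| ≤ ρ₀}
      (fun w => n * deriv U y * (laplaceScale U n y * w) + (a (y + laplaceScale U n y * w) - a y) -
        n * (U (y + laplaceScale U n y * w) - U y)) := by
  have hC := h.one_le
  have hyρ : |y - y₀| ≤ ρ := by linarith
  have hU2 := h.le_U2 y hyρ
  have hU2' := h.U2_le y hyρ
  have hU3 := h.U3_le y hyρ
  have ha1 := h.a1_le y hyρ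
  have hU2pos : 0 < iteratedDeriv 2 U y := lt_of_lt_of_le (by positivity) hU2
  obtain ⟨hς, hς2⟩ := laplaceScale_sq hn hU2pos
  set ς := laplaceScale U n y
  set u₂ := iteratedDeriv 2 U y
  set u₃ := iteratedDeriv 3 U y
  have hn' : (0 : ℝ) < n := by exact_mod_cast hn
  have hC2 : C ≤ 2 * C ^ 2 := by nlinarith
  have hinv : 1 / u₂ ≤ C := by
    rw [div_le_iff₀ (by linarith)] at hU2
    rw [div_le_iff₀ hU2pos]; linarith
  refine ⟨hς, hς1, ha1.trans hC2, ?_, ?_, ?_, ?_, ?_, ?_⟩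
  · rw [abs_div, abs_of_pos (by positivity : 0 < 3 * u₂), div_le_iff₀ (by positivity)]
    have h1 : 1 ≤ C * u₂ := by rw [div_le_iff₀ hU2pos] at hinv; linarith
    nlinarith
  · exact measurableSet_le (by fun_prop) measurable_const
  · have hl : Measurable fun w : ℝ => y + ς * w := by fun_prop
    have hA := h.measurable_a.comp hl
    have hUm := h.measurable_U.comp hl
    exact (((by fun_prop : Measurable fun w : ℝ => n * deriv U y * (ς * w)).add
      (hA.sub_const _)).sub ((hUm.sub_const _).const_mul _)).aestronglyMeasurable
  · intro w hw
    have h1 : |ς * w| ≤ |y + ς * w - y₀| + |y - y₀| := by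
      have := abs_sub (y + ς * w - y₀) (y - y₀)
      have e : y + ς * w - y₀ - (y - y₀) = ς * w := by ring
      rwa [e] at this
    rw [abs_mul, abs_of_pos hς] at h1
    have h2 : |y + ς * w - y₀| ≤ ρ₀ := hw
    linarith
  · intro w hw
    have h2 : ρ₀ < |y + ς * w - y₀| := not_le.1 hw
    have h1 : |y + ς * w - y₀| ≤ |y - y₀| + |ς * w| := by
      have := abs_add_le (y - y₀) (ς * w)
      have e : y - y₀ + ς * w = y + ς * w - y₀ := by ring
      rwa [e] at this
    rw [abs_mul, abs_of_pos hς] at h1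
    linarith
  · intro w hw
    have hw' : |y + ς * w - y₀| ≤ ρ := le_trans hw hle
    have t1 := h.taylor_U y (y + ς * w) hyρ hw'
    have t2 := h.taylor_a y (y + ς * w) hyρ hw'
    rw [add_sub_cancel_left] at t1 t2
    set R₁ := U (y + ς * w) - (U y + deriv U y * (ς * w) + u₂ / 2 * (ς * w) ^ 2 + u₃ / 6 * (ς * w) ^ 3)
    set R₂ := a (y + ς * w) - (a y + deriv a y * (ς * w))
    have e : n * deriv U y * (ς * w) + (a (y + ς * w) - a y) - n * (U (y + ς * w) - U y) -
        (-w ^ 2 + ς * (deriv a y * w - u₃ / (3 * u₂) * w ^ 3)) = R₂ - n * R₁ := by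
      have e1 : (n : ℝ) = 2 / (u₂ * ς ^ 2) := by
        rw [eq_div_iff (by positivity)]; linarith
      simp only [R₁, R₂]
      rw [e1]; field_simp; ring
    rw [e]
    have hnς : n * ς ^ 2 ≤ 2 * C := by
      have : n * ς ^ 2 = 2 * (1 / u₂) := by
        rw [← hς2]; field_simp
      rw [this]; linarith
    calc |R₂ - n * R₁| ≤ |R₂| + |n * R₁| := abs_sub _ _
      _ ≤ C * (ς * w) ^ 2 + n * (C * (ς * w) ^ 4) := by
        rw [abs_mul, abs_of_pos hn']; gcongr
      _ = C * ς ^ 2 * w ^ 2 + (n * ς ^ 2) * (C * ς ^ 2 * w ^ 4) := by ring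
      _ ≤ (2 * C ^ 2) * ς ^ 2 * w ^ 2 + (2 * C) * (C * ς ^ 2 * w ^ 4) := by gcongr
      _ = _ := by ring

/-- The exponent is parametrized from its critical value `n U'(y) / 2`, so that `η` measures the
tilt in units of the Gaussian width. -/
theorem localIntegral_eq {U a : ℝ → ℝ} {n : ℕ} {y₀ ρ y ς η : ℝ} (hς : 0 < ς) :
    localIntegral U a n y₀ ρ (n * deriv U y / 2 + η / ς) y =
      ς * ∫ w in {w | |y + ς * w - y₀| ≤ ρ}, Real.exp (2 * η * w + (n * deriv U y * (ς * w) +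
        (a (y + ς * w) - a y) - n * (U (y + ς * w) - U y))) := by
  have hm : MeasurableSet {w : ℝ | |y + ς * w - y₀| ≤ ρ} :=
    measurableSet_le (by fun_prop) measurable_const
  rw [localIntegral, ← integral_indicator measurableSet_Icc, ← integral_indicator hm]
  set G := (Set.Icc (y₀ - ρ) (y₀ + ρ)).indicator fun z => Real.exp
    (2 * (n * deriv U y / 2 + η / ς) * (z - y) + (a z - a y) - n * (U z - U y)) with hG
  have h1 := integral_add_left_eq_self (μ := volume) G y
  have h2 := Measure.integral_comp_mul_left (fun z => G (y + z)) ς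
  have h3 : ∀ w, G (y + ς * w) = {w : ℝ | |y + ς * w - y₀| ≤ ρ}.indicator (fun w =>
      Real.exp (2 * η * w + (n * deriv U y * (ς * w) +
        (a (y + ς * w) - a y) - n * (U (y + ς * w) - U y)))) w := by
    intro w
    have hiff : y + ς * w ∈ Set.Icc (y₀ - ρ) (y₀ + ρ) ↔ w ∈ {w : ℝ | |y + ς * w - y₀| ≤ ρ} := by
      rw [Set.mem_ofPred_eq, abs_le, Set.mem_Icc]
      constructor <;> rintro ⟨h1, h2⟩ <;> constructor <;> linarith
    by_cases hw : w ∈ {w : ℝ | |y + ς * w - y₀| ≤ ρ}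
    · rw [Set.indicator_of_mem hw, hG, Set.indicator_of_mem (hiff.2 hw)]
      congr 1; field_simp; ring
    · rw [Set.indicator_of_notMem hw, hG, Set.indicator_of_notMem (fun h => hw (hiff.1 h))]
  simp only [h3] at h2
  rw [h2, h1, abs_of_pos (by positivity), smul_eq_mul, mul_inv_cancel_left₀ hς.ne']

theorem eventually_log_pow_le (K : ℝ) (p : ℕ) : ∀ᶠ n : ℕ in atTop, K * Real.log n ^ p ≤ √(n : ℝ) := by
  have h : (fun x : ℝ => Real.log x ^ p) =o[atTop] fun x : ℝ => x ^ (1 / 2 : ℝ) := by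
    have := isLittleO_log_rpow_rpow_atTop (p : ℝ) (by norm_num : (0 : ℝ) < 1 / 2)
    simpa using this
  have h2 := (h.const_mul_left K).bound one_pos
  have h3 := tendsto_natCast_atTop_atTop (R := ℝ) |>.eventually h2
  filter_upwards [h3] with n hn
  rw [one_mul, Real.norm_eq_abs, Real.norm_eq_abs, ← Real.sqrt_eq_rpow,
    abs_of_nonneg (Real.sqrt_nonneg _)] at hn
  exact (le_abs_self _).trans hn

theorem eventually_pow_mul_exp_le (K : ℝ) (p : ℕ) {c : ℝ} (hc : 0 < c) :
    ∀ᶠ n : ℕ in atTop, K * (n : ℝ) ^ p * Real.exp (-(c * n)) ≤ 1 := by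
  have h := Real.tendsto_pow_mul_exp_neg_atTop_nhds_zero p
  have h1 : Tendsto (fun n : ℕ => c * (n : ℝ)) atTop atTop :=
    tendsto_natCast_atTop_atTop.const_mul_atTop hc
  have h2 := (h.comp h1).const_mul (K / c ^ p)
  rw [mul_zero] at h2
  filter_upwards [h2.eventually_le_const one_pos] with n hn
  simp only [Function.comp] at hn
  refine le_trans (le_of_eq ?_) hn
  rw [mul_pow]; field_simp

/-- The Gaussian approximation, with first correction, of the reciprocal local integral. -/
noncomputable def localDensity (U a : ℝ → ℝ) (n : ℕ) (y x : ℝ) : ℝ :=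
  1 / (laplaceScale U n y * √Real.pi) *
    Real.exp (-(laplaceScale U n y * (x - n * deriv U y / 2)) ^ 2) *
    (1 - laplaceScale U n y * laplacePoly (deriv a y)
      (iteratedDeriv 3 U y / (3 * iteratedDeriv 2 U y))
      (laplaceScale U n y * (x - n * deriv U y / 2)))

theorem LocalModel.U2_pos {U a : ℝ → ℝ} {y₀ ρ C : ℝ} (h : LocalModel U a y₀ ρ C) {y : ℝ}
    (hy : |y - y₀| ≤ ρ) : 0 < iteratedDeriv 2 U y := by
  have := h.one_le
  exact lt_of_lt_of_le (by positivity) (h.le_U2 y hy)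

/-- The Gaussian width is comparable to `1 / √n`. -/
theorem LocalModel.scale_bounds {U a : ℝ → ℝ} {y₀ ρ C : ℝ} (h : LocalModel U a y₀ ρ C) {y : ℝ}
    (hy : |y - y₀| ≤ ρ) {n : ℕ} (hn : 0 < n) :
    1 / C * (1 / √n) ≤ laplaceScale U n y ∧ laplaceScale U n y ≤ 2 * C * (1 / √n) := by
  have hC := h.one_le
  have hn' : (0 : ℝ) < n := by exact_mod_cast hn
  have h1 := h.le_U2 y hy
  have h2 := h.U2_le y hy
  have hpos := h.U2_pos hy
  have hsq : 0 < √(n : ℝ) := Real.sqrt_pos.2 hn'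
  constructor
  · refine Real.le_sqrt_of_sq_le ?_
    rw [mul_pow, div_pow, div_pow, Real.sq_sqrt hn'.le, ← mul_div_mul_comm, div_le_div_iff₀
      (by positivity) (by positivity)]
    have : iteratedDeriv 2 U y ≤ 2 * C ^ 2 := by nlinarith
    nlinarith
  · refine Real.sqrt_le_iff.2 ⟨by positivity, ?_⟩
    rw [mul_pow, div_pow, Real.sq_sqrt hn'.le, one_pow, mul_one_div, div_le_div_iff₀ (by positivity) hn']
    rw [div_le_iff₀ (by linarith)] at h1
    have h3 : 1 ≤ C ^ 2 * iteratedDeriv 2 U y := by nlinarith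
    nlinarith

theorem tendsto_one_div_sqrt_nat : Tendsto (fun n : ℕ => 1 / √(n : ℝ)) atTop (𝓝 0) := by
  have h : Tendsto (fun n : ℕ => √(n : ℝ)) atTop atTop :=
    Real.tendsto_sqrt_atTop.comp tendsto_natCast_atTop_atTop
  simp only [one_div]
  exact tendsto_inv_atTop_zero.comp h

/-- Uniformity over all real `x` is essential, because degrees at distance of order `n` enter the
sum. Beyond the threshold the bound improves to `ς³`, so that even `n` such terms have a bounded
sum. -/
theorem LocalModel.laplace {U a : ℝ → ℝ} {y₀ ρ C : ℝ} (h : LocalModel U a y₀ ρ C) {ρ₀ : ℝ}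
    (hρ₀ : 0 < ρ₀) (hle : ρ₀ ≤ ρ) (hsmall : 2 * ρ₀ ≤ 1 / (64 * (2 * C ^ 2))) :
    ∃ K : ℝ, 0 < K ∧ ∀ᶠ n : ℕ in atTop, ∀ y, |y - y₀| ≤ ρ₀ / 2 → ∀ x : ℝ,
      0 < localIntegral U a n y₀ ρ₀ x y ∧
      |1 / localIntegral U a n y₀ ρ₀ x y - localDensity U a n y x| ≤ K * laplaceScale U n y ∧
      (1 ≤ Real.exp ((laplaceScale U n y * (x - n * deriv U y / 2)) ^ 2) * laplaceScale U n y ^ 4 →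
        1 / localIntegral U a n y₀ ρ₀ x y ≤ K * laplaceScale U n y ^ 3 ∧
        |localDensity U a n y x| ≤ K * laplaceScale U n y) := by
  have hC := h.one_le
  have hC2 : 1 ≤ 2 * C ^ 2 := by nlinarith
  obtain ⟨K, ς₀, hK, hς₀, hmain⟩ := laplace_inv hC2 (by positivity : 0 < ρ₀ / 2)
  refine ⟨K + K, by positivity, ?_⟩
  have hev : ∀ᶠ n : ℕ in atTop, 2 * C * (1 / √(n : ℝ)) ≤ min ς₀ 1 := by
    have := tendsto_one_div_sqrt_nat.const_mul (2 * C)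
    rw [mul_zero] at this
    exact this.eventually_le_const (by positivity)
  filter_upwards [hev, eventually_gt_atTop 0] with n hn hn0 y hy x
  have hyρ : |y - y₀| ≤ ρ := by linarith
  obtain ⟨hς, -⟩ := laplaceScale_sq hn0 (h.U2_pos hyρ)
  have hςle := (h.scale_bounds hyρ hn0).2.trans hn
  have hdata := h.laplaceData hρ₀ hle hsmall hn0 hy (hςle.trans (min_le_right _ _))
  set ς := laplaceScale U n y with hςdef
  set η := ς * (x - n * deriv U y / 2) with hη
  have hx : x = n * deriv U y / 2 + η / ς := by rw [hη]; field_simp; ring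
  obtain ⟨-, hF, h1, h2⟩ := hmain _ _ _ _ _ hdata (hςle.trans (min_le_left _ _)) η
  have heq := localIntegral_eq (U := U) (a := a) (n := n) (y₀ := y₀) (ρ := ρ₀) (y := y) (η := η) hς
  rw [← hx] at heq
  set F := ∫ w in {w | |y + ς * w - y₀| ≤ ρ₀}, Real.exp (2 * η * w + (n * deriv U y * (ς * w) +
        (a (y + ς * w) - a y) - n * (U (y + ς * w) - U y))) with hFdef
  have hinv : 1 / localIntegral U a n y₀ ρ₀ x y = 1 / ς * (1 / F) := by
    rw [heq]; field_simp
  have hdens : localDensity U a n y x = 1 / ς * (1 / √Real.pi * Real.exp (-η ^ 2) *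
      (1 - ς * laplacePoly (deriv a y) (iteratedDeriv 3 U y / (3 * iteratedDeriv 2 U y)) η)) := by
    rw [localDensity, ← hςdef, ← hη]; field_simp
  have hς2 : 1 / ς * (K * ς ^ 2) = K * ς := by field_simp
  have hA : |1 / localIntegral U a n y₀ ρ₀ x y - localDensity U a n y x| ≤ K * ς := by
    rw [hinv, hdens, ← mul_sub, abs_mul, abs_of_pos (by positivity : 0 < 1 / ς), ← hς2]
    gcongr
  refine ⟨by rw [heq]; positivity, hA.trans (by gcongr; linarith), fun hη1 => ?_⟩
  have h3 : 1 / localIntegral U a n y₀ ρ₀ x y ≤ K * ς ^ 3 := by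
    have h4 := h2 hη1
    have : 1 / ς * (K * ς ^ 4) = K * ς ^ 3 := by field_simp
    rw [hinv, ← this]; gcongr
  refine ⟨h3.trans (by gcongr; linarith), ?_⟩
  have h5 : 0 < 1 / localIntegral U a n y₀ ρ₀ x y := by rw [hinv]; positivity
  have h6 : ς ^ 3 ≤ ς := pow_le_of_le_one hς.le hdata.le_one (by norm_num)
  have h7 := abs_sub (1 / localIntegral U a n y₀ ρ₀ x y)
    (1 / localIntegral U a n y₀ ρ₀ x y - localDensity U a n y x)
  rw [sub_sub_cancel, abs_of_pos h5] at h7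
  nlinarith

/-! ### The double well and its Fermi factor -/

/-- A double-well potential `U` in the logarithmic variable, with wells at `y₁ < y₂`, and an
amplitude `a`. -/
structure GapModel (U a : ℝ → ℝ) (y₁ y₂ ρ C : ℝ) : Prop where
  lt : y₁ < y₂
  left : LocalModel U a y₁ ρ C
  right : LocalModel U a y₂ ρ C
  left_eq : U y₁ = 0
  right_eq : U y₂ = 0
  left_deriv : deriv U y₁ = 0
  right_deriv : deriv U y₂ = 0
  nonneg : ∀ y, 0 ≤ U y
  coercive : ∀ δ, 0 < δ → ∃ c, 0 < c ∧ ∀ y, δ ≤ |y - y₁| → δ ≤ |y - y₂| → c * (1 + |y|) ≤ U y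
  amplitude_le : ∀ y, |a y| ≤ 2 * |y| + C

/-- The weight whose integral is the squared norm of a monomial, with exponent relative to the
mass inside of the gap. -/
noncomputable def gapWeight (U a : ℝ → ℝ) (n : ℕ) (x z : ℝ) : ℝ :=
  Real.exp (2 * x * z + a z - n * U z)

theorem GapModel.measurable_gapWeight {U a : ℝ → ℝ} {y₁ y₂ ρ C : ℝ} (h : GapModel U a y₁ y₂ ρ C)
    (n : ℕ) (x : ℝ) : Measurable (gapWeight U a n x) := by
  have := h.left.measurable_U
  have := h.left.measurable_a
  unfold gapWeight
  fun_prop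

theorem localIntegral_eq_setIntegral {U a : ℝ → ℝ} {n : ℕ} {y₀ ρ x y : ℝ} :
    localIntegral U a n y₀ ρ x y = (∫ z in Set.Icc (y₀ - ρ) (y₀ + ρ), gapWeight U a n x z) /
      gapWeight U a n x y := by
  rw [localIntegral, ← integral_div]
  refine integral_congr_ae (Eventually.of_forall fun z => ?_)
  simp only [gapWeight]
  rw [← Real.exp_sub]; congr 1; ring

theorem integrable_exp_neg_mul_abs {c : ℝ} (hc : 0 < c) :
    Integrable (fun z : ℝ => Real.exp (-(c * |z|))) := by
  have h1 : IntegrableOn (fun z : ℝ => Real.exp (-(c * |z|))) (Set.Ioi 0) :=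
    (integrableOn_exp_mul_Ioi (neg_lt_zero.2 hc) 0).congr_fun (fun z hz => by
      simp only [abs_of_pos (Set.mem_Ioi.1 hz), neg_mul]) measurableSet_Ioi
  have h2 : IntegrableOn (fun z : ℝ => Real.exp (-(c * |z|))) (Set.Iic 0) :=
    (integrableOn_exp_mul_Iic hc 0).congr_fun (fun z hz => by
      simp only [abs_of_nonpos (Set.mem_Iic.1 hz), mul_neg, neg_neg]) measurableSet_Iic
  rw [← integrableOn_univ, ← Set.Iic_union_Ioi (a := (0 : ℝ))]
  exact h2.union h1

/-- Away from the wells the weight is exponentially small. -/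
theorem GapModel.rest_bound {U a : ℝ → ℝ} {y₁ y₂ ρ C : ℝ} (h : GapModel U a y₁ y₂ ρ C) {ρ₀ : ℝ}
    (hρ₀ : 0 < ρ₀) :
    ∃ K c : ℝ, 0 < K ∧ 0 < c ∧ ∀ᶠ n : ℕ in atTop, ∀ x : ℝ, |x| ≤ c * n →
      Integrable (gapWeight U a n x) ∧
      (∫ z in (Set.Icc (y₁ - ρ₀) (y₁ + ρ₀) ∪ Set.Icc (y₂ - ρ₀) (y₂ + ρ₀))ᶜ, gapWeight U a n x z) ≤
        K * Real.exp (-(c * n)) * gapWeight U a n x y₁ := by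
  obtain ⟨c₀, hc₀, hcoer⟩ := h.coercive ρ₀ hρ₀
  set S := (Set.Icc (y₁ - ρ₀) (y₁ + ρ₀) ∪ Set.Icc (y₂ - ρ₀) (y₂ + ρ₀)) with hS
  have hSm : MeasurableSet S := measurableSet_Icc.union measurableSet_Icc
  have hSfin : volume S < ⊤ := (measure_union_lt_top measure_Icc_lt_top measure_Icc_lt_top)
  have hS' : ∀ z ∈ Sᶜ, ρ₀ ≤ |z - y₁| ∧ ρ₀ ≤ |z - y₂| := by
    intro z hz
    simp only [hS, Set.mem_compl_iff, Set.mem_union, Set.mem_Icc, not_or] at hz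
    constructor
    · by_contra hcon
      rw [not_le, abs_lt] at hcon
      exact hz.1 ⟨by linarith, by linarith⟩
    · by_contra hcon
      rw [not_le, abs_lt] at hcon
      exact hz.2 ⟨by linarith, by linarith⟩
  -- For `|x| ≤ c n` the tilt, relative to its value at `y₁`, uses up only a part of the coercivity
  -- `n c₀ (1 + |z|)`. The rest beats the linear growth of the amplitude and leaves both `e^{-|z|}`
  -- and `e^{-cn}`.
  set c := c₀ / (8 * (1 + |y₁|)) with hc
  have hcpos : 0 < c := by positivity
  have hcc : c ≤ c₀ / 8 := by
    rw [hc]; exact div_le_div_of_nonneg_left hc₀.le (by norm_num) (by linarith [abs_nonneg y₁])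
  have hcy : c * |y₁| ≤ c₀ / 8 := by
    rw [hc, div_mul_eq_mul_div, div_le_div_iff₀ (by positivity) (by norm_num)]
    nlinarith [abs_nonneg y₁]
  set K₁ := ∫ z : ℝ, Real.exp (-(1 * |z|)) with hK₁
  have hK₁nn : 0 ≤ K₁ := integral_nonneg fun _ => (Real.exp_pos _).le
  refine ⟨Real.exp (C + |a y₁|) * K₁ + 1, c, by positivity, hcpos, ?_⟩
  have hev : ∀ᶠ n : ℕ in atTop, 12 / c₀ ≤ (n : ℝ) := tendsto_natCast_atTop_atTop.eventually_ge_atTop _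
  filter_upwards [hev] with n hn x hx
  rw [div_le_iff₀ hc₀] at hn
  have hn0 : (0 : ℝ) ≤ n := Nat.cast_nonneg n
  have hm := h.measurable_gapWeight n x
  have hxn : |x| ≤ c₀ / 8 * n := hx.trans (by gcongr)
  have hxy : |x| * |y₁| ≤ c₀ / 8 * n := by
    calc |x| * |y₁| ≤ (c * n) * |y₁| := by gcongr
      _ = (c * |y₁|) * n := by ring
      _ ≤ _ := by gcongr
  have hpt : ∀ z ∈ Sᶜ, gapWeight U a n x z ≤
      Real.exp (C + |a y₁|) * Real.exp (-(c * n)) * gapWeight U a n x y₁ * Real.exp (-(1 * |z|)) := by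
    intro z hz
    obtain ⟨h1, h2⟩ := hS' z hz
    have h3 := hcoer z h1 h2
    rw [gapWeight, gapWeight, h.left_eq, ← Real.exp_add, ← Real.exp_add, ← Real.exp_add]
    refine Real.exp_le_exp.2 ?_
    have h4 := mul_le_mul_of_nonneg_left h3 hn0
    have h5 : x * z ≤ |x| * |z| := by rw [← abs_mul]; exact le_abs_self _
    have h6 : -(x * y₁) ≤ |x| * |y₁| := by rw [← abs_mul]; exact neg_le_abs _
    have h7 := (le_abs_self (a z)).trans (h.amplitude_le z)
    have h8 := neg_abs_le (a y₁)
    have h9 : |x| * |z| ≤ (c₀ / 8 * n) * |z| := by gcongr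
    have h10 : c * n ≤ c₀ / 8 * n := by gcongr
    have h11 : 0 ≤ |z| := abs_nonneg z
    have h12 : 12 * |z| ≤ (n * c₀) * |z| := by gcongr
    have h13 : 0 ≤ c₀ * n := by positivity
    nlinarith
  have hdom : Integrable (fun z : ℝ => Real.exp (C + |a y₁|) * Real.exp (-(c * n)) *
      gapWeight U a n x y₁ * Real.exp (-(1 * |z|))) := (integrable_exp_neg_mul_abs one_pos).const_mul _
  have hi1 : IntegrableOn (gapWeight U a n x) Sᶜ := by
    refine Integrable.mono' hdom.integrableOn hm.aestronglyMeasurable ?_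
    filter_upwards [ae_restrict_mem hSm.compl] with z hz
    rw [Real.norm_of_nonneg (show 0 ≤ gapWeight U a n x z from (Real.exp_pos _).le)]
    exact hpt z hz
  have hi2 : IntegrableOn (gapWeight U a n x) S := by
    set Y := |y₁| + |y₂| + ρ₀ with hY
    refine Measure.integrableOn_of_bounded (M := Real.exp (2 * |x| * Y + (2 * Y + C))) hSfin.ne
      hm.aestronglyMeasurable ?_
    filter_upwards [ae_restrict_mem hSm] with z hz
    have hzY : |z| ≤ Y := by
      rw [abs_le, hY]
      rcases hz with hz | hz <;> constructor <;>
      linarith [hz.1, hz.2, neg_abs_le y₁, neg_abs_le y₂, le_abs_self y₁, le_abs_self y₂,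
        abs_nonneg y₁, abs_nonneg y₂]
    rw [Real.norm_of_nonneg (show 0 ≤ gapWeight U a n x z from (Real.exp_pos _).le)]
    refine Real.exp_le_exp.2 ?_
    have h5 : x * z ≤ |x| * Y := by
      calc x * z ≤ |x| * |z| := by rw [← abs_mul]; exact le_abs_self _
        _ ≤ _ := by gcongr
    have h7 := (le_abs_self (a z)).trans (h.amplitude_le z)
    have h8 := mul_nonneg hn0 (h.nonneg z)
    linarith
  refine ⟨?_, ?_⟩
  · rw [← integrableOn_univ, ← Set.union_compl_self S]
    exact hi2.union hi1
  · have hmono : (∫ z in Sᶜ, gapWeight U a n x z) ≤ ∫ z in Sᶜ, Real.exp (C + |a y₁|) *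
        Real.exp (-(c * n)) * gapWeight U a n x y₁ * Real.exp (-(1 * |z|)) :=
      setIntegral_mono_on hi1 hdom.integrableOn hSm.compl hpt
    have hfull : (∫ z in Sᶜ, Real.exp (C + |a y₁|) * Real.exp (-(c * n)) * gapWeight U a n x y₁ *
        Real.exp (-(1 * |z|))) ≤ ∫ z, Real.exp (C + |a y₁|) * Real.exp (-(c * n)) *
          gapWeight U a n x y₁ * Real.exp (-(1 * |z|)) :=
      setIntegral_le_integral hdom (Eventually.of_forall fun z => by
        simp only [gapWeight, Pi.zero_apply]; positivity)
    refine hmono.trans (hfull.trans ?_)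
    rw [integral_const_mul, ← hK₁]
    have hg : 0 < gapWeight U a n x y₁ := Real.exp_pos _
    have : 0 ≤ Real.exp (-(c * n)) * gapWeight U a n x y₁ := by positivity
    nlinarith

theorem LocalModel.cubic_le {U a : ℝ → ℝ} {y₀ ρ C : ℝ} (h : LocalModel U a y₀ ρ C) {y : ℝ}
    (hy : |y - y₀| ≤ ρ) : |iteratedDeriv 3 U y / (3 * iteratedDeriv 2 U y)| ≤ 2 * C ^ 2 := by
  have hC := h.one_le
  have hU2 := h.le_U2 y hy
  have hU3 := h.U3_le y hy
  have hpos := h.U2_pos hy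
  rw [abs_div, abs_of_pos (by positivity : 0 < 3 * iteratedDeriv 2 U y), div_le_iff₀ (by positivity)]
  rw [div_le_iff₀ (by linarith)] at hU2
  nlinarith

theorem LocalModel.amplitude_deriv_le {U a : ℝ → ℝ} {y₀ ρ C : ℝ} (h : LocalModel U a y₀ ρ C) {y : ℝ}
    (hy : |y - y₀| ≤ ρ) : |deriv a y| ≤ 2 * C ^ 2 := by
  have := h.a1_le y hy
  have hC := h.one_le
  nlinarith

/-- The polynomial correction is at most of order `e^{η²/28}`, which the Gaussian factor absorbs. -/
theorem LocalModel.abs_localDensity_le {U a : ℝ → ℝ} {y₀ ρ C : ℝ} (h : LocalModel U a y₀ ρ C) :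
    ∃ K : ℝ, 0 < K ∧ ∀ n : ℕ, 0 < n → ∀ y, |y - y₀| ≤ ρ → laplaceScale U n y ≤ 1 → ∀ x : ℝ,
      |localDensity U a n y x| ≤ K / laplaceScale U n y := by
  have hC := h.one_le
  have hC2 : 1 ≤ 2 * C ^ 2 := by nlinarith
  obtain ⟨K, hK, hKb⟩ := abs_laplacePoly_le hC2
  refine ⟨1 + K, by positivity, fun n hn y hy hς1 x => ?_⟩
  obtain ⟨hς, -⟩ := laplaceScale_sq hn (h.U2_pos hy)
  have hP := hKb _ _ (laplaceScale U n y * (x - n * deriv U y / 2)) (h.amplitude_deriv_le hy)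
    (h.cubic_le hy)
  rw [localDensity]
  set ς := laplaceScale U n y
  set η := ς * (x - n * deriv U y / 2)
  set P := laplacePoly (deriv a y) (iteratedDeriv 3 U y / (3 * iteratedDeriv 2 U y)) η
  have hsq : 1 ≤ √Real.pi := by
    rw [Real.one_le_sqrt]; linarith [Real.pi_gt_three]
  rw [abs_mul, abs_mul, abs_of_pos (by positivity : 0 < 1 / (ς * √Real.pi)),
    abs_of_pos (Real.exp_pos _)]
  have h1 : |1 - ς * P| ≤ 1 + K * Real.exp (η ^ 2 / 28) := by
    calc |1 - ς * P| ≤ |1| + |ς * P| := abs_sub _ _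
      _ ≤ 1 + 1 * (K * Real.exp (η ^ 2 / 28)) := by
        rw [abs_one, abs_mul, abs_of_pos hς]; gcongr
      _ = _ := by ring
  have h2 : Real.exp (-η ^ 2) * |1 - ς * P| ≤ 1 + K := by
    calc Real.exp (-η ^ 2) * |1 - ς * P| ≤ Real.exp (-η ^ 2) * (1 + K * Real.exp (η ^ 2 / 28)) := by
          gcongr
      _ = Real.exp (-η ^ 2) + K * Real.exp (-η ^ 2 + η ^ 2 / 28) := by rw [Real.exp_add]; ring
      _ ≤ 1 + K * 1 := by
        gcongr
        · exact Real.exp_le_one_iff.2 (by nlinarith [sq_nonneg η])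
        · exact Real.exp_le_one_iff.2 (by nlinarith [sq_nonneg η])
      _ = _ := by ring
  calc 1 / (ς * √Real.pi) * Real.exp (-η ^ 2) * |1 - ς * P|
      = 1 / (ς * √Real.pi) * (Real.exp (-η ^ 2) * |1 - ς * P|) := by ring
    _ ≤ 1 / (ς * 1) * (1 + K) := by gcongr
    _ = _ := by field_simp

/-- The three bounds serve the three positions relative to the Fermi transition. Near it the ratio
`q / E` is controlled, on one side `q` and `E` are both small, and on the other side both are large.
The mass `e` away from the wells costs at most `e` in each case. -/
theorem abs_inv_one_add_add_sub_le {q e E : ℝ} (hq : 0 < q) (he : 0 ≤ e) (hE : 0 < E) :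
    |1 / (1 + (q + e)) - 1 / (1 + E)| ≤ e + |q / E - 1| ∧
    |1 / (1 + (q + e)) - 1 / (1 + E)| ≤ e + (q + E) ∧
    |1 / (1 + (q + e)) - 1 / (1 + E)| ≤ e + (1 / q + 1 / E) := by
  have h1 : |1 / (1 + (q + e)) - 1 / (1 + q)| ≤ e := by
    have : 1 / (1 + (q + e)) - 1 / (1 + q) = -(e / ((1 + (q + e)) * (1 + q))) := by field_simp; ring
    rw [this, abs_neg, abs_of_nonneg (by positivity), div_le_iff₀ (by positivity)]
    have : 1 ≤ (1 + (q + e)) * (1 + q) := by nlinarith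
    nlinarith
  have h0 : |1 / (1 + (q + e)) - 1 / (1 + E)| ≤ e + |1 / (1 + q) - 1 / (1 + E)| := by
    calc _ ≤ |1 / (1 + (q + e)) - 1 / (1 + q)| + |1 / (1 + q) - 1 / (1 + E)| := abs_sub_le _ _ _
      _ ≤ _ := by gcongr
  have hA : 0 < 1 / (1 + q) := by positivity
  have hB : 0 < 1 / (1 + E) := by positivity
  refine ⟨h0.trans ?_, h0.trans ?_, h0.trans ?_⟩
  · have : 1 / (1 + q) - 1 / (1 + E) = -((q / E - 1) * (E / ((1 + q) * (1 + E)))) := by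
      field_simp; ring
    rw [this, abs_neg, abs_mul, abs_of_pos (by positivity : 0 < E / ((1 + q) * (1 + E)))]
    have h2 : E / ((1 + q) * (1 + E)) ≤ 1 := by
      rw [div_le_one (by positivity)]; nlinarith [mul_pos hq hE]
    have := mul_le_mul_of_nonneg_left h2 (abs_nonneg (q / E - 1))
    linarith
  · have h2 : 1 - 1 / (1 + q) ≤ q := by
      have : 1 - 1 / (1 + q) = q / (1 + q) := by field_simp; ring
      rw [this, div_le_iff₀ (by positivity)]; nlinarith
    have h3 : 1 - 1 / (1 + E) ≤ E := by
      have : 1 - 1 / (1 + E) = E / (1 + E) := by field_simp; ring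
      rw [this, div_le_iff₀ (by positivity)]; nlinarith
    have h4 : 1 / (1 + q) ≤ 1 := by rw [div_le_one (by positivity)]; linarith
    have h5 : 1 / (1 + E) ≤ 1 := by rw [div_le_one (by positivity)]; linarith
    have : |1 / (1 + q) - 1 / (1 + E)| ≤ q + E := by rw [abs_le]; constructor <;> linarith
    linarith
  · have h2 : 1 / (1 + q) ≤ 1 / q := by gcongr; linarith
    have h3 : 1 / (1 + E) ≤ 1 / E := by gcongr; linarith
    have : |1 / (1 + q) - 1 / (1 + E)| ≤ 1 / q + 1 / E := by rw [abs_le]; constructor <;> linarith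
    linarith

/-- A crude bound, used only far from the transition, where `e^{2ρ₀|x|}` is beaten by `e^{-2L|x|}`.
-/
theorem GapModel.localIntegral_le {U a : ℝ → ℝ} {y₁ y₂ ρ C : ℝ} (h : GapModel U a y₁ y₂ ρ C)
    (y ρ₀ : ℝ) (hρ₀ : 0 < ρ₀) (hy : U y = 0) :
    ∃ K : ℝ, 0 < K ∧ ∀ (n : ℕ) (x : ℝ),
      localIntegral U a n y ρ₀ x y ≤ K * Real.exp (2 * ρ₀ * |x|) := by
  set M := 2 * (|y| + ρ₀) + C + |a y| with hM
  refine ⟨Real.exp M * (2 * ρ₀), by positivity, fun n x => ?_⟩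
  have hb : ∀ z ∈ Set.Icc (y - ρ₀) (y + ρ₀),
      ‖Real.exp (2 * x * (z - y) + (a z - a y) - n * (U z - U y))‖ ≤
        Real.exp M * Real.exp (2 * ρ₀ * |x|) := by
    intro z hz
    rw [Real.norm_of_nonneg (Real.exp_pos _).le, ← Real.exp_add, hy, sub_zero]
    refine Real.exp_le_exp.2 ?_
    have h1 : |z - y| ≤ ρ₀ := by rw [abs_le]; constructor <;> linarith [hz.1, hz.2]
    have h2 : x * (z - y) ≤ |x| * ρ₀ := by
      calc x * (z - y) ≤ |x| * |z - y| := by rw [← abs_mul]; exact le_abs_self _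
        _ ≤ _ := by gcongr
    have h3 : |z| ≤ |y| + ρ₀ := by
      have := abs_add_le y (z - y)
      rw [add_sub_cancel] at this
      linarith
    have h4 := (le_abs_self (a z)).trans (h.amplitude_le z)
    have h5 := mul_nonneg (Nat.cast_nonneg (α := ℝ) n) (h.nonneg z)
    have h6 := neg_abs_le (a y)
    linarith
  have := norm_setIntegral_le_of_norm_le_const (μ := volume) measure_Icc_lt_top hb
  rw [localIntegral]
  refine (le_abs_self _).trans (this.trans (le_of_eq ?_))
  rw [measureReal_def, Real.volume_Icc, ENNReal.toReal_ofReal (by linarith)]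
  ring

set_option maxHeartbeats 400000 in
/-- At a critical point, the reciprocal local integral is at most of the order `√n`, and it agrees
with the Gaussian value up to a relative error `O(1 / √n)` when `|x|` is of logarithmic size. -/
theorem LocalModel.inv_localIntegral_critical {U a : ℝ → ℝ} {y₀ ρ C : ℝ}
    (h : LocalModel U a y₀ ρ C) (hd : deriv U y₀ = 0) {ρ₀ : ℝ}
    (hρ₀ : 0 < ρ₀) (hle : ρ₀ ≤ ρ) (hsmall : 2 * ρ₀ ≤ 1 / (64 * (2 * C ^ 2))) (A : ℝ) :
    ∃ K : ℝ, 0 < K ∧ ∀ᶠ n : ℕ in atTop, ∀ x : ℝ,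
      0 < localIntegral U a n y₀ ρ₀ x y₀ ∧ 1 / localIntegral U a n y₀ ρ₀ x y₀ ≤ K * √(n : ℝ) ∧
      (|x| ≤ A * Real.log n →
        |laplaceScale U n y₀ * √Real.pi * (1 / localIntegral U a n y₀ ρ₀ x y₀) - 1| ≤
          K * (1 / √(n : ℝ))) := by
  have hC := h.one_le
  have hC2 : 1 ≤ 2 * C ^ 2 := by nlinarith
  obtain ⟨K₁, hK₁, hev₁⟩ := h.laplace hρ₀ hle hsmall
  obtain ⟨K₂, hK₂, hdens⟩ := h.abs_localDensity_le
  obtain ⟨K₃, hK₃, hpoly⟩ := abs_laplacePoly_le hC2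
  refine ⟨K₁ + K₂ * C + (2 * C) * (2 * C + K₃ * Real.exp (1 / 28) + K₁ * 2), by positivity, ?_⟩
  have hev₂ : ∀ᶠ n : ℕ in atTop, 2 * C * (1 / √(n : ℝ)) ≤ 1 := by
    have := tendsto_one_div_sqrt_nat.const_mul (2 * C)
    rw [mul_zero] at this
    exact this.eventually_le_const one_pos
  have hev₃ := eventually_log_pow_le (2 * C * A ^ 2) 2
  have hev₄ := eventually_log_pow_le (A ^ 2) 2
  filter_upwards [hev₁, hev₂, hev₃, hev₄, eventually_gt_atTop 0] with n hn1 hn2 hn3 hn4 hn0 x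
  have hy : |y₀ - y₀| ≤ ρ := by simp [h.rho_pos.le]
  obtain ⟨hF, hL, -⟩ := hn1 y₀ (by simp; positivity) x
  obtain ⟨hς, -⟩ := laplaceScale_sq hn0 (h.U2_pos hy)
  obtain ⟨hb1, hb2⟩ := h.scale_bounds hy hn0
  have hς1 := hb2.trans hn2
  have hd2 := hdens n hn0 y₀ hy hς1 x
  have hn' : (0 : ℝ) < n := by exact_mod_cast hn0
  have hsq : 0 < √(n : ℝ) := Real.sqrt_pos.2 hn'
  have hsq1 : 1 ≤ √(n : ℝ) := by rw [Real.one_le_sqrt]; exact_mod_cast hn0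
  have hinvς : 1 / laplaceScale U n y₀ ≤ C * √(n : ℝ) := by
    rw [div_le_iff₀ hς]
    have : C * √(n : ℝ) * (1 / C * (1 / √n)) = 1 := by field_simp
    have h2 : 0 ≤ C * √(n : ℝ) := by positivity
    nlinarith
  refine ⟨hF, ?_, ?_⟩
  · have h3 : 1 / localIntegral U a n y₀ ρ₀ x y₀ ≤
        K₁ * laplaceScale U n y₀ + K₂ / laplaceScale U n y₀ := by
      rw [abs_le] at hL hd2; linarith [hL.2, hd2.2]
    have h4 : K₂ / laplaceScale U n y₀ ≤ K₂ * (C * √n) := by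
      rw [div_eq_mul_one_div]; gcongr
    have h5 : K₁ * laplaceScale U n y₀ ≤ K₁ * √n := by gcongr; linarith
    have h6 : 0 ≤ (2 * C) * (2 * C + K₃ * Real.exp (1 / 28) + K₁ * 2) * √n := by positivity
    nlinarith
  · intro hx
    set ς := laplaceScale U n y₀ with hςdef
    have hd' : localDensity U a n y₀ x = 1 / (ς * √Real.pi) * (Real.exp (-(ς * x) ^ 2) *
      (1 - ς * laplacePoly (deriv a y₀) (iteratedDeriv 3 U y₀ / (3 * iteratedDeriv 2 U y₀)) (ς * x))) := by
      rw [localDensity, hd, ← hςdef]; simp only [mul_zero, zero_div, sub_zero]; ring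
    set P := laplacePoly (deriv a y₀) (iteratedDeriv 3 U y₀ / (3 * iteratedDeriv 2 U y₀)) (ς * x) with hP
    have hx2 : x ^ 2 ≤ A ^ 2 * Real.log n ^ 2 := by
      rw [← sq_abs x, ← mul_pow]; exact pow_le_pow_left₀ (abs_nonneg _) hx 2
    -- As `x² = O(log² n)` is below `√n`, the squared Gaussian argument is `O(ς)` and the Gaussian
    -- factor is `1 + O(ς)`.
    have hη1 : ς * x ^ 2 ≤ 2 * C := by
      calc ς * x ^ 2 ≤ (2 * C * (1 / √n)) * √n := by gcongr; exact hx2.trans hn4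
        _ = 2 * C := by field_simp
    have hη2 : (ς * x) ^ 2 ≤ 1 := by
      have e1 : (2 * C * (1 / √n)) * (2 * C * A ^ 2 * Real.log n ^ 2 / (2 * C)) ≤ 1 := by
        have : (2 * C * (1 / √n)) * (2 * C * A ^ 2 * Real.log n ^ 2 / (2 * C)) =
          (1 / √n) * (2 * C * A ^ 2 * Real.log n ^ 2) := by field_simp
        rw [this, one_div_mul_eq_div, div_le_one hsq]; exact hn3
      have e2 : ς * x ^ 2 ≤ 1 := by
        refine le_trans ?_ e1
        have : 2 * C * A ^ 2 * Real.log n ^ 2 / (2 * C) = A ^ 2 * Real.log n ^ 2 := by field_simp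
        rw [this]
        gcongr
      calc (ς * x) ^ 2 = ς * (ς * x ^ 2) := by ring
        _ ≤ 1 * 1 := by gcongr
        _ = 1 := one_mul 1
    have hPb : |P| ≤ K₃ * Real.exp (1 / 28) := by
      refine (hpoly _ _ (ς * x) (h.amplitude_deriv_le hy) (h.cubic_le hy)).trans ?_
      gcongr
    have hE1 : |Real.exp (-(ς * x) ^ 2) - 1| ≤ (ς * x) ^ 2 := by
      rw [abs_le]
      have := Real.add_one_le_exp (-(ς * x) ^ 2)
      have h2 : Real.exp (-(ς * x) ^ 2) ≤ 1 := Real.exp_le_one_iff.2 (by nlinarith [sq_nonneg (ς * x)])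
      constructor <;> nlinarith [sq_nonneg (ς * x)]
    have hE2 : Real.exp (-(ς * x) ^ 2) ≤ 1 := Real.exp_le_one_iff.2 (by nlinarith [sq_nonneg (ς * x)])
    have hpi : √Real.pi ≤ 2 := by
      rw [Real.sqrt_le_iff]; constructor <;> linarith [Real.pi_le_four]
    have e : ς * √Real.pi * (1 / localIntegral U a n y₀ ρ₀ x y₀) - 1 =
        (Real.exp (-(ς * x) ^ 2) - 1) - Real.exp (-(ς * x) ^ 2) * (ς * P) +
        ς * √Real.pi * (1 / localIntegral U a n y₀ ρ₀ x y₀ - localDensity U a n y₀ x) := by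
      rw [hd']; field_simp; ring
    rw [e]
    have hpi0 : 0 < √Real.pi := Real.sqrt_pos.2 Real.pi_pos
    have b1 : |Real.exp (-(ς * x) ^ 2) - 1| ≤ ς * (2 * C) := by
      refine hE1.trans ?_
      calc (ς * x) ^ 2 = ς * (ς * x ^ 2) := by ring
        _ ≤ _ := by gcongr
    have b2 : |Real.exp (-(ς * x) ^ 2) * (ς * P)| ≤ ς * (K₃ * Real.exp (1 / 28)) := by
      rw [abs_mul, abs_mul, abs_of_pos (Real.exp_pos _), abs_of_pos hς]
      calc Real.exp (-(ς * x) ^ 2) * (ς * |P|) ≤ 1 * (ς * (K₃ * Real.exp (1 / 28))) := by gcongr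
        _ = _ := one_mul _
    have b3 : |ς * √Real.pi * (1 / localIntegral U a n y₀ ρ₀ x y₀ - localDensity U a n y₀ x)| ≤
        ς * (K₁ * 2) := by
      rw [abs_mul, abs_of_pos (by positivity : 0 < ς * √Real.pi)]
      calc ς * √Real.pi * |1 / localIntegral U a n y₀ ρ₀ x y₀ - localDensity U a n y₀ x|
          ≤ ς * 2 * (K₁ * ς) := by gcongr
        _ ≤ ς * 2 * (K₁ * 1) := by gcongr
        _ = _ := by ring
    calc |Real.exp (-(ς * x) ^ 2) - 1 - Real.exp (-(ς * x) ^ 2) * (ς * P) +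
        ς * √Real.pi * (1 / localIntegral U a n y₀ ρ₀ x y₀ - localDensity U a n y₀ x)|
        ≤ ς * (2 * C) + ς * (K₃ * Real.exp (1 / 28)) + ς * (K₁ * 2) :=
          (abs_add_le _ _).trans (add_le_add ((abs_sub _ _).trans (add_le_add b1 b2)) b3)
      _ = ς * (2 * C + K₃ * Real.exp (1 / 28) + K₁ * 2) := by ring
      _ ≤ (2 * C * (1 / √n)) * (2 * C + K₃ * Real.exp (1 / 28) + K₁ * 2) := by gcongr
      _ ≤ _ := by
        have h6 : 0 ≤ (K₁ + K₂ * C) * (1 / √(n : ℝ)) := by positivity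
        linarith

/-- The fraction of the mass of the weight that sits near the well `y₁`. -/
noncomputable def gapFraction (U a : ℝ → ℝ) (n : ℕ) (y₁ ρ₀ x : ℝ) : ℝ :=
  (∫ z in Set.Icc (y₁ - ρ₀) (y₁ + ρ₀), gapWeight U a n x z) / ∫ z, gapWeight U a n x z

/-- The position of the Fermi transition between the two wells. -/
noncomputable def gapShift (U a : ℝ → ℝ) (y₁ y₂ : ℝ) : ℝ :=
  -(((a y₂ - a y₁) + 1 / 2 * Real.log (iteratedDeriv 2 U y₁ / iteratedDeriv 2 U y₂)) /
    (2 * (y₂ - y₁)))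

theorem gapWeight_pos {U a : ℝ → ℝ} {n : ℕ} {x z : ℝ} : 0 < gapWeight U a n x z := Real.exp_pos _

theorem gapFraction_mem (U a : ℝ → ℝ) (n : ℕ) (y₁ ρ₀ x : ℝ) :
    0 ≤ gapFraction U a n y₁ ρ₀ x ∧ gapFraction U a n y₁ ρ₀ x ≤ 1 := by
  have h0 : ∀ z, 0 ≤ gapWeight U a n x z := fun z => gapWeight_pos.le
  refine ⟨div_nonneg (integral_nonneg h0) (integral_nonneg h0), ?_⟩
  by_cases hi : Integrable (gapWeight U a n x)
  · exact div_le_one_of_le₀ (setIntegral_le_integral hi (Eventually.of_forall h0)) (integral_nonneg h0)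
  · rw [gapFraction, integral_undef hi, div_zero]; exact zero_le_one

/-- The factorization on which the analysis rests: the density relative to the left well alone,
times the probability of being in that well. The first factor depends smoothly on `x`, and the
second carries the transition. -/
theorem gapWeight_div_integral {U a : ℝ → ℝ} {n : ℕ} {y₁ ρ₀ x y : ℝ}
    (hF : 0 < localIntegral U a n y₁ ρ₀ x y) :
    gapWeight U a n x y / ∫ z, gapWeight U a n x z =
      1 / localIntegral U a n y₁ ρ₀ x y * gapFraction U a n y₁ ρ₀ x := by
  have hw : 0 < gapWeight U a n x y := gapWeight_pos
  rw [localIntegral_eq_setIntegral] at hF ⊢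
  have h1 : 0 < ∫ z in Set.Icc (y₁ - ρ₀) (y₁ + ρ₀), gapWeight U a n x z := by
    have := mul_pos hF hw
    rwa [div_mul_cancel₀ _ hw.ne'] at this
  rw [gapFraction]; field_simp

theorem GapModel.fraction_eq {U a : ℝ → ℝ} {y₁ y₂ ρ C : ℝ} (h : GapModel U a y₁ y₂ ρ C) {ρ₀ : ℝ}
    (hL : 4 * ρ₀ ≤ y₂ - y₁) (hρ₀ : 0 < ρ₀) {n : ℕ} {x : ℝ} (hi : Integrable (gapWeight U a n x))
    (hF : 0 < localIntegral U a n y₁ ρ₀ x y₁) :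
    gapFraction U a n y₁ ρ₀ x = 1 / (1 + (Real.exp (2 * x * (y₂ - y₁) + (a y₂ - a y₁)) *
      localIntegral U a n y₂ ρ₀ x y₂ * (1 / localIntegral U a n y₁ ρ₀ x y₁) +
      (∫ z in (Set.Icc (y₁ - ρ₀) (y₁ + ρ₀) ∪ Set.Icc (y₂ - ρ₀) (y₂ + ρ₀))ᶜ, gapWeight U a n x z) /
        gapWeight U a n x y₁ * (1 / localIntegral U a n y₁ ρ₀ x y₁))) := by
  set I₁ := Set.Icc (y₁ - ρ₀) (y₁ + ρ₀) with hI₁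
  set I₂ := Set.Icc (y₂ - ρ₀) (y₂ + ρ₀) with hI₂
  have hdisj : Disjoint I₁ I₂ := by
    rw [Set.disjoint_left]
    intro z hz hz'
    linarith [hz.2, hz'.1]
  have hsum : ∫ z, gapWeight U a n x z = (∫ z in I₁, gapWeight U a n x z) +
      (∫ z in I₂, gapWeight U a n x z) + ∫ z in (I₁ ∪ I₂)ᶜ, gapWeight U a n x z := by
    rw [← setIntegral_union hdisj measurableSet_Icc hi.integrableOn hi.integrableOn,
      integral_add_compl (measurableSet_Icc.union measurableSet_Icc) hi]
  have hw₁ : 0 < gapWeight U a n x y₁ := gapWeight_pos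
  have hw₂ : 0 < gapWeight U a n x y₂ := gapWeight_pos
  have hexp : Real.exp (2 * x * (y₂ - y₁) + (a y₂ - a y₁)) =
      gapWeight U a n x y₂ / gapWeight U a n x y₁ := by
    rw [gapWeight, gapWeight, ← Real.exp_sub, h.left_eq, h.right_eq]; congr 1; ring
  rw [localIntegral_eq_setIntegral] at hF
  have h1 : 0 < ∫ z in I₁, gapWeight U a n x z := by
    have := mul_pos hF hw₁
    rwa [div_mul_cancel₀ _ hw₁.ne'] at this
  rw [gapFraction, hexp, localIntegral_eq_setIntegral, localIntegral_eq_setIntegral, hsum,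
    ← hI₁, ← hI₂]
  field_simp
  congr 1; ring

/-- `gapShift` collects the amplitudes at the wells and the ratio of the Gaussian widths, in which
`n` cancels. The leading ratio of the masses of the two wells is then exactly this exponential. -/
theorem GapModel.exp_gapShift {U a : ℝ → ℝ} {y₁ y₂ ρ C : ℝ} (h : GapModel U a y₁ y₂ ρ C) {n : ℕ}
    (hn : 0 < n) (x : ℝ) :
    Real.exp (2 * (y₂ - y₁) * (x - gapShift U a y₁ y₂)) =
      Real.exp (2 * x * (y₂ - y₁) + (a y₂ - a y₁)) *
        (laplaceScale U n y₂ / laplaceScale U n y₁) := by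
  have hL : 0 < y₂ - y₁ := sub_pos.2 h.lt
  have h1 := h.left.U2_pos (y := y₁) (by simp [h.left.rho_pos.le])
  have h2 := h.right.U2_pos (y := y₂) (by simp [h.right.rho_pos.le])
  have hn' : (0 : ℝ) < n := by exact_mod_cast hn
  have e1 : laplaceScale U n y₂ / laplaceScale U n y₁ =
      Real.exp (1 / 2 * Real.log (iteratedDeriv 2 U y₁ / iteratedDeriv 2 U y₂)) := by
    rw [laplaceScale, laplaceScale, ← Real.sqrt_div (by positivity)]
    have : 2 / (↑n * iteratedDeriv 2 U y₂) / (2 / (↑n * iteratedDeriv 2 U y₁)) =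
      iteratedDeriv 2 U y₁ / iteratedDeriv 2 U y₂ := by field_simp
    rw [this, one_div_mul_eq_div, ← Real.log_sqrt (by positivity), Real.exp_log (by positivity)]
  rw [e1, ← Real.exp_add, gapShift]
  congr 1
  field_simp
  ring

/-- Of the decay `e^{-2Lw}` one half yields `1 / n`, one quarter pays for `e^{2ρ₀w}` because `2 ρ₀ ≤
L / 2`, and the last quarter pays for `√n`. -/
theorem exp_mul_exp_mul_sqrt_le {L ρ₀ w n : ℝ} (hL4 : 4 * ρ₀ ≤ L) (hw : 0 ≤ w)
    (hn : 0 < n) (hexp : Real.exp (-(L * w)) ≤ 1 / n) :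
    Real.exp (-(2 * L * w)) * Real.exp (2 * ρ₀ * w) * √n ≤ 1 / n := by
  have hsq : 0 < √n := Real.sqrt_pos.2 hn
  have h1 : Real.exp (-(2 * L * w)) * Real.exp (2 * ρ₀ * w) ≤
      Real.exp (-(L * w)) * Real.exp (-(L / 2 * w)) := by
    rw [← Real.exp_add, ← Real.exp_add]
    refine Real.exp_le_exp.2 ?_
    nlinarith
  have h2 : Real.exp (-(L / 2 * w)) * √n ≤ 1 := by
    have h3 : Real.exp (-(L / 2 * w)) ^ 2 ≤ 1 / n := by
      rw [← Real.exp_nat_mul]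
      refine le_trans (le_of_eq ?_) hexp
      congr 1; push_cast; ring
    rw [← abs_of_pos (Real.exp_pos (-(L / 2 * w))), ← abs_of_pos hsq, ← abs_mul,
      ← sq_le_one_iff_abs_le_one, mul_pow, Real.sq_sqrt hn.le]
    calc _ ≤ 1 / n * n := by gcongr
      _ = 1 := by field_simp
  calc Real.exp (-(2 * L * w)) * Real.exp (2 * ρ₀ * w) * √n
      ≤ (Real.exp (-(L * w)) * Real.exp (-(L / 2 * w))) * √n := by gcongr
    _ = Real.exp (-(L * w)) * (Real.exp (-(L / 2 * w)) * √n) := by ring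
    _ ≤ 1 / n * 1 := by gcongr
    _ = 1 / n := mul_one _

set_option maxHeartbeats 400000 in
/-- The fraction of the mass near the left well is a Fermi factor, up to small errors. -/
theorem GapModel.fraction_approx {U a : ℝ → ℝ} {y₁ y₂ ρ C : ℝ} (h : GapModel U a y₁ y₂ ρ C)
    {ρ₀ : ℝ} (hρ₀ : 0 < ρ₀) (hle : ρ₀ ≤ ρ) (hsmall : 2 * ρ₀ ≤ 1 / (64 * (2 * C ^ 2)))
    (hL4 : 4 * ρ₀ ≤ y₂ - y₁) :
    ∃ K c : ℝ, 0 < K ∧ 0 < c ∧ ∀ᶠ n : ℕ in atTop, ∀ x : ℝ, |x| ≤ c * n →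
      (|x| ≤ 1 / (y₂ - y₁) * Real.log n →
        |gapFraction U a n y₁ ρ₀ x - fermi (y₂ - y₁) (x - gapShift U a y₁ y₂)| ≤ K * (1 / √(n : ℝ))) ∧
      (1 / (y₂ - y₁) * Real.log n ≤ |x| →
        |gapFraction U a n y₁ ρ₀ x - fermi (y₂ - y₁) (x - gapShift U a y₁ y₂)| ≤ K * (1 / (n : ℝ))) := by
  have hL : 0 < y₂ - y₁ := sub_pos.2 h.lt
  set L := y₂ - y₁ with hLdef
  set δ := gapShift U a y₁ y₂ with hδ
  obtain ⟨K₁, c, hK₁, hc, hrest⟩ := h.rest_bound hρ₀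
  obtain ⟨K₂, hK₂, hleft⟩ := h.left.inv_localIntegral_critical h.left_deriv hρ₀ hle hsmall (1 / L)
  obtain ⟨K₃, hK₃, hright⟩ := h.right.inv_localIntegral_critical h.right_deriv hρ₀ hle hsmall (1 / L)
  obtain ⟨K₄, hK₄, hle₁⟩ := h.localIntegral_le y₁ ρ₀ hρ₀ h.left_eq
  obtain ⟨K₅, hK₅, hle₂⟩ := h.localIntegral_le y₂ ρ₀ hρ₀ h.right_eq
  set A := Real.exp (|a y₂ - a y₁|) with hA
  set D := Real.exp (2 * L * |δ|) with hD
  refine ⟨1 + 2 * (K₂ + K₃) + A * K₅ * K₂ + A * K₄ * K₃ + D, c, by positivity, hc, ?_⟩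
  have hev₁ : ∀ᶠ n : ℕ in atTop, K₃ * (1 / √(n : ℝ)) ≤ 1 / 2 := by
    have := tendsto_one_div_sqrt_nat.const_mul K₃
    rw [mul_zero] at this
    exact this.eventually_le_const (by norm_num)
  have hev₂ := eventually_pow_mul_exp_le (K₁ * K₂) 2 hc
  filter_upwards [hrest, hleft, hright, hev₁, hev₂, eventually_gt_atTop 0]
    with n hrest hleft hright hn1 hn2 hn0 x hx
  have hn' : (0 : ℝ) < n := by exact_mod_cast hn0
  have hn'1 : (1 : ℝ) ≤ n := by exact_mod_cast hn0
  have hsq : 0 < √(n : ℝ) := Real.sqrt_pos.2 hn'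
  have hsqn : √(n : ℝ) * √(n : ℝ) = n := Real.mul_self_sqrt hn'.le
  have hsqle : √(n : ℝ) ≤ n := by
    have : 1 ≤ √(n : ℝ) := by rw [Real.one_le_sqrt]; exact hn'1
    nlinarith
  obtain ⟨hi, hR⟩ := hrest x hx
  obtain ⟨hF₁, hI₁, hg₁⟩ := hleft x
  obtain ⟨hF₂, hI₂, hg₂⟩ := hright x
  have hfr := h.fraction_eq hL4 hρ₀ hi hF₁
  have hE := h.exp_gapShift hn0 x
  have hfermi : fermi L (x - δ) = 1 / (1 + Real.exp (2 * L * (x - δ))) := rfl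
  rw [← hLdef] at hfr hE
  rw [← hδ] at hE
  rw [hfr, hfermi]
  set F₁ := localIntegral U a n y₁ ρ₀ x y₁ with hF₁def
  set F₂ := localIntegral U a n y₂ ρ₀ x y₂ with hF₂def
  set R := ∫ z in (Set.Icc (y₁ - ρ₀) (y₁ + ρ₀) ∪ Set.Icc (y₂ - ρ₀) (y₂ + ρ₀))ᶜ, gapWeight U a n x z
  set ξ := Real.exp (2 * x * L + (a y₂ - a y₁)) with hξ
  set E := Real.exp (2 * L * (x - δ)) with hEdef
  have hw : 0 < gapWeight U a n x y₁ := gapWeight_pos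
  have hR0 : 0 ≤ R := integral_nonneg fun _ => gapWeight_pos.le
  have hξ0 : 0 < ξ := Real.exp_pos _
  have hE0 : 0 < E := Real.exp_pos _
  have hq0 : 0 < ξ * F₂ * (1 / F₁) := by positivity
  have he0 : 0 ≤ R / gapWeight U a n x y₁ * (1 / F₁) := by positivity
  have he : R / gapWeight U a n x y₁ * (1 / F₁) ≤ 1 / n := by
    have h1 : R / gapWeight U a n x y₁ ≤ K₁ * Real.exp (-(c * n)) := by
      rw [div_le_iff₀ hw]; exact hR
    calc R / gapWeight U a n x y₁ * (1 / F₁) ≤ (K₁ * Real.exp (-(c * n))) * (K₂ * n) := by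
          gcongr; exact hI₁.trans (by gcongr)
      _ = (K₁ * K₂ * n ^ 2 * Real.exp (-(c * n))) * (1 / n) := by field_simp
      _ ≤ 1 * (1 / n) := by gcongr
      _ = 1 / n := one_mul _
  obtain ⟨B1, B2, B3⟩ := abs_inv_one_add_add_sub_le hq0 he0 hE0
  obtain ⟨hς₁, -⟩ := laplaceScale_sq hn0 (h.left.U2_pos (y := y₁) (by simp [h.left.rho_pos.le]))
  obtain ⟨hς₂, -⟩ := laplaceScale_sq hn0 (h.right.U2_pos (y := y₂) (by simp [h.right.rho_pos.le]))
  -- The precision is matched to the number of degrees. Near the transition there are about `log n`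
  -- of them, and an error `1 / √n` against a density of order `√n` is affordable. Further away
  -- there are about `√n log n` that matter, and `1 / n` is needed.
  refine ⟨fun hxs => ?_, fun hxl => ?_⟩
  · specialize hg₁ hxs
    specialize hg₂ hxs
    set g₁ := laplaceScale U n y₁ * √Real.pi * (1 / F₁)
    set g₂ := laplaceScale U n y₂ * √Real.pi * (1 / F₂)
    have hg₂' : 1 / 2 ≤ g₂ := by
      have := neg_abs_le (g₂ - 1)
      linarith
    have hpi0 : 0 < √Real.pi := Real.sqrt_pos.2 Real.pi_pos
    have hqE : ξ * F₂ * (1 / F₁) / E = g₁ / g₂ := by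
      rw [hE]; simp only [g₁, g₂]; field_simp
    have hratio : |g₁ / g₂ - 1| ≤ 2 * (K₂ + K₃) * (1 / √n) := by
      have e : g₁ / g₂ - 1 = ((g₁ - 1) - (g₂ - 1)) / g₂ := by
        have : g₂ ≠ 0 := by linarith
        field_simp; ring
      rw [e, abs_div, abs_of_pos (by linarith : 0 < g₂), div_le_iff₀ (by linarith)]
      have h1 := abs_sub (g₁ - 1) (g₂ - 1)
      have h2 : 0 ≤ (K₂ + K₃) * (1 / √n) := by positivity
      nlinarith
    have hnn : 1 / (n : ℝ) ≤ 1 / √n := by gcongr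
    rw [hqE] at B1
    have h3 : 0 ≤ (A * K₅ * K₂ + A * K₄ * K₃ + D) * (1 / √n) := by positivity
    linarith only [B1, he, hratio, hnn, h3]
  · have hexpn : Real.exp (-(L * |x|)) ≤ 1 / n := by
      rw [one_div, ← Real.exp_log (inv_pos.2 hn'), Real.log_inv]
      refine Real.exp_le_exp.2 ?_
      have := mul_le_mul_of_nonneg_left hxl hL.le
      have e : L * (1 / L * Real.log n) = Real.log n := by field_simp
      linarith
    have hlow : ∀ K K', 0 < K → 0 < K' → A * Real.exp (-(2 * L * |x|)) *
        (K * Real.exp (2 * ρ₀ * |x|)) * (K' * √n) ≤ A * K * K' * (1 / n) := by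
      intro K K' hK hK'
      have h1 := exp_mul_exp_mul_sqrt_le hL4 (abs_nonneg x) hn' hexpn
      calc A * Real.exp (-(2 * L * |x|)) * (K * Real.exp (2 * ρ₀ * |x|)) * (K' * √n)
          = A * K * K' * (Real.exp (-(2 * L * |x|)) * Real.exp (2 * ρ₀ * |x|) * √n) := by ring
        _ ≤ A * K * K' * (1 / n) := mul_le_mul_of_nonneg_left h1 (by positivity)
    have hEx : Real.exp (-(2 * L * |x|)) * D ≤ D * (1 / n) := by
      have : Real.exp (-(2 * L * |x|)) ≤ Real.exp (-(L * |x|)) := by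
        refine Real.exp_le_exp.2 ?_
        linarith only [mul_nonneg hL.le (abs_nonneg x)]
      rw [mul_comm]
      exact mul_le_mul_of_nonneg_left (this.trans hexpn) (Real.exp_pos _).le
    have hδ' : L * δ ≤ L * |δ| ∧ -(L * |δ|) ≤ L * δ := by
      rw [← mul_neg]
      exact ⟨mul_le_mul_of_nonneg_left (le_abs_self δ) hL.le,
        mul_le_mul_of_nonneg_left (neg_abs_le δ) hL.le⟩
    have hnn : 0 ≤ 1 / (n : ℝ) := by positivity
    rcases le_total x 0 with hx0 | hx0
    · have hax : |x| = -x := abs_of_nonpos hx0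
      have h1 : ξ ≤ A * Real.exp (-(2 * L * |x|)) := by
        rw [hξ, hA, ← Real.exp_add]
        refine Real.exp_le_exp.2 ?_
        rw [hax]; linarith only [le_abs_self (a y₂ - a y₁)]
      have h2 : ξ * F₂ * (1 / F₁) ≤ A * K₅ * K₂ * (1 / n) :=
        le_trans (by gcongr; exact hle₂ n x) (hlow K₅ K₂ hK₅ hK₂)
      have h3 : E ≤ D * (1 / n) := by
        refine le_trans ?_ hEx
        rw [hEdef, hD, ← Real.exp_add]
        refine Real.exp_le_exp.2 ?_
        rw [hax]; linarith only [hδ'.1, hδ'.2]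
      have h4 : 0 ≤ (2 * (K₂ + K₃) + A * K₄ * K₃) * (1 / n) := by positivity
      linarith only [B2, he, h2, h3, h4]
    · have hax : |x| = x := abs_of_nonneg hx0
      have h1 : 1 / ξ ≤ A * Real.exp (-(2 * L * |x|)) := by
        rw [hξ, hA, ← Real.exp_add, one_div, ← Real.exp_neg]
        refine Real.exp_le_exp.2 ?_
        rw [hax]; linarith only [neg_abs_le (a y₂ - a y₁)]
      have h2 : 1 / (ξ * F₂ * (1 / F₁)) ≤ A * K₄ * K₃ * (1 / n) := by
        have e : 1 / (ξ * F₂ * (1 / F₁)) = (1 / ξ) * F₁ * (1 / F₂) := by field_simp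
        rw [e]
        exact le_trans (by gcongr; exact hle₁ n x) (hlow K₄ K₃ hK₄ hK₃)
      have h3 : 1 / E ≤ D * (1 / n) := by
        refine le_trans ?_ hEx
        rw [hEdef, hD, ← Real.exp_add, one_div, ← Real.exp_neg]
        refine Real.exp_le_exp.2 ?_
        rw [hax]; linarith only [hδ'.1, hδ'.2]
      have h4 : 0 ≤ (2 * (K₂ + K₃) + A * K₅ * K₂) * (1 / n) := by positivity
      linarith only [B3, he, h2, h3, h4]

/-! ### Sums of slowly varying densities against Fermi factors -/

theorem abs_sub_le_of_hasDerivAt {f f' : ℝ → ℝ} {s : Set ℝ} {K : ℝ} (hs : Convex ℝ s)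
    (hf : ∀ x, HasDerivAt f (f' x) x) (hb : ∀ x ∈ s, |f' x| ≤ K) {x y : ℝ} (hx : x ∈ s) (hy : y ∈ s) :
    |f y - f x| ≤ K * |y - x| :=
  hs.norm_image_sub_le_of_norm_hasDerivWithin_le (fun x _ => (hf x).hasDerivWithinAt)
    (fun x hx => hb x hx) hx hy

/-- Error of the midpoint rule on a unit interval. -/
theorem midpoint_rule {Φ f f₁ f₂ : ℝ → ℝ} {K : ℝ} (hΦ : ∀ x, HasDerivAt Φ (f x) x)
    (hf : ∀ x, HasDerivAt f (f₁ x) x) (hf₁ : ∀ x, HasDerivAt f₁ (f₂ x) x) (hK : 0 ≤ K)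
    (hf₂ : ∀ x, |f₂ x| ≤ K) (x : ℝ) : |Φ (x + 1 / 2) - Φ (x - 1 / 2) - f x| ≤ K := by
  have hconv : Convex ℝ (Set.Icc (0 : ℝ) (1 / 2)) := convex_Icc _ _
  have h0 : (0 : ℝ) ∈ Set.Icc (0 : ℝ) (1 / 2) := ⟨le_rfl, by norm_num⟩
  have h1 : (1 / 2 : ℝ) ∈ Set.Icc (0 : ℝ) (1 / 2) := ⟨by norm_num, le_rfl⟩
  have hG : ∀ h, HasDerivAt (fun h => Φ (x + h) - Φ (x - h) - 2 * h * f x)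
      (f (x + h) + f (x - h) - 2 * f x) h := by
    intro h
    have := (((hΦ (x + h)).comp_const_add x h).sub ((hΦ (x - h)).comp_const_sub x h)).sub
      (((hasDerivAt_id h).const_mul 2).mul_const (f x))
    exact this.congr_deriv (by ring)
  have hG1 : ∀ h, HasDerivAt (fun h => f (x + h) + f (x - h) - 2 * f x) (f₁ (x + h) - f₁ (x - h)) h := by
    intro h
    have := (((hf (x + h)).comp_const_add x h).add ((hf (x - h)).comp_const_sub x h)).sub_const (2 * f x)
    exact this.congr_deriv (by ring)
  have hb2 : ∀ h ∈ Set.Icc (0 : ℝ) (1 / 2), |f₁ (x + h) - f₁ (x - h)| ≤ K := by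
    intro h hh
    have := abs_sub_le_of_hasDerivAt convex_univ hf₁ (fun x _ => hf₂ x) (Set.mem_univ (x - h))
      (Set.mem_univ (x + h))
    refine this.trans ?_
    have : |x + h - (x - h)| ≤ 1 := by rw [abs_le]; constructor <;> linarith [hh.1, hh.2]
    nlinarith
  have hb1 : ∀ h ∈ Set.Icc (0 : ℝ) (1 / 2), |f (x + h) + f (x - h) - 2 * f x| ≤ K := by
    intro h hh
    have := abs_sub_le_of_hasDerivAt hconv hG1 hb2 h0 hh
    have e : f (x + 0) + f (x - 0) - 2 * f x = 0 := by simp; ring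
    rw [e, sub_zero, sub_zero] at this
    refine this.trans ?_
    have : |h| ≤ 1 := by rw [abs_le]; constructor <;> linarith [hh.1, hh.2]
    nlinarith
  have := abs_sub_le_of_hasDerivAt hconv hG hb1 h0 h1
  simp only [add_zero, sub_zero, sub_self, mul_zero, zero_mul] at this
  have e : (2 * (1 / 2) * f x) = f x := by ring
  rw [e] at this
  refine this.trans ?_
  rw [abs_of_pos (by norm_num : (0 : ℝ) < 1 / 2)]
  linarith

/-- The unit intervals are centred at the points `i + θ`, hence the shift by `1/2` at both ends.
Each interval costs one bound of the second derivative. -/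
theorem sum_Ico_eq_midpoint {Φ f f₁ f₂ : ℝ → ℝ} {K : ℝ} (hΦ : ∀ x, HasDerivAt Φ (f x) x)
    (hf : ∀ x, HasDerivAt f (f₁ x) x) (hf₁ : ∀ x, HasDerivAt f₁ (f₂ x) x) (hK : 0 ≤ K)
    (hf₂ : ∀ x, |f₂ x| ≤ K) (θ : ℝ) (H : ℕ) :
    |(∑ i ∈ Finset.Ico (-(H : ℤ)) 0, f (i + θ)) - (Φ (θ - 1 / 2) - Φ (θ - 1 / 2 - H))| ≤ K * H := by
  induction H with
  | zero => simp
  | succ H ih =>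
    have hI : Finset.Ico (-((H + 1 : ℕ) : ℤ)) 0 = insert (-((H + 1 : ℕ) : ℤ)) (Finset.Ico (-(H : ℤ)) 0) := by
      ext i; simp only [Finset.mem_Ico, Finset.mem_insert]; push_cast; omega
    rw [hI, Finset.sum_insert (by simp)]
    have h := midpoint_rule hΦ hf hf₁ hK hf₂ (((-((H + 1 : ℕ) : ℤ) : ℤ) : ℝ) + θ)
    have e1 : ((-((H + 1 : ℕ) : ℤ) : ℤ) : ℝ) + θ + 1 / 2 = θ - 1 / 2 - H := by push_cast; ring
    have e2 : ((-((H + 1 : ℕ) : ℤ) : ℤ) : ℝ) + θ - 1 / 2 = θ - 1 / 2 - ((H + 1 : ℕ) : ℝ) := by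
      push_cast; ring
    rw [e1, e2] at h
    rw [abs_le] at h ih ⊢
    push_cast at h ih ⊢
    constructor <;> linarith [h.1, h.2, ih.1, ih.2]

/-- Half of the exponential decay pays for the linear weight, which stems from a Lipschitz bound.
The condition `0 ≤ θ < 1` makes `i + θ < 0` equivalent to `i < 0`. -/
theorem fermi_weight_le {L : ℝ} (hL : 0 < L) (δ : ℝ) {θ : ℝ} (hθ0 : 0 ≤ θ) (hθ1 : θ < 1) (i : ℤ) :
    |(i : ℝ) + θ| * |fermi L (i + θ - δ) - if i < 0 then 1 else 0| ≤
      Real.exp (2 * L * |δ|) * (1 / L * Real.exp L) * Real.exp (-(L * |(i : ℝ)|)) := by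
  have h := abs_fermi_sub_le hL (i + θ) δ
  have hiff : ((i : ℝ) + θ < 0) ↔ i < 0 := by
    constructor
    · intro h
      have : (i : ℝ) < 0 := by linarith
      exact_mod_cast this
    · intro h
      have : (i : ℝ) ≤ -1 := by exact_mod_cast (by omega : i ≤ -1)
      linarith
  simp only [hiff] at h
  have h1 : |(i : ℝ) + θ| ≤ 1 / L * Real.exp (L * |(i : ℝ) + θ|) := by
    have := Real.add_one_le_exp (L * |(i : ℝ) + θ|)
    rw [one_div_mul_eq_div, le_div_iff₀ hL]; linarith
  have h2 : Real.exp (-(L * |(i : ℝ) + θ|)) ≤ Real.exp L * Real.exp (-(L * |(i : ℝ)|)) := by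
    rw [← Real.exp_add]
    refine Real.exp_le_exp.2 ?_
    have h3 : |(i : ℝ)| ≤ |(i : ℝ) + θ| + 1 := by
      have := abs_sub ((i : ℝ) + θ) θ
      rw [add_sub_cancel_right, abs_of_nonneg hθ0] at this
      linarith
    nlinarith
  calc |(i : ℝ) + θ| * |fermi L (i + θ - δ) - if i < 0 then 1 else 0|
      ≤ (1 / L * Real.exp (L * |(i : ℝ) + θ|)) *
        (Real.exp (2 * L * |δ|) * Real.exp (-(2 * L * |(i : ℝ) + θ|))) := by gcongr
    _ = Real.exp (2 * L * |δ|) * (1 / L) * (Real.exp (-(L * |(i : ℝ) + θ|))) := by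
      have : Real.exp (-(L * |(i : ℝ) + θ|)) =
          Real.exp (L * |(i : ℝ) + θ|) * Real.exp (-(2 * L * |(i : ℝ) + θ|)) := by
        rw [← Real.exp_add]; congr 1; ring
      rw [this]; ring
    _ ≤ Real.exp (2 * L * |δ|) * (1 / L) * (Real.exp L * Real.exp (-(L * |(i : ℝ)|))) := by gcongr
    _ = _ := by ring

/-- The sum of a slowly varying density against Fermi factors. -/
theorem exists_fermi_sum_bound {L : ℝ} (hL : 0 < L) (δ : ℝ) {K : ℝ} (hK : 0 < K) :
    ∃ K' : ℝ, 0 < K' ∧ ∀ (ς θ : ℝ) (H : ℕ) (Φ f f₁ f₂ : ℝ → ℝ), 0 < ς → 0 ≤ θ → θ < 1 →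
      1 / ς ≤ (H : ℝ) - 1 →
      (∀ x, HasDerivAt Φ (f x) x) → (∀ x, HasDerivAt f (f₁ x) x) → (∀ x, HasDerivAt f₁ (f₂ x) x) →
      (∀ x, |f x| ≤ K / ς) → (∀ x, |f₁ x| ≤ K) → (∀ x, |f₂ x| ≤ K * ς) →
      |(∑ i ∈ Finset.Ico (-(H : ℤ)) H, f (i + θ) * fermi L (i + θ - δ)) -
        (Φ 0 - Φ (θ - 1 / 2 - H) +
          f 0 * (δ + 1 / (2 * L) * logTheta' (δ - θ + 1 / 2) (Real.pi / L)))| ≤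
        K' * (1 + ς * H) := by
  set B := Real.exp (2 * L * |δ|) * (1 / L * Real.exp L) with hB
  set S := ∑' i : ℤ, Real.exp (-(L * |(i : ℝ)|)) with hS
  have hsum := summable_exp_neg_abs_int hL
  have hS0 : 0 ≤ S := tsum_nonneg fun _ => (Real.exp_pos _).le
  refine ⟨K * B * S + 2 * K, by positivity, ?_⟩
  intro ς θ H Φ f f₁ f₂ hς hθ0 hθ1 hH hΦ hf hf₁ hfb hf₁b hf₂b
  set g : ℤ → ℝ := fun i => fermi L (i + θ - δ) - if i < 0 then 1 else 0 with hg
  have hshift : ∀ i : ℤ, (i : ℝ) + θ - δ = i - (δ - θ) := fun i => by ring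
  have hlip : ∀ x, |f x - f 0| ≤ K * |x| := by
    intro x
    simpa using abs_sub_le_of_hasDerivAt convex_univ hf (fun x _ => hf₁b x) (Set.mem_univ 0)
      (Set.mem_univ x)
  have hgs : Summable g := by
    have := summable_fermi hL (δ - θ)
    simp only [hg, hshift]
    refine this.congr fun i => ?_
    simp
  have htsum : ∑' i, g i = δ - θ + 1 / 2 + 1 / (2 * L) * logTheta' (δ - θ + 1 / 2) (Real.pi / L) := by
    have := tsum_fermi hL (δ - θ) 0
    simp only [hg, hshift]
    rw [Int.cast_zero, add_zero] at this
    exact this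
  set W := Finset.Ico (-(H : ℤ)) H with hW
  -- Replacing the density by zero outside of the window keeps the Lipschitz estimate at `0`, since
  -- `|f 0| ≤ K / ς ≤ K (H - 1) ≤ K |i + θ|` there. The Fermi sum may thus run over all integers.
  set hh : ℤ → ℝ := fun i => if i ∈ W then f (i + θ) else 0 with hhh
  have hhb : ∀ i, |hh i - f 0| ≤ K * |(i : ℝ) + θ| := by
    intro i
    by_cases hi : i ∈ W
    · simp only [hhh, if_pos hi]; exact hlip _
    · simp only [hhh, if_neg hi, zero_sub, abs_neg]
      refine (hfb 0).trans ?_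
      rw [div_eq_mul_one_div]
      gcongr
      refine hH.trans ?_
      rw [hW, Finset.mem_Ico, not_and_or, not_le, not_lt] at hi
      rcases hi with hi | hi
      · have : (i : ℝ) ≤ -(H : ℝ) - 1 := by exact_mod_cast (by omega : i ≤ -(H : ℤ) - 1)
        refine le_trans ?_ (neg_le_abs _)
        linarith
      · have : (H : ℝ) ≤ i := by exact_mod_cast hi
        refine le_trans ?_ (le_abs_self _)
        linarith
  have hterm : ∀ i, ‖(hh i - f 0) * g i‖ ≤ K * B * Real.exp (-(L * |(i : ℝ)|)) := by
    intro i
    rw [Real.norm_eq_abs, abs_mul]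
    calc |hh i - f 0| * |g i| ≤ K * |(i : ℝ) + θ| * |g i| := by gcongr; exact hhb i
      _ = K * (|(i : ℝ) + θ| * |g i|) := by ring
      _ ≤ K * (B * Real.exp (-(L * |(i : ℝ)|))) :=
        mul_le_mul_of_nonneg_left (fermi_weight_le hL δ hθ0 hθ1 i) hK.le
      _ = _ := by ring
  have hdom : Summable fun i : ℤ => K * B * Real.exp (-(L * |(i : ℝ)|)) := hsum.mul_left _
  have hsd : Summable fun i => (hh i - f 0) * g i := Summable.of_norm_bounded hdom hterm
  have hs1 : |∑' i, (hh i - f 0) * g i| ≤ K * B * S := by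
    have h1 := tsum_of_norm_bounded (f := fun i => (hh i - f 0) * g i) hdom.hasSum hterm
    rwa [tsum_mul_left] at h1
  have hhg : ∑' i, hh i * g i = ∑ i ∈ W, f (i + θ) * g i := by
    rw [tsum_eq_sum (s := W) (fun i hi => by simp only [hhh, if_neg hi, zero_mul])]
    exact Finset.sum_congr rfl fun i hi => by simp only [hhh, if_pos hi]
  have hsplit : ∑' i, (hh i - f 0) * g i = (∑ i ∈ W, f (i + θ) * g i) - f 0 * ∑' i, g i := by
    have hs2 : Summable fun i => f 0 * g i := hgs.mul_left _
    have hs3 : Summable fun i => hh i * g i := by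
      refine (hsd.add hs2).congr fun i => ?_
      ring
    rw [← hhg, ← tsum_mul_left, ← hs3.tsum_sub hs2]
    exact tsum_congr fun i => by ring
  have hsplit2 : ∑ i ∈ W, f (i + θ) * fermi L (i + θ - δ) =
      (∑ i ∈ W, f (i + θ) * g i) + ∑ i ∈ Finset.Ico (-(H : ℤ)) 0, f (i + θ) := by
    have hsub : Finset.Ico (-(H : ℤ)) 0 = W.filter (· < 0) := by
      ext i; simp only [hW, Finset.mem_filter, Finset.mem_Ico]; omega
    rw [hsub, Finset.sum_filter, ← Finset.sum_add_distrib]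
    refine Finset.sum_congr rfl fun i _ => ?_
    simp only [hg]
    split_ifs <;> ring
  have hmid := sum_Ico_eq_midpoint hΦ hf hf₁ (by positivity) hf₂b θ H
  -- The term `f 0 (θ - 1/2)` cancels against the summand `δ - θ + 1/2` of the Fermi sum, leaving `f
  -- 0 δ`. Apart from the lower end of the window, `θ` survives only inside the theta function.
  have htay : |Φ (θ - 1 / 2) - Φ 0 - f 0 * (θ - 1 / 2)| ≤ K := by
    have hG : ∀ x, HasDerivAt (fun x => Φ x - f 0 * x) (f x - f 0) x := by
      intro x
      have := (hΦ x).sub ((hasDerivAt_id x).const_mul (f 0))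
      exact this.congr_deriv (by ring)
    have := abs_sub_le_of_hasDerivAt (convex_Icc (-1 : ℝ) 1) (K := K) hG (fun x hx => (hlip x).trans (by
      have : |x| ≤ 1 := abs_le.2 hx
      nlinarith)) (x := 0) (y := θ - 1 / 2) (by simp) ⟨by linarith, by linarith⟩
    have h2 : |θ - 1 / 2 - 0| ≤ 1 := by rw [abs_le]; constructor <;> linarith
    have e : Φ (θ - 1 / 2) - f 0 * (θ - 1 / 2) - (Φ 0 - f 0 * 0) =
      Φ (θ - 1 / 2) - Φ 0 - f 0 * (θ - 1 / 2) := by ring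
    rw [e] at this
    nlinarith
  rw [hsplit2]
  rw [hsplit, htsum] at hs1
  have hpos : 0 ≤ (K * B * S + K) * (ς * H) := by positivity
  rw [abs_le] at hs1 hmid htay ⊢
  constructor <;> linarith [hs1.1, hs1.2, hmid.1, hmid.2, htay.1, htay.2]

/-! ### The error function and the corrected Gaussian -/

theorem integrable_exp_neg_sq : Integrable fun x : ℝ => Real.exp (-x ^ 2) := by
  simpa using integrable_exp_neg_mul_sq (b := 1) one_pos

theorem integral_Ioi_exp_neg_sq : ∫ x in Set.Ioi (0 : ℝ), Real.exp (-x ^ 2) = √Real.pi / 2 := by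
  simpa using integral_gaussian_Ioi 1

theorem erfc_nonneg (t : ℝ) : 0 ≤ erfc t :=
  mul_nonneg (by positivity) (integral_nonneg fun _ => (Real.exp_pos _).le)

theorem hasDerivAt_erfc (t : ℝ) :
    HasDerivAt erfc (-(2 / √Real.pi * Real.exp (-t ^ 2))) t := by
  have hc : Continuous fun x : ℝ => Real.exp (-x ^ 2) := by fun_prop
  have h1 : ∀ s, erfc s = 2 / √Real.pi * ((∫ x in Set.Ioi (0 : ℝ), Real.exp (-x ^ 2)) -
      ∫ x in (0 : ℝ)..s, Real.exp (-x ^ 2)) := by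
    intro s
    have := intervalIntegral.integral_Ioi_sub_Ioi' (μ := volume) (a := 0) (b := s)
      integrable_exp_neg_sq.integrableOn integrable_exp_neg_sq.integrableOn
    rw [erfc, ← this]; ring
  have h2 : HasDerivAt (fun s => ∫ x in (0 : ℝ)..s, Real.exp (-x ^ 2)) (Real.exp (-t ^ 2)) t :=
    intervalIntegral.integral_hasDerivAt_right (hc.intervalIntegrable _ _)
      hc.aestronglyMeasurable.stronglyMeasurableAtFilter hc.continuousAt
  rw [show erfc = _ from funext h1]
  exact ((h2.const_sub _).const_mul (2 / √Real.pi)).congr_deriv (by ring)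

/-- After a shift to the half-line the cross term in `(x + t)² ≥ x² + t²` is dropped. -/
theorem erfc_le_exp {t : ℝ} (ht : 0 ≤ t) : erfc t ≤ Real.exp (-t ^ 2) := by
  have h1 : ∫ x in Set.Ioi t, Real.exp (-x ^ 2) =
      ∫ x in Set.Ioi (0 : ℝ), Real.exp (-(x + t) ^ 2) := by
    have h := (measurePreserving_add_right volume t).setIntegral_preimage_emb
      (measurableEmbedding_addRight t) (fun x : ℝ => Real.exp (-x ^ 2)) (Set.Ioi t)
    rw [← h]; simp
  have h2 : ∫ x in Set.Ioi (0 : ℝ), Real.exp (-(x + t) ^ 2) ≤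
      ∫ x in Set.Ioi (0 : ℝ), Real.exp (-t ^ 2) * Real.exp (-x ^ 2) := by
    refine setIntegral_mono_on (integrable_exp_neg_sq.comp_add_right t).integrableOn
      (integrable_exp_neg_sq.const_mul _).integrableOn measurableSet_Ioi fun x hx => ?_
    rw [← Real.exp_add]
    refine Real.exp_le_exp.2 ?_
    nlinarith [mul_nonneg ht (Set.mem_Ioi.1 hx).le]
  rw [integral_const_mul, integral_Ioi_exp_neg_sq] at h2
  have hpi : 0 < √Real.pi := Real.sqrt_pos.2 Real.pi_pos
  rw [erfc, h1]
  calc 2 / √Real.pi * ∫ x in Set.Ioi (0 : ℝ), Real.exp (-(x + t) ^ 2)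
      ≤ 2 / √Real.pi * (Real.exp (-t ^ 2) * (√Real.pi / 2)) := by gcongr
    _ = Real.exp (-t ^ 2) := by field_simp

/-- A Gaussian of mean `μ` and width `ς`, with a first order correction. -/
noncomputable def gaussDensity (ς μ β c x : ℝ) : ℝ :=
  1 / (ς * √Real.pi) * Real.exp (-(ς * (x - μ)) ^ 2) * (1 - ς * laplacePoly β c (ς * (x - μ)))

noncomputable def gaussDensityDeriv (ς μ β c x : ℝ) : ℝ :=
  1 / √Real.pi * (Real.exp (-(ς * (x - μ)) ^ 2) *
    (-ς * (β - c * (3 * (ς * (x - μ)) ^ 2 + 3 / 2)) -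
      2 * (ς * (x - μ)) * (1 - ς * laplacePoly β c (ς * (x - μ)))))

noncomputable def gaussDensityDeriv2 (ς μ β c x : ℝ) : ℝ :=
  ς / √Real.pi * (Real.exp (-(ς * (x - μ)) ^ 2) *
    (6 * ς * c * (ς * (x - μ)) + 4 * ς * (ς * (x - μ)) * (β - c * (3 * (ς * (x - μ)) ^ 2 + 3 / 2)) +
      (4 * (ς * (x - μ)) ^ 2 - 2) * (1 - ς * laplacePoly β c (ς * (x - μ)))))

/-- A primitive of `gaussDensity`. -/
noncomputable def gaussPrimitive (ς μ β c x : ℝ) : ℝ :=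
  1 / ς ^ 2 * (erfc (-(ς * (x - μ))) / 2) + 1 / (2 * ς * √Real.pi) *
    (Real.exp (-(ς * (x - μ)) ^ 2) * (β - c * ((ς * (x - μ)) ^ 2 + 5 / 2)))

theorem hasDerivAt_scaled (ς μ x : ℝ) : HasDerivAt (fun x => ς * (x - μ)) ς x := by
  simpa using ((hasDerivAt_id x).sub_const μ).const_mul ς

theorem hasDerivAt_exp_neg_sq (η : ℝ) :
    HasDerivAt (fun η => Real.exp (-η ^ 2)) (Real.exp (-η ^ 2) * (-(2 * η))) η := by
  have := ((hasDerivAt_pow 2 η).neg).exp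
  simpa using this

/-- The correction integrates in closed form: the derivative of `e^{-η²} (β - c (η² + 5/2))` is `-2
e^{-η²}` times `laplacePoly`, which fixes the constant `5/2`. -/
theorem hasDerivAt_gaussPrimitive {ς : ℝ} (hς : 0 < ς) (μ β c x : ℝ) :
    HasDerivAt (gaussPrimitive ς μ β c) (gaussDensity ς μ β c x) x := by
  have hpi : 0 < √Real.pi := Real.sqrt_pos.2 Real.pi_pos
  have h : ∀ η, HasDerivAt (fun η => 1 / ς ^ 2 * (erfc (-η) / 2) + 1 / (2 * ς * √Real.pi) *
      (Real.exp (-η ^ 2) * (β - c * (η ^ 2 + 5 / 2))))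
      (1 / ς ^ 2 * (1 / √Real.pi * Real.exp (-η ^ 2)) + 1 / (2 * ς * √Real.pi) *
        (Real.exp (-η ^ 2) * (-(2 * η)) * (β - c * (η ^ 2 + 5 / 2)) +
          Real.exp (-η ^ 2) * (-(c * (2 * η))))) η := by
    intro η
    have h1 : HasDerivAt (fun η => erfc (-η)) (2 / √Real.pi * Real.exp (-η ^ 2)) η := by
      have := (hasDerivAt_erfc (-η)).comp η (hasDerivAt_neg η)
      exact this.congr_deriv (by rw [neg_sq]; ring)
    have h2 : HasDerivAt (fun η : ℝ => β - c * (η ^ 2 + 5 / 2)) (-(c * (2 * η))) η := by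
      have := (((hasDerivAt_pow 2 η).add_const (5 / 2)).const_mul c).const_sub β
      exact this.congr_deriv (by simp)
    exact (((h1.div_const 2).const_mul (1 / ς ^ 2)).add
      (((hasDerivAt_exp_neg_sq η).mul h2).const_mul (1 / (2 * ς * √Real.pi)))).congr_deriv (by ring)
  have := (h (ς * (x - μ))).comp x (hasDerivAt_scaled ς μ x)
  refine this.congr_deriv ?_
  rw [gaussDensity, laplacePoly]
  field_simp
  ring

theorem hasDerivAt_laplacePoly (β c η : ℝ) :
    HasDerivAt (laplacePoly β c) (β - c * (3 * η ^ 2 + 3 / 2)) η := by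
  have := ((hasDerivAt_id η).const_mul β).sub
    (((hasDerivAt_pow 3 η).add ((hasDerivAt_id η).const_mul (3 / 2))).const_mul c)
  exact this.congr_deriv (by simp)

theorem hasDerivAt_gaussDensity {ς : ℝ} (hς : 0 < ς) (μ β c x : ℝ) :
    HasDerivAt (gaussDensity ς μ β c) (gaussDensityDeriv ς μ β c x) x := by
  have h : ∀ η, HasDerivAt (fun η => 1 / (ς * √Real.pi) * Real.exp (-η ^ 2) *
      (1 - ς * laplacePoly β c η)) (1 / (ς * √Real.pi) * (Real.exp (-η ^ 2) * (-(2 * η))) *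
      (1 - ς * laplacePoly β c η) + 1 / (ς * √Real.pi) * Real.exp (-η ^ 2) *
        (-(ς * (β - c * (3 * η ^ 2 + 3 / 2))))) η := fun η =>
    ((hasDerivAt_exp_neg_sq η).const_mul _).mul
      (((hasDerivAt_laplacePoly β c η).const_mul ς).const_sub 1)
  have := (h (ς * (x - μ))).comp x (hasDerivAt_scaled ς μ x)
  refine this.congr_deriv ?_
  rw [gaussDensityDeriv]
  field_simp
  ring

theorem hasDerivAt_gaussDensityDeriv {ς : ℝ} (hς : 0 < ς) (μ β c x : ℝ) :
    HasDerivAt (gaussDensityDeriv ς μ β c) (gaussDensityDeriv2 ς μ β c x) x := by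
  have h : ∀ η, HasDerivAt (fun η => 1 / √Real.pi * (Real.exp (-η ^ 2) *
      (-ς * (β - c * (3 * η ^ 2 + 3 / 2)) - 2 * η * (1 - ς * laplacePoly β c η))))
      (1 / √Real.pi * (Real.exp (-η ^ 2) * (-(2 * η)) *
      (-ς * (β - c * (3 * η ^ 2 + 3 / 2)) - 2 * η * (1 - ς * laplacePoly β c η)) +
      Real.exp (-η ^ 2) * (-ς * (-(c * (6 * η))) - (2 * (1 - ς * laplacePoly β c η) +
        2 * η * (-(ς * (β - c * (3 * η ^ 2 + 3 / 2)))))))) η := by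
    intro η
    have h1 : HasDerivAt (fun η : ℝ => -ς * (β - c * (3 * η ^ 2 + 3 / 2))) (-ς * (-(c * (6 * η)))) η := by
      have := ((((((hasDerivAt_pow 2 η).const_mul 3).add_const (3 / 2)).const_mul c).const_sub β).const_mul (-ς))
      exact this.congr_deriv (by push_cast; ring)
    have h2 : HasDerivAt (fun η : ℝ => 2 * η * (1 - ς * laplacePoly β c η))
        (2 * (1 - ς * laplacePoly β c η) + 2 * η * (-(ς * (β - c * (3 * η ^ 2 + 3 / 2))))) η := by
      have := ((hasDerivAt_id η).const_mul 2).mul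
        (((hasDerivAt_laplacePoly β c η).const_mul ς).const_sub 1)
      exact this.congr_deriv (by simp)
    exact ((hasDerivAt_exp_neg_sq η).mul (h1.sub h2)).const_mul (1 / √Real.pi)
  have := (h (ς * (x - μ))).comp x (hasDerivAt_scaled ς μ x)
  refine this.congr_deriv ?_
  rw [gaussDensityDeriv2]
  field_simp
  ring

theorem abs_laplacePoly_le_pow {C β c η : ℝ} (hC : 0 ≤ C) (hβ : |β| ≤ C) (hc : |c| ≤ C) :
    |laplacePoly β c η| ≤ 4 * C * (1 + |η|) ^ 3 := by
  have hu : 0 ≤ |η| := abs_nonneg η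
  have h1 : |η| ≤ (1 + |η|) ^ 3 := by nlinarith [pow_nonneg hu 2, pow_nonneg hu 3]
  have h2 : |η| ^ 3 + 3 / 2 * |η| ≤ 3 * (1 + |η|) ^ 3 := by nlinarith [pow_nonneg hu 2, pow_nonneg hu 3]
  calc |laplacePoly β c η| ≤ |β * η| + |c * (η ^ 3 + 3 / 2 * η)| := abs_sub _ _
    _ ≤ |β| * |η| + |c| * (|η| ^ 3 + 3 / 2 * |η|) := by
      rw [abs_mul, abs_mul]
      gcongr
      refine (abs_add_le _ _).trans (le_of_eq ?_)
      rw [abs_pow, abs_mul, abs_of_pos (by norm_num : (0 : ℝ) < 3 / 2)]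
    _ ≤ C * (1 + |η|) ^ 3 + C * (3 * (1 + |η|) ^ 3) := by gcongr
    _ = _ := by ring

theorem exp_neg_sq_mul_le (k : ℕ) : ∃ K : ℝ, 0 < K ∧
    ∀ η : ℝ, Real.exp (-η ^ 2) * (1 + |η|) ^ k ≤ K ∧
      Real.exp (-η ^ 2) * (1 + |η|) ^ k ≤ K * Real.exp (-η ^ 2 / 2) := by
  obtain ⟨K, hK, h⟩ := one_add_abs_pow_le_exp_sq k (κ := 1 / 2) (by norm_num)
  have h2 : ∀ η : ℝ, Real.exp (-η ^ 2) * (1 + |η|) ^ k ≤ K * Real.exp (-η ^ 2 / 2) := by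
    intro η
    calc Real.exp (-η ^ 2) * (1 + |η|) ^ k ≤ Real.exp (-η ^ 2) * (K * Real.exp (1 / 2 * η ^ 2)) := by
          gcongr; exact h η
      _ = K * (Real.exp (-η ^ 2) * Real.exp (1 / 2 * η ^ 2)) := by ring
      _ = _ := by rw [← Real.exp_add]; ring_nf
  refine ⟨K, hK, fun η => ⟨(h2 η).trans ?_, h2 η⟩⟩
  have : Real.exp (-η ^ 2 / 2) ≤ 1 := Real.exp_le_one_iff.2 (by nlinarith [sq_nonneg η])
  nlinarith

/-- Uniform bounds for the corrected Gaussian density and its derivatives. -/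
theorem exists_gaussDensity_bound {C : ℝ} (hC : 0 ≤ C) : ∃ K : ℝ, 0 < K ∧ ∀ ς μ β c : ℝ, 0 < ς →
    ς ≤ 1 → |β| ≤ C → |c| ≤ C → ∀ x,
      |gaussDensity ς μ β c x| ≤ K / ς ∧ |gaussDensityDeriv ς μ β c x| ≤ K ∧
      |gaussDensityDeriv2 ς μ β c x| ≤ K * ς := by
  obtain ⟨K, hK, h⟩ := exp_neg_sq_mul_le 5
  refine ⟨(6 + 60 * C) * K, by positivity, ?_⟩
  intro ς μ β c hς hς1 hβ hc x
  have hpi : 1 ≤ √Real.pi := by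
    rw [Real.one_le_sqrt]; linarith [Real.pi_gt_three]
  rw [gaussDensity, gaussDensityDeriv, gaussDensityDeriv2]
  set η := ς * (x - μ)
  have hP := abs_laplacePoly_le_pow (η := η) hC hβ hc
  have hη := (h η).1
  set P := laplacePoly β c η
  set w := 1 + |η| with hw
  have hw1 : 1 ≤ w := by linarith [abs_nonneg η]
  have hηw : |η| ≤ w := by linarith
  have hE : 0 < Real.exp (-η ^ 2) := Real.exp_pos _
  have hw35 : w ^ 3 ≤ w ^ 5 := pow_le_pow_right₀ hw1 (by norm_num)
  have hw2 : 1 ≤ w ^ 2 := one_le_pow₀ hw1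
  have hg : |1 - ς * P| ≤ (1 + 4 * C) * w ^ 3 := by
    calc |1 - ς * P| ≤ |1| + |ς * P| := abs_sub _ _
      _ ≤ w ^ 3 + 1 * (4 * C * w ^ 3) := by
        rw [abs_one, abs_mul, abs_of_pos hς]
        gcongr
        exact one_le_pow₀ hw1
      _ = _ := by ring
  have hP1 : |β - c * (3 * η ^ 2 + 3 / 2)| ≤ 6 * C * w ^ 2 := by
    have h1 : 3 * η ^ 2 + 3 / 2 ≤ 5 * w ^ 2 := by
      have : η ^ 2 ≤ w ^ 2 := by rw [← sq_abs η]; gcongr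
      linarith
    calc |β - c * (3 * η ^ 2 + 3 / 2)| ≤ |β| + |c * (3 * η ^ 2 + 3 / 2)| := abs_sub _ _
      _ ≤ C * w ^ 2 + C * (5 * w ^ 2) := by
        rw [abs_mul, abs_of_pos (by positivity : 0 < 3 * η ^ 2 + 3 / 2)]
        gcongr
        nlinarith
      _ = _ := by ring
  have hKey : ∀ B : ℝ, |B| ≤ (6 + 60 * C) * w ^ 5 →
      |Real.exp (-η ^ 2) * B| ≤ (6 + 60 * C) * K := by
    intro B hB
    rw [abs_mul, abs_of_pos hE]
    calc Real.exp (-η ^ 2) * |B| ≤ Real.exp (-η ^ 2) * ((6 + 60 * C) * w ^ 5) := by gcongr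
      _ = (6 + 60 * C) * (Real.exp (-η ^ 2) * w ^ 5) := by ring
      _ ≤ _ := by gcongr
  have hinv : 1 / √Real.pi ≤ 1 := by rw [div_le_one (by linarith)]; exact hpi
  have hCw : 0 ≤ C * w ^ 5 := by positivity
  have hw5 : 0 ≤ w ^ 5 := by positivity
  refine ⟨?_, ?_, ?_⟩
  · have h1 := hKey (1 - ς * P) (hg.trans (by nlinarith))
    rw [mul_assoc, abs_mul, abs_of_pos (by positivity : 0 < 1 / (ς * √Real.pi))]
    calc 1 / (ς * √Real.pi) * |Real.exp (-η ^ 2) * (1 - ς * P)| ≤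
          1 / (ς * 1) * ((6 + 60 * C) * K) := by gcongr
      _ = _ := by field_simp
  · have h1 := hKey (-ς * (β - c * (3 * η ^ 2 + 3 / 2)) - 2 * η * (1 - ς * P)) (by
      calc |-ς * (β - c * (3 * η ^ 2 + 3 / 2)) - 2 * η * (1 - ς * P)|
          ≤ |-ς * (β - c * (3 * η ^ 2 + 3 / 2))| + |2 * η * (1 - ς * P)| := abs_sub _ _
        _ = ς * |β - c * (3 * η ^ 2 + 3 / 2)| + 2 * |η| * |1 - ς * P| := by
          rw [abs_mul, abs_neg, abs_of_pos hς, abs_mul, abs_mul, abs_two]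
        _ ≤ 1 * (6 * C * w ^ 2) + 2 * w * ((1 + 4 * C) * w ^ 3) := by gcongr
        _ ≤ 1 * (6 * C * w ^ 5) + 2 * ((1 + 4 * C) * w ^ 5) := by
          have e2 : w ^ 2 ≤ w ^ 5 := pow_le_pow_right₀ hw1 (by norm_num)
          have e4 : w * w ^ 3 ≤ w ^ 5 := by
            rw [← pow_succ']; exact pow_le_pow_right₀ hw1 (by norm_num)
          have : 2 * w * ((1 + 4 * C) * w ^ 3) = 2 * ((1 + 4 * C) * (w * w ^ 3)) := by ring
          rw [this]; gcongr
        _ ≤ _ := by linarith)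
    rw [abs_mul, abs_of_pos (by positivity : 0 < 1 / √Real.pi)]
    have := mul_le_mul hinv h1 (abs_nonneg _) zero_le_one
    linarith
  · have h1 := hKey (6 * ς * c * η + 4 * ς * η * (β - c * (3 * η ^ 2 + 3 / 2)) +
        (4 * η ^ 2 - 2) * (1 - ς * P)) (by
      have hA : |6 * ς * c * η| ≤ 6 * C * w ^ 5 := by
        have e1 : w ≤ w ^ 5 := le_self_pow₀ hw1 (by norm_num)
        rw [abs_mul, abs_mul, abs_mul, abs_of_pos hς, abs_of_pos (by norm_num : (0 : ℝ) < 6)]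
        calc 6 * ς * |c| * |η| ≤ 6 * 1 * C * w ^ 5 := by gcongr; exact hηw.trans e1
          _ = _ := by ring
      have hB : |4 * ς * η * (β - c * (3 * η ^ 2 + 3 / 2))| ≤ 24 * C * w ^ 5 := by
        rw [abs_mul, abs_mul, abs_mul, abs_of_pos hς, abs_of_pos (by norm_num : (0 : ℝ) < 4)]
        calc 4 * ς * |η| * |β - c * (3 * η ^ 2 + 3 / 2)| ≤ 4 * 1 * w * (6 * C * w ^ 2) := by gcongr
          _ = 24 * C * w ^ 3 := by ring
          _ ≤ _ := by gcongr
      have hD : |(4 * η ^ 2 - 2) * (1 - ς * P)| ≤ 4 * ((1 + 4 * C) * w ^ 5) := by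
        have e : |4 * η ^ 2 - 2| ≤ 4 * w ^ 2 := by
          have : η ^ 2 ≤ w ^ 2 := by rw [← sq_abs η]; gcongr
          rw [abs_le]; constructor <;> nlinarith [sq_nonneg η]
        rw [abs_mul]
        calc |4 * η ^ 2 - 2| * |1 - ς * P| ≤ 4 * w ^ 2 * ((1 + 4 * C) * w ^ 3) := by gcongr
          _ = _ := by ring
      refine (abs_add_le _ _).trans ((add_le_add ((abs_add_le _ _).trans (add_le_add hA hB)) hD).trans ?_)
      linarith)
    rw [abs_mul, abs_of_pos (by positivity : 0 < ς / √Real.pi)]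
    have e : ς / √Real.pi ≤ ς := div_le_self hς.le hpi
    have := mul_le_mul e h1 (abs_nonneg _) hς.le
    linarith

/-- For the lower end of the summation window. The primitive carries the factor `1 / ς²`, which the
tail bound `e^{-η²} ≤ ς^4` compensates. -/
theorem exists_gaussPrimitive_bound {C : ℝ} (hC : 0 ≤ C) : ∃ K : ℝ, 0 < K ∧ ∀ ς μ β c : ℝ, 0 < ς →
    ς ≤ 1 → |β| ≤ C → |c| ≤ C → ∀ x, x ≤ μ → 1 ≤ Real.exp ((ς * (x - μ)) ^ 2) * ς ^ 4 →
      |gaussPrimitive ς μ β c x| ≤ K := by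
  obtain ⟨K, hK, h⟩ := exp_neg_sq_mul_le 2
  refine ⟨1 + 5 * C * K, by positivity, ?_⟩
  intro ς μ β c hς hς1 hβ hc x hx hfar
  have hpi : 1 ≤ √Real.pi := by
    rw [Real.one_le_sqrt]; linarith [Real.pi_gt_three]
  have hη0 : 0 ≤ -(ς * (x - μ)) := by nlinarith
  rw [gaussPrimitive]
  set η := ς * (x - μ)
  have he : Real.exp (-η ^ 2) ≤ ς ^ 4 := by
    rw [Real.exp_neg, inv_le_iff_one_le_mul₀ (Real.exp_pos _), mul_comm]; exact hfar
  have he2 : Real.exp (-η ^ 2 / 2) ≤ ς ^ 2 := by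
    refine le_of_sq_le_sq ?_ (by positivity)
    rw [← Real.exp_nat_mul, ← pow_mul]
    refine le_trans (le_of_eq ?_) he
    congr 1; push_cast; ring
  have h1 := erfc_le_exp hη0
  rw [neg_sq] at h1
  have h2 := erfc_nonneg (-η)
  have hA : |1 / ς ^ 2 * (erfc (-η) / 2)| ≤ 1 := by
    rw [abs_of_nonneg (by positivity)]
    calc 1 / ς ^ 2 * (erfc (-η) / 2) ≤ 1 / ς ^ 2 * ς ^ 4 := by gcongr; linarith
      _ = ς ^ 2 := by field_simp
      _ ≤ 1 := pow_le_one₀ hς.le hς1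
  have hB : |β - c * (η ^ 2 + 5 / 2)| ≤ 5 * C * (1 + |η|) ^ 2 := by
    have hu := abs_nonneg η
    have h3 : η ^ 2 + 5 / 2 ≤ 4 * (1 + |η|) ^ 2 := by nlinarith [sq_abs η]
    calc |β - c * (η ^ 2 + 5 / 2)| ≤ |β| + |c * (η ^ 2 + 5 / 2)| := abs_sub _ _
      _ ≤ C * (1 + |η|) ^ 2 + C * (4 * (1 + |η|) ^ 2) := by
        rw [abs_mul, abs_of_pos (by positivity : 0 < η ^ 2 + 5 / 2)]
        gcongr
        nlinarith [one_le_pow₀ (n := 2) (by linarith : (1 : ℝ) ≤ 1 + |η|)]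
      _ = _ := by ring
  have hD : |1 / (2 * ς * √Real.pi) * (Real.exp (-η ^ 2) * (β - c * (η ^ 2 + 5 / 2)))| ≤ 5 * C * K := by
    rw [abs_mul, abs_mul, abs_of_pos (Real.exp_pos _), abs_of_pos (by positivity : 0 < 1 / (2 * ς * √Real.pi))]
    calc 1 / (2 * ς * √Real.pi) * (Real.exp (-η ^ 2) * |β - c * (η ^ 2 + 5 / 2)|)
        ≤ 1 / (1 * ς * 1) * (Real.exp (-η ^ 2) * (5 * C * (1 + |η|) ^ 2)) := by gcongr; norm_num
      _ = 5 * C / ς * (Real.exp (-η ^ 2) * (1 + |η|) ^ 2) := by field_simp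
      _ ≤ 5 * C / ς * (K * ς ^ 2) :=
        mul_le_mul_of_nonneg_left ((h η).2.trans (by gcongr)) (by positivity)
      _ = 5 * C * K * ς := by field_simp
      _ ≤ 5 * C * K * 1 := by gcongr
      _ = _ := mul_one _
  exact (abs_add_le _ _).trans (add_le_add hA hD)

/-! ### Summation over the degrees -/

theorem sum_range_eq_sum_Ico_int (n : ℕ) (m : ℤ) (g : ℤ → ℝ) :
    ∑ j ∈ Finset.range n, g j = ∑ i ∈ Finset.Ico (-m) (n - m), g (i + m) := by
  refine Finset.sum_nbij' (fun j => (j : ℤ) - m) (fun i => (i + m).toNat) ?_ ?_ ?_ ?_ ?_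
  · intro j hj; simp only [Finset.mem_range, Finset.mem_Ico] at hj ⊢; omega
  · intro i hi; simp only [Finset.mem_range, Finset.mem_Ico] at hi ⊢; omega
  · intro j hj; simp
  · intro i hi; simp only [Finset.mem_Ico] at hi ⊢; omega
  · intro j hj; simp

/-- Bookkeeping for three kinds of degrees: those outside of the window, the generic ones inside,
and the few near the Fermi transition, for which a larger error is affordable. -/
theorem abs_sum_sub_sum_le {I W : Finset ℤ} {T g : ℤ → ℝ} {P : ℤ → Prop} [DecidablePred P]
    {ε₁ ε₂ κ : ℝ} (hW : W ⊆ I) (h₁ : ∀ i ∈ I \ W, |T i| ≤ ε₁)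
    (h₂ : ∀ i ∈ W, |T i - g i| ≤ ε₂ + if P i then κ else 0) (hε₁ : 0 ≤ ε₁) :
    |∑ i ∈ I, T i - ∑ i ∈ W, g i| ≤ I.card * ε₁ + (W.card * ε₂ + (W.filter P).card * κ) := by
  have e : ∑ i ∈ I, T i - ∑ i ∈ W, g i = ∑ i ∈ I \ W, T i + ∑ i ∈ W, (T i - g i) := by
    rw [← Finset.sum_sdiff hW, Finset.sum_sub_distrib]; ring
  rw [e]
  refine (abs_add_le _ _).trans (add_le_add ?_ ?_)
  · refine (Finset.abs_sum_le_sum_abs _ _).trans ((Finset.sum_le_sum h₁).trans ?_)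
    rw [Finset.sum_const, nsmul_eq_mul]
    gcongr
    exact Finset.sdiff_subset
  · refine (Finset.abs_sum_le_sum_abs _ _).trans ((Finset.sum_le_sum h₂).trans (le_of_eq ?_))
    rw [Finset.sum_add_distrib, ← Finset.sum_filter, Finset.sum_const, Finset.sum_const,
      nsmul_eq_mul, nsmul_eq_mul]

theorem card_filter_abs_add_le {W : Finset ℤ} {θ B : ℝ} (h0 : 0 ≤ θ) (h1 : θ < 1) (hB : 0 ≤ B) :
    ((W.filter fun i : ℤ => |(i : ℝ) + θ| ≤ B).card : ℝ) ≤ 2 * B + 5 := by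
  set N : ℤ := ⌈B⌉ + 1 with hN
  have hN0 : 0 ≤ ⌈B⌉ := Int.ceil_nonneg hB
  have hsub : (W.filter fun i : ℤ => |(i : ℝ) + θ| ≤ B) ⊆ Finset.Icc (-N) N := by
    intro i hi
    have h2 := (Finset.mem_filter.1 hi).2
    rw [abs_le] at h2
    have h3 : B ≤ ⌈B⌉ := Int.le_ceil B
    rw [Finset.mem_Icc]
    constructor
    · have : (-(N : ℝ)) ≤ i := by rw [hN]; push_cast; linarith
      exact_mod_cast this
    · have : (i : ℝ) ≤ N := by rw [hN]; push_cast; linarith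
      exact_mod_cast this
  have h2 := Finset.card_le_card hsub
  rw [Int.card_Icc] at h2
  have h3 : ((N + 1 - -N).toNat : ℝ) = 2 * N + 1 := by
    have : ((N + 1 - -N).toNat : ℤ) = 2 * N + 1 := by omega
    exact_mod_cast this
  have h4 : ((W.filter fun i : ℤ => |(i : ℝ) + θ| ≤ B).card : ℝ) ≤ 2 * N + 1 := by
    rw [← h3]; exact_mod_cast h2
  have h5 : (N : ℝ) ≤ B + 2 := by
    rw [hN]; push_cast
    linarith [Int.ceil_lt_add_one B]
  linarith

/-- Adding the Taylor expansions from `y₀` to `y` and from `y` to `y₀` cancels the value `U y` and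
isolates `U'(y) (y₀ - y)`. -/
theorem LocalModel.abs_deriv_le {U a : ℝ → ℝ} {y₀ ρ C : ℝ} (h : LocalModel U a y₀ ρ C)
    (h0 : U y₀ = 0) (hd : deriv U y₀ = 0) {y : ℝ} (hy : |y - y₀| ≤ ρ) (hy1 : |y - y₀| ≤ 1) :
    |deriv U y| ≤ 4 * C * |y - y₀| := by
  have hC := h.one_le
  have h00 : |y₀ - y₀| ≤ ρ := by simp [h.rho_pos.le]
  rcases eq_or_ne y y₀ with rfl | hne
  · simp [hd]
  have t1 := h.taylor_U y₀ y h00 hy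
  have t2 := h.taylor_U y y₀ hy h00
  rw [h0, hd] at t1
  rw [h0] at t2
  have a1 := h.U2_le y hy
  have a2 := h.U2_le y₀ h00
  have a1' := (h.U2_pos hy).le
  have a2' := (h.U2_pos h00).le
  have a3 := h.U3_le y hy
  have a4 := h.U3_le y₀ h00
  set d := |y - y₀| with hd'
  have hdpos : 0 < d := abs_pos.2 (sub_ne_zero.2 hne)
  have e2 : (y₀ - y) ^ 2 = d ^ 2 := by rw [hd', sq_abs]; ring
  have e2' : (y - y₀) ^ 2 = d ^ 2 := by rw [hd', sq_abs]
  have e4 : (y₀ - y) ^ 4 = d ^ 4 := by rw [show (y₀ - y) ^ 4 = ((y₀ - y) ^ 2) ^ 2 by ring, e2]; ring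
  have e4' : (y - y₀) ^ 4 = d ^ 4 := by rw [show (y - y₀) ^ 4 = ((y - y₀) ^ 2) ^ 2 by ring, e2']; ring
  have b3 : |iteratedDeriv 3 U y / 6 * (y₀ - y) ^ 3| ≤ C / 6 * d ^ 3 := by
    rw [abs_mul, abs_div, abs_pow, abs_sub_comm y₀ y, ← hd', abs_of_pos (by norm_num : (0 : ℝ) < 6)]
    gcongr
  have b4 : |iteratedDeriv 3 U y₀ / 6 * (y - y₀) ^ 3| ≤ C / 6 * d ^ 3 := by
    rw [abs_mul, abs_div, abs_pow, ← hd', abs_of_pos (by norm_num : (0 : ℝ) < 6)]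
    gcongr
  rw [e4'] at t1
  rw [e4] at t2
  rw [e2'] at t1
  rw [e2] at t2
  have c1 : iteratedDeriv 2 U y / 2 * d ^ 2 ≤ C / 2 * d ^ 2 := by gcongr
  have c2 : iteratedDeriv 2 U y₀ / 2 * d ^ 2 ≤ C / 2 * d ^ 2 := by gcongr
  have c1' : 0 ≤ iteratedDeriv 2 U y / 2 * d ^ 2 := by positivity
  have c2' : 0 ≤ iteratedDeriv 2 U y₀ / 2 * d ^ 2 := by positivity
  have d3 : C * d ^ 3 ≤ C * d ^ 2 :=
    mul_le_mul_of_nonneg_left (pow_le_pow_of_le_one hdpos.le hy1 (by norm_num)) (by linarith)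
  have d4 : C * d ^ 4 ≤ C * d ^ 2 :=
    mul_le_mul_of_nonneg_left (pow_le_pow_of_le_one hdpos.le hy1 (by norm_num)) (by linarith)
  have key : |deriv U y * (y₀ - y)| ≤ 4 * C * d ^ 2 := by
    rw [abs_le] at t1 t2 b3 b4 ⊢
    constructor <;> linarith [t1.1, t1.2, t2.1, t2.2, b3.1, b3.2, b4.1, b4.2]
  rw [abs_mul, abs_sub_comm y₀ y, ← hd'] at key
  have : |deriv U y| * d ≤ (4 * C * d) * d := by linarith
  exact le_of_mul_le_mul_right this hdpos

/-- The one-point function in the logarithmic variable, up to a Jacobian. -/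
noncomputable def gapSum (U a : ℝ → ℝ) (M : ℝ) (n : ℕ) (y : ℝ) : ℝ :=
  ∑ j ∈ Finset.range n, gapWeight U a n (j - n * M) y / ∫ z, gapWeight U a n (j - n * M) z

/-- At distance `2 C √n log n` from the centre the Gaussian is at most `n^{-4}`, while `ς^4` is at
least `n^{-4}`. -/
theorem one_le_exp_mul_pow_of_far {C ς n z : ℝ} (hC : 1 ≤ C) (hn : C ^ 2 ≤ n)
    (hlog : 1 ≤ Real.log n) (hς : 1 / C * (1 / √n) ≤ ς) (hz : 2 * C * (√n * Real.log n) ≤ |z|) :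
    1 ≤ Real.exp ((ς * z) ^ 2) * ς ^ 4 := by
  have hn0 : 0 < n := by nlinarith
  have hsq : 0 < √n := Real.sqrt_pos.2 hn0
  have hς0 : 0 < ς := lt_of_lt_of_le (by positivity) hς
  have h1 : 2 * Real.log n ≤ ς * |z| := by
    calc 2 * Real.log n = (1 / C * (1 / √n)) * (2 * C * (√n * Real.log n)) := by field_simp
      _ ≤ ς * |z| := by gcongr
  have h2 : 4 * Real.log n ≤ (ς * z) ^ 2 := by
    have : (ς * z) ^ 2 = (ς * |z|) ^ 2 := by rw [mul_pow, mul_pow, sq_abs]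
    rw [this]; nlinarith
  have h3 : n ^ 4 ≤ Real.exp ((ς * z) ^ 2) := by
    calc n ^ 4 = Real.exp (4 * Real.log n) := by
          rw [← Real.exp_log (pow_pos hn0 4), Real.log_pow]; norm_num
      _ ≤ _ := Real.exp_le_exp.2 h2
  have h4 : 1 ≤ n ^ 2 * ς ^ 2 := by
    have : 1 / (C ^ 2 * n) ≤ ς ^ 2 := by
      calc 1 / (C ^ 2 * n) = (1 / C * (1 / √n)) ^ 2 := by
            rw [mul_pow, div_pow, div_pow, Real.sq_sqrt hn0.le]; field_simp
        _ ≤ ς ^ 2 := by gcongr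
    calc (1 : ℝ) ≤ n / C ^ 2 := by rw [le_div_iff₀ (by positivity)]; linarith
      _ = n ^ 2 * (1 / (C ^ 2 * n)) := by field_simp
      _ ≤ _ := by gcongr
  calc (1 : ℝ) ≤ (n ^ 2 * ς ^ 2) ^ 2 := one_le_pow₀ h4
    _ = n ^ 4 * ς ^ 4 := by ring
    _ ≤ _ := by gcongr

theorem abs_mul_sub_mul_le {p f φ ψ e k : ℝ} (h : |p - f| ≤ e) (h0 : 0 ≤ φ) (h1 : φ ≤ 1)
    (hf : |f| ≤ k) : |p * φ - f * ψ| ≤ e + k * |φ - ψ| := by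
  have : p * φ - f * ψ = (p - f) * φ + f * (φ - ψ) := by ring
  rw [this]
  refine (abs_add_le _ _).trans (add_le_add ?_ ?_)
  · rw [abs_mul, abs_of_nonneg h0]
    calc |p - f| * φ ≤ |p - f| * 1 := by gcongr
      _ ≤ e := by linarith
  · rw [abs_mul]; gcongr

/-- The Gaussian profile of the one-point function near the left edge. -/
noncomputable def edgeProfile (U a : ℝ → ℝ) (n : ℕ) (y x : ℝ) : ℝ :=
  gaussPrimitive (laplaceScale U n y) (n * deriv U y / 2) (deriv a y)
    (iteratedDeriv 3 U y / (3 * iteratedDeriv 2 U y)) x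

/-- The estimates for a single summand of `gapSum`, away from and near the edge. -/
theorem GapModel.term_bound {U a : ℝ → ℝ} {y₁ y₂ ρ C : ℝ} (h : GapModel U a y₁ y₂ ρ C) {A : ℝ}
    (hA : 0 ≤ A) :
    ∃ K c A' : ℝ, 0 < K ∧ 0 < c ∧ 1 ≤ A' ∧ C + 1 ≤ A' ∧ ∀ᶠ n : ℕ in atTop, ∀ y,
      |y - y₁| ≤ A * (Real.log n / √n) → |y - y₁| ≤ ρ ∧
      (∀ x, A' * (√n * Real.log n) - 1 ≤ |x| →
        gapWeight U a n x y / (∫ z, gapWeight U a n x z) ≤ K * laplaceScale U n y ^ 3 ∧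
        1 ≤ Real.exp ((laplaceScale U n y * (x - n * deriv U y / 2)) ^ 2) * laplaceScale U n y ^ 4 ∧
        |n * deriv U y / 2| ≤ |x|) ∧
      (∀ x, |x| ≤ c * n →
        |gapWeight U a n x y / (∫ z, gapWeight U a n x z) -
          localDensity U a n y x * fermi (y₂ - y₁) (x - gapShift U a y₁ y₂)| ≤
          K * laplaceScale U n y + if |x| ≤ 1 / (y₂ - y₁) * Real.log n then K else 0) := by
  have hC := h.left.one_le
  have hL : 0 < y₂ - y₁ := sub_pos.2 h.lt
  set L := y₂ - y₁ with hLdef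
  obtain ⟨ρ₀, hρ₀, hle, hρ₀1, hsmall, hL4⟩ : ∃ ρ₀ : ℝ, 0 < ρ₀ ∧ ρ₀ ≤ ρ ∧ ρ₀ ≤ 1 ∧
      2 * ρ₀ ≤ 1 / (64 * (2 * C ^ 2)) ∧ 4 * ρ₀ ≤ L := by
    have hρ := h.left.rho_pos
    refine ⟨min (min ρ 1) (min (1 / (64 * (2 * C ^ 2)) / 2) (L / 4)), by positivity,
      (min_le_left _ _).trans (min_le_left _ _), (min_le_left _ _).trans (min_le_right _ _), ?_, ?_⟩
    · have := (min_le_right (min ρ 1) _).trans (min_le_left (1 / (64 * (2 * C ^ 2)) / 2) (L / 4))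
      linarith
    · have := (min_le_right (min ρ 1) _).trans (min_le_right (1 / (64 * (2 * C ^ 2)) / 2) (L / 4))
      linarith
  obtain ⟨K₁, hK₁, hlap⟩ := h.left.laplace hρ₀ hle hsmall
  obtain ⟨K₂, c, hK₂, hc, hfrac⟩ := h.fraction_approx hρ₀ hle hsmall hL4
  obtain ⟨K₃, hK₃, hdens⟩ := h.left.abs_localDensity_le
  -- In the last constant `4 C A` covers the centre `n U'(y) / 2` of the Gaussian, which is at most
  -- `2 C A √n log n`. The summand `2 C` is the distance demanded by `one_le_exp_mul_pow_of_far`,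
  -- and `1` absorbs the rounding.
  refine ⟨K₁ + K₃ * C * K₂ * C, c, 4 * C * A + 2 * C + 1, by positivity, hc, by nlinarith [mul_nonneg (by linarith : 0 ≤ C) hA], by nlinarith [mul_nonneg (by linarith : 0 ≤ C) hA], ?_⟩
  have hev₁ : ∀ᶠ n : ℕ in atTop, 1 ≤ Real.log n :=
    (Real.tendsto_log_atTop.comp tendsto_natCast_atTop_atTop).eventually_ge_atTop 1
  have hev₂ : ∀ᶠ n : ℕ in atTop, C ^ 2 ≤ (n : ℝ) := tendsto_natCast_atTop_atTop.eventually_ge_atTop _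
  have hev₃ : ∀ᶠ n : ℕ in atTop, 2 * C * (1 / √(n : ℝ)) ≤ 1 := by
    have := tendsto_one_div_sqrt_nat.const_mul (2 * C)
    rw [mul_zero] at this
    exact this.eventually_le_const one_pos
  have hev₄ := eventually_log_pow_le (2 * A / ρ₀) 1
  filter_upwards [hlap, hfrac, hev₁, hev₂, hev₃, hev₄, eventually_gt_atTop 0]
    with n hlap hfrac hlog hnC hς1' hnA hn0 y hy
  have hn' : (0 : ℝ) < n := by exact_mod_cast hn0
  have hn1 : (1 : ℝ) ≤ n := by exact_mod_cast hn0
  have hsq : 0 < √(n : ℝ) := Real.sqrt_pos.2 hn'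
  have hsq1 : 1 ≤ √(n : ℝ) := by rw [Real.one_le_sqrt]; exact hn1
  have hsqn : √(n : ℝ) * √(n : ℝ) = n := Real.mul_self_sqrt hn'.le
  have hyρ₀ : |y - y₁| ≤ ρ₀ / 2 := by
    refine hy.trans ?_
    rw [pow_one, div_mul_eq_mul_div, div_le_iff₀ hρ₀] at hnA
    rw [← mul_div_assoc, div_le_iff₀ hsq]
    linarith only [hnA]
  have hyρ : |y - y₁| ≤ ρ := by linarith only [hyρ₀, hle, hρ₀]
  obtain ⟨hς, -⟩ := laplaceScale_sq hn0 (h.left.U2_pos hyρ)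
  obtain ⟨hb1, hb2⟩ := h.left.scale_bounds hyρ hn0
  have hς1 := hb2.trans hς1'
  have hμ : |n * deriv U y / 2| ≤ 2 * C * A * (√n * Real.log n) := by
    have h1 := h.left.abs_deriv_le h.left_eq h.left_deriv hyρ (by linarith only [hyρ₀, hρ₀1, hρ₀])
    rw [abs_div, abs_mul, abs_of_pos hn', abs_two]
    calc n * |deriv U y| / 2 ≤ n * (4 * C * (A * (Real.log n / √n))) / 2 := by
          gcongr; exact h1.trans (by gcongr)
      _ = 2 * C * A * ((√n * √n) / √n * Real.log n) := by rw [hsqn]; ring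
      _ = _ := by rw [mul_div_assoc, div_self hsq.ne', mul_one]
  have hX1 : 1 ≤ √(n : ℝ) * Real.log n := one_le_mul_of_one_le_of_one_le hsq1 hlog
  set X := √(n : ℝ) * Real.log n with hX
  set ς := laplaceScale U n y with hςdef
  refine ⟨hyρ, fun x hx => ?_, fun x hx => ?_⟩
  · obtain ⟨hF, -, hfar⟩ := hlap y hyρ₀ x
    have hCX : 0 ≤ C * A * X := by positivity
    have hCX' : 0 ≤ C * (X - 1) := mul_nonneg (by linarith only [hC]) (by linarith only [hX1])
    have hz : 2 * C * X ≤ |x - n * deriv U y / 2| := by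
      have h1 := abs_sub_abs_le_abs_sub x (n * deriv U y / 2)
      linarith only [h1, hμ, hx, hX1, hCX]
    have hfar' := one_le_exp_mul_pow_of_far hC hnC hlog hb1 hz
    refine ⟨?_, hfar', ?_⟩
    · rw [gapWeight_div_integral hF]
      obtain ⟨h1, -⟩ := hfar hfar'
      obtain ⟨h2, h3⟩ := gapFraction_mem U a n y₁ ρ₀ x
      have h4 : 0 ≤ 1 / localIntegral U a n y₁ ρ₀ x y := by positivity
      calc 1 / localIntegral U a n y₁ ρ₀ x y * gapFraction U a n y₁ ρ₀ x
          ≤ 1 / localIntegral U a n y₁ ρ₀ x y * 1 := by gcongr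
        _ ≤ K₁ * ς ^ 3 := by rw [mul_one]; exact h1
        _ ≤ _ := by
          gcongr
          have : 0 ≤ K₃ * C * K₂ * C := by positivity
          linarith only [this]
    · linarith only [hμ, hx, hX1, hCX, hCX', hC]
  · obtain ⟨hF, hd, -⟩ := hlap y hyρ₀ x
    obtain ⟨h2, h3⟩ := gapFraction_mem U a n y₁ ρ₀ x
    have hdb := hdens n hn0 y hyρ hς1 x
    rw [gapWeight_div_integral hF]
    have hmain := abs_mul_sub_mul_le (ψ := fermi L (x - gapShift U a y₁ y₂)) hd h2 h3 hdb
    refine hmain.trans ?_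
    obtain ⟨hnear, hfar⟩ := hfrac x hx
    have hinv : 1 / ς ≤ C * √n := by
      rw [div_le_iff₀ hς]
      calc (1 : ℝ) = C * √n * (1 / C * (1 / √n)) := by field_simp
        _ ≤ _ := by gcongr
    have hinv' : K₃ / ς ≤ K₃ * C * √n := by
      rw [div_eq_mul_one_div, mul_assoc]; gcongr
    have hK : 0 ≤ K₃ * C * K₂ * C := by positivity
    have hKς : 0 ≤ K₃ * C * K₂ * C * ς := by positivity
    split_ifs with hcase
    · have h5 := hnear hcase
      have h6 : K₃ / ς * |gapFraction U a n y₁ ρ₀ x - fermi L (x - gapShift U a y₁ y₂)| ≤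
          K₃ * C * K₂ * C := by
        calc K₃ / ς * |gapFraction U a n y₁ ρ₀ x - fermi L (x - gapShift U a y₁ y₂)|
            ≤ (K₃ * C * √n) * (K₂ * (1 / √n)) := by gcongr
          _ = K₃ * C * K₂ := by field_simp
          _ ≤ K₃ * C * K₂ * C := le_mul_of_one_le_right (by positivity) hC
      linarith only [h6, hK₁, hKς]
    · have h5 := hfar (not_le.1 hcase).le
      have h6 : K₃ / ς * |gapFraction U a n y₁ ρ₀ x - fermi L (x - gapShift U a y₁ y₂)| ≤
          K₃ * C * K₂ * C * ς := by
        calc K₃ / ς * |gapFraction U a n y₁ ρ₀ x - fermi L (x - gapShift U a y₁ y₂)|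
            ≤ (K₃ * C * √n) * (K₂ * (1 / n)) := by gcongr
          _ = K₃ * C * K₂ * C * (1 / C * (√n / (√n * √n))) := by rw [hsqn]; field_simp
          _ = K₃ * C * K₂ * C * (1 / C * (1 / √n)) := by
            congr 2; field_simp
          _ ≤ _ := by gcongr
      linarith only [h6]

set_option maxHeartbeats 400000 in
/-- Edge asymptotics of the one-point function in the logarithmic variable. -/
theorem GapModel.gapSum_asymptotics {U a : ℝ → ℝ} {y₁ y₂ ρ C M : ℝ} (h : GapModel U a y₁ y₂ ρ C)
    (hM0 : 0 < M) (hM1 : M < 1) {A : ℝ} (hA : 0 ≤ A) :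
    ∃ K : ℝ, 0 < K ∧ ∀ᶠ n : ℕ in atTop, ∀ y, |y - y₁| ≤ A * (Real.log n / √n) → |y - y₁| ≤ ρ ∧
      |gapSum U a M n y - (edgeProfile U a n y 0 + localDensity U a n y 0 *
        (gapShift U a y₁ y₂ + 1 / (2 * (y₂ - y₁)) *
          logTheta' (n * M + gapShift U a y₁ y₂ + 1 / 2) (Real.pi / (y₂ - y₁))))| ≤
        K * Real.log n := by
  have hC := h.left.one_le
  have hL : 0 < y₂ - y₁ := sub_pos.2 h.lt
  set L := y₂ - y₁ with hLdef
  set δ := gapShift U a y₁ y₂ with hδ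
  obtain ⟨K₁, c, A', hK₁, hc, hA'1, hA'C, hterm⟩ := h.term_bound hA
  have hC2 : 0 ≤ 2 * C ^ 2 := by positivity
  obtain ⟨K₃, hK₃, hdens⟩ := exists_gaussDensity_bound hC2
  obtain ⟨K₄, hK₄, hprim⟩ := exists_gaussPrimitive_bound hC2
  obtain ⟨K₅, hK₅, hfermi⟩ := exists_fermi_sum_bound hL δ hK₃
  refine ⟨8 * C ^ 3 * K₁ + 4 * C * (A' + 1) * K₁ + (2 / L + 5) * K₁ + K₄ +
    K₅ * (1 + 2 * C * (A' + 1)), by positivity, ?_⟩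
  have hev₁ : ∀ᶠ n : ℕ in atTop, 1 ≤ Real.log n :=
    (Real.tendsto_log_atTop.comp tendsto_natCast_atTop_atTop).eventually_ge_atTop 1
  have hev₃ : ∀ᶠ n : ℕ in atTop, 2 * C * (1 / √(n : ℝ)) ≤ 1 := by
    have := tendsto_one_div_sqrt_nat.const_mul (2 * C)
    rw [mul_zero] at this
    exact this.eventually_le_const one_pos
  have hmin : 0 < min c (min M (1 - M)) := lt_min hc (lt_min hM0 (by linarith))
  have hev₄ := eventually_log_pow_le ((A' + 2) / min c (min M (1 - M))) 1
  filter_upwards [hterm, hev₁, hev₃, hev₄, eventually_gt_atTop 0]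
    with n hterm hlog hς1' hnA hn0 y hy
  obtain ⟨hyρ, hfar, hin⟩ := hterm y hy
  refine ⟨hyρ, ?_⟩
  have hn' : (0 : ℝ) < n := by exact_mod_cast hn0
  have hn1 : (1 : ℝ) ≤ n := by exact_mod_cast hn0
  have hsq : 0 < √(n : ℝ) := Real.sqrt_pos.2 hn'
  have hsq1 : 1 ≤ √(n : ℝ) := by rw [Real.one_le_sqrt]; exact hn1
  have hsqn : √(n : ℝ) * √(n : ℝ) = n := Real.mul_self_sqrt hn'.le
  obtain ⟨hς, -⟩ := laplaceScale_sq hn0 (h.left.U2_pos hyρ)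
  obtain ⟨hb1, hb2⟩ := h.left.scale_bounds hyρ hn0
  have hς1 := hb2.trans hς1'
  have hX1 : 1 ≤ √(n : ℝ) * Real.log n := one_le_mul_of_one_le_of_one_le hsq1 hlog
  have hXn : (A' + 2) * (√(n : ℝ) * Real.log n) ≤ min c (min M (1 - M)) * n := by
    rw [pow_one, div_mul_eq_mul_div, div_le_iff₀ hmin] at hnA
    calc (A' + 2) * (√(n : ℝ) * Real.log n) = √n * ((A' + 2) * Real.log n) := by ring
      _ ≤ √n * (√n * min c (min M (1 - M))) := by gcongr
      _ = (√n * √n) * min c (min M (1 - M)) := by ring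
      _ = _ := by rw [hsqn, mul_comm]
  have hXc : (A' + 2) * (√(n : ℝ) * Real.log n) ≤ c * n :=
    hXn.trans (mul_le_mul_of_nonneg_right (min_le_left _ _) hn'.le)
  have hXM : (A' + 2) * (√(n : ℝ) * Real.log n) ≤ M * n :=
    hXn.trans (mul_le_mul_of_nonneg_right ((min_le_right _ _).trans (min_le_left _ _)) hn'.le)
  have hXM' : (A' + 2) * (√(n : ℝ) * Real.log n) ≤ (1 - M) * n :=
    hXn.trans (mul_le_mul_of_nonneg_right ((min_le_right _ _).trans (min_le_right _ _)) hn'.le)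
  set ς := laplaceScale U n y with hςdef
  have hςX : ς * (√(n : ℝ) * Real.log n) ≤ 2 * C * Real.log n := by
    calc ς * (√(n : ℝ) * Real.log n) ≤ (2 * C * (1 / √n)) * (√(n : ℝ) * Real.log n) := by gcongr
      _ = 2 * C * Real.log n := by field_simp
  have hinvς : 1 / ς ≤ C * (√(n : ℝ) * Real.log n) := by
    rw [div_le_iff₀ hς]
    calc (1 : ℝ) = C * (√n * 1) * (1 / C * (1 / √n)) := by field_simp
      _ ≤ _ := by gcongr
  have hnς : n * ς ^ 3 ≤ 8 * C ^ 3 := by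
    calc n * ς ^ 3 ≤ n * (2 * C * (1 / √n)) ^ 3 := by gcongr
      _ = (√n * √n) * (2 * C * (1 / √n)) ^ 3 := by rw [hsqn]
      _ = 8 * C ^ 3 * (1 / √n) := by field_simp; norm_num
      _ ≤ 8 * C ^ 3 * 1 := by gcongr; rw [div_le_one hsq]; exact hsq1
      _ = _ := by ring
  set X := √(n : ℝ) * Real.log n with hX
  -- Degrees are counted from the ceiling of `n M`, so that `x = i + θ` with `0 ≤ θ < 1`. The
  -- half-width `H` of the window exceeds the Gaussian width by a logarithmic factor.
  set m : ℤ := ⌈n * M⌉ with hm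
  obtain ⟨H, hH1, hH2⟩ : ∃ H : ℕ, A' * X ≤ H ∧ (H : ℝ) < A' * X + 1 :=
    ⟨⌈A' * X⌉₊, Nat.le_ceil _, Nat.ceil_lt_add_one (by positivity)⟩
  set θ : ℝ := m - n * M with hθ
  have hθ0 : 0 ≤ θ := sub_nonneg.2 (Int.le_ceil _)
  have hθ1 : θ < 1 := by
    have := Int.ceil_lt_add_one (n * M)
    rw [hθ, hm]; linarith only [this]
  set I := Finset.Ico (-m) ((n : ℤ) - m) with hI
  set W := Finset.Ico (-(H : ℤ)) H with hW
  have hmR : (m : ℝ) = θ + n * M := by rw [hθ]; ring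
  have hWI : W ⊆ I := by
    have h1 : (H : ℤ) ≤ m := by
      have : (H : ℝ) ≤ m := by
        rw [hmR]; linarith only [hH2, hXM, hθ0, hX1]
      exact_mod_cast this
    have h2 : (H : ℤ) + m ≤ n := by
      have : (H : ℝ) + m ≤ n := by
        rw [hmR]; linarith only [hH2, hXM', hθ1, hX1]
      exact_mod_cast this
    exact Finset.Ico_subset_Ico (by omega) (by omega)
  set T : ℤ → ℝ := fun i => gapWeight U a n (i + θ) y / ∫ z, gapWeight U a n (i + θ) z with hT
  set g : ℤ → ℝ := fun i => localDensity U a n y (i + θ) * fermi L (i + θ - δ) with hg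
  have hsum : gapSum U a M n y = ∑ i ∈ I, T i := by
    rw [hI, gapSum]
    have := sum_range_eq_sum_Ico_int n m
      (fun j => gapWeight U a n (j - n * M) y / ∫ z, gapWeight U a n (j - n * M) z)
    simp only [Int.cast_natCast] at this
    rw [this]
    refine Finset.sum_congr rfl fun i _ => ?_
    have : ((i + m : ℤ) : ℝ) - n * M = i + θ := by push_cast; rw [hmR]; ring
    simp only [hT, this]
  have hout : ∀ i : ℤ, i ∉ W → A' * X - 1 ≤ |(i : ℝ) + θ| := by
    intro i hi
    rw [hW, Finset.mem_Ico, not_and_or, not_le, not_lt] at hi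
    rcases hi with hi | hi
    · have : (i : ℝ) ≤ -(H : ℝ) - 1 := by exact_mod_cast (by omega : i ≤ -(H : ℤ) - 1)
      refine le_trans ?_ (neg_le_abs _)
      linarith only [this, hH1, hθ1]
    · have : (H : ℝ) ≤ i := by exact_mod_cast hi
      refine le_trans ?_ (le_abs_self _)
      linarith only [this, hH1, hθ0]
  have hinside : ∀ i ∈ W, |(i : ℝ) + θ| ≤ c * n := by
    intro i hi
    rw [hW, Finset.mem_Ico] at hi
    have h1 : -(H : ℝ) ≤ i := by exact_mod_cast hi.1
    have h2 : (i : ℝ) ≤ H := by exact_mod_cast hi.2.le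
    rw [abs_le]
    constructor <;> linarith only [h1, h2, hH2, hθ0, hθ1, hXc, hX1]
  have hcomp := abs_sum_sub_sum_le (T := T) (g := g) (ε₁ := K₁ * ς ^ 3) (ε₂ := K₁ * ς) (κ := K₁)
    (P := fun i : ℤ => |(i : ℝ) + θ| ≤ 1 / L * Real.log n) hWI
    (fun i hi => by
      have h1 := (hfar _ (hout i (Finset.mem_sdiff.1 hi).2)).1
      rw [abs_of_nonneg (div_nonneg gapWeight_pos.le (integral_nonneg fun _ => gapWeight_pos.le))]
      exact h1)
    (fun i hi => hin _ (hinside i hi)) (by positivity)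
  rw [← hsum] at hcomp
  have hIcard : (I.card : ℝ) = n := by
    rw [hI, Int.card_Ico]
    have : ((n : ℤ) - m - -m).toNat = n := by omega
    rw [this]
  have hWcard : (W.card : ℝ) = 2 * H := by
    rw [hW, Int.card_Ico]
    have : ((H : ℤ) - -(H : ℤ)).toNat = 2 * H := by omega
    rw [this]; push_cast; ring
  have hPcard := card_filter_abs_add_le (W := W) hθ0 hθ1
    (B := 1 / L * Real.log n) (by positivity)
  have hςH : ς * H ≤ 2 * C * (A' + 1) * Real.log n := by
    calc ς * H ≤ ς * ((A' + 1) * X) := by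
          gcongr; linarith only [hH2, hX1]
      _ = (A' + 1) * (ς * X) := by ring
      _ ≤ (A' + 1) * (2 * C * Real.log n) := by gcongr
      _ = _ := by ring
  have hE : |gapSum U a M n y - ∑ i ∈ W, g i| ≤
      (8 * C ^ 3 * K₁ + 4 * C * (A' + 1) * K₁ + (2 / L + 5) * K₁) * Real.log n := by
    refine hcomp.trans ?_
    rw [hIcard, hWcard]
    have e1 : n * (K₁ * ς ^ 3) ≤ 8 * C ^ 3 * K₁ * Real.log n := by
      calc n * (K₁ * ς ^ 3) = K₁ * (n * ς ^ 3) * 1 := by ring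
        _ ≤ K₁ * (8 * C ^ 3) * Real.log n := by gcongr
        _ = _ := by ring
    have e2 : 2 * H * (K₁ * ς) ≤ 4 * C * (A' + 1) * K₁ * Real.log n := by
      calc 2 * H * (K₁ * ς) = 2 * K₁ * (ς * H) := by ring
        _ ≤ 2 * K₁ * (2 * C * (A' + 1) * Real.log n) := by gcongr
        _ = _ := by ring
    have e3 : ((W.filter fun i : ℤ => |(i : ℝ) + θ| ≤ 1 / L * Real.log n).card : ℝ) * K₁ ≤
        (2 / L + 5) * K₁ * Real.log n := by
      calc ((W.filter fun i : ℤ => |(i : ℝ) + θ| ≤ 1 / L * Real.log n).card : ℝ) * K₁ ≤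
            (2 * (1 / L * Real.log n) + 5) * K₁ := by gcongr
        _ ≤ (2 * (1 / L * Real.log n) + 5 * Real.log n) * K₁ := by gcongr; linarith only [hlog]
        _ = _ := by ring
    linarith only [e1, e2, e3]
  set μ := n * deriv U y / 2 with hμ
  set β := deriv a y with hβ
  set cc := iteratedDeriv 3 U y / (3 * iteratedDeriv 2 U y) with hcc
  have hβb := h.left.amplitude_deriv_le hyρ
  have hcb := h.left.cubic_le hyρ
  have hF := hfermi ς θ H (gaussPrimitive ς μ β cc) (gaussDensity ς μ β cc)
    (gaussDensityDeriv ς μ β cc) (gaussDensityDeriv2 ς μ β cc) hς hθ0 hθ1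
    (by
      refine hinvς.trans ?_
      have h1 : (C + 1) * X ≤ A' * X := mul_le_mul_of_nonneg_right hA'C (by linarith only [hX1])
      linarith only [h1, hH1, hX1])
    (hasDerivAt_gaussPrimitive hς μ β cc) (hasDerivAt_gaussDensity hς μ β cc)
    (hasDerivAt_gaussDensityDeriv hς μ β cc)
    (fun x => (hdens ς μ β cc hς hς1 hβb hcb x).1) (fun x => (hdens ς μ β cc hς hς1 hβb hcb x).2.1)
    (fun x => (hdens ς μ β cc hς hς1 hβb hcb x).2.2)
  -- The lower end of the window lies beyond the bulk of the Gaussian, hence the primitive there is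
  -- bounded and not of order `n`.
  have hfar' := hfar (θ - 1 / 2 - H) (by
    refine le_trans ?_ (neg_le_abs _)
    linarith only [hH1, hθ1])
  have hneg : θ - 1 / 2 - H ≤ μ := by
    have h1 := hfar'.2.2
    have h2 : 1 ≤ A' * X := one_le_mul_of_one_le_of_one_le hA'1 hX1
    rw [abs_of_nonpos (by linarith only [h2, hH1, hθ1] : θ - 1 / 2 - H ≤ 0)] at h1
    linarith only [h1, neg_abs_le μ]
  have hP := hprim ς μ β cc hς hς1 hβb hcb (θ - 1 / 2 - H) hneg hfar'.2.1
  -- As `θ = m - n M` with `m` an integer, periodicity replaces `-θ` by `n M`.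
  have hθarg : logTheta' (δ - θ + 1 / 2) (Real.pi / L) = logTheta' (n * M + δ + 1 / 2) (Real.pi / L) := by
    rw [← logTheta'_sub_int (n * M + δ + 1 / 2) _ m]
    congr 1; rw [hmR]; ring
  rw [hθarg] at hF
  have hedge : edgeProfile U a n y 0 = gaussPrimitive ς μ β cc 0 := rfl
  have hld : ∀ x, localDensity U a n y x = gaussDensity ς μ β cc x := fun x => rfl
  have hFl : K₅ * (1 + ς * H) ≤ K₅ * (1 + 2 * C * (A' + 1)) * Real.log n := by
    rw [mul_assoc]
    gcongr
    linarith only [hςH, hlog]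
  have hPl : K₄ ≤ K₄ * Real.log n := le_mul_of_one_le_right hK₄.le hlog
  simp only [hg, hld] at hE
  rw [hedge, hld]
  rw [abs_le] at hE hF hP ⊢
  constructor <;> linarith only [hE.1, hE.2, hF.1, hF.2, hP.1, hP.2, hFl, hPl]

/-! ### Passage to the logarithmic variable -/

/-- The effective potential in the logarithmic variable. -/
noncomputable def logProfile (Q : ℂ → ℝ) (M v y : ℝ) : ℝ := Q (Real.exp y : ℂ) - 2 * M * y - v

/-- The amplitude in the logarithmic variable. -/
noncomputable def logAmplitude (lam : ℂ → ℝ) (s y : ℝ) : ℝ := 2 * y + s * lam (Real.exp y : ℂ)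

theorem hasDerivAt_exp_ray (y : ℝ) (c : ℂ) (t : ℝ) :
    HasDerivAt (fun t : ℝ => Complex.exp (y + c * t)) (c * Complex.exp (y + c * t)) t := by
  have h1 : HasDerivAt (fun w : ℂ => Complex.exp (y + c * w)) (Complex.exp (y + c * t) * (c * 1)) (t : ℂ) :=
    (((hasDerivAt_id (t : ℂ)).const_mul c).const_add (y : ℂ)).cexp
  exact h1.comp_ofReal.congr_deriv (by ring)

/-- Second derivative of a function along a logarithmic spiral. -/
theorem deriv_deriv_comp_exp_ray {Q : ℂ → ℝ} {y : ℝ} (hQ : ContDiffAt ℝ 2 Q (Complex.exp y)) (c : ℂ) :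
    deriv (deriv fun t : ℝ => Q (Complex.exp (y + c * t))) 0 =
      fderiv ℝ (fderiv ℝ Q) (Complex.exp y) (c * Complex.exp y) (c * Complex.exp y) +
        fderiv ℝ Q (Complex.exp y) (c * (c * Complex.exp y)) := by
  have h0 : Complex.exp (y + c * ((0 : ℝ) : ℂ)) = Complex.exp y := by simp
  have hcont : Tendsto (fun t : ℝ => Complex.exp (y + c * t)) (𝓝 0) (𝓝 (Complex.exp y)) := by
    have := (hasDerivAt_exp_ray y c 0).continuousAt.tendsto
    rwa [h0] at this
  have hev : ∀ᶠ t in 𝓝 (0 : ℝ), deriv (fun t : ℝ => Q (Complex.exp (y + c * t))) t =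
      fderiv ℝ Q (Complex.exp (y + c * t)) (c * Complex.exp (y + c * t)) := by
    have h1 : ∀ᶠ z in 𝓝 (Complex.exp y), ContDiffAt ℝ 2 Q z := hQ.eventually (by simp)
    filter_upwards [hcont.eventually h1] with t ht
    have hd := (ht.differentiableAt (by norm_num)).hasFDerivAt
    exact (hd.comp_hasDerivAt t (hasDerivAt_exp_ray y c t)).deriv
  rw [Filter.EventuallyEq.deriv_eq hev]
  have hfd : HasFDerivAt (fderiv ℝ Q) (fderiv ℝ (fderiv ℝ Q) (Complex.exp (y + c * ((0 : ℝ) : ℂ))))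
      (Complex.exp (y + c * ((0 : ℝ) : ℂ))) := by
    rw [h0]
    have := hQ.fderiv_right (m := 1) (by norm_num)
    exact (this.differentiableAt (by norm_num)).hasFDerivAt
  have h2 := hfd.comp_hasDerivAt (0 : ℝ) (hasDerivAt_exp_ray y c 0)
  have h3 := h2.clm_apply ((hasDerivAt_exp_ray y c 0).const_mul c)
  rw [h0] at h3
  exact h3.deriv.trans (by simp)

/-- The second derivatives along the ray (`c = 1`) and along the circle (`c = i`) are added. The
first order terms cancel because `i² = -1`, and the circular contribution vanishes by radial
symmetry. What remains is the Laplacian with its conformal factor. -/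
theorem deriv_deriv_comp_exp {Q : ℂ → ℝ} (hr : IsRadial Q) {y : ℝ}
    (hQ : ContDiffAt ℝ 2 Q (Real.exp y : ℂ)) :
    deriv (deriv fun t : ℝ => Q (Real.exp (y + t) : ℂ)) 0 = 4 * Real.exp y ^ 2 * lap Q (Real.exp y : ℂ) := by
  rw [Complex.ofReal_exp] at hQ ⊢
  have h1 := deriv_deriv_comp_exp_ray hQ 1
  have h2 := deriv_deriv_comp_exp_ray hQ Complex.I
  have e1 : (fun t : ℝ => Q (Complex.exp (y + 1 * t))) = fun t : ℝ => Q (Real.exp (y + t) : ℂ) := by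
    funext t; congr 1; push_cast; rw [one_mul]
  have e2 : (fun t : ℝ => Q (Complex.exp (y + Complex.I * t))) = fun _ => Q (Complex.exp y) := by
    funext t
    rw [hr (Complex.exp (y + Complex.I * t)), hr (Complex.exp y)]
    congr 2
    simp [Complex.norm_exp]
  rw [e2] at h2
  rw [e1, one_mul, one_mul] at h1
  have h3 : deriv (deriv fun _ : ℝ => Q (Complex.exp y)) 0 = 0 := by simp
  rw [h3] at h2
  have hI : Complex.I * (Complex.I * Complex.exp y) = -Complex.exp y := by
    rw [← mul_assoc, Complex.I_mul_I]; ring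
  rw [hI, map_neg] at h2
  have hsm : ∀ c : ℂ, c * Complex.exp y = (Real.exp y) • c := by
    intro c; rw [Complex.real_smul, Complex.ofReal_exp, mul_comm]
  have h1' : Complex.exp (y : ℂ) = (Real.exp y) • (1 : ℂ) := by rw [← hsm, one_mul]
  set D := fderiv ℝ (fderiv ℝ Q) (Complex.exp y) with hD
  have hD1 : D (Complex.exp y) (Complex.exp y) = Real.exp y ^ 2 * D 1 1 := by
    rw [h1']; simp only [map_smul, smul_apply, smul_eq_mul]; ring
  have hD2 : D (Complex.I * Complex.exp y) (Complex.I * Complex.exp y) =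
      Real.exp y ^ 2 * D Complex.I Complex.I := by
    rw [hsm]; simp only [map_smul, smul_apply, smul_eq_mul]; ring
  rw [h1, lap, InnerProductSpace.laplacian_eq_iteratedFDeriv_complexPlane]
  simp only [iteratedFDeriv_two_apply, Matrix.cons_val_zero, Matrix.cons_val_one]
  rw [← hD, hD1]
  rw [hD2] at h2
  linarith

theorem ContDiffAt.comp_ofReal_exp {Q : ℂ → ℝ} {y : ℝ} {m : ℕ}
    (hQ : ContDiffAt ℝ m Q (Real.exp y : ℂ)) :
    ContDiffAt ℝ m (fun t : ℝ => Q (Real.exp t : ℂ)) y := by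
  have h : ContDiff ℝ m fun t : ℝ => (Real.exp t : ℂ) :=
    Complex.ofRealCLM.contDiff.comp Real.contDiff_exp
  exact ContDiffAt.comp y hQ h.contDiffAt

theorem contDiffAt_logProfile {Q : ℂ → ℝ} {y : ℝ} {m : ℕ}
    (hQ : ContDiffAt ℝ m Q (Real.exp y : ℂ)) (M v : ℝ) :
    ContDiffAt ℝ m (logProfile Q M v) y :=
  ((ContDiffAt.comp_ofReal_exp hQ).sub (contDiffAt_const.mul contDiffAt_id)).sub contDiffAt_const

theorem iteratedDeriv_two_logProfile {Q : ℂ → ℝ} (hr : IsRadial Q) {y : ℝ}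
    (hQ : ContDiffAt ℝ 2 Q (Real.exp y : ℂ)) (M v : ℝ) :
    iteratedDeriv 2 (logProfile Q M v) y = 4 * Real.exp y ^ 2 * lap Q (Real.exp y : ℂ) := by
  rw [← deriv_deriv_comp_exp hr hQ]
  set G : ℝ → ℝ := fun t => Q (Real.exp t : ℂ) with hG
  have e1 : deriv (fun t : ℝ => Q (Real.exp (y + t) : ℂ)) = fun t => deriv G (y + t) := by
    funext t; exact deriv_comp_const_add G y t
  rw [e1, deriv_comp_const_add (deriv G) y 0, add_zero, iteratedDeriv_succ, iteratedDeriv_one]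
  have hev : deriv (logProfile Q M v) =ᶠ[𝓝 y] fun t => deriv G t - 2 * M := by
    have h1 : ∀ᶠ t in 𝓝 y, ContDiffAt ℝ 2 G t :=
      (ContDiffAt.comp_ofReal_exp (m := 2) hQ).eventually (by simp)
    filter_upwards [h1] with t ht
    have h2 := (ht.differentiableAt (by norm_num)).hasDerivAt
    have h3 := (h2.sub ((hasDerivAt_id t).const_mul (2 * M))).sub_const v
    rw [mul_one] at h3
    exact h3.deriv
  rw [hev.deriv_eq, deriv_sub_const]

theorem hasDerivAt_iteratedDeriv {f : ℝ → ℝ} {y : ℝ} {k : ℕ} (hf : ContDiffAt ℝ (k + 1 : ℕ) f y) :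
    HasDerivAt (iteratedDeriv k f) (iteratedDeriv (k + 1) f y) y := by
  rw [iteratedDeriv_succ]
  refine DifferentiableAt.hasDerivAt ?_
  rw [iteratedDeriv_eq_equiv_comp]
  exact (LinearIsometryEquiv.differentiable _).differentiableAt.comp y
    (hf.differentiableAt_iteratedFDeriv (by exact_mod_cast Nat.lt_succ_self k))

/-- The radial derivative of the Laplacian in terms of the logarithmic variable. -/
theorem radialDeriv_lap {Q : ℂ → ℝ} (hr : IsRadial Q) {y : ℝ}
    (hQ : ContDiffAt ℝ 3 Q (Real.exp y : ℂ)) (M v : ℝ) :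
    4 * Real.exp y ^ 3 * radialDeriv (lap Q) (Real.exp y) =
      iteratedDeriv 3 (logProfile Q M v) y - 2 * iteratedDeriv 2 (logProfile Q M v) y := by
  have hpos := Real.exp_pos y
  have hcont : Tendsto (fun x : ℝ => (x : ℂ)) (𝓝 (Real.exp y)) (𝓝 (Real.exp y : ℂ)) :=
    Complex.continuous_ofReal.tendsto _
  have hev : (fun x : ℝ => lap Q (x : ℂ)) =ᶠ[𝓝 (Real.exp y)] fun x =>
      iteratedDeriv 2 (logProfile Q M v) (Real.log x) / (4 * x ^ 2) := by
    filter_upwards [hcont.eventually (hQ.eventually (by simp)), lt_mem_nhds hpos] with x hx hx0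
    have hx' : ContDiffAt ℝ 2 Q (Real.exp (Real.log x) : ℂ) := by
      rw [Real.exp_log hx0]; exact hx.of_le (by norm_num)
    rw [iteratedDeriv_two_logProfile hr hx', Real.exp_log hx0]
    field_simp
  have h1 : HasDerivAt (iteratedDeriv 2 (logProfile Q M v)) (iteratedDeriv 3 (logProfile Q M v) y)
      (Real.log (Real.exp y)) := by
    rw [Real.log_exp]
    exact hasDerivAt_iteratedDeriv (contDiffAt_logProfile (m := 3) hQ M v)
  have h2 := h1.comp (Real.exp y) (Real.hasDerivAt_log hpos.ne')
  have h3 := h2.div ((hasDerivAt_pow 2 (Real.exp y)).const_mul 4) (by positivity)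
  rw [radialDeriv, hev.deriv_eq]
  have h4 := h3.deriv
  simp only [Function.comp, Real.log_exp] at h4
  have h5 : deriv (fun x => iteratedDeriv 2 (logProfile Q M v) (Real.log x) / (4 * x ^ 2)) (Real.exp y) = _ := h4
  rw [h5]
  push_cast
  field_simp

/-- Both end points of the gap are limits of points outside of the support, so they lie on its
frontier, where positivity is assumed. -/
theorem lap_radius_pos {Q : ℂ → ℝ} {σ : Measure ℂ} {N : ℕ} {a b : ℕ → ℝ}
    (hQ : IsRadialPotential Q σ N a b) {k : ℕ} (hk : k < N) :
    0 < lap Q (b k : ℂ) ∧ 0 < lap Q (a (k + 1) : ℂ) := by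
  have hlt := hQ.radius_lt_succ k hk
  have hbpos : 0 < b k := (radius_nonneg_of_le hQ hk.le).trans_lt (hQ.radius_lt k hk.le)
  have hapos := hbpos.trans hlt
  have hc : Continuous fun x : ℝ => (x : ℂ) := Complex.continuous_ofReal
  have hgap : ∀ x : ℝ, b k < x → x < a (k + 1) → (x : ℂ) ∉ σ.support := by
    intro x h1 h2
    refine notMem_support_of_gap hQ ?_ ?_ hk <;>
      rwa [Complex.norm_real, Real.norm_of_nonneg (by linarith)]
  refine ⟨hQ.lap_pos _ ⟨subset_closure (mem_support_of_norm hQ hk.le ?_ ?_), fun hint => ?_⟩,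
    hQ.lap_pos _ ⟨subset_closure (mem_support_of_norm hQ (Nat.succ_le_of_lt hk) ?_ ?_), fun hint => ?_⟩⟩
  · rw [Complex.norm_real, Real.norm_of_nonneg hbpos.le]; exact (hQ.radius_lt k hk.le).le
  · rw [Complex.norm_real, Real.norm_of_nonneg hbpos.le]
  · have h1 := (hc.tendsto (b k)).eventually (mem_interior_iff_mem_nhds.1 hint)
    have h2 : ∀ᶠ x in 𝓝[>] b k, x < a (k + 1) := nhdsWithin_le_nhds (gt_mem_nhds hlt)
    obtain ⟨x, ⟨hx1, hx2⟩, hx3⟩ := (((h1.filter_mono nhdsWithin_le_nhds).and h2).and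
      self_mem_nhdsWithin).exists
    exact hgap x hx3 hx2 hx1
  · rw [Complex.norm_real, Real.norm_of_nonneg hapos.le]
  · rw [Complex.norm_real, Real.norm_of_nonneg hapos.le]; exact (hQ.radius_lt (k + 1) hk).le
  · have h1 := (hc.tendsto (a (k + 1))).eventually (mem_interior_iff_mem_nhds.1 hint)
    have h2 : ∀ᶠ x in 𝓝[<] a (k + 1), b k < x := nhdsWithin_le_nhds (lt_mem_nhds hlt)
    obtain ⟨x, ⟨hx1, hx2⟩, hx3⟩ := (((h1.filter_mono nhdsWithin_le_nhds).and h2).and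
      self_mem_nhdsWithin).exists
    exact hgap x hx2 hx3 hx1

/-- Polar coordinates with `r = e^y` turn `dA` into `2 e^{2y} dy`. No integrability is required, so
monomials outside of `L²` are covered. -/
theorem integral_areaMeasure_radial (h : ℝ → ℝ) :
    ∫ z : ℂ, h ‖z‖ ∂areaMeasure = 2 * ∫ y : ℝ, Real.exp (2 * y) * h (Real.exp y) := by
  have h1 := Complex.integral_comp_polarCoord_symm (fun z : ℂ => h ‖z‖)
  have h2 : ∫ p in polarCoord.target, p.1 • h ‖Complex.polarCoord.symm p‖ =
      ∫ p in Set.Ioi (0 : ℝ) ×ˢ Set.Ioo (-Real.pi) Real.pi, (p.1 * h p.1) * (fun _ => (1 : ℝ)) p.2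
        ∂((volume : Measure ℝ).prod volume) := by
    rw [← Measure.volume_eq_prod, ← polarCoord_target]
    refine setIntegral_congr_fun polarCoord.open_target.measurableSet fun p hp => ?_
    rw [polarCoord_target] at hp
    simp only [Complex.norm_polarCoord_symm, abs_of_pos (Set.mem_Ioi.1 hp.1), smul_eq_mul, mul_one]
  have h3 : ∫ x in Set.Ioi (0 : ℝ), x * h x = ∫ y : ℝ, Real.exp (2 * y) * h (Real.exp y) := by
    have := integral_image_eq_integral_abs_deriv_smul (s := Set.univ) MeasurableSet.univ
      (fun x _ => (Real.hasDerivAt_exp x).hasDerivWithinAt) Real.exp_injective.injOn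
      (fun x => x * h x)
    rw [Set.image_univ, Real.range_exp, setIntegral_univ] at this
    rw [this]
    refine integral_congr_ae (Eventually.of_forall fun y => ?_)
    simp only [abs_of_pos (Real.exp_pos y), smul_eq_mul]
    rw [two_mul, Real.exp_add]; ring
  have h4 := setIntegral_prod_mul (μ := (volume : Measure ℝ)) (ν := (volume : Measure ℝ))
    (fun x : ℝ => x * h x) (fun _ : ℝ => (1 : ℝ)) (Set.Ioi 0) (Set.Ioo (-Real.pi) Real.pi)
  rw [h2, h4, h3] at h1
  rw [areaMeasure, integral_smul_measure, ← h1]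
  simp only [integral_const, MeasurableSet.univ, measureReal_restrict_apply, Set.univ_inter, smul_eq_mul,
    mul_one, Real.volume_real_Ioo]
  rw [ENNReal.toReal_ofReal (by positivity), max_eq_left (by linarith [Real.pi_pos])]
  field_simp
  ring

theorem norm_weightedMonomial_sq (V : ℂ → ℝ) (n j : ℕ) (z : ℂ) :
    ‖weightedMonomial V n j z‖ ^ 2 = ‖z‖ ^ (2 * j) * Real.exp (-(n * V z)) := by
  rw [weightedMonomial, norm_mul, norm_pow, Complex.norm_real, Real.norm_of_nonneg (Real.exp_pos _).le,
    mul_pow, ← Real.exp_nat_mul, ← pow_mul, mul_comm j 2]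
  congr 2; push_cast; ring

theorem onePoint_eq_sum (V : ℂ → ℝ) (n : ℕ) (z : ℂ) :
    onePoint V n z = ∑ j ∈ Finset.range n, ‖weightedMonomial V n j z‖ ^ 2 / sqNorm V n j := by
  rw [onePoint, corrKernel, Complex.re_sum]
  refine Finset.sum_congr rfl fun j _ => ?_
  rw [Complex.mul_conj, Complex.normSq_eq_norm_sq, ← Complex.ofReal_div, Complex.ofReal_re]

/-- The one-point function of the perturbed potential in the logarithmic variable. -/
theorem onePoint_perturbed_eq {Q lam : ℂ → ℝ} (hQ : IsRadial Q) (hlam : IsRadial lam) (M v s : ℝ)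
    {n : ℕ} (hn : 0 < n) {z : ℂ} {y : ℝ} (hz : ‖z‖ = Real.exp y) :
    onePoint (perturbed Q lam s n) n z =
      1 / (2 * Real.exp y ^ 2) * gapSum (logProfile Q M v) (logAmplitude lam s) M n y := by
  have hn' : (n : ℝ) ≠ 0 := by exact_mod_cast hn.ne'
  have hV : ∀ (j : ℕ) (w : ℂ) (t : ℝ), ‖w‖ = Real.exp t →
      ‖weightedMonomial (perturbed Q lam s n) n j w‖ ^ 2 = Real.exp (-(n * v)) * Real.exp (-(2 * t)) *
        gapWeight (logProfile Q M v) (logAmplitude lam s) n (j - n * M) t := by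
    intro j w t hw
    rw [norm_weightedMonomial_sq, gapWeight, logProfile, logAmplitude, perturbed, hQ w, hlam w, hw,
      ← Real.exp_nat_mul, ← Real.exp_add, ← Real.exp_add, ← Real.exp_add]
    congr 1
    push_cast
    field_simp
    ring
  have hN : ∀ j : ℕ, sqNorm (perturbed Q lam s n) n j = 2 * (Real.exp (-(n * v)) *
      ∫ t, gapWeight (logProfile Q M v) (logAmplitude lam s) n (j - n * M) t) := by
    intro j
    have h1 : ∀ w : ℂ, ‖weightedMonomial (perturbed Q lam s n) n j w‖ ^ 2 =
        (fun r : ℝ => ‖weightedMonomial (perturbed Q lam s n) n j (r : ℂ)‖ ^ 2) ‖w‖ := by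
      intro w
      simp only [norm_weightedMonomial_sq, Complex.norm_real, norm_norm, perturbed]
      rw [hQ w, hlam w]
    rw [sqNorm, integral_congr_ae (Eventually.of_forall h1), integral_areaMeasure_radial
      (fun r : ℝ => ‖weightedMonomial (perturbed Q lam s n) n j (r : ℂ)‖ ^ 2)]
    congr 1
    rw [← integral_const_mul]
    refine integral_congr_ae (Eventually.of_forall fun t => ?_)
    simp only
    rw [hV j (Real.exp t : ℂ) t (by rw [Complex.norm_real, Real.norm_of_nonneg (Real.exp_pos t).le])]
    have : Real.exp (2 * t) * Real.exp (-(2 * t)) = 1 := by rw [← Real.exp_add]; simp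
    linear_combination (Real.exp (-(n * v)) *
      gapWeight (logProfile Q M v) (logAmplitude lam s) n (j - n * M) t) * this
  rw [onePoint_eq_sum, gapSum, Finset.mul_sum]
  refine Finset.sum_congr rfl fun j _ => ?_
  rw [hV j z y hz, hN j]
  have h2 : Real.exp (-(2 * y)) = 1 / Real.exp y ^ 2 := by
    rw [Real.exp_neg, one_div, ← Real.exp_nat_mul]; norm_num
  rw [h2]
  have h3 : Real.exp (-(n * v)) ≠ 0 := (Real.exp_pos _).ne'
  -- The integral of the positive weight can vanish only by convention, when the weight is not
  -- integrable. Both sides are then zero.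
  by_cases h4 : (∫ t, gapWeight (logProfile Q M v) (logAmplitude lam s) n (j - n * M) t) = 0
  · simp [h4]
  · field_simp

theorem LocalModel.mono {U a : ℝ → ℝ} {y₀ ρ C ρ' C' : ℝ} (h : LocalModel U a y₀ ρ C)
    (hρ' : 0 < ρ') (hρ : ρ' ≤ ρ) (hC : C ≤ C') : LocalModel U a y₀ ρ' C' := by
  have h1 := h.one_le
  refine ⟨hρ', h1.trans hC, h.measurable_U, h.measurable_a, ?_, ?_, ?_, ?_, ?_, ?_⟩
  · intro y z hy hz
    refine (h.taylor_U y z (hy.trans hρ) (hz.trans hρ)).trans ?_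
    gcongr
  · intro y z hy hz
    refine (h.taylor_a y z (hy.trans hρ) (hz.trans hρ)).trans ?_
    gcongr
  · intro y hy
    exact le_trans (by gcongr) (h.le_U2 y (hy.trans hρ))
  · exact fun y hy => (h.U2_le y (hy.trans hρ)).trans hC
  · exact fun y hy => (h.U3_le y (hy.trans hρ)).trans hC
  · exact fun y hy => (h.a1_le y (hy.trans hρ)).trans hC

theorem droplet_bounded {Q : ℂ → ℝ} {σ : Measure ℂ} {N : ℕ} {a b : ℕ → ℝ}
    (hQ : IsRadialPotential Q σ N a b) {z : ℂ} (hz : z ∈ σ.support) : ‖z‖ ≤ b N := by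
  rw [hQ.droplet_eq] at hz
  obtain ⟨i, hi, -, h⟩ := hz
  exact h.trans (radii_mono hQ hi le_rfl).2

theorem exists_abs_logAmplitude_le {lam : ℂ → ℝ} (hlam : Continuous lam)
    (hc : HasCompactSupport lam) (s : ℝ) : ∃ C : ℝ, ∀ y, |logAmplitude lam s y| ≤ 2 * |y| + C := by
  obtain ⟨B, hB⟩ := hc.exists_bound_of_continuous hlam
  refine ⟨|s| * B, fun y => ?_⟩
  rw [logAmplitude]
  refine (abs_add_le _ _).trans ?_
  rw [abs_mul, abs_mul, abs_two]
  gcongr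
  exact hB _

theorem contDiffAt_logAmplitude {lam : ℂ → ℝ} {m : ℕ} (hlam : ContDiff ℝ m lam) (s y : ℝ) :
    ContDiffAt ℝ m (logAmplitude lam s) y :=
  (contDiffAt_const.mul contDiffAt_id).add
    (contDiffAt_const.mul (ContDiffAt.comp_ofReal_exp hlam.contDiffAt))

/-- The wells of the effective potential of a gap of the droplet. -/
theorem exists_gapModel {Q : ℂ → ℝ} {σ : Measure ℂ} {N : ℕ} {a b : ℕ → ℝ}
    (hQ : IsRadialPotential Q σ N a b) {k : ℕ} (hk : k < N)
    (hQ₁ : ContDiffAt ℝ 4 Q (b k : ℂ)) (hQ₂ : ContDiffAt ℝ 4 Q (a (k + 1) : ℂ))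
    {lam : ℂ → ℝ} (hlam : ContDiff ℝ 2 lam) (hc : HasCompactSupport lam) (s : ℝ) :
    ∃ M v ρ C : ℝ, 0 < M ∧ M < 1 ∧ gapB Q (b k) (a (k + 1)) = 2 * M ∧
      GapModel (logProfile Q M v) (logAmplitude lam s) (Real.log (b k)) (Real.log (a (k + 1))) ρ C := by
  obtain ⟨M, v, hM0, hM1, he1, he2, hpos⟩ := exists_gap_effective_potential hQ hk
  have hlt := hQ.radius_lt_succ k hk
  have hbpos : 0 < b k := (radius_nonneg_of_le hQ hk.le).trans_lt (hQ.radius_lt k hk.le)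
  have hapos := hbpos.trans hlt
  obtain ⟨hl₁, hl₂⟩ := lap_radius_pos hQ hk
  set r₁ := b k with hr₁
  set r₂ := a (k + 1) with hr₂
  set y₁ := Real.log r₁ with hy₁
  set y₂ := Real.log r₂ with hy₂
  have hexp₁ : Real.exp y₁ = r₁ := Real.exp_log hbpos
  have hexp₂ : Real.exp y₂ = r₂ := Real.exp_log hapos
  have hy12 : y₁ < y₂ := Real.log_lt_log hbpos hlt
  have hexpc : Continuous fun y : ℝ => (Real.exp y : ℂ) :=
    Complex.continuous_ofReal.comp Real.continuous_exp
  set U := logProfile Q M v with hU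
  have hUm : Measurable U := by
    have h1 := hQ.lowerSemicontinuous.measurable.comp hexpc.measurable
    exact (h1.sub (measurable_id.const_mul (2 * M))).sub_const v
  have ham : Measurable (logAmplitude lam s) := by
    have h1 := hlam.continuous.measurable.comp hexpc.measurable
    exact (measurable_id.const_mul 2).add (h1.const_mul s)
  have hU₁ : U y₁ = 0 := by rw [hU, logProfile, hexp₁, hy₁]; linarith
  have hU₂ : U y₂ = 0 := by rw [hU, logProfile, hexp₂, hy₂]; linarith
  have hposU : ∀ y, y ≠ y₁ → y ≠ y₂ → 0 < Q (Real.exp y : ℂ) - 2 * M * y - v := by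
    intro y h1 h2
    have := hpos (Real.exp y) (Real.exp_pos y) (fun h => h1 (by rw [hy₁, ← h, Real.log_exp]))
      (fun h => h2 (by rw [hy₂, ← h, Real.log_exp]))
    rw [Real.log_exp] at this
    linarith
  have hnn : ∀ y, 0 ≤ U y := by
    intro y
    rcases eq_or_ne y y₁ with rfl | h1
    · exact hU₁.ge
    rcases eq_or_ne y y₂ with rfl | h2
    · exact hU₂.ge
    exact (hposU y h1 h2).le
  -- A zero of the nonnegative function `U` is a minimum. This gives the critical point condition
  -- without an explicit formula for the derivative of `Q` at the edges.
  have hd : ∀ y, U y = 0 → deriv U y = 0 := fun y hy =>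
    IsLocalMin.deriv_eq_zero (Eventually.of_forall fun t => by rw [hy]; exact hnn t)
  rw [← hexp₁] at hQ₁ hl₁
  rw [← hexp₂] at hQ₂ hl₂
  have h2₁ : 0 < iteratedDeriv 2 U y₁ := by
    rw [hU, iteratedDeriv_two_logProfile hQ.radial (hQ₁.of_le (by norm_num))]; positivity
  have h2₂ : 0 < iteratedDeriv 2 U y₂ := by
    rw [hU, iteratedDeriv_two_logProfile hQ.radial (hQ₂.of_le (by norm_num))]; positivity
  obtain ⟨ρ₁, C₁, hm₁⟩ := exists_localModel hUm ham (contDiffAt_logProfile (m := 4) hQ₁ M v)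
    (contDiffAt_logAmplitude (m := 2) hlam s y₁) h2₁
  obtain ⟨ρ₂, C₂, hm₂⟩ := exists_localModel hUm ham (contDiffAt_logProfile (m := 4) hQ₂ M v)
    (contDiffAt_logAmplitude (m := 2) hlam s y₂) h2₂
  obtain ⟨C₃, hC₃⟩ := exists_abs_logAmplitude_le hlam.continuous hc s
  have hρ : 0 < min ρ₁ ρ₂ := lt_min hm₁.rho_pos hm₂.rho_pos
  refine ⟨M, v, min ρ₁ ρ₂, max (max C₁ C₂) C₃, hM0, hM1, ?_, hy12,
    hm₁.mono hρ (min_le_left _ _) ((le_max_left _ _).trans (le_max_left _ _)),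
    hm₂.mono hρ (min_le_right _ _) ((le_max_right _ _).trans (le_max_left _ _)),
    hU₁, hU₂, hd _ hU₁, hd _ hU₂, hnn, ?_, fun y => (hC₃ y).trans (by gcongr; exact le_max_right _ _)⟩
  -- The effective potential takes the same value at both ends of the gap, which determines its
  -- slope.
  · rw [gapB, Real.log_div hapos.ne' hbpos.ne', ← hy₁, ← hy₂, div_eq_iff (sub_pos.2 hy12).ne']
    linarith
  · intro δ hδ
    exact gap_effective_potential_coercive hQ.lowerSemicontinuous hQ.growth hM0 hM1 hposU hδ

/-! ### Expansion in the boundary layer -/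

theorem contDiffAt_deriv {f : ℝ → ℝ} {y : ℝ} {m : ℕ} (hf : ContDiffAt ℝ (m + 1 : ℕ) f y) :
    ContDiffAt ℝ m (deriv f) y := by
  have h1 : ContDiffAt ℝ m (fderiv ℝ f) y := hf.fderiv_right (by norm_cast)
  have h2 := h1.clm_apply (contDiffAt_const (c := (1 : ℝ)))
  exact h2.congr_of_eventuallyEq (Eventually.of_forall fun x => fderiv_apply_one_eq_deriv.symm)

/-- Expansions of the derivatives of `U` and `a` at a critical point of `U`. -/
theorem exists_derivative_expansion {U a : ℝ → ℝ} {y₀ : ℝ} (hU : ContDiffAt ℝ 4 U y₀)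
    (ha : ContDiffAt ℝ 2 a y₀) (hd : deriv U y₀ = 0) :
    ∃ ρ K : ℝ, 0 < ρ ∧ 0 < K ∧ ∀ y, |y - y₀| ≤ ρ →
      |deriv U y - (iteratedDeriv 2 U y₀ * (y - y₀) + iteratedDeriv 3 U y₀ / 2 * (y - y₀) ^ 2)| ≤
        K * |y - y₀| ^ 3 ∧
      |iteratedDeriv 2 U y - (iteratedDeriv 2 U y₀ + iteratedDeriv 3 U y₀ * (y - y₀))| ≤
        K * |y - y₀| ^ 2 ∧
      |iteratedDeriv 3 U y - iteratedDeriv 3 U y₀| ≤ K * |y - y₀| ∧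
      |deriv a y - deriv a y₀| ≤ K * |y - y₀| := by
  have c1 : ContDiffAt ℝ (2 + 1 : ℕ) (deriv U) y₀ := contDiffAt_deriv (m := 3) hU
  have c2 : ContDiffAt ℝ (1 + 1 : ℕ) (deriv (deriv U)) y₀ := contDiffAt_deriv (m := 2) c1
  have c3 : ContDiffAt ℝ (0 + 1 : ℕ) (deriv (deriv (deriv U))) y₀ := contDiffAt_deriv (m := 1) c2
  have c4 : ContDiffAt ℝ (0 + 1 : ℕ) (deriv a) y₀ := contDiffAt_deriv (m := 1) ha
  have e2 : iteratedDeriv 2 U = deriv (deriv U) := by rw [iteratedDeriv_succ, iteratedDeriv_one]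
  have e3 : iteratedDeriv 3 U = deriv (deriv (deriv U)) := by rw [iteratedDeriv_succ, e2]
  have e2' : iteratedDeriv 2 (deriv U) = deriv (deriv (deriv U)) := by
    rw [iteratedDeriv_succ, iteratedDeriv_one]
  obtain ⟨ρ₁, K₁, hρ₁, hK₁, -, h1, -⟩ := exists_taylor_bound c1
  obtain ⟨ρ₂, K₂, hρ₂, hK₂, -, h2, -⟩ := exists_taylor_bound c2
  obtain ⟨ρ₃, K₃, hρ₃, hK₃, -, h3, -⟩ := exists_taylor_bound c3
  obtain ⟨ρ₄, K₄, hρ₄, hK₄, -, h4, -⟩ := exists_taylor_bound c4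
  refine ⟨min (min ρ₁ ρ₂) (min ρ₃ ρ₄), K₁ + K₂ + K₃ + K₄, by positivity, by positivity, fun y hy => ?_⟩
  rw [le_min_iff, le_min_iff, le_min_iff] at hy
  obtain ⟨⟨hy1, hy2⟩, hy3, hy4⟩ := hy
  have g1 := h1 y₀ y (by simp [hρ₁.le]) hy1
  have g2 := h2 y₀ y (by simp [hρ₂.le]) hy2
  have g3 := h3 y₀ y (by simp [hρ₃.le]) hy3
  have g4 := h4 y₀ y (by simp [hρ₄.le]) hy4
  simp only [Finset.sum_range_succ, Finset.sum_range_zero, iteratedDeriv_zero, iteratedDeriv_one, e2',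
    hd, zero_add, pow_zero, pow_one, mul_one, Nat.factorial, Nat.cast_one, div_one,
    Nat.reduceAdd] at g1 g2 g3 g4
  rw [e2, e3]
  have hn : 0 ≤ |y - y₀| := abs_nonneg _
  refine ⟨?_, ?_, ?_, ?_⟩
  · have e : deriv U y - (deriv (deriv U) y₀ * (y - y₀) + deriv (deriv (deriv U)) y₀ / 2 * (y - y₀) ^ 2) =
        deriv U y - (deriv (deriv U) y₀ * (y - y₀) + deriv (deriv (deriv U)) y₀ * (y - y₀) ^ 2 / 2) := by
      ring
    rw [e]
    exact g1.trans (by gcongr; linarith)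
  · exact g2.trans (by gcongr; linarith)
  · exact g3.trans (by gcongr; linarith)
  · exact g4.trans (by gcongr; linarith)

theorem abs_log_one_add_sub_le {x : ℝ} (hx : |x| ≤ 1 / 2) :
    |Real.log (1 + x)| ≤ 2 * |x| ∧ |Real.log (1 + x) - x| ≤ 2 * |x| ^ 2 ∧
      |Real.log (1 + x) - x + x ^ 2 / 2| ≤ 2 * |x| ^ 3 := by
  have h0 : |(-x)| < 1 := by rw [abs_neg]; linarith
  have hd : ∀ k : ℕ, |x| ^ k / (1 - |x|) ≤ 2 * |x| ^ k := by
    intro k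
    rw [div_le_iff₀ (by linarith)]
    nlinarith [pow_nonneg (abs_nonneg x) k]
  have g0 := Real.abs_log_sub_add_sum_range_le h0 0
  have g1 := Real.abs_log_sub_add_sum_range_le h0 1
  have g2 := Real.abs_log_sub_add_sum_range_le h0 2
  simp only [Finset.sum_range_succ, Finset.sum_range_zero, abs_neg, sub_neg_eq_add, zero_add] at g0 g1 g2
  refine ⟨?_, ?_, ?_⟩
  · exact (g0.trans (hd 1)).trans (by rw [pow_one])
  · refine le_trans (le_of_eq ?_) (g1.trans (hd 2))
    congr 1; norm_num; ring
  · refine le_trans (le_of_eq ?_) (g2.trans (hd 3))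
    congr 1; norm_num; ring

theorem abs_inv_sq_one_add_sub_one_le {x : ℝ} (hx : |x| ≤ 1 / 2) :
    0 < 1 / (1 + x) ^ 2 ∧ 1 / (1 + x) ^ 2 ≤ 4 ∧ |1 / (1 + x) ^ 2 - 1| ≤ 10 * |x| := by
  have hx1 : 1 / 4 ≤ (1 + x) ^ 2 := by nlinarith [(abs_le.1 hx).1]
  have hinv : 0 < 1 / (1 + x) ^ 2 := by positivity
  have hinv4 : 1 / (1 + x) ^ 2 ≤ 4 := by
    rw [div_le_iff₀ (by linarith)]; linarith
  refine ⟨hinv, hinv4, ?_⟩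
  have e : 1 / (1 + x) ^ 2 - 1 = -(1 / (1 + x) ^ 2 * (2 * x + x ^ 2)) := by
    have hne : 1 + x ≠ 0 := by intro h; rw [h] at hx1; norm_num at hx1
    field_simp; ring
  rw [e, abs_neg, abs_mul, abs_of_pos hinv]
  have h1 : |2 * x + x ^ 2| ≤ 5 / 2 * |x| := by
    have h2 : |2 * x + x ^ 2| ≤ 2 * |x| + |x| ^ 2 := by
      refine (abs_add_le _ _).trans (le_of_eq ?_)
      rw [abs_mul, abs_two, abs_pow]
    nlinarith [abs_nonneg x]
  calc 1 / (1 + x) ^ 2 * |2 * x + x ^ 2| ≤ 4 * (5 / 2 * |x|) := by gcongr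
    _ = _ := by ring

section

variable {p k x h A B G : ℝ}

/-- In this group of bounds `x` stands for the relative displacement `σ t`, `h` for `log (1 + x)`
and `k` for `U''' / U''` at the edge. `A`, `B`, `G` are the first three derivatives of `U` at the
displaced point, divided by the curvature at the edge. The number `p` bounds `k` and all Taylor
errors. -/
theorem edge_curvature_bound (hp : 1 ≤ p) (hk : |k| ≤ p) (hx : |x| ≤ 1 / (8 * p)) (hh : |h| ≤ 2 * |x|)
    (hB : |B - (1 + k * h)| ≤ p * |h| ^ 2) : |B - 1| ≤ 4 * p * |x| ∧ 1 / 2 ≤ B := by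
  have hx' : p * |x| ≤ 1 / 8 := by
    rw [le_div_iff₀ (by positivity)] at hx; linarith
  have h1 : |h| ≤ 1 := by nlinarith [abs_nonneg x]
  have h2 : |B - 1| ≤ 4 * p * |x| := by
    have e : B - 1 = (B - (1 + k * h)) + k * h := by ring
    rw [e]
    refine (abs_add_le _ _).trans ?_
    have b1 : p * |h| ^ 2 ≤ p * (1 * |h|) := by
      rw [sq]; gcongr
    have b2 : |k * h| ≤ p * |h| := by rw [abs_mul]; gcongr
    have b3 : p * |h| ≤ p * (2 * |x|) := by gcongr
    linarith
  exact ⟨h2, by linarith [(abs_le.1 h2).1]⟩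

/-- The area factor `1 / (1 + x)²` contributes `-2 x`, so the relative slope of the leading term is
`k - 2`. -/
theorem edge_leading_bound (hp : 1 ≤ p) (hk : |k| ≤ p) (hx : |x| ≤ 1 / 2) (hh : |h| ≤ 2 * |x|)
    (hh2 : |h - x| ≤ 2 * |x| ^ 2) (hB : |B - (1 + k * h)| ≤ p * |h| ^ 2) :
    |1 / (1 + x) ^ 2 * B - (1 + (k - 2) * x)| ≤ 56 * p * |x| ^ 2 := by
  obtain ⟨hinv, hinv4, -⟩ := abs_inv_sq_one_add_sub_one_le hx
  have e : 1 / (1 + x) ^ 2 * B - (1 + (k - 2) * x) = 1 / (1 + x) ^ 2 *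
      ((B - (1 + k * h)) + k * (h - x) - x ^ 2 * (2 * k - 3 + (k - 2) * x)) := by
    have hne : 1 + x ≠ 0 := by intro h; rw [h] at hinv; norm_num at hinv
    field_simp; ring
  rw [e, abs_mul, abs_of_pos hinv]
  have b1 : |B - (1 + k * h)| ≤ 4 * p * |x| ^ 2 := by
    calc |B - (1 + k * h)| ≤ p * |h| ^ 2 := hB
      _ ≤ p * (2 * |x|) ^ 2 := by gcongr
      _ = _ := by ring
  have b2 : |k * (h - x)| ≤ 2 * p * |x| ^ 2 := by
    rw [abs_mul]
    calc |k| * |h - x| ≤ p * (2 * |x| ^ 2) := by gcongr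
      _ = _ := by ring
  have b3 : |x ^ 2 * (2 * k - 3 + (k - 2) * x)| ≤ 8 * p * |x| ^ 2 := by
    rw [abs_mul, abs_of_nonneg (sq_nonneg x), ← sq_abs x]
    have : |2 * k - 3 + (k - 2) * x| ≤ 8 * p := by
      have h1 : |(k - 2) * x| ≤ (p + 2) * 1 := by
        rw [abs_mul]
        gcongr
        · refine (abs_sub _ _).trans ?_
          rw [abs_two]; linarith
        · linarith
      have h2 := abs_le.1 hk
      have h3 := abs_le.1 h1
      rw [abs_le]; constructor <;> linarith [h2.1, h2.2, h3.1, h3.2]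
    calc |x| ^ 2 * |2 * k - 3 + (k - 2) * x| ≤ |x| ^ 2 * (8 * p) := by gcongr
      _ = _ := by ring
  calc 1 / (1 + x) ^ 2 * |(B - (1 + k * h)) + k * (h - x) - x ^ 2 * (2 * k - 3 + (k - 2) * x)|
      ≤ 4 * (4 * p * |x| ^ 2 + 2 * p * |x| ^ 2 + 8 * p * |x| ^ 2) := by
        gcongr
        exact (abs_sub _ _).trans (add_le_add ((abs_add_le _ _).trans (add_le_add b1 b2)) b3)
    _ = 56 * p * |x| ^ 2 := by ring

/-- The cubic coefficient disappears to this order, because `h + k h² / 2` is `h (1 + k h / 2)` and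
`1 + k h / 2` approximates `√B`. Only the expansion of the logarithm survives. -/
theorem edge_argument_bound (hp : 1 ≤ p) (hk : |k| ≤ p) (hx : |x| ≤ 1 / (8 * p)) (hh : |h| ≤ 2 * |x|)
    (hh3 : |h - x + x ^ 2 / 2| ≤ 2 * |x| ^ 3) (hA : |A - (h + k / 2 * h ^ 2)| ≤ p * |h| ^ 3)
    (hB : |B - (1 + k * h)| ≤ p * |h| ^ 2) :
    |A / √B - x + x ^ 2 / 2| ≤ 60 * p ^ 2 * |x| ^ 3 := by
  obtain ⟨-, hB2⟩ := edge_curvature_bound hp hk hx hh hB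
  have hx' : p * |x| ≤ 1 / 8 := by
    rw [le_div_iff₀ (by positivity)] at hx; linarith
  have hξ0 := abs_nonneg x
  have hp2 : p ≤ p ^ 2 := le_self_pow₀ hp (by norm_num)
  set S := √B with hS
  have hSsq : S * S = B := Real.mul_self_sqrt (by linarith)
  have hSlow : 1 / 2 ≤ S := Real.le_sqrt_of_sq_le (by linarith)
  set m := 1 + k * h / 2 with hm
  have hkh : |k * h| ≤ 2 * p * |x| := by
    rw [abs_mul]
    calc |k| * |h| ≤ p * (2 * |x|) := by gcongr
      _ = _ := by ring
  have hm0 : 1 / 2 ≤ m := by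
    have := (abs_le.1 hkh).1
    rw [hm]; linarith
  have hSm : |S - m| ≤ 5 * p ^ 2 * |x| ^ 2 := by
    have e : (S - m) * (S + m) = (B - (1 + k * h)) - (k * h) ^ 2 / 4 := by
      rw [hm]; linear_combination hSsq
    have b1 : |(S - m) * (S + m)| ≤ 5 * p ^ 2 * |x| ^ 2 := by
      rw [e]
      have c1 : |B - (1 + k * h)| ≤ 4 * p ^ 2 * |x| ^ 2 := by
        calc |B - (1 + k * h)| ≤ p * |h| ^ 2 := hB
          _ ≤ p ^ 2 * (2 * |x|) ^ 2 := by gcongr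
          _ = _ := by ring
      have c2 : |(k * h) ^ 2 / 4| ≤ p ^ 2 * |x| ^ 2 := by
        rw [abs_of_nonneg (by positivity), ← sq_abs]
        calc |k * h| ^ 2 / 4 ≤ (2 * p * |x|) ^ 2 / 4 := by gcongr
          _ = _ := by ring
      exact (abs_sub _ _).trans ((add_le_add c1 c2).trans (le_of_eq (by ring)))
    rw [abs_mul, abs_of_pos (by linarith : 0 < S + m)] at b1
    have : |S - m| * 1 ≤ |S - m| * (S + m) := by gcongr; linarith
    linarith
  have e : A / S - x + x ^ 2 / 2 = ((A - (h + k / 2 * h ^ 2)) - (S - m) * h) / S +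
      (h - x + x ^ 2 / 2) := by
    rw [hm]; field_simp; ring
  have hA' : |A - (h + k / 2 * h ^ 2)| ≤ 8 * p ^ 2 * |x| ^ 3 := by
    calc |A - (h + k / 2 * h ^ 2)| ≤ p * |h| ^ 3 := hA
      _ ≤ p ^ 2 * (2 * |x|) ^ 3 := by gcongr
      _ = _ := by ring
  have hSh : |(S - m) * h| ≤ 10 * p ^ 2 * |x| ^ 3 := by
    rw [abs_mul]
    calc |S - m| * |h| ≤ (5 * p ^ 2 * |x| ^ 2) * (2 * |x|) := by gcongr
      _ = _ := by ring
  rw [e]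
  have b1 : |((A - (h + k / 2 * h ^ 2)) - (S - m) * h) / S| ≤ 36 * p ^ 2 * |x| ^ 3 := by
    rw [abs_div, abs_of_pos (by linarith : 0 < S), div_le_iff₀ (by linarith)]
    calc |A - (h + k / 2 * h ^ 2) - (S - m) * h| ≤ 8 * p ^ 2 * |x| ^ 3 + 10 * p ^ 2 * |x| ^ 3 :=
          (abs_sub _ _).trans (add_le_add hA' hSh)
      _ = 36 * p ^ 2 * |x| ^ 3 * (1 / 2) := by ring
      _ ≤ _ := by gcongr
  have b3 : 1 * |x| ^ 3 ≤ p ^ 2 * |x| ^ 3 := by gcongr; exact one_le_pow₀ hp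
  have b4 : 0 ≤ p ^ 2 * |x| ^ 3 := by positivity
  refine (abs_add_le _ _).trans ?_
  linarith

theorem edge_scale_bound (hp : 1 ≤ p) (hk : |k| ≤ p) (hx : |x| ≤ 1 / (8 * p)) (hh : |h| ≤ 2 * |x|)
    (hB : |B - (1 + k * h)| ≤ p * |h| ^ 2) : |1 / (1 + x) ^ 2 * √B - 1| ≤ 26 * p * |x| := by
  obtain ⟨hB1, hB2⟩ := edge_curvature_bound hp hk hx hh hB
  have hx2 : |x| ≤ 1 / 2 := by
    refine hx.trans ?_
    rw [div_le_div_iff₀ (by positivity) (by norm_num)]; linarith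
  obtain ⟨hinv, hinv4, hinv1⟩ := abs_inv_sq_one_add_sub_one_le hx2
  set q := √B with hq
  have hqq : q * q = B := Real.mul_self_sqrt (by linarith)
  have hqn : 0 ≤ q := Real.sqrt_nonneg _
  have hq1 : |q - 1| ≤ 4 * p * |x| := by
    have e : (q - 1) * (q + 1) = B - 1 := by linear_combination hqq
    rw [← e, abs_mul, abs_of_pos (by linarith : 0 < q + 1)] at hB1
    have : |q - 1| * 1 ≤ |q - 1| * (q + 1) := by gcongr; linarith
    linarith
  have e : 1 / (1 + x) ^ 2 * q - 1 = 1 / (1 + x) ^ 2 * (q - 1) + (1 / (1 + x) ^ 2 - 1) := by ring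
  rw [e]
  have b1 : |1 / (1 + x) ^ 2 * (q - 1)| ≤ 16 * p * |x| := by
    rw [abs_mul, abs_of_pos hinv]
    calc 1 / (1 + x) ^ 2 * |q - 1| ≤ 4 * (4 * p * |x|) := by gcongr
      _ = _ := by ring
  have b3 : 1 * |x| ≤ p * |x| := by gcongr
  refine (abs_add_le _ _).trans ?_
  linarith

theorem edge_cubic_bound (hp : 1 ≤ p) (hk : |k| ≤ p) (hx : |x| ≤ 1 / (8 * p)) (hh : |h| ≤ 2 * |x|)
    (hB : |B - (1 + k * h)| ≤ p * |h| ^ 2) (hG : |G - k| ≤ p * |h|) :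
    |G / (3 * B) - k / 3| ≤ 4 * p ^ 2 * |x| := by
  obtain ⟨hB1, hB2⟩ := edge_curvature_bound hp hk hx hh hB
  have hB0 : 0 < B := by linarith
  have e : G / (3 * B) - k / 3 = ((G - k) - k * (B - 1)) / (3 * B) := by field_simp; ring
  rw [e, abs_div, abs_of_pos (by positivity : 0 < 3 * B), div_le_iff₀ (by positivity)]
  have b1 : |G - k| ≤ 2 * p * |x| := by
    calc |G - k| ≤ p * |h| := hG
      _ ≤ p * (2 * |x|) := by gcongr
      _ = _ := by ring
  have b2 : |k * (B - 1)| ≤ 4 * p ^ 2 * |x| := by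
    rw [abs_mul]
    calc |k| * |B - 1| ≤ p * (4 * p * |x|) := by gcongr
      _ = _ := by ring
  have b3 : 2 * p * |x| ≤ 2 * p ^ 2 * |x| := by gcongr; exact le_self_pow₀ hp (by norm_num)
  calc |(G - k) - k * (B - 1)| ≤ 6 * p ^ 2 * |x| := by
        refine (abs_sub _ _).trans ?_
        linarith
    _ = 4 * p ^ 2 * |x| * (3 * (1 / 2)) := by ring
    _ ≤ _ := by gcongr

end

theorem erfc_le_two (t : ℝ) : erfc t ≤ 2 := by
  have hpi : 0 < √Real.pi := Real.sqrt_pos.2 Real.pi_pos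
  have h1 : ∫ x in Set.Ioi t, Real.exp (-x ^ 2) ≤ ∫ x, Real.exp (-x ^ 2) :=
    setIntegral_le_integral integrable_exp_neg_sq (Eventually.of_forall fun x => (Real.exp_pos _).le)
  have h2 : ∫ x : ℝ, Real.exp (-x ^ 2) = √Real.pi := by simpa using integral_gaussian 1
  rw [h2] at h1
  calc erfc t ≤ 2 / √Real.pi * √Real.pi := by rw [erfc]; gcongr
    _ = 2 := by field_simp

theorem two_div_sqrt_pi_le : 2 / √Real.pi ≤ 2 := by
  have : 1 ≤ √Real.pi := by rw [Real.one_le_sqrt]; linarith [Real.pi_gt_three]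
  exact div_le_self (by norm_num) this

theorem abs_exp_neg_sq_sub_le (w t : ℝ) : |Real.exp (-w ^ 2) - Real.exp (-t ^ 2)| ≤ |w - t| := by
  have := abs_sub_le_of_hasDerivAt (K := 1) convex_univ hasDerivAt_exp_neg_sq (fun x _ => ?_)
    (Set.mem_univ t) (Set.mem_univ w)
  · simpa using this
  · rw [abs_mul, abs_of_pos (Real.exp_pos _), Real.exp_neg, inv_mul_le_iff₀ (Real.exp_pos _), mul_one,
      abs_neg, abs_mul, abs_two]
    have := Real.add_one_le_exp (x ^ 2)
    nlinarith [sq_nonneg (|x| - 1), sq_abs x]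

theorem sq_mul_exp_neg_sq_le (w : ℝ) : w ^ 2 * Real.exp (-w ^ 2) ≤ 1 := by
  rw [Real.exp_neg, ← div_eq_mul_inv, div_le_one (Real.exp_pos _)]
  linarith [Real.add_one_le_exp (w ^ 2)]

/-- The polynomial factor is unbounded over the boundary layer, so the whole product is estimated.
Its Lipschitz constant does not depend on the position. -/
theorem abs_sq_mul_exp_neg_sq_sub_le (w t : ℝ) :
    |w ^ 2 * Real.exp (-w ^ 2) - t ^ 2 * Real.exp (-t ^ 2)| ≤ 4 * |w - t| := by
  have hd : ∀ x : ℝ, HasDerivAt (fun x : ℝ => x ^ 2 * Real.exp (-x ^ 2))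
      ((2 * x - 2 * x ^ 3) * Real.exp (-x ^ 2)) x := by
    intro x
    exact ((hasDerivAt_pow 2 x).mul (hasDerivAt_exp_neg_sq x)).congr_deriv (by push_cast; ring)
  refine abs_sub_le_of_hasDerivAt convex_univ hd (fun x _ => ?_) (Set.mem_univ t) (Set.mem_univ w)
  rw [abs_mul, abs_of_pos (Real.exp_pos _), Real.exp_neg, ← div_eq_mul_inv, div_le_iff₀ (Real.exp_pos _)]
  have h1 : (1 + x ^ 2 / 2) ^ 2 ≤ Real.exp (x ^ 2) := by
    have h2 := Real.add_one_le_exp (x ^ 2 / 2)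
    have h3 : Real.exp (x ^ 2) = Real.exp (x ^ 2 / 2) ^ 2 := by
      rw [← Real.exp_nat_mul]; congr 1; push_cast; ring
    rw [h3]
    exact pow_le_pow_left₀ (by positivity) (by linarith) 2
  have h4 : |2 * x - 2 * x ^ 3| ≤ (1 + x ^ 2) ^ 2 := by
    have e : 2 * x - 2 * x ^ 3 = (2 * x) * (1 - x ^ 2) := by ring
    have h5 : |2 * x| ≤ 1 + x ^ 2 := by rw [abs_le]; constructor <;> nlinarith [sq_nonneg (x - 1), sq_nonneg (x + 1)]
    have h6 : |1 - x ^ 2| ≤ 1 + x ^ 2 := by rw [abs_le]; constructor <;> nlinarith [sq_nonneg x]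
    rw [e, abs_mul, sq (1 + x ^ 2)]
    exact mul_le_mul h5 h6 (abs_nonneg _) (by positivity)
  nlinarith [sq_nonneg x, sq_nonneg (x ^ 2)]

theorem abs_erfc_sub_le (w t : ℝ) : |erfc w - erfc t| ≤ 2 * |w - t| := by
  refine abs_sub_le_of_hasDerivAt convex_univ hasDerivAt_erfc (fun x _ => ?_) (Set.mem_univ t)
    (Set.mem_univ w)
  rw [abs_neg, abs_of_nonneg (by positivity)]
  have : Real.exp (-x ^ 2) ≤ 1 := Real.exp_le_one_iff.2 (by nlinarith [sq_nonneg x])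
  calc 2 / √Real.pi * Real.exp (-x ^ 2) ≤ 2 * 1 := by gcongr; exact two_div_sqrt_pi_le
    _ = 2 := by norm_num

theorem abs_erfc_taylor_le (w t : ℝ) :
    |erfc w - erfc t + 2 / √Real.pi * Real.exp (-t ^ 2) * (w - t)| ≤ 2 * (w - t) ^ 2 := by
  have hd : ∀ x : ℝ, HasDerivAt (fun x => erfc x + 2 / √Real.pi * Real.exp (-t ^ 2) * x)
      (-(2 / √Real.pi * (Real.exp (-x ^ 2) - Real.exp (-t ^ 2)))) x := by
    intro x
    exact ((hasDerivAt_erfc x).add ((hasDerivAt_id x).const_mul _)).congr_deriv (by ring)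
  have := abs_sub_le_of_hasDerivAt (K := 2 * |w - t|) (convex_uIcc t w) hd (fun x hx => ?_)
    Set.left_mem_uIcc Set.right_mem_uIcc
  · refine le_trans (le_of_eq ?_) (this.trans (le_of_eq ?_))
    · congr 1; ring
    · rw [mul_assoc, ← sq, sq_abs]
  · rw [abs_neg, abs_mul, abs_of_pos (by positivity : 0 < 2 / √Real.pi)]
    have h1 := abs_exp_neg_sq_sub_le x t
    have h2 : |x - t| ≤ |w - t| := Set.abs_sub_left_of_mem_uIcc hx
    have h3 := two_div_sqrt_pi_le
    exact mul_le_mul h3 (h1.trans h2) (abs_nonneg _) two_pos.le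

/-- Expansion of the error function part of the edge profile. -/
theorem edge_erfc_bound {P σ t r₂ w κ : ℝ} (hP : 1 ≤ P) (hσ : 0 < σ) (hσt : σ * (1 + |t|) ^ 2 ≤ 1)
    (hκ : |κ| ≤ P) (hr₂ : |r₂ - (1 + κ * (σ * t))| ≤ P * (σ ^ 2 * (1 + |t|) ^ 2))
    (hw : |w - t + σ * t ^ 2 / 2| ≤ P * (σ ^ 2 * (1 + |t|) ^ 3)) :
    |w - t| ≤ 2 * P * (σ * (1 + |t|) ^ 2) ∧
    |r₂ * (erfc w / 2) - ((1 + κ * (σ * t)) * (erfc t / 2) +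
      1 / √Real.pi * Real.exp (-t ^ 2) * (σ * t ^ 2 / 2))| ≤ 14 * P ^ 2 * (σ ^ 2 * (1 + |t|) ^ 4) := by
  set τ := 1 + |t| with hτ
  have hτ1 : 1 ≤ τ := by rw [hτ]; linarith [abs_nonneg t]
  have htτ : |t| ≤ τ := by rw [hτ]; linarith
  have ht2 : t ^ 2 ≤ τ ^ 2 := by rw [← sq_abs t]; gcongr
  have hστ : σ * τ ≤ 1 := le_trans (by gcongr; exact le_self_pow₀ hτ1 (by norm_num)) hσt
  have hPP : P ≤ P ^ 2 := le_self_pow₀ hP (by norm_num)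
  have hwt : |w - t| ≤ 2 * P * (σ * τ ^ 2) := by
    have e : w - t = (w - t + σ * t ^ 2 / 2) - σ * t ^ 2 / 2 := by ring
    rw [e]
    refine (abs_sub _ _).trans ?_
    have h1 : P * (σ ^ 2 * τ ^ 3) ≤ P * (σ * τ ^ 2) := by
      have : σ ^ 2 * τ ^ 3 = (σ * τ) * (σ * τ ^ 2) := by ring
      rw [this]
      have h2 : (σ * τ) * (σ * τ ^ 2) ≤ 1 * (σ * τ ^ 2) := by gcongr
      rw [one_mul] at h2
      gcongr
    have h2 : |σ * t ^ 2 / 2| ≤ P * (σ * τ ^ 2) := by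
      rw [abs_of_nonneg (by positivity)]
      have h3 : σ * t ^ 2 ≤ σ * τ ^ 2 := by gcongr
      have h4 : 1 * (σ * τ ^ 2) ≤ P * (σ * τ ^ 2) := by gcongr
      have h5 : 0 ≤ σ * τ ^ 2 := by positivity
      linarith
    linarith
  refine ⟨hwt, ?_⟩
  have hE1 : Real.exp (-t ^ 2) ≤ 1 := Real.exp_le_one_iff.2 (by nlinarith [sq_nonneg t])
  have hspi : 1 ≤ √Real.pi := by rw [Real.one_le_sqrt]; linarith [Real.pi_gt_three]
  have hipi : 1 / √Real.pi ≤ 1 := by rw [div_le_one (by linarith)]; exact hspi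
  -- The displacement `w - t` is `-σ t² / 2` to first order, and through the derivative of `erfc` it
  -- becomes the Gaussian term. The remaining summands are of second order in `σ`.
  have e : r₂ * (erfc w / 2) - ((1 + κ * (σ * t)) * (erfc t / 2) +
      1 / √Real.pi * Real.exp (-t ^ 2) * (σ * t ^ 2 / 2)) =
      (r₂ - (1 + κ * (σ * t))) * (erfc w / 2) +
      1 / 2 * (erfc w - erfc t + 2 / √Real.pi * Real.exp (-t ^ 2) * (w - t)) -
      1 / √Real.pi * Real.exp (-t ^ 2) * (w - t + σ * t ^ 2 / 2) +
      κ * (σ * t) * (1 / 2 * (erfc w - erfc t)) := by ring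
  rw [e]
  set ε := σ ^ 2 * τ ^ 4 with hε
  have hε0 : 0 ≤ ε := by positivity
  have b1 : |(r₂ - (1 + κ * (σ * t))) * (erfc w / 2)| ≤ P * ε := by
    rw [abs_mul, abs_of_nonneg (div_nonneg (erfc_nonneg w) two_pos.le)]
    calc |r₂ - (1 + κ * (σ * t))| * (erfc w / 2) ≤ P * (σ ^ 2 * τ ^ 2) * 1 :=
          mul_le_mul hr₂ (by linarith [erfc_le_two w]) (div_nonneg (erfc_nonneg w) two_pos.le)
            (by positivity)
      _ ≤ P * ε := by rw [mul_one, hε]; gcongr; norm_num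
  have b2 : |1 / 2 * (erfc w - erfc t + 2 / √Real.pi * Real.exp (-t ^ 2) * (w - t))| ≤ 4 * P ^ 2 * ε := by
    rw [abs_mul, abs_of_pos (by norm_num : (0 : ℝ) < 1 / 2)]
    calc 1 / 2 * |erfc w - erfc t + 2 / √Real.pi * Real.exp (-t ^ 2) * (w - t)|
        ≤ 1 / 2 * (2 * (w - t) ^ 2) := by gcongr; exact abs_erfc_taylor_le w t
      _ = |w - t| ^ 2 := by rw [sq_abs]; ring
      _ ≤ (2 * P * (σ * τ ^ 2)) ^ 2 := by gcongr
      _ = _ := by rw [hε]; ring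
  have b3 : |1 / √Real.pi * Real.exp (-t ^ 2) * (w - t + σ * t ^ 2 / 2)| ≤ P * ε := by
    rw [abs_mul, abs_of_pos (by positivity : 0 < 1 / √Real.pi * Real.exp (-t ^ 2))]
    calc 1 / √Real.pi * Real.exp (-t ^ 2) * |w - t + σ * t ^ 2 / 2| ≤ 1 * 1 * (P * (σ ^ 2 * τ ^ 3)) := by
          gcongr
      _ ≤ P * ε := by rw [one_mul, one_mul, hε]; gcongr; norm_num
  have b4 : |κ * (σ * t) * (1 / 2 * (erfc w - erfc t))| ≤ 2 * P ^ 2 * ε := by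
    rw [abs_mul, abs_mul, abs_mul, abs_mul, abs_of_pos hσ, abs_of_pos (by norm_num : (0 : ℝ) < 1 / 2)]
    calc |κ| * (σ * |t|) * (1 / 2 * |erfc w - erfc t|) ≤ P * (σ * τ) * (1 / 2 * (2 * (2 * P * (σ * τ ^ 2)))) := by
          gcongr
          exact (abs_erfc_sub_le w t).trans (by gcongr)
      _ = 2 * P ^ 2 * (σ ^ 2 * τ ^ 3) := by ring
      _ ≤ _ := by rw [hε]; gcongr; norm_num
  have h1 := (abs_add_le _ _).trans (add_le_add ((abs_sub _ _).trans
    (add_le_add ((abs_add_le _ _).trans (add_le_add b1 b2)) b3)) b4)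
  refine h1.trans ?_
  have h2 : P * ε ≤ P ^ 2 * ε := by gcongr
  have h3 : 0 ≤ P ^ 2 * ε := by positivity
  linarith

/-- Expansion of the Gaussian part of the edge profile. -/
theorem exists_edge_gauss_bound {P : ℝ} (hP : 1 ≤ P) : ∃ K : ℝ, 0 < K ∧
    ∀ σ t r₁ w β β₁ c c₁ E ς : ℝ, 0 < σ → σ * (1 + |t|) ^ 2 ≤ 1 → 0 < ς → ς ≤ P * σ →
      |r₁ - 1| ≤ P * (σ * (1 + |t|)) → |w - t| ≤ 2 * P * (σ * (1 + |t|) ^ 2) →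
      |β - β₁| ≤ P * (σ * (1 + |t|)) → |c - c₁| ≤ P * (σ * (1 + |t|)) → |β₁| ≤ P → |c₁| ≤ P → |E| ≤ P →
      |r₁ * (Real.exp (-w ^ 2) * (1 / 2 * (β - c * (w ^ 2 + 5 / 2)) + E * (1 - ς * laplacePoly β c (-w)))) -
        Real.exp (-t ^ 2) * (1 / 2 * (β₁ - c₁ * (t ^ 2 + 5 / 2)) + E)| ≤ K * (σ * (1 + |t|) ^ 2) := by
  obtain ⟨K₀, hK₀, hexp⟩ := exp_neg_sq_mul_le 3
  refine ⟨3 * P + 10 * P ^ 2 + 8 * P ^ 3 * K₀ + P * (4 * P + (3 * P + 10 * P ^ 2 + 8 * P ^ 3 * K₀)),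
    by positivity, ?_⟩
  intro σ t r₁ w β β₁ c c₁ E ς hσ hσt hς hςσ hr₁ hwt hβ hc hβ₁ hc₁ hE
  set τ := 1 + |t| with hτ
  have hτ1 : 1 ≤ τ := by rw [hτ]; linarith [abs_nonneg t]
  have hττ : τ ≤ τ ^ 2 := le_self_pow₀ hτ1 (by norm_num)
  set ε := σ * τ ^ 2 with hε
  have hε0 : 0 ≤ ε := by positivity
  have hσε : σ * τ ≤ ε := by rw [hε]; gcongr
  have hσε' : σ ≤ ε := by
    calc σ = σ * 1 := (mul_one σ).symm
      _ ≤ ε := by rw [hε]; gcongr; exact one_le_pow₀ hτ1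
  have hEw : Real.exp (-w ^ 2) ≤ 1 := Real.exp_le_one_iff.2 (by nlinarith [sq_nonneg w])
  have hEt : Real.exp (-t ^ 2) ≤ 1 := Real.exp_le_one_iff.2 (by nlinarith [sq_nonneg t])
  have hEw0 := Real.exp_pos (-w ^ 2)
  have hEt0 := Real.exp_pos (-t ^ 2)
  have hPε : P * ε ≤ P := by nlinarith
  have hββ : |β| ≤ 2 * P := by
    have := abs_add_le (β - β₁) β₁
    rw [sub_add_cancel] at this
    have h2 : P * (σ * τ) ≤ P * ε := by gcongr
    linarith
  have hcc : |c| ≤ 2 * P := by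
    have := abs_add_le (c - c₁) c₁
    rw [sub_add_cancel] at this
    have h2 : P * (σ * τ) ≤ P * ε := by gcongr
    linarith
  set Z := Real.exp (-t ^ 2) * (1 / 2 * (β₁ - c₁ * (t ^ 2 + 5 / 2)) + E) with hZ
  set V := Real.exp (-w ^ 2) * (1 / 2 * (β - c * (w ^ 2 + 5 / 2)) + E * (1 - ς * laplacePoly β c (-w)))
    with hV
  have hwe := sq_mul_exp_neg_sq_le w
  have hte := sq_mul_exp_neg_sq_le t
  have hwe0 : 0 ≤ w ^ 2 * Real.exp (-w ^ 2) := by positivity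
  have hte0 : 0 ≤ t ^ 2 * Real.exp (-t ^ 2) := by positivity
  have hZb : |Z| ≤ 4 * P := by
    have e : Z = 1 / 2 * (β₁ * Real.exp (-t ^ 2)) -
        1 / 2 * (c₁ * (t ^ 2 * Real.exp (-t ^ 2) + 5 / 2 * Real.exp (-t ^ 2))) +
        E * Real.exp (-t ^ 2) := by rw [hZ]; ring
    have b1 : |1 / 2 * (β₁ * Real.exp (-t ^ 2))| ≤ 1 / 2 * (P * 1) := by
      rw [abs_mul, abs_mul, abs_of_pos hEt0, abs_of_pos (by norm_num : (0 : ℝ) < 1 / 2)]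
      gcongr
    have b2 : |1 / 2 * (c₁ * (t ^ 2 * Real.exp (-t ^ 2) + 5 / 2 * Real.exp (-t ^ 2)))| ≤
        1 / 2 * (P * (1 + 5 / 2 * 1)) := by
      rw [abs_mul, abs_mul, abs_of_pos (by norm_num : (0 : ℝ) < 1 / 2),
        abs_of_pos (by positivity : 0 < t ^ 2 * Real.exp (-t ^ 2) + 5 / 2 * Real.exp (-t ^ 2))]
      gcongr
    have b3 : |E * Real.exp (-t ^ 2)| ≤ P * 1 := by
      rw [abs_mul, abs_of_pos hEt0]; gcongr
    rw [e]
    refine (abs_add_le _ _).trans ((add_le_add ((abs_sub _ _).trans (add_le_add b1 b2)) b3).trans ?_)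
    linarith
  have hVZ : |V - Z| ≤ (3 * P + 10 * P ^ 2 + 8 * P ^ 3 * K₀) * ε := by
    have e : V - Z = 1 / 2 * ((β - β₁) * Real.exp (-w ^ 2)) -
        1 / 2 * ((c - c₁) * (w ^ 2 * Real.exp (-w ^ 2) + 5 / 2 * Real.exp (-w ^ 2))) +
        (1 / 2 * β₁ - 5 / 4 * c₁ + E) * (Real.exp (-w ^ 2) - Real.exp (-t ^ 2)) -
        1 / 2 * c₁ * (w ^ 2 * Real.exp (-w ^ 2) - t ^ 2 * Real.exp (-t ^ 2)) -
        E * (ς * (Real.exp (-w ^ 2) * laplacePoly β c (-w))) := by rw [hV, hZ]; ring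
    have b1 : |1 / 2 * ((β - β₁) * Real.exp (-w ^ 2))| ≤ 1 / 2 * (P * ε * 1) := by
      rw [abs_mul, abs_mul, abs_of_pos hEw0, abs_of_pos (by norm_num : (0 : ℝ) < 1 / 2)]
      gcongr
      exact hβ.trans (by gcongr)
    have b2 : |1 / 2 * ((c - c₁) * (w ^ 2 * Real.exp (-w ^ 2) + 5 / 2 * Real.exp (-w ^ 2)))| ≤
        1 / 2 * (P * ε * (1 + 5 / 2 * 1)) := by
      rw [abs_mul, abs_mul, abs_of_pos (by norm_num : (0 : ℝ) < 1 / 2),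
        abs_of_pos (by positivity : 0 < w ^ 2 * Real.exp (-w ^ 2) + 5 / 2 * Real.exp (-w ^ 2))]
      gcongr
      exact hc.trans (by gcongr)
    have b3 : |(1 / 2 * β₁ - 5 / 4 * c₁ + E) * (Real.exp (-w ^ 2) - Real.exp (-t ^ 2))| ≤
        (11 / 4 * P) * (2 * P * ε) := by
      rw [abs_mul]
      gcongr
      · have h1 := abs_le.1 hβ₁
        have h2 := abs_le.1 hc₁
        have h3 := abs_le.1 hE
        rw [abs_le]; constructor <;> linarith [h1.1, h1.2, h2.1, h2.2, h3.1, h3.2]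
      · exact (abs_exp_neg_sq_sub_le w t).trans hwt
    have b4 : |1 / 2 * c₁ * (w ^ 2 * Real.exp (-w ^ 2) - t ^ 2 * Real.exp (-t ^ 2))| ≤
        1 / 2 * P * (4 * (2 * P * ε)) := by
      rw [abs_mul, abs_mul, abs_of_pos (by norm_num : (0 : ℝ) < 1 / 2)]
      gcongr
      exact (abs_sq_mul_exp_neg_sq_sub_le w t).trans (by gcongr)
    have b5 : |E * (ς * (Real.exp (-w ^ 2) * laplacePoly β c (-w)))| ≤ P * (P * ε * (8 * P * K₀)) := by
      rw [abs_mul, abs_mul, abs_mul, abs_of_pos hς, abs_of_pos hEw0]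
      have h1 := abs_laplacePoly_le_pow (η := -w) (by positivity : 0 ≤ 2 * P) hββ hcc
      have h2 := (hexp (-w)).1
      rw [neg_sq] at h2
      have h3 : Real.exp (-w ^ 2) * |laplacePoly β c (-w)| ≤ 8 * P * K₀ := by
        calc Real.exp (-w ^ 2) * |laplacePoly β c (-w)| ≤
              Real.exp (-w ^ 2) * (4 * (2 * P) * (1 + |(-w)|) ^ 3) := by gcongr
          _ = 8 * P * (Real.exp (-w ^ 2) * (1 + |(-w)|) ^ 3) := by ring
          _ ≤ _ := by gcongr
      gcongr
      exact hςσ.trans (by gcongr)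
    rw [e]
    refine (abs_sub _ _).trans ((add_le_add ((abs_sub _ _).trans (add_le_add ((abs_add_le _ _).trans
      (add_le_add ((abs_sub _ _).trans (add_le_add b1 b2)) b3)) b4)) b5).trans ?_)
    have h1 : 0 ≤ P * ε := by positivity
    have h2 : 0 ≤ P ^ 2 * ε := by positivity
    linarith
  have e : r₁ * V - Z = (r₁ - 1) * V + (V - Z) := by ring
  rw [e]
  have hVb : |V| ≤ 4 * P + (3 * P + 10 * P ^ 2 + 8 * P ^ 3 * K₀) := by
    have h1 := abs_add_le (V - Z) Z
    rw [sub_add_cancel] at h1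
    have h2 : (3 * P + 10 * P ^ 2 + 8 * P ^ 3 * K₀) * ε ≤ (3 * P + 10 * P ^ 2 + 8 * P ^ 3 * K₀) * 1 := by
      gcongr
    linarith
  have b1 : |(r₁ - 1) * V| ≤ P * ε * (4 * P + (3 * P + 10 * P ^ 2 + 8 * P ^ 3 * K₀)) := by
    rw [abs_mul]
    gcongr
    exact hr₁.trans (by gcongr)
  refine (abs_add_le _ _).trans ((add_le_add b1 hVZ).trans (le_of_eq (by ring)))

/-- Periodicity reduces `x` to the unit interval, and `tsum_fermi` expresses the function by a Fermi
sum with a uniform exponential majorant. -/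
theorem exists_abs_logTheta'_le {L : ℝ} (hL : 0 < L) :
    ∃ K : ℝ, 0 < K ∧ ∀ x : ℝ, |logTheta' x (Real.pi / L)| ≤ K := by
  have hs := (summable_exp_neg_abs_int (c := 2 * L) (by positivity)).mul_left (Real.exp L)
  set T := ∑' j : ℤ, Real.exp L * Real.exp (-(2 * L * |(j : ℝ)|)) with hT
  have hT0 : 0 ≤ T := tsum_nonneg fun j => by positivity
  refine ⟨2 * L * (T + 1), by positivity, fun x => ?_⟩
  rw [← logTheta'_sub_int x _ ⌊x⌋]
  have h0 : 0 ≤ x - ⌊x⌋ := by linarith [Int.floor_le x]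
  have h1 : x - ⌊x⌋ < 1 := by linarith [Int.lt_floor_add_one x]
  set w := x - ⌊x⌋ with hw
  have hsum := tsum_fermi hL (w - 1 / 2) 0
  rw [sub_add_cancel, Int.cast_zero, add_zero] at hsum
  have hb : ‖∑' j : ℤ, (fermi L (j - (w - 1 / 2)) - if j < 0 then (1 : ℝ) else 0)‖ ≤ T := by
    refine tsum_of_norm_bounded hs.hasSum fun j => ?_
    have h2 := abs_fermi_sub_le hL (j : ℝ) (w - 1 / 2)
    have h3 : ((j : ℝ) < 0) ↔ j < 0 := by exact_mod_cast Iff.rfl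
    simp only [h3] at h2
    rw [Real.norm_eq_abs]
    refine h2.trans ?_
    have h4 : |w - 1 / 2| ≤ 1 / 2 := by rw [abs_le]; constructor <;> linarith
    gcongr
    nlinarith
  rw [hsum, Real.norm_eq_abs] at hb
  have e : logTheta' w (Real.pi / L) = 2 * L * ((w + 1 / (2 * L) * logTheta' w (Real.pi / L)) - w) := by
    field_simp; ring
  rw [e, abs_mul, abs_of_pos (by positivity : 0 < 2 * L)]
  gcongr
  refine (abs_sub _ _).trans (add_le_add hb ?_)
  rw [abs_of_nonneg h0]; exact h1.le

set_option maxHeartbeats 400000 in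
/-- Expansion of the edge profile at a point of the boundary layer, in the intrinsic scale. -/
theorem exists_edge_expansion {U a : ℝ → ℝ} {y₀ : ℝ} (hU : ContDiffAt ℝ 4 U y₀)
    (ha : ContDiffAt ℝ 2 a y₀) (hd : deriv U y₀ = 0) (hpos : 0 < iteratedDeriv 2 U y₀) {E₀ : ℝ}
    (hE₀ : 0 ≤ E₀) :
    ∃ K x₀ : ℝ, 0 < K ∧ 0 < x₀ ∧ x₀ ≤ 1 / 2 ∧ ∀ n : ℕ, 0 < n → ∀ σ t E : ℝ, σ = laplaceScale U n y₀ →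
      |E| ≤ E₀ → σ * (1 + |t|) ^ 2 ≤ 1 → |σ * t| ≤ x₀ →
      |1 / (1 + σ * t) ^ 2 * (edgeProfile U a n (y₀ + Real.log (1 + σ * t)) 0 +
          localDensity U a n (y₀ + Real.log (1 + σ * t)) 0 * E) -
        (1 / σ ^ 2 * ((1 + (iteratedDeriv 3 U y₀ / iteratedDeriv 2 U y₀ - 2) * (σ * t)) * (erfc t / 2)) +
          1 / (σ * √Real.pi) * (Real.exp (-t ^ 2) * (t ^ 2 / 2 + 1 / 2 * (deriv a y₀ -
            iteratedDeriv 3 U y₀ / iteratedDeriv 2 U y₀ / 3 * (t ^ 2 + 5 / 2)) + E)))| ≤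
        K * (1 + |t|) ^ 4 := by
  obtain ⟨ρ, K₀, hρ, hK₀, hexp⟩ := exists_derivative_expansion hU ha hd
  set u := iteratedDeriv 2 U y₀ with hu
  set k := iteratedDeriv 3 U y₀ / u with hk
  set p := 1 + K₀ / u + |k| with hp
  have hKu : 0 < K₀ / u := by positivity
  have hp1 : 1 ≤ p := by rw [hp]; linarith [abs_nonneg k]
  have hkp : |k| ≤ p := by rw [hp]; linarith
  have hKp : K₀ / u ≤ p := by rw [hp]; linarith [abs_nonneg k]
  have hpp : p ≤ p ^ 2 := le_self_pow₀ hp1 (by norm_num)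
  -- A single constant that dominates the coefficients of all the preceding edge bounds.
  set P := 60 * p ^ 2 + 2 * K₀ + |deriv a y₀| + E₀ with hP
  have hP60 : 60 * p ^ 2 ≤ P := by rw [hP]; linarith [abs_nonneg (deriv a y₀)]
  have hP1 : 1 ≤ P := by linarith
  have hp56 : 56 * p ≤ P := by linarith
  have hp26 : 26 * p ≤ P := by linarith
  have hp4 : 4 * p ^ 2 ≤ P := by linarith
  have hP2 : 2 ≤ P := by linarith
  have hpsq : 0 ≤ p ^ 2 := by positivity
  have hPK : 2 * K₀ ≤ P := by rw [hP]; linarith [abs_nonneg (deriv a y₀)]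
  have hPa : |deriv a y₀| ≤ P := by rw [hP]; linarith
  have hPE : E₀ ≤ P := by rw [hP]; linarith [abs_nonneg (deriv a y₀)]
  have hPk : |k / 3| ≤ P := by
    rw [abs_div, abs_of_pos (by norm_num : (0 : ℝ) < 3)]
    linarith [abs_nonneg k]
  have hκ : |k - 2| ≤ P := by
    refine (abs_sub _ _).trans ?_
    rw [abs_two]; linarith
  obtain ⟨Kg, hKg, hgauss⟩ := exists_edge_gauss_bound hP1
  refine ⟨14 * P ^ 2 + Kg, min (1 / (8 * p)) (ρ / 2), by positivity, by positivity,
    (min_le_left _ _).trans ?_, ?_⟩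
  · rw [div_le_div_iff₀ (by positivity) (by norm_num)]; linarith
  intro n hn σ t E hσ hE hσt hx
  have hn' : (0 : ℝ) < n := by exact_mod_cast hn
  obtain ⟨hσ0, hσ2⟩ := laplaceScale_sq (U := U) (y := y₀) hn hpos
  rw [← hσ, ← hu] at hσ2
  rw [← hσ] at hσ0
  obtain ⟨hx1, hxρ⟩ := le_min_iff.1 hx
  have hx2 : |σ * t| ≤ 1 / 2 := by
    refine hx1.trans ?_
    rw [div_le_div_iff₀ (by positivity) (by norm_num)]; linarith
  obtain ⟨hh1, hh2, hh3⟩ := abs_log_one_add_sub_le hx2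
  have hxt : |σ * t| = σ * |t| := by rw [abs_mul, abs_of_pos hσ0]
  set x := σ * t with hxdef
  have hx0 : 0 < 1 + x := by linarith [(abs_le.1 hx2).1]
  set y := y₀ + Real.log (1 + x) with hy
  have hyh : y - y₀ = Real.log (1 + x) := by rw [hy]; ring
  obtain ⟨e1, e2, e3, e4⟩ := hexp y (by rw [hyh]; linarith)
  rw [hyh] at e1 e2 e3 e4
  set h := Real.log (1 + x) with hh
  set A := deriv U y / u with hA
  set B := iteratedDeriv 2 U y / u with hB
  set G := iteratedDeriv 3 U y / u with hG
  have hdiv : ∀ q r : ℝ, ∀ j : ℕ, |q - r| ≤ K₀ * |h| ^ j → |q / u - r / u| ≤ p * |h| ^ j := by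
    intro q r j hq
    rw [← sub_div, abs_div, abs_of_pos hpos, div_le_iff₀ hpos]
    refine hq.trans ?_
    rw [div_le_iff₀ hpos] at hKp
    calc K₀ * |h| ^ j ≤ (p * u) * |h| ^ j := by gcongr
      _ = _ := by ring
  have hA' : |A - (h + k / 2 * h ^ 2)| ≤ p * |h| ^ 3 := by
    have := hdiv _ _ 3 e1
    rw [show (u * h + iteratedDeriv 3 U y₀ / 2 * h ^ 2) / u = h + k / 2 * h ^ 2 by
      rw [hk]; field_simp] at this
    exact this
  have hB' : |B - (1 + k * h)| ≤ p * |h| ^ 2 := by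
    have := hdiv _ _ 2 e2
    rw [show (u + iteratedDeriv 3 U y₀ * h) / u = 1 + k * h by rw [hk]; field_simp] at this
    exact this
  have hG' : |G - k| ≤ p * |h| := by
    have := hdiv _ _ 1 (by rw [pow_one]; exact e3)
    rwa [pow_one] at this
  obtain ⟨-, hB2⟩ := edge_curvature_bound hp1 hkp hx1 hh1 hB'
  have hB0 : 0 < B := by linarith
  have l1 := edge_leading_bound hp1 hkp hx2 hh1 hh2 hB'
  have l2 := edge_argument_bound hp1 hkp hx1 hh1 hh3 hA' hB'
  have l3 := edge_scale_bound hp1 hkp hx1 hh1 hB'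
  have l4 := edge_cubic_bound hp1 hkp hx1 hh1 hB' hG'
  set S := √B with hS
  have hS0 : 0 < S := Real.sqrt_pos.2 hB0
  have hSS : S ^ 2 = B := Real.sq_sqrt hB0.le
  have hShalf : 1 / 2 ≤ S := Real.le_sqrt_of_sq_le (by linarith)
  set ς := laplaceScale U n y with hς
  have hςe : ς = σ / S := by
    rw [hς, hσ, hS, laplaceScale, laplaceScale, ← Real.sqrt_div' _ hB0.le, ← hu]
    congr 1
    rw [hB]; field_simp
  -- Eliminating `n` by `n u σ² = 2` turns the mean `n U'(y) / 2` into `A / σ²`, while the width at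
  -- `y` is `σ / S`. Thus `-w` is the scaled position of `x = 0` relative to the mean.
  set w := A / S / σ with hw
  have hwe : ς * (0 - n * deriv U y / 2) = -w := by
    rw [hςe, hw, hA]
    have : (n : ℝ) = 2 / (u * σ ^ 2) := by
      field_simp; linarith
    rw [this]; field_simp; ring
  have hτ1 : 1 ≤ 1 + |t| := by linarith [abs_nonneg t]
  have htτ : |t| ≤ 1 + |t| := by linarith
  have hc : iteratedDeriv 3 U y / (3 * iteratedDeriv 2 U y) = G / (3 * B) := by
    rw [hG, hB]; field_simp
  set τ := 1 + |t| with hτ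
  have hτ0 : 0 < τ := by linarith
  have b1 : |1 / (1 + x) ^ 2 * B - (1 + (k - 2) * (σ * t))| ≤ P * (σ ^ 2 * τ ^ 2) := by
    refine l1.trans ?_
    rw [hxt]
    calc 56 * p * (σ * |t|) ^ 2 ≤ P * (σ * τ) ^ 2 := by gcongr
      _ = _ := by ring
  have b2 : |w - t + σ * t ^ 2 / 2| ≤ P * (σ ^ 2 * τ ^ 3) := by
    have e : w - t + σ * t ^ 2 / 2 = (A / S - x + x ^ 2 / 2) / σ := by
      rw [hw, hxdef]; field_simp
    rw [e, abs_div, abs_of_pos hσ0, div_le_iff₀ hσ0]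
    refine l2.trans ?_
    rw [hxt]
    calc 60 * p ^ 2 * (σ * |t|) ^ 3 ≤ P * (σ * τ) ^ 3 := by gcongr
      _ = _ := by ring
  obtain ⟨b3, b4⟩ := edge_erfc_bound hP1 hσ0 hσt hκ b1 b2
  have b5 := hgauss σ t (1 / (1 + x) ^ 2 * S) w (deriv a y) (deriv a y₀) (G / (3 * B)) (k / 3) E ς hσ0 hσt
    (by rw [hςe]; positivity)
    (by
      rw [hςe, div_le_iff₀ hS0]
      calc σ = 2 * σ * (1 / 2) := by ring
        _ ≤ P * σ * S := by gcongr)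
    (by
      refine l3.trans ?_
      rw [hxt]
      calc 26 * p * (σ * |t|) ≤ P * (σ * τ) := by gcongr)
    b3
    (by
      refine e4.trans ?_
      calc K₀ * |h| ≤ K₀ * (2 * |x|) := by gcongr
        _ = 2 * K₀ * (σ * |t|) := by rw [hxt]; ring
        _ ≤ P * (σ * τ) := by gcongr)
    (by
      refine l4.trans ?_
      rw [hxt]
      calc 4 * p ^ 2 * (σ * |t|) ≤ P * (σ * τ) := by gcongr)
    hPa hPk (hE.trans hPE)
  have hspi : 1 ≤ √Real.pi := by rw [Real.one_le_sqrt]; linarith [Real.pi_gt_three]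
  have hspi0 : 0 < √Real.pi := by linarith
  have e : 1 / (1 + x) ^ 2 * (edgeProfile U a n y 0 + localDensity U a n y 0 * E) -
      (1 / σ ^ 2 * ((1 + (k - 2) * x) * (erfc t / 2)) + 1 / (σ * √Real.pi) * (Real.exp (-t ^ 2) *
        (t ^ 2 / 2 + 1 / 2 * (deriv a y₀ - k / 3 * (t ^ 2 + 5 / 2)) + E))) =
      1 / σ ^ 2 * (1 / (1 + x) ^ 2 * B * (erfc w / 2) - ((1 + (k - 2) * (σ * t)) * (erfc t / 2) +
        1 / √Real.pi * Real.exp (-t ^ 2) * (σ * t ^ 2 / 2))) +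
      1 / (σ * √Real.pi) * (1 / (1 + x) ^ 2 * S * (Real.exp (-w ^ 2) *
        (1 / 2 * (deriv a y - G / (3 * B) * (w ^ 2 + 5 / 2)) +
          E * (1 - ς * laplacePoly (deriv a y) (G / (3 * B)) (-w)))) -
        Real.exp (-t ^ 2) * (1 / 2 * (deriv a y₀ - k / 3 * (t ^ 2 + 5 / 2)) + E)) := by
    rw [edgeProfile, gaussPrimitive, localDensity, ← hς, hwe, hc, neg_neg, neg_sq]
    have i1 : 1 / ς ^ 2 = 1 / σ ^ 2 * B := by rw [hςe, div_pow, hSS]; field_simp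
    have i2 : 1 / (2 * ς * √Real.pi) = 1 / 2 * (1 / (σ * √Real.pi) * S) := by rw [hςe]; field_simp
    have i3 : 1 / (ς * √Real.pi) = 1 / (σ * √Real.pi) * S := by rw [hςe]; field_simp
    have i4 : 1 / σ ^ 2 * (1 / √Real.pi * Real.exp (-t ^ 2) * (σ * t ^ 2 / 2)) =
        1 / (σ * √Real.pi) * (Real.exp (-t ^ 2) * (t ^ 2 / 2)) := by field_simp
    rw [i1, i2, i3]
    linear_combination i4
  rw [e]
  refine (abs_add_le _ _).trans ?_
  rw [abs_mul, abs_mul (1 / (σ * √Real.pi)), abs_of_pos (by positivity : 0 < 1 / σ ^ 2),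
    abs_of_pos (by positivity : 0 < 1 / (σ * √Real.pi))]
  have f1 : 1 / σ ^ 2 * (14 * P ^ 2 * (σ ^ 2 * τ ^ 4)) = 14 * P ^ 2 * τ ^ 4 := by field_simp
  have f2 : 1 / (σ * √Real.pi) * (Kg * (σ * τ ^ 2)) ≤ Kg * τ ^ 4 := by
    have : 1 / (σ * √Real.pi) * (Kg * (σ * τ ^ 2)) = Kg * τ ^ 2 / √Real.pi := by field_simp
    rw [this]
    refine (div_le_self (by positivity) hspi).trans ?_
    gcongr
    · norm_num
  have g1 : 1 / σ ^ 2 * |1 / (1 + x) ^ 2 * B * (erfc w / 2) - ((1 + (k - 2) * (σ * t)) * (erfc t / 2) +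
        1 / √Real.pi * Real.exp (-t ^ 2) * (σ * t ^ 2 / 2))| ≤ 14 * P ^ 2 * τ ^ 4 := by
    rw [← f1]; gcongr
  have g2 := mul_le_mul_of_nonneg_left b5 (by positivity : 0 ≤ 1 / (σ * √Real.pi))
  exact (add_le_add g1 (g2.trans f2)).trans (le_of_eq (add_mul _ _ _).symm)

/-- For `|t| ≤ log n` the displacement `log (1 + σ t)` is at most `4 C log n / √n`, which sets the
range required of `gapSum_asymptotics`. The bound `(1 + |t|)^4 ≤ 16 log^4 n` fixes the power of the
logarithm in the error. -/
theorem GapModel.edge_asymptotics {U a : ℝ → ℝ} {y₁ y₂ ρ C M : ℝ} (h : GapModel U a y₁ y₂ ρ C)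
    (hM0 : 0 < M) (hM1 : M < 1) (hU : ContDiffAt ℝ 4 U y₁) (ha : ContDiffAt ℝ 2 a y₁) :
    ∃ K : ℝ, 0 < K ∧ ∀ᶠ n : ℕ in atTop, ∀ σ t : ℝ, σ = laplaceScale U n y₁ → |t| ≤ Real.log n →
      0 < n ∧ 0 < 1 + σ * t ∧
      |1 / (1 + σ * t) ^ 2 * gapSum U a M n (y₁ + Real.log (1 + σ * t)) -
        (1 / σ ^ 2 * ((1 + (iteratedDeriv 3 U y₁ / iteratedDeriv 2 U y₁ - 2) * (σ * t)) * (erfc t / 2)) +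
          1 / (σ * √Real.pi) * (Real.exp (-t ^ 2) * (t ^ 2 / 2 + 1 / 2 * (deriv a y₁ -
            iteratedDeriv 3 U y₁ / iteratedDeriv 2 U y₁ / 3 * (t ^ 2 + 5 / 2)) +
            (gapShift U a y₁ y₂ + 1 / (2 * (y₂ - y₁)) *
              logTheta' (n * M + gapShift U a y₁ y₂ + 1 / 2) (Real.pi / (y₂ - y₁))))))| ≤
        K * Real.log n ^ 4 := by
  have hL : 0 < y₂ - y₁ := sub_pos.2 h.lt
  have hC := h.left.one_le
  have hy₁ : |y₁ - y₁| ≤ ρ := by simpa using h.left.rho_pos.le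
  obtain ⟨T, hT, hθ⟩ := exists_abs_logTheta'_le hL
  obtain ⟨K₁, hK₁, hsum⟩ := h.gapSum_asymptotics hM0 hM1 (A := 4 * C) (by positivity)
  obtain ⟨K₂, x₀, hK₂, hx₀, hx₀', hedge⟩ := exists_edge_expansion hU ha h.left_deriv (h.left.U2_pos hy₁)
    (E₀ := |gapShift U a y₁ y₂| + 1 / (2 * (y₂ - y₁)) * T) (by positivity)
  refine ⟨4 * K₁ + 16 * K₂, by positivity, ?_⟩
  have hev₁ : ∀ᶠ n : ℕ in atTop, 1 ≤ Real.log n :=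
    (Real.tendsto_log_atTop.comp tendsto_natCast_atTop_atTop).eventually_ge_atTop 1
  filter_upwards [hsum, hev₁, eventually_log_pow_le (8 * C) 2, eventually_log_pow_le (2 * C / x₀) 1,
    eventually_gt_atTop 0] with n hsum hlog hn1 hn2 hn0 σ t hσ ht
  have hn' : (0 : ℝ) < n := by exact_mod_cast hn0
  have hsq : 0 < √(n : ℝ) := Real.sqrt_pos.2 hn'
  obtain ⟨hσlow, hσup⟩ := h.left.scale_bounds hy₁ hn0
  rw [← hσ] at hσlow hσup
  have hσ0 : 0 < σ := lt_of_lt_of_le (by positivity) hσlow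
  have hτ : 1 + |t| ≤ 2 * Real.log n := by linarith
  have hσt : σ * (1 + |t|) ^ 2 ≤ 1 := by
    calc σ * (1 + |t|) ^ 2 ≤ 2 * C * (1 / √n) * (2 * Real.log n) ^ 2 := by gcongr
      _ = 8 * C * Real.log n ^ 2 / √n := by ring
      _ ≤ 1 := by rw [div_le_one hsq]; exact hn1
  have hxl : |σ * t| ≤ 2 * C * (Real.log n / √n) := by
    rw [abs_mul, abs_of_pos hσ0]
    calc σ * |t| ≤ 2 * C * (1 / √n) * Real.log n := by gcongr
      _ = _ := by ring
  have hx : |σ * t| ≤ x₀ := by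
    refine hxl.trans ?_
    rw [← mul_div_assoc, div_le_iff₀ hsq]
    rw [pow_one, div_mul_eq_mul_div, div_le_iff₀ hx₀] at hn2
    linarith
  have hx2 : |σ * t| ≤ 1 / 2 := hx.trans hx₀'
  have hx0 : 0 < 1 + σ * t := by linarith [(abs_le.1 hx2).1]
  refine ⟨hn0, hx0, ?_⟩
  have hE : |gapShift U a y₁ y₂ + 1 / (2 * (y₂ - y₁)) *
      logTheta' (n * M + gapShift U a y₁ y₂ + 1 / 2) (Real.pi / (y₂ - y₁))| ≤
      |gapShift U a y₁ y₂| + 1 / (2 * (y₂ - y₁)) * T := by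
    refine (abs_add_le _ _).trans ?_
    rw [abs_mul, abs_of_pos (by positivity : 0 < 1 / (2 * (y₂ - y₁)))]
    gcongr
    exact hθ _
  have g1 := hedge n hn0 σ t _ hσ hE hσt hx
  obtain ⟨-, g2⟩ := hsum (y₁ + Real.log (1 + σ * t)) (by
    rw [add_sub_cancel_left]
    refine (abs_log_one_add_sub_le hx2).1.trans ?_
    linarith)
  obtain ⟨hinv, hinv4, -⟩ := abs_inv_sq_one_add_sub_one_le hx2
  have hl4 : Real.log n ≤ Real.log n ^ 4 := le_self_pow₀ hlog (by norm_num)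
  set E := gapShift U a y₁ y₂ + 1 / (2 * (y₂ - y₁)) *
      logTheta' (n * M + gapShift U a y₁ y₂ + 1 / 2) (Real.pi / (y₂ - y₁))
  set q := 1 / (1 + σ * t) ^ 2
  set y := y₁ + Real.log (1 + σ * t)
  have g3 : |q * gapSum U a M n y - q * (edgeProfile U a n y 0 + localDensity U a n y 0 * E)| ≤
      4 * K₁ * Real.log n ^ 4 := by
    rw [← mul_sub, abs_mul, abs_of_pos hinv]
    calc q * |gapSum U a M n y - (edgeProfile U a n y 0 + localDensity U a n y 0 * E)| ≤
        4 * (K₁ * Real.log n ^ 4) := by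
          refine mul_le_mul hinv4 (g2.trans (by gcongr)) (abs_nonneg _) (by norm_num)
      _ = _ := by ring
  have g4 : K₂ * (1 + |t|) ^ 4 ≤ 16 * K₂ * Real.log n ^ 4 := by
    calc K₂ * (1 + |t|) ^ 4 ≤ K₂ * (2 * Real.log n) ^ 4 := by gcongr
      _ = _ := by ring
  refine (abs_sub_le _ _ _).trans ((add_le_add g3 (g1.trans g4)).trans (le_of_eq (by ring)))

/-! ### Return to the original quantities -/

theorem deriv_logAmplitude {lam : ℂ → ℝ} (hlam : ContDiff ℝ 1 lam) (s y : ℝ) :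
    deriv (logAmplitude lam s) y = 2 + s * (Real.exp y * radialDeriv lam (Real.exp y)) := by
  have hc : Differentiable ℝ fun x : ℝ => lam (x : ℂ) :=
    (hlam.comp Complex.ofRealCLM.contDiff).differentiable (by norm_num)
  have h1 : HasDerivAt (fun t : ℝ => lam (Real.exp t : ℂ))
      (radialDeriv lam (Real.exp y) * Real.exp y) y :=
    HasDerivAt.comp y (hc (Real.exp y)).hasDerivAt (Real.hasDerivAt_exp y)
  have h2 : HasDerivAt (logAmplitude lam s)
      (2 * 1 + s * (radialDeriv lam (Real.exp y) * Real.exp y)) y :=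
    ((hasDerivAt_id y).const_mul 2).add (h1.const_mul s)
  rw [h2.deriv]; ring

/-- The Jacobian `2 y` in the amplitude contributes `-1` to the shift, and the factors `r²` in `U''
= 4 r² ΔQ` contribute `+1/2`. The resulting `-1/2` cancels the half that `tsum_fermi` adds to the
argument of the theta function. -/
theorem gapShift_eq {Q lam : ℂ → ℝ} (hr : IsRadial Q) {r₁ r₂ : ℝ} (h₁ : 0 < r₁) (h₂ : 0 < r₂)
    (hQ₁ : ContDiffAt ℝ 2 Q (r₁ : ℂ)) (hQ₂ : ContDiffAt ℝ 2 Q (r₂ : ℂ)) (hD₁ : 0 < lap Q r₁)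
    (hD₂ : 0 < lap Q r₂) (hlt : r₁ < r₂) (M v s : ℝ) :
    gapShift (logProfile Q M v) (logAmplitude lam s) (Real.log r₁) (Real.log r₂) + 1 / 2 =
      Real.log (lap Q r₂ / lap Q r₁) / (4 * Real.log (r₂ / r₁)) +
        s * (lam r₁ - lam r₂) / (2 * Real.log (r₂ / r₁)) := by
  have hL : 0 < Real.log r₂ - Real.log r₁ := sub_pos.2 (Real.log_lt_log h₁ hlt)
  have u₁ := iteratedDeriv_two_logProfile hr (y := Real.log r₁) (by rwa [Real.exp_log h₁]) M v
  have u₂ := iteratedDeriv_two_logProfile hr (y := Real.log r₂) (by rwa [Real.exp_log h₂]) M v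
  rw [gapShift, u₁, u₂, logAmplitude, logAmplitude, Real.exp_log h₁, Real.exp_log h₂,
    Real.log_div (by positivity) (by positivity), Real.log_mul (by positivity) hD₁.ne',
    Real.log_mul (by positivity) hD₂.ne', Real.log_mul (by norm_num) (by positivity),
    Real.log_mul (by norm_num) (by positivity), Real.log_pow, Real.log_pow,
    Real.log_div hD₂.ne' hD₁.ne', Real.log_div h₂.ne' h₁.ne']
  have hL' := hL.ne'
  field_simp
  push_cast
  ring

/-- Here `κ` is `U''' / U'' - 2`, the normalized derivative of the Laplacian. The term with `t erfc`
in the bracket loses its Gaussian factor and becomes the linear correction of the leading term; the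
rest is collecting coefficients. -/
theorem edge_density_eq {nD pre r σ t e κ d s l L W Θ : ℝ} (hσ : 0 < σ)
    (h₁ : nD = 1 / (2 * r ^ 2) * (1 / σ ^ 2)) (h₂ : pre = 1 / (2 * r ^ 2) * (1 / (σ * √Real.pi))) :
    nD * (e / 2) + pre * Real.exp (-t ^ 2) * (s / 2 * (d + l / L) + 1 / 6 * (t ^ 2 - 2) +
        κ * (1 / 2 * √Real.pi * t * e * Real.exp (t ^ 2) - 1 / 12 * (2 * t ^ 2 + 5)) +
        W / (4 * L) + 1 / (2 * L) * Θ) =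
      1 / (2 * r ^ 2) * (1 / σ ^ 2 * ((1 + κ * (σ * t)) * (e / 2)) + 1 / (σ * √Real.pi) *
        (Real.exp (-t ^ 2) * (t ^ 2 / 2 + 1 / 2 * (2 + s * d - (κ + 2) / 3 * (t ^ 2 + 5 / 2)) +
          (W / (4 * L) + s * l / (2 * L) - 1 / 2 + 1 / (2 * L) * Θ)))) := by
  have hE : Real.exp (-t ^ 2) * Real.exp (t ^ 2) = 1 := by rw [← Real.exp_add]; simp
  have hpi : 0 < √Real.pi := Real.sqrt_pos.2 Real.pi_pos
  have g1 : 1 / (σ * √Real.pi) * √Real.pi = 1 / σ := by field_simp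
  have g2 : 1 / σ ^ 2 * σ = 1 / σ := by field_simp
  rw [h₁, h₂]
  generalize 1 / (σ * √Real.pi) = X at *
  generalize 1 / σ ^ 2 = Y at *
  linear_combination (1 / (2 * r ^ 2) * κ * t * e / 2) * (X * √Real.pi * hE + g1 - g2)

end CoulombGap

theorem theorem1p9 (Q : ℂ → ℝ) (σ : MeasureTheory.Measure ℂ) (N : ℕ) (a b : ℕ → ℝ)
    (hQ : CoulombGap.IsRadialPotential Q σ N a b)
    (k : ℕ) (hk : k < N) (r₁ r₂ : ℝ) (hr₁ : r₁ = b k) (hr₂ : r₂ = a (k + 1))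
    (hQ6 : ∃ U : Set ℂ, IsOpen U ∧ Metric.sphere (0 : ℂ) r₁ ∪ Metric.sphere (0 : ℂ) r₂ ⊆ U ∧
      ContDiffOn ℝ 6 Q U)
    (lam : ℂ → ℝ) (hlam : ContDiff ℝ 6 lam) (hlam_radial : CoulombGap.IsRadial lam)
    (hlam_supp : tsupport lam ⊆ interior (σ.support ∪ {z : ℂ | r₁ < ‖z‖ ∧ ‖z‖ < r₂}))
    (s α : ℝ) (hα : α ∈ Set.Ico 0 (2 * Real.pi)) :
    ∃ C : ℝ, ∃ n₀ : ℕ, ∀ n : ℕ, n₀ ≤ n → ∀ t : ℝ, |t| ≤ Real.log n →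
      let D₁ : ℝ := CoulombGap.lap Q (r₁ : ℂ)
      let D₂ : ℝ := CoulombGap.lap Q (r₂ : ℂ)
      let L : ℝ := Real.log (r₂ / r₁)
      let l₁ : ℝ := lam (r₁ : ℂ)
      let l₂ : ℝ := lam (r₂ : ℂ)
      let z : ℂ := Complex.exp (Complex.I * (α : ℂ)) *
        ((r₁ + t / Real.sqrt (2 * n * D₁) : ℝ) : ℂ)
      |CoulombGap.onePoint (CoulombGap.perturbed Q lam s n) n z -
        (n * D₁ * (CoulombGap.erfc t / 2) +
          Real.sqrt (n * D₁) / (Real.sqrt (2 * Real.pi) * r₁) * Real.exp (-t ^ 2) *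
            (s / 2 * (r₁ * CoulombGap.radialDeriv lam r₁ + (l₁ - l₂) / L)
              + 1 / 6 * (t ^ 2 - 2)
              + r₁ * (CoulombGap.radialDeriv (CoulombGap.lap Q) r₁ / D₁) *
                  (1 / 2 * Real.sqrt Real.pi * t * CoulombGap.erfc t * Real.exp (t ^ 2)
                    - 1 / 12 * (2 * t ^ 2 + 5))
              + Real.log (D₂ / D₁) / (4 * L)
              + 1 / (2 * L) * CoulombGap.logTheta'
                  (CoulombGap.gapB Q r₁ r₂ / 2 * n + Real.log (D₂ / D₁) / (4 * L)
                    + s * (l₁ - l₂) / (2 * L))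
                  (Real.pi / L)))|
        ≤ C * Real.log n ^ 4 := by
  subst hr₁ hr₂
  obtain ⟨O, hO, hsub, hQO⟩ := hQ6
  have hlt := hQ.radius_lt_succ k hk
  have hr : 0 < b k := (CoulombGap.radius_nonneg_of_le hQ hk.le).trans_lt (hQ.radius_lt k hk.le)
  have hr' : 0 < a (k + 1) := hr.trans hlt
  have hc₁ : ContDiffAt ℝ 6 Q (b k : ℂ) :=
    hQO.contDiffAt (hO.mem_nhds (hsub (Or.inl (by simp [abs_of_pos hr]))))
  have hc₂ : ContDiffAt ℝ 6 Q (a (k + 1) : ℂ) :=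
    hQO.contDiffAt (hO.mem_nhds (hsub (Or.inr (by simp [abs_of_pos hr']))))
  -- The droplet and the gap lie in a common disc. Compact support makes the amplitude differ from
  -- `2 y` by a bounded function.
  have hcomp : HasCompactSupport lam := by
    refine Metric.isCompact_of_isClosed_isBounded (isClosed_tsupport lam) ?_
    refine (Metric.isBounded_closedBall (x := (0 : ℂ)) (r := max (b N) (a (k + 1)))).subset
      fun w hw => ?_
    rw [mem_closedBall_zero_iff]
    rcases interior_subset (hlam_supp hw) with h | h
    · exact (CoulombGap.droplet_bounded hQ h).trans (le_max_left _ _)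
    · exact h.2.le.trans (le_max_right _ _)
  obtain ⟨hD₁, hD₂⟩ := CoulombGap.lap_radius_pos hQ hk
  obtain ⟨M, v, ρ, C, hM0, hM1, hB, hgap⟩ := CoulombGap.exists_gapModel hQ hk
    (hc₁.of_le (by norm_num)) (hc₂.of_le (by norm_num)) (hlam.of_le (by norm_num)) hcomp s
  have hexp : Real.exp (Real.log (b k)) = b k := Real.exp_log hr
  have hcy : ContDiffAt ℝ 6 Q (Real.exp (Real.log (b k)) : ℂ) := by rwa [hexp]
  obtain ⟨K, hK, hev⟩ := hgap.edge_asymptotics hM0 hM1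
    (CoulombGap.contDiffAt_logProfile (m := 4) (hcy.of_le (by norm_num)) M v)
    (CoulombGap.contDiffAt_logAmplitude (m := 2) (hlam.of_le (by norm_num)) s _)
  obtain ⟨n₀, hn₀⟩ := eventually_atTop.1 hev
  refine ⟨1 / (2 * b k ^ 2) * K, n₀, fun n hn t ht => ?_⟩
  intro D₁ D₂ L l₁ l₂ z
  obtain ⟨hn0, hx, hmain⟩ := hn₀ n hn _ t rfl ht
  have hn' : (0 : ℝ) < n := by exact_mod_cast hn0
  have hu₂ : iteratedDeriv 2 (CoulombGap.logProfile Q M v) (Real.log (b k)) = 4 * b k ^ 2 * D₁ := by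
    rw [CoulombGap.iteratedDeriv_two_logProfile hQ.radial (hcy.of_le (by norm_num)), hexp]
  have hu₃ := CoulombGap.radialDeriv_lap hQ.radial (hcy.of_le (by norm_num)) M v
  rw [hexp, hu₂] at hu₃
  have hD₁' : 0 < D₁ := hD₁
  set q := √(2 * n * D₁) with hq
  have hq0 : 0 < q := Real.sqrt_pos.2 (by positivity)
  have hqsq : q ^ 2 = 2 * n * D₁ := Real.sq_sqrt (by positivity)
  -- The point at radius `r₁ + t / √(2 n D₁)` is `r₁ (1 + σ' t)`, where `σ'` is exactly the Gaussian
  -- width of the left well. The boundary layer expansion therefore applies with the same `t`.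
  have hσe : CoulombGap.laplaceScale (CoulombGap.logProfile Q M v) n (Real.log (b k)) =
      1 / (b k * q) := by
    have e : 2 / (n * (4 * b k ^ 2 * D₁)) = (1 / (b k * q)) ^ 2 := by
      rw [div_pow, mul_pow, hqsq]
      field_simp
      norm_num
    rw [CoulombGap.laplaceScale, hu₂, e, Real.sqrt_sq (by positivity)]
  rw [hσe] at hx hmain
  set σ' := 1 / (b k * q) with hσ'
  have hσ0 : 0 < σ' := by positivity
  have hz : ‖z‖ = Real.exp (Real.log (b k) + Real.log (1 + σ' * t)) := by
    rw [Real.exp_add, hexp, Real.exp_log hx, norm_mul, mul_comm Complex.I, Complex.norm_exp_ofReal_mul_I,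
      one_mul, Complex.norm_real, Real.norm_eq_abs]
    have e : b k + t / q = b k * (1 + σ' * t) := by rw [hσ']; field_simp
    rw [e, abs_of_pos (by positivity)]
  rw [CoulombGap.onePoint_perturbed_eq hQ.radial hlam_radial M v s hn0 hz, Real.exp_add, hexp,
    Real.exp_log hx]
  have hκ : iteratedDeriv 3 (CoulombGap.logProfile Q M v) (Real.log (b k)) / (4 * b k ^ 2 * D₁) - 2 =
      b k * (CoulombGap.radialDeriv (CoulombGap.lap Q) (b k) / D₁) := by
    field_simp
    linear_combination -hu₃
  have hκ' : iteratedDeriv 3 (CoulombGap.logProfile Q M v) (Real.log (b k)) / (4 * b k ^ 2 * D₁) =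
      b k * (CoulombGap.radialDeriv (CoulombGap.lap Q) (b k) / D₁) + 2 := by
    rw [← hκ]; ring
  have hshift := CoulombGap.gapShift_eq (lam := lam) hQ.radial hr hr' (hc₁.of_le (by norm_num))
    (hc₂.of_le (by norm_num)) hD₁ hD₂ hlt M v s
  have hLe : Real.log (a (k + 1)) - Real.log (b k) = L := (Real.log_div hr'.ne' hr.ne').symm
  -- With `B = 2 M` the term `n M` becomes `B n / 2`, and the extra half is absorbed by the shift
  -- identity.
  have harg : n * M + CoulombGap.gapShift (CoulombGap.logProfile Q M v) (CoulombGap.logAmplitude lam s)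
      (Real.log (b k)) (Real.log (a (k + 1))) + 1 / 2 =
      CoulombGap.gapB Q (b k) (a (k + 1)) / 2 * n + Real.log (D₂ / D₁) / (4 * L) +
        s * (l₁ - l₂) / (2 * L) := by
    rw [hB]
    linear_combination hshift
  rw [harg, hLe, hu₂, hκ, hκ', CoulombGap.deriv_logAmplitude (hlam.of_le (by norm_num)), hexp,
    eq_sub_of_add_eq hshift] at hmain
  have hpi : 0 < √Real.pi := Real.sqrt_pos.2 Real.pi_pos
  have h2 : 0 < √(2 : ℝ) := by positivity
  have hpre₁ : n * D₁ = 1 / (2 * b k ^ 2) * (1 / σ' ^ 2) := by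
    rw [hσ', div_pow, mul_pow, hqsq]; field_simp
  have hpre₂ : √(n * D₁) / (√(2 * Real.pi) * b k) = 1 / (2 * b k ^ 2) * (1 / (σ' * √Real.pi)) := by
    have e : √2 * √(n * D₁) = q := by
      rw [← Real.sqrt_mul (by norm_num), hq, mul_assoc]
    have e2 : √(2 : ℝ) ^ 2 = 2 := Real.sq_sqrt (by norm_num)
    rw [hσ', ← e, Real.sqrt_mul (by norm_num : (0 : ℝ) ≤ 2) Real.pi]
    field_simp
    linear_combination -e2
  rw [CoulombGap.edge_density_eq hσ0 hpre₁ hpre₂]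
  have e : ∀ g : ℝ, 1 / (2 * (b k * (1 + σ' * t)) ^ 2) * g =
      1 / (2 * b k ^ 2) * (1 / (1 + σ' * t) ^ 2 * g) := by
    intro g
    field_simp
  rw [e, ← mul_sub, abs_mul, abs_of_pos (by positivity : 0 < 1 / (2 * b k ^ 2)),
    mul_assoc (1 / (2 * b k ^ 2)) K]
  exact mul_le_mul_of_nonneg_left hmain (by positivity)
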